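/- **Notation.** Everything is over $\mathbb Q$. Graded objects carry a *complex degree* $c\in\mathbb Z$ and a *weight* $w\in\mathbb Z$; the topological degree is $c+2w$, differentials have bidegree $(-1,0)$, and the Koszul sign rule uses $c$ (equivalently, the parity of the topological degree). * $A=\widetilde E_*\otimes\mathbb Q=\mathbb Q\oplus\bigoplus_{k\ge 0}\mathbb Q\,e_{2k+1}$ is the square-zero extension, regarded as a DG algebra with zero differential, with $e_{2k+1}$ of topological degree $2k+1$ and weight $k+1$ (so $c=-1$). * $\mathbf{QSymm}$ is the commutative bialgebra with basis the words in letters $x_{2(k+1)}$, $k\ge0$ (of weight $k+1$ and $c=0$), shuffle product and deconcatenation coproduct; $\mathsf{QSymm}$ is the same coalgebra with the quasi-shuffle product, where letters merge by $x_{2i}\star x_{2j}=x_{2(i+j)}$. * $\mathsf{NSymm}=\mathbb Q\langle Z_{2(k+1)}\mid k\ge 0\rangle$ with $\Delta Z_{2k}=\sum_{i+j=k}Z_{2i}\otimes Z_{2j}$, $Z_0=1$; $\mathfrak f$ is the free Lie algebra over $\mathbb Q$ on one generator of each weight $k+1$, $k\ge0$. * $\mathsf G_0(\mathfrak f)=\operatorname{Spec}\mathsf{QSymm}$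 and $\mathsf G(\mathfrak f)=\mathbb G_m\ltimes\mathsf G_0(\mathfrak f)$, with $\mathbb G_m$ acting through the weight: $\mathcal O(\mathsf G(\mathfrak f))=\mathsf{QSymm}[t^{\pm1}]$ with $\Delta(f t^a)=\sum f' t^a\otimes f'' t^{a+|f'|}$ for $\Delta f=\sum f'\otimes f''$ with homogeneous $f'$ of weight $|f'|$. Its representations are the comodules over $\mathcal O(\mathsf G(\mathfrak f))$. * $D_b(A\text{-Mod})$ is the full subcategory of the derived category of (weight-)graded DG $A$-modules, with tensor product $\otimes^L_A$, on the objects whose homology lies in a bounded range of complex degrees $c$. $D_b(C\text{-Comod})$, for $C=\mathbf{QSymm}$ or $\mathsf{QSymm}$, is the same for complexes of (weight-)graded $C$-comodules, with tensor product $\otimes_{\mathbb Q}$ and the coaction $m\otimes n\mapsto\sum (m_0\otimes n_0)\otimes m_1n_1$; $D_b(\mathrm{Rep}\,\mathsf G(\mathfrak f))$ is the bounded derived category of complexes of representations of $\mathsf G(\mathfrak f)$. All are symmetric monoidal. * For a DG $A$-module $M$, the bar construction $M\otimes_A\mathbb B(A/\mathbb Q)\otimes\mathbb Q = M\otimes\mathbf{QSymm}$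 has differential $d(m\otimes x_{2(k+1)}u)=dm\otimes x_{2(k+1)}u+e_{2k+1}m\otimes u$, $d(m\otimes\varnothing)=dm\otimes\varnothing$, coaction by deconcatenation, and lax monoidal structure $(m\otimes u)\otimes(n\otimes v)\mapsto(m\otimes n)\otimes uv$. **Theorem.** 1. The derived category of graded DG $A$-modules is the localization of the $K$-flat modules at quasi-isomorphisms, and for $K$-flat $M$ the augmentation from the bar construction of $M$ to $M\otimes_A\mathbb Q$ is a quasi-isomorphism. The bar construction induces a symmetric (strong) monoidal functor $L\varphi^\dagger$ from the derived category of graded DG $A$-modules to that of graded $\mathbf{QSymm}$-comodules, which agrees with it, as lax monoidal functors, on $K$-flat modules. The three bounded categories above, $D_b(A\text{-Mod})$, $D_b(\mathbf{QSymm}\text{-Comod})$ and $D_b(\mathrm{Rep}\,\mathsf G(\mathfrak f))$, are closed under the tensor product and contain the unit, and $L\varphi^\dagger$ restricts to an equivalence of symmetric monoidal categories $$L\varphi^\dagger: D_b(\widetilde E_*\otimes\mathbb Q\text{-Mod})\longrightarrow D_b(\mathbf{QSymm}_*\otimes\mathbb Q\text{-Comod}).$$ 2. (Hoffman's exponential.)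 There is an isomorphism of graded Hopf algebras $\exp:\mathbf{QSymm}\to\mathsf{QSymm}$ given on words by $\exp(u)=\sum_{(i_1,\dots,i_l)}\frac1{i_1!\cdots i_l!}\,u[i_1,\dots,i_l]$, the sum over all compositions of the length of $u$, where $u[i_1,\dots,i_l]$ arises from $u$ by merging with $\star$ the first $i_1$ letters, the next $i_2$ letters, and so on. 3. (PBW.) There is an isomorphism of algebras $U(\mathfrak f)\cong\mathsf{NSymm}$ which maps $\mathfrak f$ to primitive elements and each generator of $\mathfrak f$ to an element of the same weight; $\mathsf{QSymm}$ is the graded dual of $\mathsf{NSymm}$ (the words are dual to the monomials in the $Z$'s, and the products and coproducts are dual to each other); $\mathcal O(\mathsf G(\mathfrak f))$ is a Hopf algebra; and the functor $\mathrm{PBW}$, which takes a complex of graded $\mathsf{QSymm}$-comodules to the same complex with coaction $n\mapsto\sum n_0\otimes n_1t^{|n_0|}$, is an equivalence between complexes of graded $\mathsf{QSymm}$-comodules and complexes of representations of $\mathsf G(\mathfrak f)$. 4. Pushing coactions forward along $\exp$, and $\mathrm{PBW}$, induce functors on derived categories, and the composite $\mathrm{PBW}\circ\exp^*\circ L\varphi^\dagger$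 is an equivalence of symmetric monoidal categories $$D_b(\widetilde E_*\otimes\mathbb Q\text{-Mod})\longrightarrow D_b(\mathrm{Rep}\,\mathsf G(\mathfrak f)).$$ -/

import Mathlib

open CategoryTheory MonoidalCategory
open scoped TensorProduct

set_option linter.unusedSectionVars false

noncomputable section
namespace HKM

/-- A grading by `Γ` on a rational vector space: `comp m i` is the component of `m` in degree `i`. -/
structure Grading (Γ M : Type) [AddCommGroup M] [Module ℚ M] where
  comp : M →ₗ[ℚ] (Γ →₀ M)
  comp_comp : ∀ m i, comp (comp m i) = Finsupp.single i (comp m i)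
  sum_comp : ∀ m, ((comp m).sum fun _ x => x) = m

namespace Grading

section
variable {Γ M N : Type} [AddCommGroup M] [Module ℚ M] [AddCommGroup N] [Module ℚ N]

/-- `m` is homogeneous of degree `i`. -/
def IsHom (G : Grading Γ M) (i : Γ) (m : M) : Prop := G.comp m = Finsupp.single i m

theorem isHom_comp (G : Grading Γ M) (i : Γ) (m : M) : G.IsHom i (G.comp m i) := G.comp_comp m i

theorem span_isHom (G : Grading Γ M) :
    Submodule.span ℚ {m | ∃ i, G.IsHom i m} = ⊤ := by
  rw [eq_top_iff]
  intro m _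
  rw [← G.sum_comp m]
  exact Submodule.sum_mem _ fun i _ => Submodule.subset_span ⟨i, G.isHom_comp i m⟩

theorem ext_hom (G : Grading Γ M) {f g : M →ₗ[ℚ] N}
    (h : ∀ i m, G.IsHom i m → f m = g m) : f = g :=
  LinearMap.ext_on G.span_isHom fun m ⟨i, hm⟩ => h i m hm

/-- A linear map to the finitely supported families is a grading as soon as the vectors that it
treats as homogeneous span. -/
def ofSpan (c : M →ₗ[ℚ] (Γ →₀ M))
    (h : Submodule.span ℚ {m | ∃ i, c m = Finsupp.single i m} = ⊤) : Grading Γ M where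
  comp := c
  comp_comp m i := by
    have := LinearMap.ext_on (f := c ∘ₗ Finsupp.lapply i ∘ₗ c)
      (g := Finsupp.lsingle i ∘ₗ Finsupp.lapply i ∘ₗ c) h (by
        rintro m ⟨j, hj⟩
        classical
        simp only [LinearMap.comp_apply, hj, Finsupp.lapply_apply, Finsupp.lsingle_apply,
          Finsupp.single_apply]
        split_ifs with hji
        · rw [hj, hji]
        · simp)
    exact LinearMap.congr_fun this m
  sum_comp m := by
    have := LinearMap.ext_on (f := Finsupp.lsum ℚ (fun _ : Γ => (LinearMap.id : M →ₗ[ℚ] M)) ∘ₗ c)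
      (g := LinearMap.id) h (by
        rintro m ⟨j, hj⟩
        simp [hj])
    exact LinearMap.congr_fun this m

theorem map_of_span {Γ' : Type} {G : Grading Γ M} {K : Grading Γ' N} {f : M →ₗ[ℚ] N} {s : Γ → Γ'}
    {S : Set M} (hS : Submodule.span ℚ S = ⊤)
    (h : ∀ m ∈ S, ∃ i, G.IsHom i m ∧ K.IsHom (s i) (f m)) (k : Γ) (t : M) (ht : G.IsHom k t) :
    K.IsHom (s k) (f t) := by
  have key : K.comp ∘ₗ f = Finsupp.lmapDomain N ℚ s ∘ₗ Finsupp.mapRange.linearMap f ∘ₗ G.comp := by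
    refine LinearMap.ext_on hS fun m hm => ?_
    obtain ⟨i, h1, h2⟩ := h m hm
    unfold IsHom at h1 h2
    simp [h1, h2]
  have := LinearMap.congr_fun key t
  unfold IsHom at ht ⊢
  simpa [ht] using this

theorem IsHom.zero (G : Grading Γ M) (i : Γ) : G.IsHom i 0 := by simp [IsHom]
theorem IsHom.add {G : Grading Γ M} {i : Γ} {x y : M} (hx : G.IsHom i x) (hy : G.IsHom i y) :
    G.IsHom i (x + y) := by unfold IsHom at *; simp [hx, hy]
theorem IsHom.smul {G : Grading Γ M} {i : Γ} {x : M} (a : ℚ) (hx : G.IsHom i x) :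
    G.IsHom i (a • x) := by unfold IsHom at *; simp [hx]
theorem IsHom.sub {G : Grading Γ M} {i : Γ} {x y : M} (hx : G.IsHom i x) (hy : G.IsHom i y) :
    G.IsHom i (x - y) := by unfold IsHom at *; simp [hx, hy]
theorem IsHom.comp_mem {G : Grading Γ M} {i : Γ} {x : M} (hx : G.IsHom i x) {R : Submodule ℚ M}
    (h : x ∈ R) (k : Γ) : G.comp x k ∈ R := by
  unfold IsHom at hx
  classical
  rw [hx, Finsupp.single_apply]
  split_ifs
  · exact h
  · exact R.zero_mem
theorem IsHom.sum {G : Grading Γ M} {i : Γ} {ι : Type*} {s : Finset ι} {x : ι → M}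
    (hx : ∀ a ∈ s, G.IsHom i (x a)) : G.IsHom i (∑ a ∈ s, x a) := by
  unfold IsHom at *
  rw [map_sum, Finset.sum_congr rfl hx, Finsupp.single_finsetSum]

end

section tensor
variable {Γ M N : Type} [AddCommGroup Γ] [AddCommGroup M] [Module ℚ M] [AddCommGroup N] [Module ℚ N]

/-- The components of an element of a tensor product. -/
def tensorComp (G : Grading Γ M) (H : Grading Γ N) : M ⊗[ℚ] N →ₗ[ℚ] (Γ →₀ M ⊗[ℚ] N) :=
  Finsupp.lmapDomain _ ℚ (fun p : Γ × Γ => p.1 + p.2) ∘ₗ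
    (finsuppTensorFinsupp ℚ ℚ M N Γ Γ).toLinearMap ∘ₗ TensorProduct.map G.comp H.comp

theorem tensorComp_tmul {G : Grading Γ M} {H : Grading Γ N} {i j : Γ} {m : M} {n : N}
    (hm : G.IsHom i m) (hn : H.IsHom j n) :
    tensorComp G H (m ⊗ₜ n) = Finsupp.single (i + j) (m ⊗ₜ n) := by
  unfold IsHom at hm hn
  simp [tensorComp, hm, hn]

theorem span_tmul_of_span {S : Set M} {T : Set N} (hS : Submodule.span ℚ S = ⊤)
    (hT : Submodule.span ℚ T = ⊤) :
    Submodule.span ℚ {t : M ⊗[ℚ] N | ∃ m ∈ S, ∃ n ∈ T, t = m ⊗ₜ n} = ⊤ := by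
  have := Submodule.map₂_span_span ℚ (TensorProduct.mk ℚ M N) S T
  rw [hS, hT, TensorProduct.map₂_mk_top_top_eq_top] at this
  rw [eq_top_iff, this]
  refine Submodule.span_mono ?_
  rintro _ ⟨m, hm, n, hn, rfl⟩
  exact ⟨m, hm, n, hn, rfl⟩

/-- The grading of the tensor product: `|m ⊗ n| = |m| + |n|`. -/
def tensor (G : Grading Γ M) (H : Grading Γ N) : Grading Γ (M ⊗[ℚ] N) :=
  ofSpan (tensorComp G H) <| by
    rw [eq_top_iff, ← span_tmul_of_span G.span_isHom H.span_isHom]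
    refine Submodule.span_mono ?_
    rintro _ ⟨m, ⟨i, hm⟩, n, ⟨j, hn⟩, rfl⟩
    exact ⟨i + j, tensorComp_tmul hm hn⟩

theorem IsHom.tmul {G : Grading Γ M} {H : Grading Γ N} {i j : Γ} {m : M} {n : N}
    (hm : G.IsHom i m) (hn : H.IsHom j n) : (tensor G H).IsHom (i + j) (m ⊗ₜ n) :=
  tensorComp_tmul hm hn

theorem tensor_map {Γ' M' : Type} [AddCommGroup M'] [Module ℚ M'] {G : Grading Γ M}
    {H : Grading Γ N} {K : Grading Γ' M'} {f : M ⊗[ℚ] N →ₗ[ℚ] M'} {s : Γ → Γ'}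
    (h : ∀ i j m n, G.IsHom i m → H.IsHom j n → K.IsHom (s (i + j)) (f (m ⊗ₜ n))) (k : Γ)
    (t : M ⊗[ℚ] N) (ht : (tensor G H).IsHom k t) : K.IsHom (s k) (f t) := by
  refine map_of_span (span_tmul_of_span G.span_isHom H.span_isHom) ?_ k t ht
  rintro _ ⟨m, ⟨i, hm⟩, n, ⟨j, hn⟩, rfl⟩
  exact ⟨i + j, hm.tmul hn, h i j m n hm hn⟩

variable {P : Type} [AddCommGroup P] [Module ℚ P]

theorem tensor_map_left {Γ' M' : Type} [AddCommGroup M'] [Module ℚ M'] {G : Grading Γ M}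
    {H : Grading Γ N} {L : Grading Γ P} {K : Grading Γ' M'} {f : (M ⊗[ℚ] N) ⊗[ℚ] P →ₗ[ℚ] M'}
    {s : Γ → Γ'}
    (h : ∀ i j l m n p, G.IsHom i m → H.IsHom j n → L.IsHom l p →
      K.IsHom (s (i + j + l)) (f ((m ⊗ₜ n) ⊗ₜ p))) (k : Γ)
    (t : (M ⊗[ℚ] N) ⊗[ℚ] P) (ht : (tensor (tensor G H) L).IsHom k t) : K.IsHom (s k) (f t) := by
  refine map_of_span (span_tmul_of_span (span_tmul_of_span G.span_isHom H.span_isHom)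
    L.span_isHom) ?_ k t ht
  rintro _ ⟨_, ⟨m, ⟨i, hm⟩, n, ⟨j, hn⟩, rfl⟩, p, ⟨l, hp⟩, rfl⟩
  exact ⟨i + j + l, (hm.tmul hn).tmul hp, h i j l m n p hm hn hp⟩

theorem tensor_map_right {Γ' M' : Type} [AddCommGroup M'] [Module ℚ M'] {G : Grading Γ M}
    {H : Grading Γ N} {L : Grading Γ P} {K : Grading Γ' M'} {f : M ⊗[ℚ] (N ⊗[ℚ] P) →ₗ[ℚ] M'}
    {s : Γ → Γ'}
    (h : ∀ i j l m n p, G.IsHom i m → H.IsHom j n → L.IsHom l p →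
      K.IsHom (s (i + (j + l))) (f (m ⊗ₜ (n ⊗ₜ p)))) (k : Γ)
    (t : M ⊗[ℚ] (N ⊗[ℚ] P)) (ht : (tensor G (tensor H L)).IsHom k t) : K.IsHom (s k) (f t) := by
  refine map_of_span (span_tmul_of_span G.span_isHom (span_tmul_of_span H.span_isHom
    L.span_isHom)) ?_ k t ht
  rintro _ ⟨m, ⟨i, hm⟩, _, ⟨n, ⟨j, hn⟩, p, ⟨l, hp⟩, rfl⟩, rfl⟩
  exact ⟨i + (j + l), hm.tmul (hn.tmul hp), h i j l m n p hm hn hp⟩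

/-- The field of scalars, in degree `0`. -/
def unit (Γ : Type) [AddCommGroup Γ] : Grading Γ ℚ :=
  ofSpan (Finsupp.lsingle 0) <| by
    rw [eq_top_iff]; intro m _; exact Submodule.subset_span ⟨0, rfl⟩

end tensor

section quot
variable {Γ M : Type} [AddCommGroup M] [Module ℚ M]

/-- The homogeneous components in a quotient by a homogeneous subspace. -/
def quotComp (G : Grading Γ M) (R : Submodule ℚ M) (hR : ∀ r ∈ R, ∀ i, G.comp r i ∈ R) :
    M ⧸ R →ₗ[ℚ] (Γ →₀ M ⧸ R) :=
  R.liftQ (Finsupp.mapRange.linearMap R.mkQ ∘ₗ G.comp) (by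
    intro r hr
    ext i
    simpa using hR r hr i)

theorem quotComp_mkQ (G : Grading Γ M) (R : Submodule ℚ M) (hR : ∀ r ∈ R, ∀ i, G.comp r i ∈ R)
    (m : M) : quotComp G R hR (R.mkQ m) = Finsupp.mapRange.linearMap R.mkQ (G.comp m) := rfl

/-- The grading of the quotient by a homogeneous subspace. -/
def quot (G : Grading Γ M) (R : Submodule ℚ M) (hR : ∀ r ∈ R, ∀ i, G.comp r i ∈ R) :
    Grading Γ (M ⧸ R) :=
  ofSpan (quotComp G R hR) <| by
    rw [eq_top_iff]
    rintro x -
    obtain ⟨m, rfl⟩ := R.mkQ_surjective x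
    rw [← G.sum_comp m, Finsupp.sum, map_sum]
    refine Submodule.sum_mem _ fun i _ => Submodule.subset_span ⟨i, ?_⟩
    rw [quotComp_mkQ, G.comp_comp]
    simp

theorem IsHom.mkQ {G : Grading Γ M} {R : Submodule ℚ M} {hR : ∀ r ∈ R, ∀ i, G.comp r i ∈ R} {i : Γ}
    {m : M} (hm : G.IsHom i m) : (G.quot R hR).IsHom i (R.mkQ m) := by
  unfold IsHom at *
  change quotComp G R hR (R.mkQ m) = _
  rw [quotComp_mkQ, hm]
  simp

theorem quot_map {Γ' M' : Type} [AddCommGroup M'] [Module ℚ M'] {G : Grading Γ M}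
    {R : Submodule ℚ M} {hR : ∀ r ∈ R, ∀ i, G.comp r i ∈ R} {K : Grading Γ' M'}
    {f : M ⧸ R →ₗ[ℚ] M'} {s : Γ → Γ'}
    (h : ∀ i m, G.IsHom i m → K.IsHom (s i) (f (R.mkQ m))) (k : Γ)
    (t : M ⧸ R) (ht : (G.quot R hR).IsHom k t) : K.IsHom (s k) (f t) := by
  obtain ⟨m, rfl⟩ := R.mkQ_surjective t
  have e : R.mkQ m = R.mkQ (G.comp m k) := by
    have := DFunLike.congr_fun (show quotComp G R hR (R.mkQ m) = _ from ht) k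
    rw [quotComp_mkQ] at this
    simpa using this.symm
  rw [e]
  exact h _ _ (G.isHom_comp k m)

end quot

section sign
variable {J M N : Type} [AddCommGroup J] [AddCommGroup M] [Module ℚ M] [AddCommGroup N] [Module ℚ N]

/-- The parity operator: multiplication by `(-1) ^ c` on the elements of degree `(c, j)`. -/
def sign (G : Grading (ℤ × J) M) : M →ₗ[ℚ] M :=
  Finsupp.lsum ℚ (fun i : ℤ × J => ((-1 : ℚ) ^ i.1) • (LinearMap.id : M →ₗ[ℚ] M)) ∘ₗ G.comp

theorem sign_apply {G : Grading (ℤ × J) M} {i : ℤ × J} {m : M} (hm : G.IsHom i m) :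
    G.sign m = ((-1 : ℚ) ^ i.1) • m := by
  unfold IsHom at hm
  simp [sign, hm]

theorem sign_sign (G : Grading (ℤ × J) M) (m : M) : G.sign (G.sign m) = m := by
  have : G.sign ∘ₗ G.sign = LinearMap.id := G.ext_hom fun i m hm => by
    rw [LinearMap.comp_apply, sign_apply hm, map_smul, sign_apply hm, smul_smul, ← mul_zpow]
    simp
  exact LinearMap.congr_fun this m

theorem sign_hom {G : Grading (ℤ × J) M} {i : ℤ × J} {m : M} (hm : G.IsHom i m) :
    G.IsHom i (G.sign m) := by rw [sign_apply hm]; exact hm.smul _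

theorem sign_even {G : Grading (ℤ × J) M} {H : Grading (ℤ × J) N} {f : M →ₗ[ℚ] N}
    (h : ∀ i m, G.IsHom i m → H.IsHom i (f m)) (m : M) : H.sign (f m) = f (G.sign m) := by
  have : H.sign ∘ₗ f = f ∘ₗ G.sign := G.ext_hom fun i m hm => by
    rw [LinearMap.comp_apply, LinearMap.comp_apply, sign_apply hm, sign_apply (h i m hm), map_smul]
  exact LinearMap.congr_fun this m

theorem sign_odd {G : Grading (ℤ × J) M} {H : Grading (ℤ × J) N} {f : M →ₗ[ℚ] N} {j : J}
    (h : ∀ i m, G.IsHom i m → H.IsHom (i + (-1, j)) (f m)) (m : M) :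
    H.sign (f m) = - f (G.sign m) := by
  have : H.sign ∘ₗ f = - (f ∘ₗ G.sign) := G.ext_hom fun i m hm => by
    rw [LinearMap.comp_apply, LinearMap.neg_apply, LinearMap.comp_apply, sign_apply hm,
      sign_apply (h i m hm), map_smul, ← neg_smul]
    congr 1
    rw [Prod.fst_add, zpow_add₀ (by norm_num)]
    simp
  exact LinearMap.congr_fun this m

theorem sign_tensor (G : Grading (ℤ × J) M) (H : Grading (ℤ × J) N) :
    (tensor G H).sign = TensorProduct.map G.sign H.sign := by
  refine LinearMap.ext_on (span_tmul_of_span G.span_isHom H.span_isHom) ?_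
  rintro _ ⟨m, ⟨i, hm⟩, n, ⟨j, hn⟩, rfl⟩
  rw [sign_apply (hm.tmul hn), TensorProduct.map_tmul, sign_apply hm, sign_apply hn,
    TensorProduct.smul_tmul_smul, Prod.fst_add, zpow_add₀ (by norm_num)]

@[simp] theorem sign_tmul (G : Grading (ℤ × J) M) (H : Grading (ℤ × J) N) (m : M) (n : N) :
    (tensor G H).sign (m ⊗ₜ n) = G.sign m ⊗ₜ H.sign n := by
  rw [sign_tensor, TensorProduct.map_tmul]

theorem sign_unit (a : ℚ) : (unit (ℤ × J)).sign a = a := by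
  have : (unit (ℤ × J)).IsHom 0 a := rfl
  rw [sign_apply this]; simp

end sign
end Grading

namespace Grading
section
variable {J M N P M' N' : Type} [AddCommGroup J] [AddCommGroup M] [Module ℚ M]
  [AddCommGroup N] [Module ℚ N] [AddCommGroup P] [Module ℚ P]
  [AddCommGroup M'] [Module ℚ M'] [AddCommGroup N'] [Module ℚ N']

/-- The differential of a tensor product, `d (m ⊗ n) = d m ⊗ n + (-1) ^ |m| m ⊗ d n`. -/
def dT (G : Grading (ℤ × J) M) (dM : M →ₗ[ℚ] M) (dN : N →ₗ[ℚ] N) : M ⊗[ℚ] N →ₗ[ℚ] M ⊗[ℚ] N :=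
  TensorProduct.map dM LinearMap.id + TensorProduct.map G.sign dN

theorem dT_tmul (G : Grading (ℤ × J) M) (dM : M →ₗ[ℚ] M) (dN : N →ₗ[ℚ] N) (m : M) (n : N) :
    dT G dM dN (m ⊗ₜ n) = dM m ⊗ₜ n + G.sign m ⊗ₜ dN n := rfl

theorem dT_assoc (G : Grading (ℤ × J) M) (H : Grading (ℤ × J) N) (dM : M →ₗ[ℚ] M)
    (dN : N →ₗ[ℚ] N) (dP : P →ₗ[ℚ] P) :
    (TensorProduct.assoc ℚ M N P).toLinearMap ∘ₗ dT (G.tensor H) (dT G dM dN) dP =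
      dT G dM (dT H dN dP) ∘ₗ (TensorProduct.assoc ℚ M N P).toLinearMap := by
  refine TensorProduct.ext_threefold fun m n p => ?_
  simp only [LinearMap.comp_apply, dT_tmul, sign_tmul, TensorProduct.add_tmul, map_add,
    LinearEquiv.coe_coe, TensorProduct.assoc_tmul, TensorProduct.tmul_add, add_assoc]

theorem dT_map {G : Grading (ℤ × J) M} {G' : Grading (ℤ × J) M'} {dM : M →ₗ[ℚ] M}
    {dN : N →ₗ[ℚ] N} {dM' : M' →ₗ[ℚ] M'} {dN' : N' →ₗ[ℚ] N'} {f : M →ₗ[ℚ] M'} {g : N →ₗ[ℚ] N'}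
    (hs : ∀ m, G'.sign (f m) = f (G.sign m)) (hf : ∀ m, f (dM m) = dM' (f m))
    (hg : ∀ n, g (dN n) = dN' (g n)) (t : M ⊗[ℚ] N) :
    TensorProduct.map f g (dT G dM dN t) = dT G' dM' dN' (TensorProduct.map f g t) := by
  refine LinearMap.congr_fun (f := TensorProduct.map f g ∘ₗ dT G dM dN)
    (g := dT G' dM' dN' ∘ₗ TensorProduct.map f g) ?_ t
  refine TensorProduct.ext' fun m n => ?_
  simp only [LinearMap.comp_apply, dT_tmul, map_add, TensorProduct.map_tmul, hs, hf, hg]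

/-- The Koszul symmetry `m ⊗ n ↦ (-1) ^ (|m| |n|) n ⊗ m`, written with the parity operators. -/
def swap (G : Grading (ℤ × J) M) (H : Grading (ℤ × J) N) : M ⊗[ℚ] N →ₗ[ℚ] N ⊗[ℚ] M :=
  TensorProduct.lift <| (2⁻¹ : ℚ) •
    ((TensorProduct.mk ℚ N M).flip + (TensorProduct.mk ℚ N M).flip ∘ₗ G.sign +
      (TensorProduct.mk ℚ N M ∘ₗ H.sign).flip -
      (TensorProduct.mk ℚ N M ∘ₗ H.sign).flip ∘ₗ G.sign)

theorem swap_tmul (G : Grading (ℤ × J) M) (H : Grading (ℤ × J) N) (m : M) (n : N) :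
    swap G H (m ⊗ₜ n) = (2⁻¹ : ℚ) •
    (n ⊗ₜ[ℚ] m + n ⊗ₜ[ℚ] G.sign m + H.sign n ⊗ₜ[ℚ] m - H.sign n ⊗ₜ[ℚ] G.sign m) := rfl

/-- The operator of `swap` really is the Koszul symmetry. -/
theorem swap_hom_tmul {G : Grading (ℤ × J) M} {H : Grading (ℤ × J) N} {i j : ℤ × J} {m : M} {n : N}
    (hm : G.IsHom i m) (hn : H.IsHom j n) :
    swap G H (m ⊗ₜ n) = ((-1 : ℚ) ^ (i.1 * j.1)) • (n ⊗ₜ[ℚ] m) := by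
  rw [swap_tmul, sign_apply hm, sign_apply hn]
  rcases Int.even_or_odd i.1 with hi | hi <;> rcases Int.even_or_odd j.1 with hj | hj
  · rw [hi.neg_one_zpow, hj.neg_one_zpow, (hi.mul_right _).neg_one_zpow]
    simp only [one_smul]; module
  · rw [hi.neg_one_zpow, hj.neg_one_zpow, (hi.mul_right _).neg_one_zpow]
    simp only [one_smul, neg_smul, TensorProduct.neg_tmul]; module
  · rw [hi.neg_one_zpow, hj.neg_one_zpow, (hj.mul_left _).neg_one_zpow]
    simp only [one_smul, neg_smul, TensorProduct.tmul_neg]; module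
  · rw [hi.neg_one_zpow, hj.neg_one_zpow, (hi.mul hj).neg_one_zpow]
    simp only [one_smul, neg_smul, TensorProduct.neg_tmul, TensorProduct.tmul_neg]; module

theorem swap_swap (G : Grading (ℤ × J) M) (H : Grading (ℤ × J) N) :
    swap H G ∘ₗ swap G H = LinearMap.id := by
  refine TensorProduct.ext' fun m n => ?_
  simp only [LinearMap.comp_apply, swap_tmul, map_smul, map_add, map_sub, sign_sign,
    LinearMap.id_apply]
  module

theorem swap_isHom (G : Grading (ℤ × J) M) (H : Grading (ℤ × J) N) (k : ℤ × J) (t : M ⊗[ℚ] N)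
    (ht : (G.tensor H).IsHom k t) : (H.tensor G).IsHom k (swap G H t) := by
  refine tensor_map (s := fun i => i) (f := swap G H) (fun i j m n hm hn => ?_) k t ht
  rw [swap_hom_tmul hm hn, add_comm i j]
  exact (hn.tmul hm).smul _

theorem swap_map {G : Grading (ℤ × J) M} {H : Grading (ℤ × J) N} {G' : Grading (ℤ × J) M'}
    {H' : Grading (ℤ × J) N'} {f : M →ₗ[ℚ] M'} {g : N →ₗ[ℚ] N'}
    (hf : ∀ m, G'.sign (f m) = f (G.sign m)) (hg : ∀ n, H'.sign (g n) = g (H.sign n)) :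
    swap G' H' ∘ₗ TensorProduct.map f g = TensorProduct.map g f ∘ₗ swap G H := by
  refine TensorProduct.ext' fun m n => ?_
  simp only [LinearMap.comp_apply, TensorProduct.map_tmul, swap_tmul, hf, hg, map_smul, map_add,
    map_sub]

theorem swap_dT (G : Grading (ℤ × J) M) (H : Grading (ℤ × J) N) {dM : M →ₗ[ℚ] M} {dN : N →ₗ[ℚ] N}
    (hM : ∀ m, G.sign (dM m) = - dM (G.sign m)) (hN : ∀ n, H.sign (dN n) = - dN (H.sign n)) :
    swap G H ∘ₗ dT G dM dN = dT H dN dM ∘ₗ swap G H := by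
  refine TensorProduct.ext' fun m n => ?_
  simp only [LinearMap.comp_apply, dT_tmul, map_smul, map_add, map_sub, swap_tmul, sign_sign, hM, hN,
        TensorProduct.neg_tmul, TensorProduct.tmul_neg]
  module

theorem swap_hexagon (G : Grading (ℤ × J) M) (H : Grading (ℤ × J) N) (K : Grading (ℤ × J) P) :
    (TensorProduct.assoc ℚ N P M).toLinearMap ∘ₗ swap G (H.tensor K) ∘ₗ
        (TensorProduct.assoc ℚ M N P).toLinearMap =
      TensorProduct.map LinearMap.id (swap G K) ∘ₗ (TensorProduct.assoc ℚ N M P).toLinearMap ∘ₗ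
        TensorProduct.map (swap G H) LinearMap.id := by
  refine TensorProduct.ext_threefold fun m n p => ?_
  simp only [LinearMap.comp_apply, LinearEquiv.coe_coe, TensorProduct.map_tmul, LinearMap.id_apply,
    TensorProduct.assoc_tmul, swap_tmul, sign_tmul, map_smul, map_add, map_sub,
    ← TensorProduct.smul_tmul', TensorProduct.add_tmul,
    TensorProduct.sub_tmul, TensorProduct.tmul_smul, TensorProduct.tmul_add,
    TensorProduct.tmul_sub, sign_sign]
  module

theorem swap_hexagon' (G : Grading (ℤ × J) M) (H : Grading (ℤ × J) N) (K : Grading (ℤ × J) P) :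
    (TensorProduct.assoc ℚ P M N).symm.toLinearMap ∘ₗ swap (G.tensor H) K ∘ₗ
        (TensorProduct.assoc ℚ M N P).symm.toLinearMap =
      TensorProduct.map (swap G K) LinearMap.id ∘ₗ
        (TensorProduct.assoc ℚ M P N).symm.toLinearMap ∘ₗ
        TensorProduct.map LinearMap.id (swap H K) := by
  refine TensorProduct.ext ?_
  refine LinearMap.ext fun m => TensorProduct.ext' fun n p => ?_
  change (TensorProduct.assoc ℚ P M N).symm (swap (G.tensor H) K
      ((TensorProduct.assoc ℚ M N P).symm (m ⊗ₜ (n ⊗ₜ p)))) =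
    TensorProduct.map (swap G K) LinearMap.id ((TensorProduct.assoc ℚ M P N).symm
      (TensorProduct.map LinearMap.id (swap H K) (m ⊗ₜ (n ⊗ₜ p))))
  simp only [TensorProduct.map_tmul, LinearMap.id_apply,
    TensorProduct.assoc_symm_tmul, swap_tmul, sign_tmul, map_smul, map_add, map_sub,
    ← TensorProduct.smul_tmul', TensorProduct.add_tmul,
    TensorProduct.sub_tmul, TensorProduct.tmul_smul, TensorProduct.tmul_add,
    TensorProduct.tmul_sub, sign_sign]
  module

end
end Grading

/-- Complexes of `J`-graded rational vector spaces. An element of degree `(c, j)` has complex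
degree `c` and weight `j`; the differential lowers `c` by one and preserves `j`. For `J = ℤ` the
total (topological) degree is `c + 2 j`, which has the parity of `c`. For `J = PUnit` these are
plain complexes. -/
structure Cx (J : Type) [AddCommGroup J] where
  X : Type
  [grp : AddCommGroup X]
  [mod : Module ℚ X]
  gr : Grading (ℤ × J) X
  d : X →ₗ[ℚ] X
  d_hom : ∀ i m, gr.IsHom i m → gr.IsHom (i + (-1, 0)) (d m)
  d_d : ∀ m, d (d m) = 0

attribute [instance] Cx.grp Cx.mod

namespace Cx
variable {J : Type} [AddCommGroup J]

/-- Chain maps. -/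
@[ext] structure Hom (M N : Cx J) where
  toLin : M.X →ₗ[ℚ] N.X
  map_hom : ∀ i m, M.gr.IsHom i m → N.gr.IsHom i (toLin m)
  map_d : ∀ m, toLin (M.d m) = N.d (toLin m)

instance : Category (Cx J) where
  Hom := Hom
  id M := ⟨LinearMap.id, fun _ _ h => h, fun _ => rfl⟩
  comp f g := ⟨g.toLin ∘ₗ f.toLin, fun i m h => g.map_hom i _ (f.map_hom i m h), fun m => by
    simp [f.map_d, g.map_d]⟩

@[ext] theorem hom_ext {M N : Cx J} {f g : M ⟶ N} (h : f.toLin = g.toLin) : f = g := Hom.ext h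
@[simp] theorem id_toLin (M : Cx J) : Hom.toLin (𝟙 M) = LinearMap.id := rfl
@[simp] theorem comp_toLin {M N P : Cx J} (f : M ⟶ N) (g : N ⟶ P) :
    Hom.toLin (f ≫ g) = Hom.toLin g ∘ₗ Hom.toLin f := rfl

theorem sign_d (M : Cx J) (m : M.X) : M.gr.sign (M.d m) = - M.d (M.gr.sign m) :=
  Grading.sign_odd M.d_hom m

theorem sign_map {M N : Cx J} (f : M ⟶ N) (m : M.X) : N.gr.sign (f.toLin m) = f.toLin (M.gr.sign m) :=
  Grading.sign_even f.map_hom m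

/-- An isomorphism of complexes from a linear equivalence. -/
def mkIso {M N : Cx J} (e : M.X ≃ₗ[ℚ] N.X) (h : ∀ i m, M.gr.IsHom i m → N.gr.IsHom i (e m))
    (h' : ∀ i m, N.gr.IsHom i m → M.gr.IsHom i (e.symm m))
    (hd : ∀ m, e (M.d m) = N.d (e m)) : M ≅ N where
  hom := ⟨e.toLinearMap, h, hd⟩
  inv := ⟨e.symm.toLinearMap, h', fun m => by
    apply e.injective
    simp [hd]⟩
  hom_inv_id := by ext; simp
  inv_hom_id := by ext; simp

/-- The tensor product of complexes. -/
abbrev tens (M N : Cx J) : Cx J where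
  X := M.X ⊗[ℚ] N.X
  gr := M.gr.tensor N.gr
  d := M.gr.dT M.d N.d
  d_hom := by
    refine Grading.tensor_map (s := fun i => i + (-1, 0)) fun i j m n hm hn => ?_
    refine Grading.IsHom.add ?_ ?_
    · have := (M.d_hom i m hm).tmul hn
      rwa [add_right_comm] at this
    · have := (Grading.sign_hom hm).tmul (N.d_hom j n hn)
      rwa [← add_assoc] at this
  d_d t := by
    refine LinearMap.congr_fun (f := M.gr.dT M.d N.d ∘ₗ M.gr.dT M.d N.d) (g := 0) ?_ t
    refine TensorProduct.ext' fun m n => ?_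
    simp [Grading.dT_tmul, M.d_d, N.d_d, sign_d, TensorProduct.neg_tmul]

/-- The unit complex: `ℚ` in degree `0`. -/
abbrev one (J : Type) [AddCommGroup J] : Cx J where
  X := ℚ
  gr := Grading.unit _
  d := 0
  d_hom i m _ := by simpa using Grading.IsHom.zero _ _
  d_d _ := rfl

/-- The tensor product of two chain maps. -/
def tensHom {M M' N N' : Cx J} (f : M ⟶ M') (g : N ⟶ N') : tens M N ⟶ tens M' N' where
  toLin := TensorProduct.map f.toLin g.toLin
  map_hom := Grading.tensor_map (s := fun i => i) fun i j m n hm hn =>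
    (f.map_hom i m hm).tmul (g.map_hom j n hn)
  map_d := Grading.dT_map (sign_map f) f.map_d g.map_d

/-- The associativity isomorphism. -/
def assoc (M N P : Cx J) : tens (tens M N) P ≅ tens M (tens N P) :=
  mkIso (M := tens (tens M N) P) (N := tens M (tens N P)) (TensorProduct.assoc ℚ M.X N.X P.X)
    (Grading.tensor_map_left (s := fun i => i)
      (f := (TensorProduct.assoc ℚ M.X N.X P.X).toLinearMap) fun i j l m n p hm hn hp => by
        have := hm.tmul (hn.tmul hp)
        rwa [← add_assoc] at this)
    (Grading.tensor_map_right (s := fun i => i)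
      (f := (TensorProduct.assoc ℚ M.X N.X P.X).symm.toLinearMap) fun i j l m n p hm hn hp => by
        have := (hm.tmul hn).tmul hp
        rwa [add_assoc] at this)
    (LinearMap.congr_fun (Grading.dT_assoc M.gr N.gr M.d N.d P.d))

theorem unit_isHom' {Γ : Type} [AddCommGroup Γ] {i : Γ} {a : ℚ} (h : (Grading.unit Γ).IsHom i a) :
    a = 0 ∨ i = 0 := by
  by_cases h0 : a = 0
  · exact Or.inl h0
  · have h1 : Finsupp.single (0 : Γ) a = Finsupp.single i a := h
    exact Or.inr ((Finsupp.single_left_inj h0).mp h1).symm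

theorem unit_isHom {i : ℤ × J} {a : ℚ} (h : (Grading.unit (ℤ × J)).IsHom i a) : a = 0 ∨ i = 0 := by
  by_cases h0 : a = 0
  · exact Or.inl h0
  · have h1 : Finsupp.single (0 : ℤ × J) a = Finsupp.single i a := h
    exact Or.inr ((Finsupp.single_left_inj h0).mp h1).symm

/-- The left unit isomorphism. -/
def lunit (M : Cx J) : tens (one J) M ≅ M :=
  mkIso (M := tens (one J) M) (N := M) (TensorProduct.lid ℚ M.X)
    (Grading.tensor_map (s := fun i => i) (f := (TensorProduct.lid ℚ M.X).toLinearMap)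
      fun i j a m ha hm => by
        change M.gr.IsHom _ ((a : ℚ) • m)
        rcases unit_isHom ha with rfl | rfl
        · rw [zero_smul]; exact Grading.IsHom.zero _ _
        · rw [zero_add]
          exact hm.smul a)
    (fun i m hm => by
      have : (Grading.unit (ℤ × J)).IsHom 0 (1 : ℚ) := rfl
      have := this.tmul hm
      rwa [zero_add] at this)
    (LinearMap.congr_fun (f := (TensorProduct.lid ℚ M.X).toLinearMap ∘ₗ
        (Grading.unit (ℤ × J)).dT 0 M.d) (g := M.d ∘ₗ (TensorProduct.lid ℚ M.X).toLinearMap)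
      (TensorProduct.ext' fun a m => by
        simp [Grading.dT_tmul, Grading.sign_unit]))

/-- The right unit isomorphism. -/
def runit (M : Cx J) : tens M (one J) ≅ M :=
  mkIso (M := tens M (one J)) (N := M) (TensorProduct.rid ℚ M.X)
    (Grading.tensor_map (s := fun i => i) (f := (TensorProduct.rid ℚ M.X).toLinearMap)
      fun i j m a hm ha => by
        change M.gr.IsHom _ ((a : ℚ) • m)
        rcases unit_isHom ha with rfl | rfl
        · rw [zero_smul]; exact Grading.IsHom.zero _ _
        · rw [add_zero]
          exact hm.smul a)
    (fun i m hm => by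
      have : (Grading.unit (ℤ × J)).IsHom 0 (1 : ℚ) := rfl
      have := hm.tmul this
      rwa [add_zero] at this)
    (LinearMap.congr_fun (f := (TensorProduct.rid ℚ M.X).toLinearMap ∘ₗ
        M.gr.dT M.d (0 : ℚ →ₗ[ℚ] ℚ)) (g := M.d ∘ₗ (TensorProduct.rid ℚ M.X).toLinearMap)
      (TensorProduct.ext' fun m a => by
        simp [Grading.dT_tmul]))

instance : MonoidalCategoryStruct (Cx J) where
  tensorObj := tens
  whiskerLeft M _ _ g := tensHom (𝟙 M) g
  whiskerRight f N := tensHom f (𝟙 N)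
  tensorHom := tensHom
  tensorUnit := one J
  associator := assoc
  leftUnitor := lunit
  rightUnitor := runit

/-- The underlying vector space. -/
def forgetV : Cx J ⥤ ModuleCat.{0} ℚ where
  obj M := ModuleCat.of ℚ M.X
  map f := ModuleCat.ofHom f.toLin

instance : (forgetV (J := J)).Faithful where
  map_injective h := hom_ext (ModuleCat.hom_ext_iff.mp h)

instance : MonoidalCategory (Cx J) :=
  Monoidal.induced forgetV
    { μIso := fun _ _ => Iso.refl _
      εIso := Iso.refl _
      whiskerLeft_eq := fun _ _ _ _ => rfl
      whiskerRight_eq := fun _ _ => rfl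
      tensorHom_eq := fun _ _ => rfl
      associator_eq := fun M N P => by
        ext1
        exact TensorProduct.ext_threefold fun _ _ _ => rfl
      leftUnitor_eq := fun M => by
        ext1
        exact TensorProduct.ext' fun _ _ => rfl
      rightUnitor_eq := fun M => by
        ext1
        exact TensorProduct.ext' fun _ _ => rfl }

/-- The symmetry isomorphism. -/
def braid (M N : Cx J) : tens M N ≅ tens N M :=
  mkIso (M := tens M N) (N := tens N M)
    (LinearEquiv.ofLinearMap (M.gr.swap N.gr) (N.gr.swap M.gr) (N.gr.swap_swap M.gr)
      (M.gr.swap_swap N.gr))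
    (M.gr.swap_isHom N.gr) (N.gr.swap_isHom M.gr)
    (LinearMap.congr_fun (M.gr.swap_dT N.gr (sign_d M) (sign_d N)))

instance : BraidedCategory (Cx J) where
  braiding := braid
  braiding_naturality_right M N N' g := by
    ext1
    exact Grading.swap_map (f := LinearMap.id) (fun _ => rfl) (sign_map g)
  braiding_naturality_left {M M'} f N := by
    ext1
    exact Grading.swap_map (g := LinearMap.id) (sign_map f) (fun _ => rfl)
  hexagon_forward M N P := by
    ext1
    exact Grading.swap_hexagon M.gr N.gr P.gr
  hexagon_reverse M N P := by
    ext1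
    exact Grading.swap_hexagon' M.gr N.gr P.gr

instance : SymmetricCategory (Cx J) where
  symmetry M N := by
    ext1
    exact M.gr.swap_swap N.gr

end Cx

/-- The square-zero extension `ℚ ⊕ ℚ{e₁, e₃, e₅, …}`. -/
abbrev Etilde : Type := TrivSqZeroExt ℚ (ℕ →₀ ℚ)

/-- The generator `e_{2k+1}`. -/
def e (k : ℕ) : Etilde := TrivSqZeroExt.inr (Finsupp.single k 1)

theorem Etilde.linearMap_ext {M : Type} [AddCommGroup M] [Module ℚ M] {f g : Etilde →ₗ[ℚ] M}
    (h1 : f 1 = g 1) (he : ∀ k, f (e k) = g (e k)) : f = g := by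
  refine TrivSqZeroExt.linearMap_ext (fun r => ?_) (fun v => ?_)
  · have : (TrivSqZeroExt.inl r : Etilde) = r • (1 : Etilde) := by
      ext <;> simp
    rw [this, map_smul, map_smul, h1]
  · induction v using Finsupp.induction_linear with
    | zero => simp
    | add x y hx hy => rw [TrivSqZeroExt.inr_add, map_add, map_add, hx, hy]
    | single k r =>
      have : (TrivSqZeroExt.inr (Finsupp.single k r) : Etilde) = r • e k := by
        rw [e, ← TrivSqZeroExt.inr_smul, Finsupp.smul_single, smul_eq_mul, mul_one]
      rw [this, map_smul, map_smul, he]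

theorem Etilde.span_top : Submodule.span ℚ ({1} ∪ Set.range e : Set Etilde) = ⊤ := by
  have := Etilde.linearMap_ext (f := (Submodule.span ℚ ({1} ∪ Set.range e : Set Etilde)).mkQ)
    (g := 0)
    (by rw [LinearMap.zero_apply, Submodule.mkQ_apply, Submodule.Quotient.mk_eq_zero]
        exact Submodule.subset_span (Or.inl rfl))
    (fun k => by rw [LinearMap.zero_apply, Submodule.mkQ_apply, Submodule.Quotient.mk_eq_zero]
                 exact Submodule.subset_span (Or.inr ⟨k, rfl⟩))
  rw [← Submodule.ker_mkQ (Submodule.span ℚ ({1} ∪ Set.range e : Set Etilde)), this,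
    LinearMap.ker_zero]

@[simp] theorem e_mul_e (k l : ℕ) : e k * e l = 0 := TrivSqZeroExt.inr_mul_inr _ _ _

/-- Graded DG modules over the square-zero extension, which has differential `0` and in which
`e_{2k+1}` has complex degree `-1` and weight `k + 1`, hence total degree
`-1 + 2 (k + 1) = 2 k + 1`. -/
structure DGMod extends Cx ℤ where
  act : Etilde →ₐ[ℚ] Module.End ℚ X
  act_hom : ∀ (k : ℕ) i m, gr.IsHom i m → gr.IsHom (i + (-1, (k : ℤ) + 1)) (act (e k) m)
  d_act : ∀ k m, d (act (e k) m) = - act (e k) (d m)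

namespace DGMod

/-- Morphisms of DG modules: chain maps that commute with the action. -/
@[ext] structure Hom (M N : DGMod) extends Cx.Hom M.toCx N.toCx where
  map_act : ∀ a m, toLin (M.act a m) = N.act a (toLin m)

instance : Category DGMod where
  Hom := Hom
  id M := ⟨𝟙 M.toCx, fun _ _ => rfl⟩
  comp f g := ⟨CategoryStruct.comp (obj := Cx ℤ) f.toHom g.toHom, fun a m => by
    rw [Cx.comp_toLin, LinearMap.comp_apply, LinearMap.comp_apply, f.map_act, g.map_act]⟩

theorem hom_ext {M N : DGMod} {f g : M ⟶ N} (h : ∀ m, f.toLin m = g.toLin m) : f = g := by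
  refine Hom.ext (LinearMap.ext h)

theorem id_apply (M : DGMod) (m : M.X) : (Hom.toHom (𝟙 M)).toLin m = m := rfl
theorem comp_apply {M N P : DGMod} (f : M ⟶ N) (g : N ⟶ P) (m : M.X) :
    (Hom.toHom (f ≫ g)).toLin m = g.toLin (f.toLin m) := rfl

/-- Forgetting the action. -/
def forget : DGMod ⥤ Cx ℤ where
  obj M := M.toCx
  map f := f.toHom

section
variable (M N P : DGMod)

theorem act_mul (a b : Etilde) (m : M.X) : M.act a (M.act b m) = M.act (a * b) m := by
  rw [map_mul]; rfl

theorem act_ee (k l : ℕ) (m : M.X) : M.act (e k) (M.act (e l) m) = 0 := by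
  rw [act_mul, e_mul_e, map_zero]; rfl

theorem act_one (m : M.X) : M.act 1 m = m := by rw [map_one]; rfl

theorem sign_act_e (k : ℕ) (m : M.X) : M.gr.sign (M.act (e k) m) = - M.act (e k) (M.gr.sign m) :=
  Grading.sign_odd (f := M.act (e k)) (M.act_hom k) m

theorem e_sign_act (k : ℕ) (a : Etilde) (m : M.X) :
    M.act (e k) (M.gr.sign (M.act a m)) = M.act a (M.act (e k) (M.gr.sign m)) := by
  refine LinearMap.congr_fun (f := (M.act (e k) ∘ₗ M.gr.sign) ∘ₗ
    (LinearMap.flip M.act.toLinearMap m)) (g := (LinearMap.flip M.act.toLinearMap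
      (M.act (e k) (M.gr.sign m)))) (Etilde.linearMap_ext ?_ fun l => ?_) a
  · simp
  · change M.act (e k) (M.gr.sign (M.act (e l) m)) = M.act (e l) (M.act (e k) (M.gr.sign m))
    rw [sign_act_e, map_neg, act_ee, act_ee, neg_zero]

/-- The relations `(m a) ⊗ n = m ⊗ (a n)`, where `m e_{2k+1} = (-1) ^ |m| e_{2k+1} m`. -/
def rel : Submodule ℚ (M.X ⊗[ℚ] N.X) :=
  Submodule.span ℚ {t | ∃ k m n, t = M.act (e k) (M.gr.sign m) ⊗ₜ n - m ⊗ₜ N.act (e k) n}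

theorem rel_le {M N : DGMod} {P : Type} [AddCommGroup P] [Module ℚ P]
    {f : M.X ⊗[ℚ] N.X →ₗ[ℚ] P} {Q : Submodule ℚ P}
    (h : ∀ k i j m n, M.gr.IsHom i m → N.gr.IsHom j n →
      f (M.act (e k) (M.gr.sign m) ⊗ₜ n - m ⊗ₜ N.act (e k) n) ∈ Q) : rel M N ≤ Q.comap f := by
  rw [rel, Submodule.span_le]
  rintro _ ⟨k, m, n, rfl⟩
  let g : M.X ⊗[ℚ] N.X →ₗ[ℚ] P ⧸ Q := Q.mkQ ∘ₗ f ∘ₗ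
    (TensorProduct.map (M.act (e k) ∘ₗ M.gr.sign) LinearMap.id -
      TensorProduct.map LinearMap.id (N.act (e k)))
  have hg : g = 0 := by
    refine LinearMap.ext_on (Grading.span_tmul_of_span M.gr.span_isHom N.gr.span_isHom) ?_
    rintro _ ⟨m, ⟨i, hm⟩, n, ⟨j, hn⟩, rfl⟩
    exact (Submodule.Quotient.mk_eq_zero Q).mpr (h k i j m n hm hn)
  have := LinearMap.congr_fun hg (m ⊗ₜ n)
  exact (Submodule.Quotient.mk_eq_zero Q).mp this

theorem rel_comp (t : M.X ⊗[ℚ] N.X) (ht : t ∈ rel M N) (i : ℤ × ℤ) :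
    (M.gr.tensor N.gr).comp t i ∈ rel M N := by
  have : rel M N ≤ (rel M N).comap (Finsupp.lapply i ∘ₗ (M.gr.tensor N.gr).comp) := by
    refine rel_le fun k a b m n hm hn => ?_
    have h1 := (M.act_hom k _ _ (Grading.sign_hom hm)).tmul hn
    have h2 := hm.tmul (N.act_hom k _ _ hn)
    rw [add_right_comm] at h1
    rw [← add_assoc] at h2
    exact Grading.IsHom.comp_mem (R := rel M N) (h1.sub h2)
      (Submodule.subset_span ⟨k, m, n, rfl⟩) i
  exact this ht

theorem rel_d : rel M N ≤ (rel M N).comap (M.gr.dT M.d N.d) := by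
  rw [rel, Submodule.span_le]
  rintro _ ⟨k, m, n, rfl⟩
  have h1 : M.act (e k) (M.gr.sign (M.d m)) ⊗ₜ n - M.d m ⊗ₜ N.act (e k) n ∈ rel M N :=
    Submodule.subset_span ⟨k, _, _, rfl⟩
  have h2 : M.act (e k) (M.gr.sign (M.gr.sign m)) ⊗ₜ N.d n -
      M.gr.sign m ⊗ₜ N.act (e k) (N.d n) ∈ rel M N :=
    Submodule.subset_span ⟨k, _, _, rfl⟩
  have h3 := Submodule.sub_mem _ h1 h2
  change M.gr.dT M.d N.d _ ∈ rel M N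
  convert h3 using 1
  simp only [map_sub, Grading.dT_tmul, M.d_act, N.d_act, sign_act_e, Cx.sign_d, map_neg,
    Grading.sign_sign, TensorProduct.neg_tmul, TensorProduct.tmul_neg]
  abel

theorem rel_act (a : Etilde) :
    rel M N ≤ (rel M N).comap (TensorProduct.map (M.act a) LinearMap.id) := by
  rw [rel, Submodule.span_le]
  rintro _ ⟨k, m, n, rfl⟩
  refine Submodule.subset_span ⟨k, M.act a m, n, ?_⟩
  rw [map_sub, TensorProduct.map_tmul, TensorProduct.map_tmul, e_sign_act]
  rfl

/-- The tensor product `M ⊗ N` over the square-zero extension. -/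
def tens : DGMod where
  X := (M.X ⊗[ℚ] N.X) ⧸ rel M N
  gr := (M.gr.tensor N.gr).quot (rel M N) (rel_comp M N)
  d := (rel M N).mapQ (rel M N) (M.gr.dT M.d N.d) (rel_d M N)
  d_hom := Grading.quot_map (s := fun i => i + (-1, 0)) fun i t ht =>
    ((Cx.tens M.toCx N.toCx).d_hom i t ht).mkQ
  d_d t := by
    obtain ⟨t, rfl⟩ := (rel M N).mkQ_surjective t
    rw [Submodule.mkQ_apply, Submodule.mapQ_apply, Submodule.mapQ_apply]
    exact (Submodule.Quotient.mk_eq_zero _).mpr (by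
      rw [(Cx.tens M.toCx N.toCx).d_d t]; exact Submodule.zero_mem _)
  act :=
    { toFun := fun a => (rel M N).mapQ (rel M N) (TensorProduct.map (M.act a) LinearMap.id)
        (rel_act M N a)
      map_one' := by
        refine Submodule.linearMap_qext _ (TensorProduct.ext' fun m n => ?_)
        simp
      map_mul' := fun a b => by
        refine Submodule.linearMap_qext _ (TensorProduct.ext' fun m n => ?_)
        simp
      map_zero' := by
        refine Submodule.linearMap_qext _ (TensorProduct.ext' fun m n => ?_)
        simp
      map_add' := fun a b => by
        refine Submodule.linearMap_qext _ (TensorProduct.ext' fun m n => ?_)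
        simp [TensorProduct.add_tmul]
      commutes' := fun r => by
        refine Submodule.linearMap_qext _ (TensorProduct.ext' fun m n => ?_)
        simp [← TensorProduct.smul_tmul', Algebra.algebraMap_eq_smul_one] }
  act_hom k := Grading.quot_map (s := fun i => i + (-1, (k : ℤ) + 1)) fun i t ht => by
    refine Grading.IsHom.mkQ (Grading.tensor_map (s := fun i => i + (-1, (k : ℤ) + 1))
      (f := TensorProduct.map (M.act (e k)) LinearMap.id) (fun i j m n hm hn => ?_) i t ht)
    have := (M.act_hom k i m hm).tmul hn
    rwa [add_right_comm] at this
  d_act k t := by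
    refine LinearMap.congr_fun (f := ((rel M N).mapQ (rel M N) (M.gr.dT M.d N.d) (rel_d M N)) ∘ₗ
        (rel M N).mapQ (rel M N) (TensorProduct.map (M.act (e k)) LinearMap.id) (rel_act M N (e k)))
      (g := - ((rel M N).mapQ (rel M N) (TensorProduct.map (M.act (e k)) LinearMap.id)
        (rel_act M N (e k)) ∘ₗ (rel M N).mapQ (rel M N) (M.gr.dT M.d N.d) (rel_d M N))) ?_ t
    refine Submodule.linearMap_qext _ (TensorProduct.ext' fun m n => ?_)
    change (rel M N).mkQ (M.gr.dT M.d N.d (M.act (e k) m ⊗ₜ n)) = - (rel M N).mkQ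
      (TensorProduct.map (M.act (e k)) LinearMap.id (M.gr.dT M.d N.d (m ⊗ₜ n)))
    rw [← map_neg]
    congr 1
    simp only [Grading.dT_tmul, M.d_act, sign_act_e, map_add, TensorProduct.map_tmul,
      TensorProduct.neg_tmul, LinearMap.id_apply, neg_add]

variable {M N P}

/-- The class of `m ⊗ n`. -/
def tm : M.X →ₗ[ℚ] N.X →ₗ[ℚ] (tens M N).X :=
  (TensorProduct.mk ℚ M.X N.X).compr₂ (rel M N).mkQ

theorem tm_d (m : M.X) (n : N.X) :
    (tens M N).d (tm m n) = tm (M.d m) n + tm (M.gr.sign m) (N.d n) := rfl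

theorem tm_act (a : Etilde) (m : M.X) (n : N.X) :
    (tens M N).act a (tm m n) = tm (M.act a m) n := rfl

theorem tm_isHom {i j : ℤ × ℤ} {m : M.X} {n : N.X} (hm : M.gr.IsHom i m) (hn : N.gr.IsHom j n) :
    (tens M N).gr.IsHom (i + j) (tm m n) := (hm.tmul hn).mkQ

theorem tm_bal (k : ℕ) (m : M.X) (n : N.X) :
    tm (M.act (e k) (M.gr.sign m)) n = tm m (N.act (e k) n) := by
  rw [← sub_eq_zero]
  exact (Submodule.Quotient.mk_eq_zero (rel M N)).mpr (Submodule.subset_span ⟨k, m, n, rfl⟩)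

theorem tm_sign (m : M.X) (n : N.X) :
    (tens M N).gr.sign (tm m n) = tm (M.gr.sign m) (N.gr.sign n) := by
  have := Grading.sign_even (G := M.gr.tensor N.gr) (H := (tens M N).gr) (f := (rel M N).mkQ)
    (fun i t ht => ht.mkQ) (m ⊗ₜ n)
  rw [Grading.sign_tmul] at this
  exact this

theorem tm_ext {V : Type} [AddCommGroup V] [Module ℚ V] {f g : (tens M N).X →ₗ[ℚ] V}
    (h : ∀ m n, f (tm m n) = g (tm m n)) : f = g :=
  Submodule.linearMap_qext _ (TensorProduct.ext' h)

/-- Linear maps out of the tensor product from balanced bilinear maps. -/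
def lift {V : Type} [AddCommGroup V] [Module ℚ V] (f : M.X →ₗ[ℚ] N.X →ₗ[ℚ] V)
    (h : ∀ k m n, f (M.act (e k) (M.gr.sign m)) n = f m (N.act (e k) n)) :
    (tens M N).X →ₗ[ℚ] V :=
  (rel M N).liftQ (TensorProduct.lift f) (by
    rw [rel, Submodule.span_le]
    rintro _ ⟨k, m, n, rfl⟩
    change TensorProduct.lift f _ = 0
    rw [map_sub, TensorProduct.lift.tmul, TensorProduct.lift.tmul, h, sub_self])

theorem lift_tm {V : Type} [AddCommGroup V] [Module ℚ V] (f : M.X →ₗ[ℚ] N.X →ₗ[ℚ] V)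
    (h : ∀ k m n, f (M.act (e k) (M.gr.sign m)) n = f m (N.act (e k) n)) (m : M.X) (n : N.X) :
    lift f h (tm m n) = f m n := rfl

theorem tm_map_hom {V : Type} [AddCommGroup V] [Module ℚ V] {K : Grading (ℤ × ℤ) V}
    {f : (tens M N).X →ₗ[ℚ] V} {s : ℤ × ℤ → ℤ × ℤ}
    (h : ∀ i j m n, M.gr.IsHom i m → N.gr.IsHom j n → K.IsHom (s (i + j)) (f (tm m n))) :
    ∀ k t, (tens M N).gr.IsHom k t → K.IsHom (s k) (f t) :=
  Grading.quot_map (s := s) fun i t ht =>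
    Grading.tensor_map (s := s) (f := f ∘ₗ (rel M N).mkQ) h i t ht

end

/-- An isomorphism of DG modules from a linear equivalence. -/
def mkIso {M N : DGMod} (f : M.X →ₗ[ℚ] N.X) (g : N.X →ₗ[ℚ] M.X) (hfg : ∀ m, g (f m) = m)
    (hgf : ∀ n, f (g n) = n)
    (h : ∀ i m, M.gr.IsHom i m → N.gr.IsHom i (f m))
    (h' : ∀ i m, N.gr.IsHom i m → M.gr.IsHom i (g m))
    (hd : ∀ m, f (M.d m) = N.d (f m)) (ha : ∀ a m, f (M.act a m) = N.act a (f m)) : M ≅ N where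
  hom := ⟨⟨f, h, hd⟩, ha⟩
  inv := ⟨⟨g, h', fun m => by
    conv_lhs => rw [← hgf m, ← hd, hfg]⟩, fun a m => by
    conv_lhs => rw [← hgf m, ← ha, hfg]⟩
  hom_inv_id := hom_ext hfg
  inv_hom_id := hom_ext hgf

end DGMod

namespace DGMod

section
variable {M N P M' N' : DGMod}

theorem map_sign (f : M ⟶ N) (m : M.X) : N.gr.sign (f.toLin m) = f.toLin (M.gr.sign m) :=
  Grading.sign_even f.map_hom m

theorem sign_d (m : M.X) : M.gr.sign (M.d m) = - M.d (M.gr.sign m) :=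
  Grading.sign_odd M.d_hom m

/-- The map `m ⊗ n ↦ f m ⊗ g n`. -/
def tensLin (f : M ⟶ M') (g : N ⟶ N') : (tens M N).X →ₗ[ℚ] (tens M' N').X :=
  lift (tm.compl₁₂ f.toLin g.toLin) fun k m n => by
    simp only [LinearMap.compl₁₂_apply]
    rw [f.map_act, g.map_act, ← tm_bal, map_sign]

theorem tensLin_tm (f : M ⟶ M') (g : N ⟶ N') (m : M.X) (n : N.X) :
    tensLin f g (tm m n) = tm (f.toLin m) (g.toLin n) := rfl

/-- The tensor product of two morphisms. -/
def tensHom (f : M ⟶ M') (g : N ⟶ N') : tens M N ⟶ tens M' N' where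
  toLin := tensLin f g
  map_hom := tm_map_hom (s := fun i => i) fun i j m n hm hn =>
    tm_isHom (f.map_hom i m hm) (g.map_hom j n hn)
  map_d := LinearMap.congr_fun (f := tensLin f g ∘ₗ (tens M N).d)
    (g := (tens M' N').d ∘ₗ tensLin f g) (tm_ext fun m n => by
      simp only [LinearMap.comp_apply, tm_d, map_add, tensLin_tm, f.map_d, g.map_d, map_sign])
  map_act a := LinearMap.congr_fun (f := tensLin f g ∘ₗ (tens M N).act a)
    (g := (tens M' N').act a ∘ₗ tensLin f g) (tm_ext fun m n => by
      simp only [LinearMap.comp_apply, tm_act, tensLin_tm, f.map_act])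

theorem tensHom_tm (f : M ⟶ M') (g : N ⟶ N') (m : M.X) (n : N.X) :
    (tensHom f g).toLin (tm m n) = tm (f.toLin m) (g.toLin n) := rfl

/-- Morphisms out of a tensor product are determined on the classes `m ⊗ n`. -/
theorem tens_ext {Q : DGMod} {f g : tens M N ⟶ Q} (h : ∀ m n, f.toLin (tm m n) = g.toLin (tm m n)) :
    f = g := hom_ext (LinearMap.congr_fun (tm_ext h))

theorem tens_ext₃ {Q : DGMod} {f g : tens (tens M N) P ⟶ Q}
    (h : ∀ m n p, f.toLin (tm (tm m n) p) = g.toLin (tm (tm m n) p)) : f = g := by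
  refine tens_ext fun x p => ?_
  exact LinearMap.congr_fun (f := f.toLin ∘ₗ tm.flip p) (g := g.toLin ∘ₗ tm.flip p)
    (tm_ext fun m n => h m n p) x

theorem tens_ext₃' {Q : DGMod} {f g : tens M (tens N P) ⟶ Q}
    (h : ∀ m n p, f.toLin (tm m (tm n p)) = g.toLin (tm m (tm n p))) : f = g := by
  refine tens_ext fun m x => ?_
  exact LinearMap.congr_fun (f := f.toLin ∘ₗ tm m) (g := g.toLin ∘ₗ tm m)
    (tm_ext fun n p => h m n p) x

theorem tens_ext₄ {O Q : DGMod} {f g : tens (tens (tens O M) N) P ⟶ Q}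
    (h : ∀ o m n p, f.toLin (tm (tm (tm o m) n) p) = g.toLin (tm (tm (tm o m) n) p)) : f = g := by
  refine tens_ext₃ fun x n p => ?_
  exact LinearMap.congr_fun (f := f.toLin ∘ₗ tm.flip p ∘ₗ tm.flip n)
    (g := g.toLin ∘ₗ tm.flip p ∘ₗ tm.flip n) (tm_ext fun o m => h o m n p) x

variable (M N P)

/-- `m ⊗ n ↦ (p ↦ m ⊗ (n ⊗ p))`. -/
def assocAux : (tens M N).X →ₗ[ℚ] P.X →ₗ[ℚ] (tens M (tens N P)).X :=
  lift (LinearMap.mk₂ ℚ (fun m n => (tm m : (tens N P).X →ₗ[ℚ] _) ∘ₗ (tm n : P.X →ₗ[ℚ] _))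
    (fun m m' n => LinearMap.ext fun p => by simp) (fun c m n => LinearMap.ext fun p => by simp)
    (fun m n n' => LinearMap.ext fun p => by simp) (fun c m n => LinearMap.ext fun p => by simp))
    fun k m n => LinearMap.ext fun p => tm_bal k m (tm n p)

theorem assocAux_tm (m : M.X) (n : N.X) (p : P.X) :
    assocAux M N P (tm m n) p = tm m (tm n p) := rfl

/-- `(m ⊗ n) ⊗ p ↦ m ⊗ (n ⊗ p)`. -/
def assocLin : (tens (tens M N) P).X →ₗ[ℚ] (tens M (tens N P)).X :=
  lift (assocAux M N P) fun k x p => by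
    refine LinearMap.congr_fun (f := (assocAux M N P).flip p ∘ₗ (tens M N).act (e k) ∘ₗ
      (tens M N).gr.sign) (g := (assocAux M N P).flip (P.act (e k) p)) (tm_ext fun m n => ?_) x
    simp only [LinearMap.comp_apply, LinearMap.flip_apply, tm_sign, tm_act, assocAux_tm]
    rw [tm_bal, tm_act, tm_bal]

theorem assocLin_tm (m : M.X) (n : N.X) (p : P.X) :
    assocLin M N P (tm (tm m n) p) = tm m (tm n p) := rfl

/-- `m ↦ (n ⊗ p ↦ (m ⊗ n) ⊗ p)`. -/
def assocInvAux : M.X →ₗ[ℚ] (tens N P).X →ₗ[ℚ] (tens (tens M N) P).X where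
  toFun m := lift ((tm : (tens M N).X →ₗ[ℚ] P.X →ₗ[ℚ] _) ∘ₗ (tm m : N.X →ₗ[ℚ] _)) fun k n p => by
    simp only [LinearMap.comp_apply]
    rw [← tm_bal k (tm m n) p, tm_sign, tm_act, tm_bal]
  map_add' m m' := tm_ext fun n p => by
    simp only [lift_tm, LinearMap.comp_apply, LinearMap.add_apply, map_add]
  map_smul' c m := tm_ext fun n p => by
    simp only [lift_tm, LinearMap.comp_apply, LinearMap.smul_apply, map_smul, RingHom.id_apply]

theorem assocInvAux_tm (m : M.X) (n : N.X) (p : P.X) :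
    assocInvAux M N P m (tm n p) = tm (tm m n) p := rfl

/-- `m ⊗ (n ⊗ p) ↦ (m ⊗ n) ⊗ p`. -/
def assocInvLin : (tens M (tens N P)).X →ₗ[ℚ] (tens (tens M N) P).X :=
  lift (assocInvAux M N P) fun k m x => by
    refine LinearMap.congr_fun (f := assocInvAux M N P (M.act (e k) (M.gr.sign m)))
      (g := assocInvAux M N P m ∘ₗ (tens N P).act (e k)) (tm_ext fun n p => ?_) x
    simp only [LinearMap.comp_apply, tm_act, assocInvAux_tm]
    rw [tm_bal]

theorem assocInvLin_tm (m : M.X) (n : N.X) (p : P.X) :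
    assocInvLin M N P (tm m (tm n p)) = tm (tm m n) p := rfl

theorem tm_ext₃ {V : Type} [AddCommGroup V] [Module ℚ V] {f g : (tens (tens M N) P).X →ₗ[ℚ] V}
    (h : ∀ m n p, f (tm (tm m n) p) = g (tm (tm m n) p)) : f = g :=
  tm_ext fun x p => LinearMap.congr_fun (f := f ∘ₗ tm.flip p) (g := g ∘ₗ tm.flip p)
    (tm_ext fun m n => h m n p) x

theorem tm_ext₃' {V : Type} [AddCommGroup V] [Module ℚ V] {f g : (tens M (tens N P)).X →ₗ[ℚ] V}
    (h : ∀ m n p, f (tm m (tm n p)) = g (tm m (tm n p))) : f = g :=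
  tm_ext fun m x => LinearMap.congr_fun (f := f ∘ₗ tm m) (g := g ∘ₗ tm m)
    (tm_ext fun n p => h m n p) x

theorem tm_map_hom₃ {V : Type} [AddCommGroup V] [Module ℚ V] {K : Grading (ℤ × ℤ) V}
    {f : (tens (tens M N) P).X →ₗ[ℚ] V}
    (h : ∀ i j l m n p, M.gr.IsHom i m → N.gr.IsHom j n → P.gr.IsHom l p →
      K.IsHom (i + j + l) (f (tm (tm m n) p))) :
    ∀ k t, (tens (tens M N) P).gr.IsHom k t → K.IsHom k (f t) :=
  tm_map_hom (s := fun i => i) fun i l x p hx hp =>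
    tm_map_hom (f := f ∘ₗ tm.flip p) (s := fun i => i + l)
      (fun a b m n hm hn => h a b l m n p hm hn hp) i x hx

theorem tm_map_hom₃' {V : Type} [AddCommGroup V] [Module ℚ V] {K : Grading (ℤ × ℤ) V}
    {f : (tens M (tens N P)).X →ₗ[ℚ] V}
    (h : ∀ i j l m n p, M.gr.IsHom i m → N.gr.IsHom j n → P.gr.IsHom l p →
      K.IsHom (i + (j + l)) (f (tm m (tm n p)))) :
    ∀ k t, (tens M (tens N P)).gr.IsHom k t → K.IsHom k (f t) :=
  tm_map_hom (s := fun i => i) fun i l m x hm hx =>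
    tm_map_hom (f := f ∘ₗ tm m) (s := fun j => i + j)
      (fun a b n p hn hp => h i a b m n p hm hn hp) l x hx

/-- The associativity isomorphism. -/
def assoc : tens (tens M N) P ≅ tens M (tens N P) :=
  mkIso (assocLin M N P) (assocInvLin M N P)
    (LinearMap.congr_fun (f := assocInvLin M N P ∘ₗ assocLin M N P) (g := LinearMap.id)
      (tm_ext₃ M N P fun m n p => rfl))
    (LinearMap.congr_fun (f := assocLin M N P ∘ₗ assocInvLin M N P) (g := LinearMap.id)
      (tm_ext₃' M N P fun m n p => rfl))
    (tm_map_hom₃ M N P fun i j l m n p hm hn hp => by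
      rw [assocLin_tm, add_assoc]; exact tm_isHom hm (tm_isHom hn hp))
    (tm_map_hom₃' M N P fun i j l m n p hm hn hp => by
      rw [assocInvLin_tm, ← add_assoc]; exact tm_isHom (tm_isHom hm hn) hp)
    (LinearMap.congr_fun (f := assocLin M N P ∘ₗ (tens (tens M N) P).d)
      (g := (tens M (tens N P)).d ∘ₗ assocLin M N P) (tm_ext₃ M N P fun m n p => by
        simp only [LinearMap.comp_apply, tm_d, map_add, LinearMap.add_apply, assocLin_tm, tm_sign,
          add_assoc]))
    (fun a => LinearMap.congr_fun (f := assocLin M N P ∘ₗ (tens (tens M N) P).act a)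
      (g := (tens M (tens N P)).act a ∘ₗ assocLin M N P) (tm_ext₃ M N P fun m n p => by
        simp only [LinearMap.comp_apply, tm_act, assocLin_tm]))

/-- The Koszul symmetry on the tensor product of DG modules. -/
def swapLin : (tens M N).X →ₗ[ℚ] (tens N M).X :=
  lift ((2⁻¹ : ℚ) • ((tm : N.X →ₗ[ℚ] M.X →ₗ[ℚ] _).flip + (tm : N.X →ₗ[ℚ] M.X →ₗ[ℚ] _).flip ∘ₗ M.gr.sign
    + ((tm : N.X →ₗ[ℚ] M.X →ₗ[ℚ] _) ∘ₗ N.gr.sign).flip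
    - ((tm : N.X →ₗ[ℚ] M.X →ₗ[ℚ] _) ∘ₗ N.gr.sign).flip ∘ₗ M.gr.sign)) fun k m n => by
    simp only [LinearMap.smul_apply, LinearMap.add_apply, LinearMap.sub_apply, LinearMap.comp_apply,
      LinearMap.flip_apply, sign_act_e, Grading.sign_sign, map_neg, LinearMap.neg_apply]
    simp only [← tm_bal, Grading.sign_sign]
    module

theorem swapLin_tm (m : M.X) (n : N.X) : swapLin M N (tm m n) = (2⁻¹ : ℚ) •
    (tm n m + tm n (M.gr.sign m) + tm (N.gr.sign n) m - tm (N.gr.sign n) (M.gr.sign m)) := rfl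

theorem swapLin_hom_tm {i j : ℤ × ℤ} {m : M.X} {n : N.X} (hm : M.gr.IsHom i m)
    (hn : N.gr.IsHom j n) : swapLin M N (tm m n) = ((-1 : ℚ) ^ (i.1 * j.1)) • tm n m := by
  have := congrArg (rel N M).mkQ (Grading.swap_hom_tmul hm hn)
  rw [map_smul] at this
  exact this

theorem swapLin_act (a : Etilde) (t : (tens M N).X) :
    swapLin M N ((tens M N).act a t) = (tens N M).act a (swapLin M N t) := by
  refine LinearMap.congr_fun (f := swapLin M N ∘ₗ LinearMap.flip (tens M N).act.toLinearMap t)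
    (g := LinearMap.flip (tens N M).act.toLinearMap (swapLin M N t))
    (Etilde.linearMap_ext ?_ fun k => ?_) a
  · simp
  · refine LinearMap.congr_fun (f := swapLin M N ∘ₗ (tens M N).act (e k))
      (g := (tens N M).act (e k) ∘ₗ swapLin M N) (tm_ext fun m n => ?_) t
    simp only [LinearMap.comp_apply, tm_act, swapLin_tm, map_smul, map_add, map_sub,
      sign_act_e, map_neg]
    simp only [← tm_bal, Grading.sign_sign]
    module

/-- The symmetry isomorphism. -/
def braid : tens M N ≅ tens N M :=
  have hs : ∀ (M N : DGMod) t, swapLin N M (swapLin M N t) = t := fun M N =>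
    LinearMap.congr_fun (f := swapLin N M ∘ₗ swapLin M N) (g := LinearMap.id)
      (tm_ext fun m n => by
        simp only [LinearMap.comp_apply, swapLin_tm, map_smul, map_add, map_sub,
          Grading.sign_sign, LinearMap.id_apply]
        module)
  have hh : ∀ (M N : DGMod) k t, (tens M N).gr.IsHom k t → (tens N M).gr.IsHom k (swapLin M N t) :=
    fun M N => tm_map_hom (s := fun i => i) fun i j m n hm hn => by
      rw [swapLin_hom_tm M N hm hn, add_comm i j]
      exact (tm_isHom hn hm).smul _
  mkIso (swapLin M N) (swapLin N M) (hs M N) (hs N M) (hh M N) (hh N M)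
    (LinearMap.congr_fun (f := swapLin M N ∘ₗ (tens M N).d)
      (g := (tens N M).d ∘ₗ swapLin M N) (tm_ext fun m n => by
        simp only [LinearMap.comp_apply, tm_d, swapLin_tm, map_smul, map_add, map_sub,
          Grading.sign_sign, sign_d, map_neg, LinearMap.neg_apply]
        module))
    (swapLin_act M N)

end
end DGMod

namespace DGMod

/-- The components of an element of the square-zero extension: `1` has degree `(0, 0)` and
`e_{2k+1}` has degree `(-1, k + 1)`. -/
def unitComp : Etilde →ₗ[ℚ] (ℤ × ℤ →₀ Etilde) :=
  Finsupp.lsingle 0 ∘ₗ LinearMap.toSpanSingleton ℚ Etilde 1 ∘ₗ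
      (TrivSqZeroExt.fstHom ℚ ℚ (ℕ →₀ ℚ)).toLinearMap +
    (Finsupp.lsum ℚ fun k : ℕ => Finsupp.lsingle (-1, (k : ℤ) + 1) ∘ₗ
      LinearMap.toSpanSingleton ℚ Etilde (e k)) ∘ₗ TrivSqZeroExt.sndHom ℚ (ℕ →₀ ℚ)

theorem unitComp_one : unitComp 1 = Finsupp.single 0 1 := by
  simp [unitComp]

theorem unitComp_e (k : ℕ) : unitComp (e k) = Finsupp.single (-1, (k : ℤ) + 1) (e k) := by
  simp [unitComp, e]

/-- The square-zero extension as a DG module over itself, with zero differential. -/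
def unit : DGMod where
  X := Etilde
  gr := Grading.ofSpan unitComp <| by
    rw [eq_top_iff, ← Etilde.span_top]
    refine Submodule.span_mono ?_
    rintro _ (rfl | ⟨k, rfl⟩)
    · exact ⟨_, unitComp_one⟩
    · exact ⟨_, unitComp_e k⟩
  d := 0
  d_hom i m _ := Grading.IsHom.zero _ _
  d_d _ := rfl
  act := Algebra.lmul ℚ Etilde
  act_hom k := by
    refine Grading.map_of_span (s := fun i => i + (-1, (k : ℤ) + 1))
      (f := Algebra.lmul ℚ Etilde (e k)) Etilde.span_top ?_
    rintro _ (rfl | ⟨l, rfl⟩)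
    · refine ⟨0, unitComp_one, ?_⟩
      change unitComp (e k * 1) = Finsupp.single _ (e k * 1)
      rw [mul_one, unitComp_e, zero_add]
    · refine ⟨_, unitComp_e l, ?_⟩
      change unitComp (e k * e l) = Finsupp.single _ (e k * e l)
      rw [e_mul_e, map_zero, Finsupp.single_zero]
  d_act k m := by simp

/-- `1`, as an element of the unit module. -/
def uone : unit.X := (1 : Etilde)

theorem uone_isHom : unit.gr.IsHom 0 uone := unitComp_one
theorem uone_sign : unit.gr.sign uone = uone := by
  rw [Grading.sign_apply uone_isHom]; simp
theorem uone_d : unit.d uone = 0 := rfl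

theorem act_uone (a : Etilde) : unit.act a uone = (a : Etilde) := mul_one a

variable (M N P : DGMod)

theorem unit_ext {V : Type} [AddCommGroup V] [Module ℚ V] {f g : unit.X →ₗ[ℚ] V}
    (h1 : f uone = g uone) (he : ∀ k, f (unit.act (e k) uone) = g (unit.act (e k) uone)) : f = g :=
  Etilde.linearMap_ext (f := f) (g := g) h1 fun k => by
    have := he k
    rwa [act_uone] at this

theorem left_ext {V : Type} [AddCommGroup V] [Module ℚ V] {f g : (tens unit M).X →ₗ[ℚ] V}
    (h : ∀ m, f (tm uone m) = g (tm uone m)) : f = g :=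
  tm_ext fun a m => LinearMap.congr_fun (f := f ∘ₗ tm.flip m) (g := g ∘ₗ tm.flip m)
    (unit_ext (h m) fun k => by
      have := h (M.act (e k) m)
      rw [← tm_bal, uone_sign] at this
      exact this) a

theorem right_ext {V : Type} [AddCommGroup V] [Module ℚ V] {f g : (tens M unit).X →ₗ[ℚ] V}
    (h : ∀ m, f (tm m uone) = g (tm m uone)) : f = g :=
  tm_ext fun m a => LinearMap.congr_fun (f := f ∘ₗ tm m) (g := g ∘ₗ tm m)
    (unit_ext (h m) fun k => by
      have := h (M.act (e k) (M.gr.sign m))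
      rw [tm_bal] at this
      exact this) a

/-- The action, on the underlying space of the unit module. -/
def actLin : unit.X →ₗ[ℚ] M.X →ₗ[ℚ] M.X := M.act.toLinearMap

/-- `a ⊗ m ↦ a m`. -/
def lunitLin : (tens unit M).X →ₗ[ℚ] M.X :=
  lift (actLin M) fun k a m => by
    refine LinearMap.congr_fun
      (f := (actLin M).flip m ∘ₗ (unit.act (e k) ∘ₗ unit.gr.sign))
      (g := (actLin M).flip (M.act (e k) m)) (unit_ext ?_ fun l => ?_) a
    · change actLin M (unit.act (e k) (unit.gr.sign uone)) m = actLin M uone (M.act (e k) m)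
      rw [uone_sign, act_uone]
      exact (M.act_one _).symm
    · change actLin M (unit.act (e k) (unit.gr.sign (unit.act (e l) uone))) m =
        actLin M (unit.act (e l) uone) (M.act (e k) m)
      rw [sign_act_e, map_neg, act_ee, neg_zero, map_zero, act_uone]
      exact (M.act_ee l k m).symm

theorem lunitLin_tm (a : Etilde) (m : M.X) : lunitLin M (tm (unit.act a uone) m) = M.act a m := by
  rw [act_uone]; rfl

theorem lunitLin_one (m : M.X) : lunitLin M (tm uone m) = m := M.act_one m

/-- The left unit isomorphism. -/
def lunit : tens unit M ≅ M :=
  mkIso (lunitLin M) (tm uone)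
    (LinearMap.congr_fun (f := tm uone ∘ₗ lunitLin M) (g := LinearMap.id) (left_ext M fun m => by
      rw [LinearMap.comp_apply, lunitLin_one]; rfl))
    (lunitLin_one M)
    (by
      refine Grading.map_of_span (s := fun i => i)
        (S := {t | ∃ i m, M.gr.IsHom i m ∧ t = (tm uone m : (tens unit M).X)}) ?_ ?_
      · have h : ∀ Q : Submodule ℚ (tens unit M).X,
            Q.mkQ ∘ₗ (tm uone : M.X →ₗ[ℚ] (tens unit M).X) = 0 → Q = ⊤ := fun Q hQ => by
          have : Q.mkQ = 0 := left_ext M fun m => LinearMap.congr_fun hQ m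
          rw [← Submodule.ker_mkQ Q, this, LinearMap.ker_zero]
        refine h _ (M.gr.ext_hom fun i m hm => ?_)
        exact (Submodule.Quotient.mk_eq_zero _).mpr (Submodule.subset_span ⟨i, m, hm, rfl⟩)
      · rintro _ ⟨i, m, hm, rfl⟩
        refine ⟨i, ?_, ?_⟩
        · have := tm_isHom uone_isHom hm
          rwa [zero_add] at this
        · rwa [lunitLin_one])
    (fun i m hm => by
      have := tm_isHom uone_isHom hm
      rwa [zero_add] at this)
    (LinearMap.congr_fun (f := lunitLin M ∘ₗ (tens unit M).d) (g := M.d ∘ₗ lunitLin M)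
      (left_ext M fun m => by
        rw [LinearMap.comp_apply, LinearMap.comp_apply, tm_d, lunitLin_one, uone_d, uone_sign,
          map_add, lunitLin_one, map_zero, LinearMap.zero_apply, map_zero, zero_add]))
    (fun a => LinearMap.congr_fun (f := lunitLin M ∘ₗ (tens unit M).act a)
      (g := M.act a ∘ₗ lunitLin M) (left_ext M fun m => by
        rw [LinearMap.comp_apply, LinearMap.comp_apply, tm_act, lunitLin_one, lunitLin_tm]))

theorem lunit_hom_one (m : M.X) : (lunit M).hom.toLin (tm uone m) = m := lunitLin_one M m

/-- The right unit isomorphism. -/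
def runit : tens M unit ≅ M := braid M unit ≪≫ lunit M

theorem runit_hom_one (m : M.X) : (runit M).hom.toLin (tm m uone) = m := by
  change lunitLin M (swapLin M unit (tm m uone)) = m
  rw [swapLin_tm, uone_sign]
  simp only [map_smul, map_add, map_sub, lunitLin_one]
  module

instance : MonoidalCategoryStruct DGMod where
  tensorObj := tens
  whiskerLeft M _ _ g := tensHom (𝟙 M) g
  whiskerRight f N := tensHom f (𝟙 N)
  tensorHom := tensHom
  tensorUnit := unit
  associator := assoc
  leftUnitor := lunit
  rightUnitor := runit

instance : MonoidalCategory DGMod where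
  tensorHom_def f g := tens_ext fun _ _ => rfl
  id_tensorHom_id M N := tens_ext fun _ _ => rfl
  tensorHom_comp_tensorHom f g h k := tens_ext fun _ _ => rfl
  whiskerLeft_id M N := tens_ext fun _ _ => rfl
  id_whiskerRight M N := tens_ext fun _ _ => rfl
  associator_naturality {M N P M' N' P'} f g h :=
    tens_ext₃ fun _ _ _ => rfl
  leftUnitor_naturality {M N} f := hom_ext (LinearMap.congr_fun (left_ext M fun m => by
    change (lunit N).hom.toLin (tm uone (f.toLin m)) = f.toLin ((lunit M).hom.toLin (tm uone m))
    rw [lunit_hom_one, lunit_hom_one]))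
  rightUnitor_naturality {M N} f := hom_ext (LinearMap.congr_fun (right_ext M fun m => by
    change (runit N).hom.toLin (tm (f.toLin m) uone) = f.toLin ((runit M).hom.toLin (tm m uone))
    rw [runit_hom_one, runit_hom_one]))
  pentagon M N P Q := tens_ext₄ fun _ _ _ _ => rfl
  triangle M N := tens_ext fun x n => by
    refine LinearMap.congr_fun
      (f := Cx.Hom.toLin (Hom.toHom ((assoc M unit N).hom ≫ tensHom (𝟙 M) (lunit N).hom)) ∘ₗ
        tm.flip n)
      (g := Cx.Hom.toLin (Hom.toHom (tensHom (runit M).hom (𝟙 N))) ∘ₗ tm.flip n)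
      (right_ext M fun m => ?_) x
    change tm m ((lunit N).hom.toLin (tm uone n)) = tm ((runit M).hom.toLin (tm m uone)) n
    rw [lunit_hom_one, runit_hom_one]

instance : BraidedCategory DGMod where
  braiding := braid
  braiding_naturality_right M N N' g := tens_ext fun m n => by
    change swapLin M N' (tm m (g.toLin n)) = (tensHom g (𝟙 M)).toLin (swapLin M N (tm m n))
    simp only [swapLin_tm, map_smul, map_add, map_sub, map_sign, tensHom_tm]
    rfl
  braiding_naturality_left {M M'} f N := tens_ext fun m n => by
    change swapLin M' N (tm (f.toLin m) n) = (tensHom (𝟙 N) f).toLin (swapLin M N (tm m n))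
    simp only [swapLin_tm, map_smul, map_add, map_sub, map_sign, tensHom_tm]
    rfl
  hexagon_forward M N P := hom_ext (LinearMap.congr_fun (tm_ext₃ M N P fun m n p => by
    change assocLin N P M (swapLin M (tens N P) (tm m (tm n p))) =
      tensLin (𝟙 N) (braid M P).hom (assocLin N M P (tensLin (braid M N).hom (𝟙 P)
        (tm (tm m n) p)))
    have hb : ∀ (M N : DGMod) t, (braid M N).hom.toLin t = swapLin M N t := fun _ _ _ => rfl
    simp only [tensLin_tm, id_apply, hb, swapLin_tm, tm_sign, map_smul, map_add, map_sub,
      LinearMap.smul_apply, LinearMap.add_apply, LinearMap.sub_apply, assocLin_tm, Grading.sign_sign]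
    module))
  hexagon_reverse M N P := hom_ext (LinearMap.congr_fun (tm_ext₃' M N P fun m n p => by
    change assocInvLin P M N (swapLin (tens M N) P (tm (tm m n) p)) =
      tensLin (braid M P).hom (𝟙 N) (assocInvLin M P N (tensLin (𝟙 M) (braid N P).hom
        (tm m (tm n p))))
    have hb : ∀ (M N : DGMod) t, (braid M N).hom.toLin t = swapLin M N t := fun _ _ _ => rfl
    simp only [tensLin_tm, id_apply, hb, swapLin_tm, tm_sign, map_smul, map_add, map_sub,
      LinearMap.smul_apply, LinearMap.add_apply, LinearMap.sub_apply, assocInvLin_tm, Grading.sign_sign]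
    module))

instance : SymmetricCategory DGMod where
  symmetry M N := (braid M N).hom_inv_id

end DGMod

section
variable {X Y : Type} [AddCommGroup X] [Module ℚ X] [AddCommGroup Y] [Module ℚ Y]

/-- `f` induces a bijection `ker d / im d → ker d' / im d'`. -/
structure IsQis (f : X →ₗ[ℚ] Y) (d : X →ₗ[ℚ] X) (d' : Y →ₗ[ℚ] Y) : Prop where
  inj : ∀ x, d x = 0 → (∃ y, d' y = f x) → ∃ z, d z = x
  surj : ∀ y, d' y = 0 → ∃ x, d x = 0 ∧ ∃ z, d' z = y - f x

/-- `f` is a chain homotopy equivalence (of ungraded complexes). -/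
def IsHtpyEquiv (f : X →ₗ[ℚ] Y) (d : X →ₗ[ℚ] X) (d' : Y →ₗ[ℚ] Y) : Prop :=
  ∃ (g : Y →ₗ[ℚ] X) (h : X →ₗ[ℚ] X) (k : Y →ₗ[ℚ] Y), (∀ y, d (g y) = g (d' y)) ∧
    (∀ x, x = g (f x) + d (h x) + h (d x)) ∧ ∀ y, y = f (g y) + d' (k y) + k (d' y)

theorem IsHtpyEquiv.isQis {f : X →ₗ[ℚ] Y} {d : X →ₗ[ℚ] X} {d' : Y →ₗ[ℚ] Y}
    (hf : IsHtpyEquiv f d d') : IsQis f d d' := by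
  obtain ⟨g, h, k, hg, hx, hy⟩ := hf
  refine ⟨?_, ?_⟩
  · rintro x h0 ⟨y, hxy⟩
    refine ⟨g y + h x, ?_⟩
    have := hx x
    rw [h0, map_zero, add_zero, ← hxy, ← hg] at this
    rw [map_add, ← this]
  · intro y h0
    refine ⟨g y, by rw [hg, h0, map_zero], k y, ?_⟩
    have := hy y
    rw [h0, map_zero, add_zero] at this
    rw [eq_sub_iff_add_eq, add_comm, ← this]

theorem exists_contraction (D : X →ₗ[ℚ] X) (h : ∀ x, D x = 0 → ∃ z, D z = x)
    (hD : ∀ x, D (D x) = 0) : ∃ H : X →ₗ[ℚ] X, ∀ x, D (H x) + H (D x) = x := by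
  obtain ⟨s, hs⟩ := D.rangeRestrict.exists_rightInverse_of_surjective D.range_rangeRestrict
  obtain ⟨p, hp⟩ := (LinearMap.range D).subtype.exists_leftInverse_of_injective
    (LinearMap.range D).ker_subtype
  have h1 : ∀ x, D (s (p (D x))) = D x := fun x => by
    have a1 : p (D x) = ⟨D x, x, rfl⟩ := LinearMap.congr_fun hp ⟨D x, x, rfl⟩
    have a2 := congrArg Subtype.val (LinearMap.congr_fun hs ⟨D x, x, rfl⟩)
    rw [a1]
    exact a2
  let t := s ∘ₗ p
  have ht : ∀ x, D (t (D x)) = D x := h1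
  refine ⟨t ∘ₗ (LinearMap.id - t ∘ₗ D), fun x => ?_⟩
  have h3 : ∀ x, D (t (x - t (D x))) = x - t (D x) := fun x => by
    obtain ⟨z, hz⟩ := h (x - t (D x)) (by rw [map_sub, ht, sub_self])
    rw [← hz, ht]
  simp only [LinearMap.comp_apply, LinearMap.sub_apply, LinearMap.id_apply]
  rw [h3, hD, map_zero, sub_zero, sub_add_cancel]

theorem IsQis.isHtpyEquiv {f : X →ₗ[ℚ] Y} {d : X →ₗ[ℚ] X} {d' : Y →ₗ[ℚ] Y}
    (hf : IsQis f d d') (hfd : ∀ x, f (d x) = d' (f x)) (hd : ∀ x, d (d x) = 0)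
    (hd' : ∀ y, d' (d' y) = 0) : IsHtpyEquiv f d d' := by
  let D : X × Y →ₗ[ℚ] X × Y :=
    LinearMap.prod (d ∘ₗ LinearMap.fst ℚ X Y) (f ∘ₗ LinearMap.fst ℚ X Y - d' ∘ₗ LinearMap.snd ℚ X Y)
  have hD : ∀ x y, D (x, y) = (d x, f x - d' y) := fun x y => rfl
  obtain ⟨H, hH⟩ := exists_contraction D
    (by
      rintro ⟨x, y⟩ h0
      rw [hD, Prod.mk_eq_zero] at h0
      obtain ⟨z, hz⟩ := hf.inj x h0.1 ⟨y, (sub_eq_zero.mp h0.2).symm⟩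
      obtain ⟨x', h1, w, hw⟩ := hf.surj (f z - y) (by
        rw [map_sub, ← hfd, hz, h0.2])
      refine ⟨(z - x', w), ?_⟩
      rw [hD, map_sub, h1, hz, sub_zero, hw, map_sub]
      exact Prod.ext rfl (by simp))
    (by
      rintro ⟨x, y⟩
      rw [hD, hD, hd, hfd, map_sub, hd']
      simp)
  refine ⟨LinearMap.fst ℚ X Y ∘ₗ H ∘ₗ LinearMap.inr ℚ X Y,
    LinearMap.fst ℚ X Y ∘ₗ H ∘ₗ LinearMap.inl ℚ X Y,
    -(LinearMap.snd ℚ X Y ∘ₗ H ∘ₗ LinearMap.inr ℚ X Y), ?_, ?_, ?_⟩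
  · intro y
    have h1 := congrArg Prod.fst (hH (0, y))
    have h2 : D (0, y) = -((0 : X), d' y) := by rw [hD]; simp
    rw [h2, map_neg] at h1
    change d (H (0, y)).1 + -(H (0, d' y)).1 = 0 at h1
    exact eq_of_sub_eq_zero ((sub_eq_add_neg _ _).trans h1)
  · intro x
    have h1 := congrArg Prod.fst (hH (x, 0))
    have h2 : D (x, 0) = (d x, (0 : Y)) + (0, f x) := by rw [hD]; simp
    rw [h2, map_add] at h1
    change d (H (x, 0)).1 + ((H (d x, 0)).1 + (H (0, f x)).1) = x at h1
    change x = (H (0, f x)).1 + d (H (x, 0)).1 + (H (d x, 0)).1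
    conv_lhs => rw [← h1]
    abel
  · intro y
    have h1 := congrArg Prod.snd (hH (0, y))
    have h2 : D (0, y) = -((0 : X), d' y) := by rw [hD]; simp
    rw [h2, map_neg] at h1
    change f (H (0, y)).1 - d' (H (0, y)).2 + -(H (0, d' y)).2 = y at h1
    change y = f (H (0, y)).1 + d' (-(H (0, y)).2) + -(H (0, d' y)).2
    conv_lhs => rw [← h1]
    rw [map_neg]
    abel

end

namespace Cx
variable {J : Type} [AddCommGroup J]

/-- Chain maps that induce isomorphisms in homology. -/
def qis (J : Type) [AddCommGroup J] : MorphismProperty (Cx J) :=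
  fun M N f => IsQis f.toLin M.d N.d

instance : (qis J).IsStableUnderComposition where
  comp_mem {M N P} f g hf hg := by
    refine ⟨fun x h0 hy => ?_, fun y h0 => ?_⟩
    · exact hf.inj x h0 (hg.inj _ (by rw [← f.map_d, h0, map_zero]) hy)
    · obtain ⟨n, h1, w, hw⟩ := hg.surj y h0
      obtain ⟨m, h2, v, hv⟩ := hf.surj n h1
      refine ⟨m, h2, w + g.toLin v, ?_⟩
      rw [map_add, hw, ← g.map_d, hv, map_sub, comp_toLin, LinearMap.comp_apply]
      abel

theorem isomorphisms_le_qis : MorphismProperty.isomorphisms (Cx J) ≤ qis J := by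
  intro M N f hf
  have : IsIso f := hf
  have h1 : ∀ m, (inv f).toLin (f.toLin m) = m := fun m =>
    LinearMap.congr_fun (congrArg Hom.toLin (IsIso.hom_inv_id f)) m
  have h2 : ∀ m, f.toLin ((inv f).toLin m) = m := fun m =>
    LinearMap.congr_fun (congrArg Hom.toLin (IsIso.inv_hom_id f)) m
  refine ⟨fun x _ ⟨y, hy⟩ => ⟨(inv f).toLin y, ?_⟩, fun y h0 => ⟨(inv f).toLin y, ?_, 0, ?_⟩⟩
  · rw [← (inv f).map_d, hy, h1]
  · rw [← (inv f).map_d, h0, map_zero]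
  · rw [h2, sub_self, map_zero]

instance : (qis J).IsMultiplicative where
  id_mem M := isomorphisms_le_qis _ (MorphismProperty.isomorphisms.infer_property (𝟙 M))

instance : (qis J).RespectsIso :=
  MorphismProperty.respectsIso_of_isStableUnderComposition isomorphisms_le_qis

theorem qis_whiskerLeft (N : Cx J) {M M' : Cx J} (f : M ⟶ M') (hf : qis J f) : qis J (N ◁ f) := by
  obtain ⟨g, h, k, hg, hx, hy⟩ := IsQis.isHtpyEquiv hf f.map_d M.d_d M'.d_d
  refine IsHtpyEquiv.isQis ⟨TensorProduct.map LinearMap.id g, TensorProduct.map N.gr.sign h,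
    TensorProduct.map N.gr.sign k, ?_, ?_, ?_⟩
  · refine LinearMap.congr_fun (f := N.gr.dT N.d M.d ∘ₗ TensorProduct.map LinearMap.id g)
      (g := TensorProduct.map LinearMap.id g ∘ₗ N.gr.dT N.d M'.d) (TensorProduct.ext' fun n m => ?_)
    simp only [LinearMap.comp_apply, Grading.dT_tmul, map_add, TensorProduct.map_tmul,
      LinearMap.id_apply, hg]
  · refine LinearMap.congr_fun (f := LinearMap.id)
      (g := TensorProduct.map LinearMap.id g ∘ₗ TensorProduct.map LinearMap.id f.toLin +
        N.gr.dT N.d M.d ∘ₗ TensorProduct.map N.gr.sign h +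
        TensorProduct.map N.gr.sign h ∘ₗ N.gr.dT N.d M.d) (TensorProduct.ext' fun n m => ?_)
    simp only [LinearMap.comp_apply, LinearMap.add_apply, Grading.dT_tmul, map_add,
      TensorProduct.map_tmul, LinearMap.id_apply, sign_d, Grading.sign_sign,
      TensorProduct.neg_tmul]
    conv_lhs => rw [hx m]
    simp only [TensorProduct.tmul_add]
    abel
  · refine LinearMap.congr_fun (f := LinearMap.id)
      (g := TensorProduct.map LinearMap.id f.toLin ∘ₗ TensorProduct.map LinearMap.id g +
        N.gr.dT N.d M'.d ∘ₗ TensorProduct.map N.gr.sign k +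
        TensorProduct.map N.gr.sign k ∘ₗ N.gr.dT N.d M'.d) (TensorProduct.ext' fun n m => ?_)
    simp only [LinearMap.comp_apply, LinearMap.add_apply, Grading.dT_tmul, map_add,
      TensorProduct.map_tmul, LinearMap.id_apply, sign_d, Grading.sign_sign,
      TensorProduct.neg_tmul]
    conv_lhs => rw [hy m]
    simp only [TensorProduct.tmul_add]
    abel

/-- Over a field the tensor product of complexes preserves quasi-isomorphisms. -/
instance : (qis J).IsMonoidal where
  whiskerLeft N _ _ f hf := qis_whiskerLeft N f hf
  whiskerRight f hf N := by
    have h := (qis J).comp_mem _ _ (isomorphisms_le_qis _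
      (MorphismProperty.isomorphisms.infer_property (β_ _ N).hom)) (qis_whiskerLeft N f hf)
    have h2 := (qis J).comp_mem _ _ h (isomorphisms_le_qis _
      (MorphismProperty.isomorphisms.infer_property (β_ N _).hom))
    rw [← BraidedCategory.braiding_naturality_left, Category.assoc, SymmetricCategory.symmetry,
      Category.comp_id] at h2
    exact h2

/-- The homology of `M` vanishes outside a bounded range of complex degrees. -/
def bounded (J : Type) [AddCommGroup J] : ObjectProperty (Cx J) := fun M =>
  ∃ a b : ℤ, ∀ i m, M.gr.IsHom i m → M.d m = 0 → i.1 < a ∨ b < i.1 → ∃ z, M.d z = m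

end Cx

namespace DGMod

/-- Morphisms of DG modules that induce isomorphisms in homology. -/
def qis : MorphismProperty DGMod := (Cx.qis ℤ).inverseImage forget

instance : qis.IsMultiplicative := inferInstanceAs ((Cx.qis ℤ).inverseImage forget).IsMultiplicative
instance : qis.RespectsIso := inferInstanceAs ((Cx.qis ℤ).inverseImage forget).RespectsIso

/-- The `K`-flat DG modules: `M ⊗ -` preserves quasi-isomorphisms. -/
def kflat : ObjectProperty DGMod := fun M => ∀ ⦃N N' : DGMod⦄ (f : N ⟶ N'), qis f → qis (M ◁ f)

instance : kflat.IsMonoidal where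
  prop_unit N N' f hf := by
    rw [id_whiskerLeft]
    exact MorphismProperty.RespectsIso.precomp _ _ _
      (MorphismProperty.RespectsIso.postcomp _ _ _ hf)
  prop_tensor M M' h h' N N' f hf := by
    rw [tensor_whiskerLeft]
    exact MorphismProperty.RespectsIso.precomp _ _ _
      (MorphismProperty.RespectsIso.postcomp _ _ _ (h _ (h' _ hf)))

/-- Quasi-isomorphisms between `K`-flat DG modules. -/
def flatQis : MorphismProperty kflat.FullSubcategory := qis.inverseImage kflat.ι

instance : flatQis.IsMultiplicative := inferInstanceAs (qis.inverseImage kflat.ι).IsMultiplicative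

instance : flatQis.IsMonoidal where
  whiskerLeft M _ _ f hf := M.property _ hf
  whiskerRight {M N} f hf P := by
    have : qis (f.hom ▷ P.obj) := by
      have h := P.property f.hom hf
      have h2 := (MorphismProperty.cancel_left_of_respectsIso qis (β_ M.obj P.obj).hom _).mpr h
      rw [← BraidedCategory.braiding_naturality_left] at h2
      exact (MorphismProperty.cancel_right_of_respectsIso qis _ _).mp h2
    exact this

/-- The inclusion of the `K`-flat DG modules, as a morphism of localizers. -/
def flatLocalizer : LocalizerMorphism flatQis qis where
  functor := kflat.ι
  map _ _ _ h := h

/-- The derived category of DG modules, as the localization of the `K`-flat ones, with its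
derived tensor product. -/
abbrev Der : Type 1 := LocalizedMonoidal flatQis.Q flatQis (Iso.refl _)

/-- The localization functor. -/
abbrev toDer : kflat.FullSubcategory ⥤ Der :=
  Localization.Monoidal.toMonoidalCategory flatQis.Q flatQis (Iso.refl _)

/-- The objects of the derived category with bounded homology. -/
def derBounded : ObjectProperty Der :=
  fun M => ∃ N : kflat.FullSubcategory, Cx.bounded ℤ (forget.obj N.obj) ∧
    Nonempty (toDer.obj N ≅ M)

end DGMod

/-- The vector space on the words in the letters `0, 1, 2, …`. The letter `k` stands for a
generator of weight `k + 1`. The parameter selects the product below. -/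
def Words (lam : ℚ) : Type := (fun _ => List ℕ →₀ ℚ) lam

namespace Words
variable {lam : ℚ}

instance : AddCommGroup (Words lam) := inferInstanceAs (AddCommGroup (List ℕ →₀ ℚ))
instance : Module ℚ (Words lam) := inferInstanceAs (Module ℚ (List ℕ →₀ ℚ))

/-- A word, as a basis vector. -/
def wd (u : List ℕ) : Words lam := Finsupp.single u (1 : ℚ)

/-- The words form a basis. -/
def basis : Module.Basis (List ℕ) ℚ (Words lam) :=
  Module.Basis.ofRepr (LinearEquiv.refl ℚ (List ℕ →₀ ℚ))

theorem basis_apply (u : List ℕ) : (basis : Module.Basis _ ℚ (Words lam)) u = wd u := rfl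

theorem lin_ext {M : Type*} [AddCommMonoid M] [Module ℚ M] {f g : Words lam →ₗ[ℚ] M}
    (h : ∀ u, f (wd u) = g (wd u)) : f = g := basis.ext h

/-- Linear maps out of the space of words. -/
def lift {M : Type*} [AddCommMonoid M] [Module ℚ M] (f : List ℕ → M) : Words lam →ₗ[ℚ] M :=
  basis.constr ℚ f

@[simp] theorem lift_wd {M : Type*} [AddCommMonoid M] [Module ℚ M] (f : List ℕ → M) (u : List ℕ) :
    (lift f : Words lam →ₗ[ℚ] M) (wd u) = f u := basis.constr_basis ℚ f u

/-- Putting a letter in front. -/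
def cons (a : ℕ) : Words lam →ₗ[ℚ] Words lam := lift fun u => wd (a :: u)

@[simp] theorem cons_wd (a : ℕ) (u : List ℕ) : cons a (wd u : Words lam) = wd (a :: u) :=
  lift_wd _ _

/-- Induction on the length of words. -/
theorem lin_ext' {M : Type*} [AddCommMonoid M] [Module ℚ M] {f g : Words lam →ₗ[ℚ] M}
    (h1 : f (wd []) = g (wd [])) (h : ∀ a u, f (wd u) = g (wd u) →
      f (wd (a :: u)) = g (wd (a :: u))) : f = g :=
  lin_ext fun u => by
    induction u with
    | nil => exact h1
    | cons a u ih => exact h a u ih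

/-- The product of words: `∅` is the unit, and
`(a u) * (b v) = a (u * (b v)) + b ((a u) * v) + lam (a + b + 1) (u * v)`. In terms of weights, the
letters `a` and `b` of weights `a + 1` and `b + 1` merge to the letter of weight
`(a + 1) + (b + 1)`. The case `lam = 0` is the shuffle product, the case `lam = 1` is the
quasi-shuffle product. -/
def wmul : List ℕ → List ℕ → Words lam
  | [], v => wd v
  | a :: u, [] => wd (a :: u)
  | a :: u, b :: v => cons a (wmul u (b :: v)) + cons b (wmul (a :: u) v) +
      lam • cons (a + b + 1) (wmul u v)
termination_by u v => u.length + v.length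

/-- The product, as a bilinear map. -/
def mulLin : Words lam →ₗ[ℚ] Words lam →ₗ[ℚ] Words lam := lift fun u => lift fun v => wmul u v

theorem mulLin_wd (u v : List ℕ) : mulLin (wd u : Words lam) (wd v) = wmul u v := by
  simp [mulLin]

instance : Mul (Words lam) := ⟨fun x y => mulLin x y⟩
instance : One (Words lam) := ⟨wd []⟩

theorem mul_def (x y : Words lam) : x * y = mulLin x y := rfl
theorem one_def : (1 : Words lam) = wd [] := rfl
theorem wd_mul_wd (u v : List ℕ) : (wd u * wd v : Words lam) = wmul u v := mulLin_wd u v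

theorem wmul_nil (u : List ℕ) : (wmul u [] : Words lam) = wd u := by
  cases u <;> rw [wmul]

theorem mulLin_one (x : Words lam) : mulLin x 1 = x :=
  LinearMap.congr_fun (f := mulLin.flip 1) (g := LinearMap.id) (lin_ext fun u => by
    rw [LinearMap.flip_apply, one_def, mulLin_wd, wmul_nil]; rfl) x

theorem one_mulLin (x : Words lam) : mulLin 1 x = x :=
  LinearMap.congr_fun (f := mulLin 1) (g := LinearMap.id) (lin_ext fun u => by
    rw [one_def, mulLin_wd, wmul]; rfl) x

theorem mulLin_cons (a b : ℕ) (x y : Words lam) :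
    mulLin (cons a x) (cons b y) = cons a (mulLin x (cons b y)) + cons b (mulLin (cons a x) y) +
      lam • cons (a + b + 1) (mulLin x y) := by
  refine LinearMap.congr_fun (f := mulLin.flip (cons b y) ∘ₗ cons a)
    (g := cons a ∘ₗ mulLin.flip (cons b y) + cons b ∘ₗ mulLin.flip y ∘ₗ cons a +
      lam • cons (a + b + 1) ∘ₗ mulLin.flip y) (lin_ext fun u => ?_) x
  refine LinearMap.congr_fun (f := mulLin (cons a (wd u)) ∘ₗ cons b)
    (g := cons a ∘ₗ mulLin (wd u) ∘ₗ cons b + cons b ∘ₗ mulLin (cons a (wd u)) +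
      lam • cons (a + b + 1) ∘ₗ mulLin (wd u)) (lin_ext fun v => ?_) y
  simp only [LinearMap.comp_apply, LinearMap.add_apply, LinearMap.smul_apply, cons_wd, mulLin_wd]
  rw [wmul]

theorem wmul_comm (u v : List ℕ) : (wmul u v : Words lam) = wmul v u := by
  match u, v with
  | [], v => rw [wmul_nil, wmul]
  | a :: u, [] => rw [wmul_nil, wmul]
  | a :: u, b :: v =>
    rw [wmul, wmul, wmul_comm u (b :: v), wmul_comm (a :: u) v, wmul_comm u v,
      show b + a + 1 = a + b + 1 by omega]
    abel
termination_by u.length + v.length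

theorem mulLin_comm (x y : Words lam) : mulLin x y = mulLin y x := by
  have : (mulLin : Words lam →ₗ[ℚ] _) = mulLin.flip := lin_ext fun u => lin_ext fun v => by
    rw [LinearMap.flip_apply, mulLin_wd, mulLin_wd, wmul_comm]
  exact LinearMap.congr_fun (LinearMap.congr_fun this x) y

theorem mulLin_assoc_wd (u v w : List ℕ) :
    mulLin (mulLin (wd u : Words lam) (wd v)) (wd w) = mulLin (wd u) (mulLin (wd v) (wd w)) := by
  match u, v, w with
  | [], v, w => rw [← one_def, one_mulLin, one_mulLin]
  | a :: u, [], w => rw [← one_def, one_mulLin, mulLin_one]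
  | a :: u, b :: v, [] => rw [← one_def, mulLin_one, mulLin_one]
  | a :: u, b :: v, c :: w =>
    have h1 := mulLin_assoc_wd u (b :: v) (c :: w)
    have h2 := mulLin_assoc_wd u v (c :: w)
    have h3 := mulLin_assoc_wd u (b :: v) w
    have h4 := mulLin_assoc_wd u v w
    have h5 := mulLin_assoc_wd (a :: u) v (c :: w)
    have h6 := mulLin_assoc_wd (a :: u) v w
    have h7 := mulLin_assoc_wd (a :: u) (b :: v) w
    have e1 : a + b + 1 + c + 1 = a + (b + c + 1) + 1 := by omega
    simp only [← cons_wd, mulLin_cons, map_add, map_smul, LinearMap.add_apply,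
      LinearMap.smul_apply, e1] at h1 h2 h3 h4 h5 h6 h7 ⊢
    replace h1 := congrArg (cons a) h1
    replace h7 := congrArg (cons c) h7
    simp only [map_add, map_smul] at h1 h7
    rw [h2, h3, h4, h5, h6]
    linear_combination (norm := module) h1 + h7
termination_by u.length + v.length + w.length

theorem mulLin_assoc (x y z : Words lam) : mulLin (mulLin x y) z = mulLin x (mulLin y z) := by
  refine LinearMap.congr_fun (f := mulLin.flip z ∘ₗ mulLin.flip y)
    (g := mulLin.flip (mulLin y z)) (lin_ext fun u => ?_) x
  refine LinearMap.congr_fun (f := mulLin.flip z ∘ₗ mulLin (wd u))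
    (g := mulLin (wd u) ∘ₗ mulLin.flip z) (lin_ext fun v => ?_) y
  refine LinearMap.congr_fun (f := mulLin (mulLin (wd u) (wd v)))
    (g := mulLin (wd u) ∘ₗ mulLin (wd v)) (lin_ext fun w => ?_) z
  exact mulLin_assoc_wd u v w

instance : CommRing (Words lam) :=
  { (inferInstance : AddCommGroup (Words lam)) with
    mul_assoc := mulLin_assoc
    mul_comm := mulLin_comm
    one_mul := one_mulLin
    mul_one := mulLin_one
    left_distrib := fun x y z => map_add (mulLin x) y z
    right_distrib := fun x y z => by simp only [mul_def, map_add, LinearMap.add_apply]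
    zero_mul := fun x => by simp only [mul_def, map_zero, LinearMap.zero_apply]
    mul_zero := fun x => map_zero (mulLin x) }

instance : Algebra ℚ (Words lam) :=
  Algebra.ofModule (fun r x y => by simp only [mul_def, map_smul, LinearMap.smul_apply])
    (fun r x y => by simp only [mul_def, map_smul])

theorem cons_mul_cons (a b : ℕ) (x y : Words lam) :
    cons a x * cons b y = cons a (x * cons b y) + cons b (cons a x * y) +
      lam • cons (a + b + 1) (x * y) := mulLin_cons a b x y

/-- Deconcatenation. -/
def deconc : List ℕ → Words lam ⊗[ℚ] Words lam
  | [] => wd [] ⊗ₜ wd []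
  | a :: u => wd [] ⊗ₜ wd (a :: u) + TensorProduct.map (cons a) LinearMap.id (deconc u)

/-- The deconcatenation coproduct, as a linear map. -/
def comulLin : Words lam →ₗ[ℚ] Words lam ⊗[ℚ] Words lam := lift deconc

/-- The coefficient of the empty word. -/
def counitLin : Words lam →ₗ[ℚ] ℚ := lift fun u => if u = [] then 1 else 0

theorem comulLin_one : comulLin (1 : Words lam) = 1 ⊗ₜ 1 := lift_wd _ _

/-- Putting a letter in front of the left tensor factor. -/
def consL (a : ℕ) : Words lam ⊗[ℚ] Words lam →ₗ[ℚ] Words lam ⊗[ℚ] Words lam :=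
  TensorProduct.map (cons a) LinearMap.id

theorem consL_tmul (a : ℕ) (x y : Words lam) : consL a (x ⊗ₜ y) = cons a x ⊗ₜ y := rfl

theorem comulLin_cons (a : ℕ) (x : Words lam) :
    comulLin (cons a x) = 1 ⊗ₜ cons a x + consL a (comulLin x) := by
  refine LinearMap.congr_fun (f := comulLin ∘ₗ cons a)
    (g := TensorProduct.mk ℚ _ _ 1 ∘ₗ cons a + consL a ∘ₗ comulLin) (lin_ext fun u => ?_) x
  simp only [LinearMap.comp_apply, LinearMap.add_apply, cons_wd, comulLin, lift_wd]
  rfl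

theorem consL_mul_consL (a b : ℕ) (x y : Words lam ⊗[ℚ] Words lam) :
    consL a x * consL b y = consL a (x * consL b y) + consL b (consL a x * y) +
      lam • consL (a + b + 1) (x * y) := by
  induction x with
  | zero => simp
  | add x x' hx hx' => simp only [map_add, add_mul, hx, hx', smul_add]; abel
  | tmul x x' =>
    induction y with
    | zero => simp
    | add y y' hy hy' => simp only [map_add, mul_add, hy, hy', smul_add]; abel
    | tmul y y' =>
      simp only [consL_tmul, Algebra.TensorProduct.tmul_mul_tmul, cons_mul_cons,
        TensorProduct.add_tmul, TensorProduct.smul_tmul']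

theorem tmul_mul_consL (a : ℕ) (x : Words lam) (y : Words lam ⊗[ℚ] Words lam) :
    (1 ⊗ₜ x) * consL a y = consL a ((1 ⊗ₜ x) * y) := by
  induction y with
  | zero => simp
  | add y y' hy hy' => simp only [map_add, mul_add, hy, hy']
  | tmul y y' => simp only [consL_tmul, Algebra.TensorProduct.tmul_mul_tmul, one_mul]

theorem comulLin_mul_wd (u v : List ℕ) :
    comulLin (wd u * wd v : Words lam) = comulLin (wd u) * comulLin (wd v) := by
  match u, v with
  | [], v => rw [← one_def, one_mul, comulLin_one, ← Algebra.TensorProduct.one_def, one_mul]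
  | a :: u, [] => rw [← one_def, mul_one, comulLin_one, ← Algebra.TensorProduct.one_def, mul_one]
  | a :: u, b :: v =>
    have h1 := comulLin_mul_wd u (b :: v)
    have h2 := comulLin_mul_wd (a :: u) v
    have h3 := comulLin_mul_wd u v
    simp only [← cons_wd] at h1 h2 h3 ⊢
    rw [cons_mul_cons, map_add, map_add, map_smul, comulLin_cons a, comulLin_cons b,
      comulLin_cons (a + b + 1), h1, h2, h3]
    simp only [comulLin_cons, mul_add, add_mul, consL_mul_consL, tmul_mul_consL, map_add]
    rw [mul_comm (consL a (comulLin (wd u))) (1 ⊗ₜ cons b (wd v)), tmul_mul_consL,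
      mul_comm (comulLin (wd u)) (1 ⊗ₜ cons b (wd v))]
    rw [Algebra.TensorProduct.tmul_mul_tmul, one_mul, cons_mul_cons]
    simp only [TensorProduct.tmul_add, TensorProduct.tmul_smul]
    module
termination_by u.length + v.length

theorem counitLin_mul_wd (u v : List ℕ) :
    counitLin (wd u * wd v : Words lam) = counitLin (wd u : Words lam) * counitLin (wd v : Words lam) := by
  have h : ∀ a (x : Words lam), counitLin (cons a x) = 0 := fun a x =>
    LinearMap.congr_fun (f := counitLin ∘ₗ cons a) (g := 0) (lin_ext fun u => by
      simp [counitLin]) x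
  have h1 : counitLin (1 : Words lam) = 1 := by rw [one_def, counitLin, lift_wd]; rfl
  match u, v with
  | [], v => rw [← one_def, one_mul, h1, one_mul]
  | a :: u, [] => rw [← one_def, mul_one, h1, mul_one]
  | a :: u, b :: v =>
    simp only [← cons_wd]
    rw [cons_mul_cons, map_add, map_add, map_smul, h, h, h, h]
    simp

/-- A linear map which is multiplicative on words is a homomorphism of algebras. -/
def algHom {B : Type} [CommRing B] [Algebra ℚ B] (f : Words lam →ₗ[ℚ] B) (h1 : f 1 = 1)
    (h : ∀ u v, f (wd u * wd v) = f (wd u) * f (wd v)) : Words lam →ₐ[ℚ] B :=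
  AlgHom.ofLinearMap f h1 fun x y => by
    refine LinearMap.congr_fun (f := f ∘ₗ LinearMap.mulRight ℚ y)
      (g := LinearMap.mulRight ℚ (f y) ∘ₗ f) (lin_ext fun u => ?_) x
    refine LinearMap.congr_fun (f := f ∘ₗ LinearMap.mulLeft ℚ (wd u))
      (g := LinearMap.mulLeft ℚ (f (wd u)) ∘ₗ f) (lin_ext fun v => ?_) y
    exact h u v

/-- The coproduct, as a homomorphism of algebras. -/
def comulAlg : Words lam →ₐ[ℚ] Words lam ⊗[ℚ] Words lam :=
  algHom comulLin comulLin_one comulLin_mul_wd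

/-- The counit, as a homomorphism of algebras. -/
def counitAlg : Words lam →ₐ[ℚ] ℚ :=
  algHom counitLin (by rw [one_def, counitLin, lift_wd]; rfl) counitLin_mul_wd

theorem counit_cons (a : ℕ) (x : Words lam) : counitLin (cons a x) = 0 :=
  LinearMap.congr_fun (f := counitLin ∘ₗ cons a) (g := 0) (lin_ext fun u => by
    simp [counitLin]) x

theorem coassoc_wd (x : Words lam) :
    TensorProduct.assoc ℚ _ _ _ (TensorProduct.map comulLin LinearMap.id (comulLin x)) =
      TensorProduct.map LinearMap.id comulLin (comulLin x) := by
  refine LinearMap.congr_fun (f := (TensorProduct.assoc ℚ _ _ _).toLinearMap ∘ₗ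
      TensorProduct.map comulLin LinearMap.id ∘ₗ comulLin)
    (g := TensorProduct.map LinearMap.id comulLin ∘ₗ comulLin) (lin_ext' ?_ fun a u ih => ?_) x
  · simp only [LinearMap.comp_apply, ← one_def, comulLin_one, TensorProduct.map_tmul]
    rfl
  · have k1 : ∀ t : Words lam ⊗[ℚ] Words lam,
        TensorProduct.assoc ℚ _ _ _ (TensorProduct.map comulLin LinearMap.id (consL a t)) =
          1 ⊗ₜ consL a t + TensorProduct.map (cons a) LinearMap.id
            (TensorProduct.assoc ℚ _ _ _ (TensorProduct.map comulLin LinearMap.id t)) := by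
      intro t
      induction t with
      | zero => simp
      | add t t' h h' => simp only [map_add, h, h', TensorProduct.tmul_add]; abel
      | tmul y z =>
        rw [consL_tmul, TensorProduct.map_tmul, TensorProduct.map_tmul, comulLin_cons,
          TensorProduct.add_tmul, map_add, LinearMap.id_apply]
        refine congrArg₂ (· + ·) rfl ?_
        induction comulLin y with
        | zero => simp
        | add t t' h h' => simp only [map_add, h, h', TensorProduct.add_tmul]
        | tmul y z => rfl
    have k2 : ∀ t : Words lam ⊗[ℚ] Words lam,
        TensorProduct.map LinearMap.id comulLin (consL a t) =
          TensorProduct.map (cons a) LinearMap.id (TensorProduct.map LinearMap.id comulLin t) := by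
      intro t
      induction t with
      | zero => simp
      | add t t' h h' => simp only [map_add, h, h']
      | tmul y z => rfl
    simp only [LinearMap.comp_apply, LinearEquiv.coe_coe] at ih ⊢
    rw [← cons_wd, comulLin_cons, map_add, map_add, map_add, k1, k2, ih, TensorProduct.map_tmul,
      TensorProduct.map_tmul, LinearMap.id_apply, LinearMap.id_apply, comulLin_one, comulLin_cons,
      TensorProduct.tmul_add, add_assoc]
    rfl

theorem rTensor_counit (x : Words lam) :
    TensorProduct.map counitLin LinearMap.id (comulLin x) = (1 : ℚ) ⊗ₜ x := by
  refine LinearMap.congr_fun (f := TensorProduct.map counitLin LinearMap.id ∘ₗ comulLin)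
    (g := TensorProduct.mk ℚ ℚ _ 1) (lin_ext' ?_ fun a u ih => ?_) x
  · rw [LinearMap.comp_apply, ← one_def, comulLin_one, TensorProduct.map_tmul]
    exact congrArg (· ⊗ₜ[ℚ] (1 : Words lam)) (map_one (counitAlg (lam := lam)))
  · have k : ∀ t : Words lam ⊗[ℚ] Words lam,
        TensorProduct.map counitLin LinearMap.id (consL a t) = 0 := by
      intro t
      induction t with
      | zero => simp
      | add t t' h h' => simp only [map_add, h, h', add_zero]
      | tmul y z => rw [consL_tmul, TensorProduct.map_tmul, counit_cons, TensorProduct.zero_tmul]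
    rw [LinearMap.comp_apply, ← cons_wd, comulLin_cons, map_add, k, add_zero,
      TensorProduct.map_tmul]
    exact congrArg (· ⊗ₜ[ℚ] cons a (wd u)) (map_one (counitAlg (lam := lam)))

theorem lTensor_counit (x : Words lam) :
    TensorProduct.map LinearMap.id counitLin (comulLin x) = x ⊗ₜ (1 : ℚ) := by
  refine LinearMap.congr_fun (f := TensorProduct.map LinearMap.id counitLin ∘ₗ comulLin)
    (g := (TensorProduct.mk ℚ _ ℚ).flip 1) (lin_ext' ?_ fun a u ih => ?_) x
  · rw [LinearMap.comp_apply, ← one_def, comulLin_one, TensorProduct.map_tmul]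
    exact congrArg ((1 : Words lam) ⊗ₜ[ℚ] ·) (map_one (counitAlg (lam := lam)))
  · have k : ∀ t : Words lam ⊗[ℚ] Words lam,
        TensorProduct.map LinearMap.id counitLin (consL a t) =
          TensorProduct.map (cons a) LinearMap.id (TensorProduct.map LinearMap.id counitLin t) := by
      intro t
      induction t with
      | zero => simp
      | add t t' h h' => simp only [map_add, h, h']
      | tmul y z => rfl
    rw [LinearMap.comp_apply] at ih
    rw [LinearMap.comp_apply, ← cons_wd, comulLin_cons, map_add, k, ih,
      TensorProduct.map_tmul, counit_cons, TensorProduct.tmul_zero, zero_add]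
    rfl

instance : Bialgebra ℚ (Words lam) :=
  Bialgebra.ofAlgHom comulAlg counitAlg (AlgHom.ext coassoc_wd) (AlgHom.ext rTensor_counit)
    (AlgHom.ext lTensor_counit)

theorem comul_eq (x : Words lam) : Coalgebra.comul (R := ℚ) x = comulLin x := rfl
theorem counit_eq (x : Words lam) : Coalgebra.counit (R := ℚ) x = counitLin x := rfl

/-- The weight of a word: the letter `k` has weight `k + 1`. -/
def weight : List ℕ → ℤ
  | [] => 0
  | a :: u => (a : ℤ) + 1 + weight u

/-- The grading of the space of words by weight. -/
def gr : Grading ℤ (Words lam) :=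
  Grading.ofSpan (lift fun u => Finsupp.single (weight u) (wd u)) <| by
    rw [eq_top_iff, ← basis.span_eq]
    refine Submodule.span_mono ?_
    rintro _ ⟨u, rfl⟩
    exact ⟨weight u, lift_wd _ _⟩

theorem wd_isHom (u : List ℕ) : (gr : Grading ℤ (Words lam)).IsHom (weight u) (wd u) := lift_wd _ _

end Words

namespace Grading
section
variable {J M : Type} [AddCommGroup J] [AddCommGroup M] [Module ℚ M]

/-- A `J`-graded vector space, placed in complex degree `0`. -/
def inc (G : Grading J M) : Grading (ℤ × J) M :=
  ofSpan (Finsupp.lmapDomain M ℚ (fun j : J => ((0 : ℤ), j)) ∘ₗ G.comp) <| by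
    rw [eq_top_iff, ← G.span_isHom]
    refine Submodule.span_mono ?_
    rintro m ⟨j, hm⟩
    refine ⟨(0, j), ?_⟩
    unfold IsHom at hm
    simp [hm]

theorem IsHom.inc {G : Grading J M} {j : J} {m : M} (hm : G.IsHom j m) :
    G.inc.IsHom (0, j) m := by
  unfold IsHom at hm
  change Finsupp.lmapDomain M ℚ (fun j : J => ((0 : ℤ), j)) (G.comp m) = _
  simp [hm]

theorem inc_isHom {G : Grading J M} {i : ℤ × J} {m : M} (hm : G.inc.IsHom i m) :
    m = 0 ∨ (i.1 = 0 ∧ G.IsHom i.2 m) := by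
  by_cases h0 : m = 0
  · exact Or.inl h0
  refine Or.inr ?_
  have h1 : Finsupp.lmapDomain M ℚ (fun j : J => ((0 : ℤ), j)) (G.comp m) = Finsupp.single i m := hm
  have hinj : Function.Injective (fun j : J => ((0 : ℤ), j)) := fun a b h => (Prod.mk.inj h).2
  have h2 : i ∈ Set.range (fun j : J => ((0 : ℤ), j)) := by
    by_contra hi
    have := Finsupp.mapDomain_of_notMem_range (G.comp m) i hi
    rw [show Finsupp.mapDomain _ (G.comp m) = Finsupp.single i m from h1,
      Finsupp.single_eq_same] at this
    exact h0 this
  obtain ⟨j, rfl⟩ := h2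
  refine ⟨rfl, ?_⟩
  apply Finsupp.mapDomain_injective hinj
  rw [show Finsupp.mapDomain _ (G.comp m) = Finsupp.single _ m from h1, Finsupp.mapDomain_single]

theorem inc_map {G : Grading J M} {N : Type} [AddCommGroup N] [Module ℚ N]
    {K : Grading (ℤ × J) N} {f : M →ₗ[ℚ] N} {s : ℤ × J → ℤ × J}
    (h : ∀ j m, G.IsHom j m → K.IsHom (s (0, j)) (f m)) (i : ℤ × J) (m : M)
    (hm : G.inc.IsHom i m) : K.IsHom (s i) (f m) := by
  rcases inc_isHom hm with rfl | ⟨h1, h2⟩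
  · rw [map_zero]; exact IsHom.zero _ _
  · obtain ⟨c, j⟩ := i
    obtain rfl : c = 0 := h1
    exact h j m h2

end
end Grading

/-- A `J`-graded commutative bialgebra. -/
class GradedBialgebra (J C : Type) [AddCommGroup J] [CommRing C] [Bialgebra ℚ C] where
  gr : Grading J C
  one_hom : gr.IsHom 0 1
  mul_hom : ∀ {i j x y}, gr.IsHom i x → gr.IsHom j y → gr.IsHom (i + j) (x * y)
  comul_hom : ∀ {i x}, gr.IsHom i x → (gr.tensor gr).IsHom i (Coalgebra.comul (R := ℚ) x)
  counit_hom : ∀ {i x}, gr.IsHom i x → (Grading.unit J).IsHom i (Coalgebra.counit (R := ℚ) x)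

/-- The grading of `C` in complex degree `0`. -/
abbrev cgr (J C : Type) [AddCommGroup J] [CommRing C] [Bialgebra ℚ C] [GradedBialgebra J C] :
    Grading (ℤ × J) C := (GradedBialgebra.gr : Grading J C).inc

section cmb
variable {M N P M' N' B B' : Type} [AddCommGroup M] [Module ℚ M] [AddCommGroup N] [Module ℚ N]
  [AddCommGroup P] [Module ℚ P] [AddCommGroup M'] [Module ℚ M'] [AddCommGroup N'] [Module ℚ N']
  [CommRing B] [Algebra ℚ B] [CommRing B'] [Algebra ℚ B']

/-- `(m ⊗ x) ⊗ (n ⊗ y) ↦ (m ⊗ n) ⊗ x y`. -/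
def cmb (M N B : Type) [AddCommGroup M] [Module ℚ M] [AddCommGroup N] [Module ℚ N]
    [CommRing B] [Algebra ℚ B] : (M ⊗[ℚ] B) ⊗[ℚ] (N ⊗[ℚ] B) →ₗ[ℚ] (M ⊗[ℚ] N) ⊗[ℚ] B :=
  TensorProduct.map LinearMap.id (LinearMap.mul' ℚ B) ∘ₗ
    (TensorProduct.tensorTensorTensorComm ℚ M B N B).toLinearMap

theorem cmb_tmul (m : M) (n : N) (x y : B) :
    cmb M N B ((m ⊗ₜ x) ⊗ₜ (n ⊗ₜ y)) = (m ⊗ₜ n) ⊗ₜ (x * y) := rfl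

theorem cmb_map (f : M →ₗ[ℚ] M') (g : N →ₗ[ℚ] N') (φ : B →ₐ[ℚ] B')
    (t : (M ⊗[ℚ] B) ⊗[ℚ] (N ⊗[ℚ] B)) :
    TensorProduct.map (TensorProduct.map f g) φ.toLinearMap (cmb M N B t) =
      cmb M' N' B' (TensorProduct.map (TensorProduct.map f φ.toLinearMap)
        (TensorProduct.map g φ.toLinearMap) t) := by
  refine LinearMap.congr_fun (f := TensorProduct.map (TensorProduct.map f g) φ.toLinearMap ∘ₗ
      cmb M N B) (g := cmb M' N' B' ∘ₗ (TensorProduct.map (TensorProduct.map f φ.toLinearMap)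
        (TensorProduct.map g φ.toLinearMap))) (TensorProduct.ext_fourfold' fun m x n y => ?_) t
  simp only [LinearMap.comp_apply, cmb_tmul, TensorProduct.map_tmul, AlgHom.toLinearMap_apply,
    map_mul]

theorem cmb_assoc (t : ((M ⊗[ℚ] B) ⊗[ℚ] (N ⊗[ℚ] B)) ⊗[ℚ] (P ⊗[ℚ] B)) :
    TensorProduct.map (TensorProduct.assoc ℚ M N P).toLinearMap LinearMap.id
        (cmb _ P B (TensorProduct.map (cmb M N B) LinearMap.id t)) =
      cmb M _ B (TensorProduct.map LinearMap.id (cmb N P B) (TensorProduct.assoc ℚ _ _ _ t)) := by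
  refine LinearMap.congr_fun (f := TensorProduct.map (TensorProduct.assoc ℚ M N P).toLinearMap
        LinearMap.id ∘ₗ cmb _ P B ∘ₗ TensorProduct.map (cmb M N B) LinearMap.id)
    (g := cmb M _ B ∘ₗ TensorProduct.map LinearMap.id (cmb N P B) ∘ₗ
      (TensorProduct.assoc ℚ _ _ _).toLinearMap) (TensorProduct.ext ?_) t
  refine TensorProduct.ext_fourfold' fun m x n y => ?_
  refine TensorProduct.ext' fun p z => ?_
  change TensorProduct.map (TensorProduct.assoc ℚ M N P).toLinearMap LinearMap.id
    (((m ⊗ₜ[ℚ] n) ⊗ₜ[ℚ] p) ⊗ₜ[ℚ] (x * y * z)) = (m ⊗ₜ[ℚ] (n ⊗ₜ[ℚ] p)) ⊗ₜ[ℚ] (x * (y * z))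
  rw [mul_assoc]
  rfl

/-- The coaction on a tensor product. -/
def coactT (ρ : M →ₗ[ℚ] M ⊗[ℚ] B) (σ : N →ₗ[ℚ] N ⊗[ℚ] B) : M ⊗[ℚ] N →ₗ[ℚ] (M ⊗[ℚ] N) ⊗[ℚ] B :=
  cmb M N B ∘ₗ TensorProduct.map ρ σ

theorem coactT_tmul (ρ : M →ₗ[ℚ] M ⊗[ℚ] B) (σ : N →ₗ[ℚ] N ⊗[ℚ] B) (m : M) (n : N) :
    coactT ρ σ (m ⊗ₜ n) = cmb M N B (ρ m ⊗ₜ σ n) := rfl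

theorem coactT_cmb (ρ : M →ₗ[ℚ] M ⊗[ℚ] B) (σ : N →ₗ[ℚ] N ⊗[ℚ] B)
    (t : (M ⊗[ℚ] B) ⊗[ℚ] (N ⊗[ℚ] B)) :
    TensorProduct.assoc ℚ _ _ _ (TensorProduct.map (coactT ρ σ) LinearMap.id (cmb M N B t)) =
      cmb M N (B ⊗[ℚ] B) (TensorProduct.map
        ((TensorProduct.assoc ℚ M B B).toLinearMap ∘ₗ TensorProduct.map ρ LinearMap.id)
        ((TensorProduct.assoc ℚ N B B).toLinearMap ∘ₗ TensorProduct.map σ LinearMap.id) t) := by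
  refine LinearMap.congr_fun (f := (TensorProduct.assoc ℚ _ _ _).toLinearMap ∘ₗ
      TensorProduct.map (coactT ρ σ) LinearMap.id ∘ₗ cmb M N B)
    (g := cmb M N (B ⊗[ℚ] B) ∘ₗ TensorProduct.map
        ((TensorProduct.assoc ℚ M B B).toLinearMap ∘ₗ TensorProduct.map ρ LinearMap.id)
        ((TensorProduct.assoc ℚ N B B).toLinearMap ∘ₗ TensorProduct.map σ LinearMap.id))
    (TensorProduct.ext_fourfold' fun m x n y => ?_) t
  change (TensorProduct.assoc ℚ _ _ _) ((cmb M N B (ρ m ⊗ₜ[ℚ] σ n)) ⊗ₜ[ℚ] (x * y)) =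
    cmb M N (B ⊗[ℚ] B) ((TensorProduct.assoc ℚ M B B) (ρ m ⊗ₜ[ℚ] x) ⊗ₜ[ℚ]
      (TensorProduct.assoc ℚ N B B) (σ n ⊗ₜ[ℚ] y))
  induction ρ m with
  | zero => simp
  | add a b ha hb => simp only [map_add, TensorProduct.add_tmul, ha, hb]
  | tmul m' x' =>
    induction σ n with
    | zero => simp
    | add a b ha hb =>
      simp only [map_add, TensorProduct.add_tmul, TensorProduct.tmul_add, ha, hb]
    | tmul n' y' =>
      rw [TensorProduct.assoc_tmul, TensorProduct.assoc_tmul, cmb_tmul, cmb_tmul,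
        TensorProduct.assoc_tmul, Algebra.TensorProduct.tmul_mul_tmul]

end cmb

section
variable (J C : Type) [AddCommGroup J] [CommRing C] [Bialgebra ℚ C] [GradedBialgebra J C]

/-- DG comodules over the graded bialgebra `C`, which has differential `0` and sits in complex
degree `0`: complexes of `J`-graded comodules. -/
structure DGComod extends Cx J where
  coact : X →ₗ[ℚ] X ⊗[ℚ] C
  coact_hom : ∀ i n, gr.IsHom i n → (gr.tensor (cgr J C)).IsHom i (coact n)
  coact_d : ∀ n, coact (d n) = TensorProduct.map d LinearMap.id (coact n)
  coassoc : ∀ n, TensorProduct.assoc ℚ X C C (TensorProduct.map coact LinearMap.id (coact n)) =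
    TensorProduct.map LinearMap.id (Coalgebra.comul (R := ℚ)) (coact n)
  coact_counit : ∀ n, TensorProduct.map LinearMap.id (Coalgebra.counit (R := ℚ)) (coact n) =
    n ⊗ₜ (1 : ℚ)

end

namespace DGComod
variable {J C : Type} [AddCommGroup J] [CommRing C] [Bialgebra ℚ C] [GradedBialgebra J C]

/-- Morphisms of DG comodules: chain maps that commute with the coaction. -/
@[ext] structure Hom (M N : DGComod J C) extends Cx.Hom M.toCx N.toCx where
  map_coact : ∀ m, N.coact (toLin m) = TensorProduct.map toLin LinearMap.id (M.coact m)

instance : Category (DGComod J C) where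
  Hom := Hom
  id M := ⟨𝟙 M.toCx, fun m => by rw [Cx.id_toLin, TensorProduct.map_id]; rfl⟩
  comp f g := ⟨CategoryStruct.comp (obj := Cx J) f.toHom g.toHom, fun m => by
    rw [Cx.comp_toLin, LinearMap.comp_apply, g.map_coact, f.map_coact,
      ← LinearMap.comp_apply, ← TensorProduct.map_comp]
    rfl⟩

theorem hom_ext {M N : DGComod J C} {f g : M ⟶ N} (h : f.toLin = g.toLin) : f = g := by
  refine Hom.ext h

/-- Forgetting the coaction. -/
def forget : DGComod J C ⥤ Cx J where
  obj M := M.toCx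
  map f := f.toHom

instance : (forget (J := J) (C := C)).Faithful where
  map_injective h := hom_ext (congrArg Cx.Hom.toLin h)

/-- An isomorphism of complexes that commutes with the coactions. -/
def mkIso {M N : DGComod J C} (f : M.toCx ≅ N.toCx)
    (h : ∀ m, N.coact (f.hom.toLin m) = TensorProduct.map f.hom.toLin LinearMap.id (M.coact m)) :
    M ≅ N where
  hom := ⟨f.hom, h⟩
  inv := ⟨f.inv, fun n => by
    have h1 : f.hom.toLin (f.inv.toLin n) = n :=
      LinearMap.congr_fun (congrArg Cx.Hom.toLin f.inv_hom_id) n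
    have h2 : f.inv.toLin ∘ₗ f.hom.toLin = LinearMap.id := congrArg Cx.Hom.toLin f.hom_inv_id
    conv_rhs => rw [← h1, h, ← LinearMap.comp_apply, ← TensorProduct.map_comp, h2,
      LinearMap.id_comp, TensorProduct.map_id]
    rfl⟩
  hom_inv_id := hom_ext (congrArg Cx.Hom.toLin f.hom_inv_id)
  inv_hom_id := hom_ext (congrArg Cx.Hom.toLin f.inv_hom_id)

variable (M N P : DGComod J C)

/-- The tensor product of DG comodules, with the coaction `m ⊗ n ↦ Σ (m₀ ⊗ n₀) ⊗ m₁ n₁`. -/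
def tens : DGComod J C where
  toCx := Cx.tens M.toCx N.toCx
  coact := coactT M.coact N.coact
  coact_hom := by
    refine Grading.tensor_map (s := fun i => i) fun i j m n hm hn => ?_
    refine Grading.tensor_map (s := fun i => i) (f := cmb M.X N.X C)
      (G := M.gr.tensor (cgr J C)) (H := N.gr.tensor (cgr J C)) (fun i j s t hs ht => ?_) _ _
      ((M.coact_hom i m hm).tmul (N.coact_hom j n hn))
    refine Grading.tensor_map (s := fun i => i + j) (G := M.gr) (H := cgr J C)
      (f := cmb M.X N.X C ∘ₗ (TensorProduct.mk ℚ _ _).flip t) (fun i i' m x hm hx => ?_) i s hs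
    refine Grading.tensor_map (s := fun j => i + i' + j) (G := N.gr) (H := cgr J C)
      (f := cmb M.X N.X C ∘ₗ TensorProduct.mk ℚ _ _ (m ⊗ₜ x)) (fun j j' n y hn hy => ?_) j t ht
    have hxy : (cgr J C).IsHom (i' + j') (x * y) := by
      rcases Grading.inc_isHom hx with rfl | ⟨h1, h2⟩
      · rw [zero_mul]; exact Grading.IsHom.zero _ _
      rcases Grading.inc_isHom hy with rfl | ⟨h3, h4⟩
      · rw [mul_zero]; exact Grading.IsHom.zero _ _
      have := (GradedBialgebra.mul_hom h2 h4).inc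
      convert this using 1
      exact Prod.ext (by simp [h1, h3]) rfl
    have := (hm.tmul hn).tmul hxy
    rwa [add_add_add_comm] at this
  coact_d t := by
    refine LinearMap.congr_fun (f := coactT M.coact N.coact ∘ₗ M.gr.dT M.d N.d)
      (g := TensorProduct.map (M.gr.dT M.d N.d) LinearMap.id ∘ₗ coactT M.coact N.coact)
      (TensorProduct.ext' fun m n => ?_) t
    have hs : M.coact (M.gr.sign m) = TensorProduct.map M.gr.sign LinearMap.id (M.coact m) := by
      rw [← Grading.sign_even (H := M.gr.tensor (cgr J C)) M.coact_hom, Grading.sign_tensor]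
      congr 2
      refine Grading.ext_hom (cgr J C) fun i x hx => ?_
      rw [Grading.sign_apply hx]
      rcases Grading.inc_isHom hx with rfl | ⟨h1, -⟩
      · simp
      · rw [h1]; simp
    simp only [LinearMap.comp_apply, Grading.dT_tmul, map_add, coactT_tmul, M.coact_d, N.coact_d, hs]
    have k1 := cmb_map M.d (LinearMap.id : N.X →ₗ[ℚ] N.X) (AlgHom.id ℚ C) (M.coact m ⊗ₜ N.coact n)
    have k2 := cmb_map M.gr.sign N.d (AlgHom.id ℚ C) (M.coact m ⊗ₜ N.coact n)
    rw [TensorProduct.map_tmul] at k1 k2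
    rw [show (AlgHom.id ℚ C).toLinearMap = LinearMap.id from rfl] at k1 k2
    rw [TensorProduct.map_id, LinearMap.id_apply] at k1
    rw [← k1, ← k2, Grading.dT, TensorProduct.map_add_left, LinearMap.add_apply]
  coassoc t := by
    refine LinearMap.congr_fun (f := (TensorProduct.assoc ℚ _ C C).toLinearMap ∘ₗ
        TensorProduct.map (coactT M.coact N.coact) LinearMap.id ∘ₗ coactT M.coact N.coact)
      (g := TensorProduct.map LinearMap.id (Coalgebra.comul (R := ℚ)) ∘ₗ coactT M.coact N.coact)
      (TensorProduct.ext' fun m n => ?_) t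
    have k := cmb_map (LinearMap.id : M.X →ₗ[ℚ] M.X) (LinearMap.id : N.X →ₗ[ℚ] N.X)
      (Bialgebra.comulAlgHom ℚ C) (M.coact m ⊗ₜ N.coact n)
    rw [TensorProduct.map_id] at k
    simp only [LinearMap.comp_apply, LinearEquiv.coe_coe, coactT_tmul]
    rw [coactT_cmb, TensorProduct.map_tmul]
    simp only [LinearMap.comp_apply, LinearEquiv.coe_coe, M.coassoc, N.coassoc]
    exact k.symm
  coact_counit t := by
    refine LinearMap.congr_fun
      (f := TensorProduct.map LinearMap.id (Coalgebra.counit (R := ℚ)) ∘ₗ coactT M.coact N.coact)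
      (g := (TensorProduct.mk ℚ _ ℚ).flip 1)
      (TensorProduct.ext' fun m n => ?_) t
    have k := cmb_map (LinearMap.id : M.X →ₗ[ℚ] M.X) (LinearMap.id : N.X →ₗ[ℚ] N.X)
      (Bialgebra.counitAlgHom ℚ C) (M.coact m ⊗ₜ N.coact n)
    rw [TensorProduct.map_id, TensorProduct.map_tmul] at k
    refine k.trans ?_
    change cmb M.X N.X ℚ (TensorProduct.map LinearMap.id (Coalgebra.counit (R := ℚ)) (M.coact m) ⊗ₜ
      TensorProduct.map LinearMap.id (Coalgebra.counit (R := ℚ)) (N.coact n)) = _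
    rw [M.coact_counit, N.coact_counit, cmb_tmul, mul_one]
    rfl

/-- The tensor product of two morphisms. -/
def tensHom {M M' N N' : DGComod J C} (f : M ⟶ M') (g : N ⟶ N') : tens M N ⟶ tens M' N' where
  toHom := Cx.tensHom f.toHom g.toHom
  map_coact := LinearMap.congr_fun
    (f := coactT M'.coact N'.coact ∘ₗ TensorProduct.map f.toLin g.toLin)
    (g := TensorProduct.map (TensorProduct.map f.toLin g.toLin) LinearMap.id ∘ₗ
      coactT M.coact N.coact) (TensorProduct.ext' fun m n => by
        have k := cmb_map f.toLin g.toLin (AlgHom.id ℚ C) (M.coact m ⊗ₜ N.coact n)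
        simp only [LinearMap.comp_apply, TensorProduct.map_tmul, coactT_tmul, f.map_coact,
          g.map_coact]
        exact k.symm)

/-- The unit comodule. -/
def unit (J C : Type) [AddCommGroup J] [CommRing C] [Bialgebra ℚ C] [GradedBialgebra J C] :
    DGComod J C where
  toCx := Cx.one J
  coact := (TensorProduct.mk ℚ ℚ C).flip 1
  coact_hom i a ha := by
    have := ha.tmul (GradedBialgebra.one_hom (J := J) (C := C)).inc
    rwa [Prod.mk_zero_zero, add_zero] at this
  coact_d a := by simp
  coassoc a := by
    change TensorProduct.assoc ℚ ℚ C C ((a ⊗ₜ[ℚ] 1) ⊗ₜ[ℚ] 1) = a ⊗ₜ[ℚ] Coalgebra.comul (1 : C)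
    rw [Bialgebra.comul_one]
    rfl
  coact_counit a := by
    change a ⊗ₜ[ℚ] Coalgebra.counit (R := ℚ) (1 : C) = _
    rw [Bialgebra.counit_one]

/-- The associativity isomorphism. -/
def assoc : tens (tens M N) P ≅ tens M (tens N P) :=
  mkIso (M := tens (tens M N) P) (N := tens M (tens N P)) (Cx.assoc M.toCx N.toCx P.toCx) <|
    LinearMap.congr_fun
      (f := coactT M.coact (coactT N.coact P.coact) ∘ₗ
        (TensorProduct.assoc ℚ M.X N.X P.X).toLinearMap)
      (g := TensorProduct.map (TensorProduct.assoc ℚ M.X N.X P.X).toLinearMap LinearMap.id ∘ₗ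
        coactT (coactT M.coact N.coact) P.coact)
      (TensorProduct.ext_threefold fun m n p =>
        (cmb_assoc ((M.coact m ⊗ₜ N.coact n) ⊗ₜ P.coact p)).symm)

/-- The left unit isomorphism. -/
def lunit : tens (unit J C) M ≅ M :=
  mkIso (M := tens (unit J C) M) (N := M) (Cx.lunit M.toCx) <|
    LinearMap.congr_fun (f := M.coact ∘ₗ (TensorProduct.lid ℚ M.X).toLinearMap)
      (g := TensorProduct.map (TensorProduct.lid ℚ M.X).toLinearMap LinearMap.id ∘ₗ
        coactT ((TensorProduct.mk ℚ ℚ C).flip 1) M.coact)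
      (TensorProduct.ext' fun a m => by
        change M.coact (a • m) = TensorProduct.map (TensorProduct.lid ℚ M.X).toLinearMap
          LinearMap.id (cmb ℚ M.X C ((a ⊗ₜ 1) ⊗ₜ M.coact m))
        rw [map_smul]
        induction M.coact m with
        | zero => simp
        | add s t hs ht => simp only [smul_add, map_add, TensorProduct.tmul_add, hs, ht]
        | tmul n x =>
          rw [cmb_tmul, one_mul]
          rfl)

/-- The right unit isomorphism. -/
def runit : tens M (unit J C) ≅ M :=
  mkIso (M := tens M (unit J C)) (N := M) (Cx.runit M.toCx) <|
    LinearMap.congr_fun (f := M.coact ∘ₗ (TensorProduct.rid ℚ M.X).toLinearMap)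
      (g := TensorProduct.map (TensorProduct.rid ℚ M.X).toLinearMap LinearMap.id ∘ₗ
        coactT M.coact ((TensorProduct.mk ℚ ℚ C).flip 1))
      (TensorProduct.ext' fun m a => by
        change M.coact (a • m) = TensorProduct.map (TensorProduct.rid ℚ M.X).toLinearMap
          LinearMap.id (cmb M.X ℚ C (M.coact m ⊗ₜ (a ⊗ₜ 1)))
        rw [map_smul]
        induction M.coact m with
        | zero => simp
        | add s t hs ht => simp only [smul_add, map_add, TensorProduct.add_tmul, hs, ht]
        | tmul n x =>
          rw [cmb_tmul, mul_one]
          rfl)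

instance : MonoidalCategoryStruct (DGComod J C) where
  tensorObj := tens
  whiskerLeft M _ _ g := tensHom (𝟙 M) g
  whiskerRight f N := tensHom f (𝟙 N)
  tensorHom := tensHom
  tensorUnit := unit J C
  associator := assoc
  leftUnitor := lunit
  rightUnitor := runit

/-- The forgetful functor induces the monoidal structure. -/
def forgetData : Monoidal.InducingFunctorData (forget (J := J) (C := C)) where
  μIso _ _ := Iso.refl _
  εIso := Iso.refl _
  whiskerLeft_eq _ _ _ _ := rfl
  whiskerRight_eq _ _ := rfl
  tensorHom_eq _ _ := rfl
  associator_eq M N P := by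
    ext1
    exact TensorProduct.ext_threefold fun _ _ _ => rfl
  leftUnitor_eq M := by
    ext1
    exact TensorProduct.ext' fun _ _ => rfl
  rightUnitor_eq M := by
    ext1
    exact TensorProduct.ext' fun _ _ => rfl

instance : MonoidalCategory (DGComod J C) := Monoidal.induced forget forgetData

instance : (forget (J := J) (C := C)).Monoidal :=
  Monoidal.fromInducedMonoidal forget forgetData

theorem forget_mu (M N : DGComod J C) :
    Functor.LaxMonoidal.μ (forget (J := J) (C := C)) M N = 𝟙 (Cx.tens M.toCx N.toCx) := rfl

/-- The symmetry isomorphism. -/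
def braid : tens M N ≅ tens N M :=
  mkIso (M := tens M N) (N := tens N M) (Cx.braid M.toCx N.toCx) <| by
    have hc : ∀ (u : M.X →ₗ[ℚ] M.X) (v : N.X →ₗ[ℚ] N.X) (s : M.X ⊗[ℚ] C) (t : N.X ⊗[ℚ] C),
        cmb N.X M.X C (TensorProduct.map v LinearMap.id t ⊗ₜ TensorProduct.map u LinearMap.id s) =
        TensorProduct.map (TensorProduct.map v u ∘ₗ (TensorProduct.comm ℚ M.X N.X).toLinearMap)
          LinearMap.id (cmb M.X N.X C (s ⊗ₜ t)) := by
      intro u v s t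
      induction s with
      | zero => simp
      | add s s' h h' => simp only [map_add, TensorProduct.tmul_add, TensorProduct.add_tmul, h, h']
      | tmul m x =>
        induction t with
        | zero => simp
        | add s s' h h' =>
          simp only [map_add, TensorProduct.tmul_add, TensorProduct.add_tmul, h, h']
        | tmul n y =>
          simp only [TensorProduct.map_tmul, cmb_tmul, LinearMap.id_apply, mul_comm y x]
          rfl
    have hs : ∀ (M : DGComod J C) m,
        M.coact (M.gr.sign m) = TensorProduct.map M.gr.sign LinearMap.id (M.coact m) := by
      intro M m
      rw [← Grading.sign_even (H := M.gr.tensor (cgr J C)) M.coact_hom, Grading.sign_tensor]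
      congr 2
      refine Grading.ext_hom (cgr J C) fun i x hx => ?_
      rw [Grading.sign_apply hx]
      rcases Grading.inc_isHom hx with rfl | ⟨h1, -⟩
      · simp
      · rw [h1]; simp
    refine LinearMap.congr_fun
      (f := coactT N.coact M.coact ∘ₗ M.gr.swap N.gr)
      (g := TensorProduct.map (M.gr.swap N.gr) LinearMap.id ∘ₗ coactT M.coact N.coact)
      (TensorProduct.ext' fun m n => ?_)
    have h0 : M.gr.swap N.gr = (2⁻¹ : ℚ) •
        (TensorProduct.map LinearMap.id LinearMap.id ∘ₗ (TensorProduct.comm ℚ M.X N.X).toLinearMap +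
        TensorProduct.map LinearMap.id M.gr.sign ∘ₗ (TensorProduct.comm ℚ M.X N.X).toLinearMap +
        TensorProduct.map N.gr.sign LinearMap.id ∘ₗ (TensorProduct.comm ℚ M.X N.X).toLinearMap -
        TensorProduct.map N.gr.sign M.gr.sign ∘ₗ (TensorProduct.comm ℚ M.X N.X).toLinearMap) :=
      TensorProduct.ext' fun m n => rfl
    simp only [LinearMap.comp_apply, Grading.swap_tmul, map_smul, map_add, map_sub, coactT_tmul, hs]
    rw [h0]
    have e1 := hc LinearMap.id LinearMap.id (M.coact m) (N.coact n)
    have e2 := hc M.gr.sign LinearMap.id (M.coact m) (N.coact n)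
    have e3 := hc LinearMap.id N.gr.sign (M.coact m) (N.coact n)
    have e4 := hc M.gr.sign N.gr.sign (M.coact m) (N.coact n)
    simp only [TensorProduct.map_id, LinearMap.id_apply] at e1 e2 e3 e4
    rw [e1, e2, e3, e4]
    have h5 : ∀ (a b c d : M.X ⊗[ℚ] N.X →ₗ[ℚ] N.X ⊗[ℚ] M.X) (t : (M.X ⊗[ℚ] N.X) ⊗[ℚ] C),
        TensorProduct.map ((2⁻¹ : ℚ) • (a + b + c - d)) LinearMap.id t = (2⁻¹ : ℚ) •
        (TensorProduct.map a LinearMap.id t + TensorProduct.map b LinearMap.id t +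
          TensorProduct.map c LinearMap.id t - TensorProduct.map d LinearMap.id t) := by
      intro a b c d t
      change LinearMap.rTensor C _ t = _
      rw [LinearMap.rTensor_smul, LinearMap.rTensor_sub, LinearMap.rTensor_add,
        LinearMap.rTensor_add]
      rfl
    rw [h5]
    simp only [TensorProduct.map_id]

instance : BraidedCategory (DGComod J C) :=
  BraidedCategory.ofFaithful forget braid fun M N => by
    rw [forget_mu, forget_mu]
    exact (Category.id_comp _).trans (Category.comp_id _).symm

instance : SymmetricCategory (DGComod J C) where
  symmetry M N := hom_ext (M.gr.swap_swap N.gr)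

/-- Morphisms of DG comodules that induce isomorphisms in homology. -/
def qis (J C : Type) [AddCommGroup J] [CommRing C] [Bialgebra ℚ C] [GradedBialgebra J C] :
    MorphismProperty (DGComod J C) := (Cx.qis J).inverseImage forget

instance : (qis J C).IsMonoidal := inferInstanceAs ((Cx.qis J).inverseImage forget).IsMonoidal

variable (J C)

/-- The derived category of DG comodules. -/
abbrev Der : Type 1 := LocalizedMonoidal (qis J C).Q (qis J C) (Iso.refl _)

/-- The localization functor. -/
abbrev toDer : DGComod J C ⥤ Der J C :=
  Localization.Monoidal.toMonoidalCategory (qis J C).Q (qis J C) (Iso.refl _)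

/-- The objects of the derived category with bounded homology. -/
def derBounded : ObjectProperty (Der J C) :=
  fun M => ∃ N : DGComod J C, Cx.bounded J N.toCx ∧ Nonempty ((toDer J C).obj N ≅ M)

end DGComod

namespace Words
variable {lam : ℚ}

theorem span_wd : Submodule.span ℚ (Set.range (wd : List ℕ → Words lam)) = ⊤ :=
  (basis (lam := lam)).span_eq

theorem cons_isHom {i : ℤ} {x : Words lam} (a : ℕ) (hx : gr.IsHom i x) :
    gr.IsHom ((a : ℤ) + 1 + i) (cons a x) := by
  refine Grading.map_of_span (s := fun i => (a : ℤ) + 1 + i) span_wd ?_ i x hx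
  rintro _ ⟨u, rfl⟩
  refine ⟨weight u, wd_isHom u, ?_⟩
  rw [cons_wd]
  exact wd_isHom (a :: u)

theorem wmul_isHom (u v : List ℕ) :
    (gr : Grading ℤ (Words lam)).IsHom (weight u + weight v) (wmul u v) := by
  match u, v with
  | [], v =>
    rw [wmul]
    have := wd_isHom (lam := lam) v
    rwa [← zero_add (weight v)] at this
  | a :: u, [] =>
    rw [wmul]
    have := wd_isHom (lam := lam) (a :: u)
    rwa [← add_zero (weight (a :: u))] at this
  | a :: u, b :: v =>
    rw [wmul]
    have h1 := cons_isHom (lam := lam) a (wmul_isHom u (b :: v))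
    have h2 := cons_isHom (lam := lam) b (wmul_isHom (a :: u) v)
    have h3 := cons_isHom (lam := lam) (a + b + 1) (wmul_isHom u v)
    have e1 : (a : ℤ) + 1 + (weight u + weight (b :: v)) = weight (a :: u) + weight (b :: v) := by
      simp only [weight]; ring
    have e2 : (b : ℤ) + 1 + (weight (a :: u) + weight v) = weight (a :: u) + weight (b :: v) := by
      simp only [weight]; ring
    have e3 : ((a + b + 1 : ℕ) : ℤ) + 1 + (weight u + weight v) =
        weight (a :: u) + weight (b :: v) := by
      simp only [weight]; push_cast; ring
    rw [e1] at h1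
    rw [e2] at h2
    rw [e3] at h3
    exact (h1.add h2).add (h3.smul lam)
termination_by u.length + v.length

theorem deconc_isHom (u : List ℕ) :
    ((gr : Grading ℤ (Words lam)).tensor gr).IsHom (weight u) (deconc u) := by
  have h0 : (gr : Grading ℤ (Words lam)).IsHom 0 (wd []) := wd_isHom []
  induction u with
  | nil =>
    have := h0.tmul h0
    rwa [add_zero] at this
  | cons a u ih =>
    have h1 := h0.tmul (wd_isHom (lam := lam) (a :: u))
    rw [zero_add] at h1
    refine h1.add ?_
    refine Grading.tensor_map (s := fun i => (a : ℤ) + 1 + i) (f := consL a)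
      (fun i j x y hx hy => ?_) (weight u) (deconc u) ih
    have := (cons_isHom a hx).tmul hy
    rwa [add_assoc] at this

instance : GradedBialgebra ℤ (Words lam) where
  gr := gr
  one_hom := wd_isHom []
  mul_hom {i j x y} hx hy := by
    refine Grading.map_of_span (s := fun i => i + j) (f := LinearMap.mulRight ℚ y) span_wd ?_ i x hx
    rintro _ ⟨u, rfl⟩
    refine ⟨weight u, wd_isHom u, ?_⟩
    refine Grading.map_of_span (s := fun j => weight u + j) (f := LinearMap.mulLeft ℚ (wd u))
      span_wd ?_ j y hy
    rintro _ ⟨v, rfl⟩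
    refine ⟨weight v, wd_isHom v, ?_⟩
    have := wmul_isHom (lam := lam) u v
    rwa [← wd_mul_wd] at this
  comul_hom {i x} hx := by
    refine Grading.map_of_span (s := fun i => i) (f := comulLin) span_wd ?_ i x hx
    rintro _ ⟨u, rfl⟩
    refine ⟨weight u, wd_isHom u, ?_⟩
    have := deconc_isHom (lam := lam) u
    rwa [← lift_wd deconc u] at this
  counit_hom {i x} hx := by
    refine Grading.map_of_span (s := fun i => i) (f := counitLin) span_wd ?_ i x hx
    rintro _ ⟨u, rfl⟩
    refine ⟨weight u, wd_isHom u, ?_⟩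
    cases u with
    | nil => rw [counitLin, lift_wd]; rfl
    | cons a u =>
      rw [← cons_wd, counit_cons]
      exact Grading.IsHom.zero _ _

end Words

namespace Hkm
open Words

/-- The commutative Hopf algebra `Tor^Ẽ(ℚ, ℚ)`: words with the shuffle product. -/
abbrev W : Type := Words 0

variable (M N P : DGMod)

/-- `k u ↦ (m ↦ e_{2k+1} m ⊗ u)` and `∅ ↦ 0`. -/
def twist : W →ₗ[ℚ] M.X →ₗ[ℚ] M.X ⊗[ℚ] W :=
  Words.lift fun
    | [] => 0
    | k :: u => (TensorProduct.mk ℚ M.X W).flip (wd u) ∘ₗ M.act (e k)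

theorem twist_one (m : M.X) : twist M 1 m = 0 :=
  LinearMap.congr_fun (lift_wd (M := M.X →ₗ[ℚ] M.X ⊗[ℚ] W) _ []) m

theorem twist_cons (k : ℕ) (x : W) (m : M.X) : twist M (cons k x) m = M.act (e k) m ⊗ₜ x := by
  refine LinearMap.congr_fun (f := (twist M).flip m ∘ₗ cons k)
    (g := TensorProduct.mk ℚ M.X W (M.act (e k) m)) (lin_ext fun u => ?_) x
  rw [LinearMap.comp_apply, cons_wd]
  exact LinearMap.congr_fun (lift_wd (M := M.X →ₗ[ℚ] M.X ⊗[ℚ] W) _ (k :: u)) m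

/-- The differential of the bar construction: `m ⊗ k u ↦ d m ⊗ k u + e_{2k+1} m ⊗ u`. -/
def D : M.X ⊗[ℚ] W →ₗ[ℚ] M.X ⊗[ℚ] W :=
  TensorProduct.map M.d LinearMap.id + TensorProduct.lift (twist M).flip

theorem D_tmul (m : M.X) (x : W) : D M (m ⊗ₜ x) = M.d m ⊗ₜ x + twist M x m := rfl

theorem D_one (m : M.X) : D M (m ⊗ₜ 1) = M.d m ⊗ₜ 1 := by rw [D_tmul, twist_one, add_zero]

theorem D_cons (m : M.X) (k : ℕ) (x : W) :
    D M (m ⊗ₜ cons k x) = M.d m ⊗ₜ cons k x + M.act (e k) m ⊗ₜ x := by rw [D_tmul, twist_cons]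

/-- Linear maps on `M ⊗ W` are determined on the elements `m ⊗ ∅` and `m ⊗ k u`. -/
theorem ext {V X : Type} [AddCommGroup X] [Module ℚ X] [AddCommGroup V] [Module ℚ V]
    {f g : X ⊗[ℚ] W →ₗ[ℚ] V} (h1 : ∀ m, f (m ⊗ₜ 1) = g (m ⊗ₜ 1))
    (h2 : ∀ m k x, f (m ⊗ₜ cons k x) = g (m ⊗ₜ cons k x)) : f = g :=
  TensorProduct.ext' fun m x => LinearMap.congr_fun (f := f ∘ₗ TensorProduct.mk ℚ X W m)
    (g := g ∘ₗ TensorProduct.mk ℚ X W m) (lin_ext fun u => by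
      cases u with
      | nil => exact h1 m
      | cons k u => rw [← cons_wd]; exact h2 m k _) x

/-- The coaction `m ⊗ u ↦ Σ (m ⊗ u₀) ⊗ u₁`. -/
def coactW (X : Type) [AddCommGroup X] [Module ℚ X] : X ⊗[ℚ] W →ₗ[ℚ] (X ⊗[ℚ] W) ⊗[ℚ] W :=
  (TensorProduct.assoc ℚ X W W).symm.toLinearMap ∘ₗ TensorProduct.map LinearMap.id comulLin

theorem coactW_tmul {X : Type} [AddCommGroup X] [Module ℚ X] (m : X) (x : W) :
    coactW X (m ⊗ₜ x) = (TensorProduct.assoc ℚ X W W).symm (m ⊗ₜ comulLin x) := rfl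

/-- The bar construction of a DG module. -/
def obj : DGComod ℤ W where
  X := M.X ⊗[ℚ] W
  gr := M.gr.tensor (cgr ℤ W)
  d := D M
  d_hom := by
    refine Grading.tensor_map (s := fun i => i + (-1, 0)) fun i j m x hm hx => ?_
    have h1 := (M.d_hom i m hm).tmul hx
    rw [add_right_comm] at h1
    refine h1.add ?_
    refine Grading.inc_map (s := fun j => i + j + (-1, 0)) (f := (twist M).flip m)
      (fun j x hx => ?_) j x hx
    refine Grading.map_of_span (s := fun j : ℤ => i + ((0 : ℤ), j) + (-1, 0))
      (f := (twist M).flip m) (G := gr) span_wd ?_ j x hx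
    rintro _ ⟨u, rfl⟩
    refine ⟨weight u, wd_isHom u, ?_⟩
    cases u with
    | nil =>
      rw [LinearMap.flip_apply, ← one_def, twist_one]
      exact Grading.IsHom.zero _ _
    | cons k u =>
      rw [LinearMap.flip_apply, ← cons_wd, twist_cons]
      have h2 := (M.act_hom k i m hm).tmul (wd_isHom (lam := 0) u).inc
      have e1 : i + (-1, (k : ℤ) + 1) + ((0 : ℤ), weight u) =
          i + ((0 : ℤ), weight (k :: u)) + (-1, 0) := by
        refine Prod.ext ?_ ?_
        · simp
        · simp [weight, add_assoc]
      rwa [e1] at h2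
  d_d := LinearMap.congr_fun (f := D M ∘ₗ D M) (g := 0) <| ext
    (fun m => by
      rw [LinearMap.comp_apply, D_one, D_one, M.d_d, TensorProduct.zero_tmul]; rfl)
    (fun m k x => by
      refine LinearMap.congr_fun (f := D M ∘ₗ D M ∘ₗ TensorProduct.mk ℚ M.X W m ∘ₗ cons k) (g := 0)
        (lin_ext fun u => ?_) x
      simp only [LinearMap.comp_apply, TensorProduct.mk_apply, D_cons, map_add, M.d_d,
        TensorProduct.zero_tmul]
      cases u with
      | nil => rw [← one_def, D_one, M.d_act, TensorProduct.neg_tmul]; simp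
      | cons l u =>
        rw [← cons_wd, D_cons, M.act_ee, M.d_act, TensorProduct.neg_tmul, TensorProduct.zero_tmul]
        simp)
  coact := coactW M.X
  coact_hom := by
    refine Grading.tensor_map (s := fun i => i) fun i j m x hm hx => ?_
    refine Grading.inc_map (s := fun j => i + j)
      (f := coactW M.X ∘ₗ TensorProduct.mk ℚ M.X W m) (fun j x hx => ?_) j x hx
    refine Grading.tensor_map (s := fun j : ℤ => i + ((0 : ℤ), j))
      (f := (TensorProduct.assoc ℚ M.X W W).symm.toLinearMap ∘ₗ TensorProduct.mk ℚ M.X _ m)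
      (fun a b y z hy hz => ?_) j (comulLin x) (GradedBialgebra.comul_hom (J := ℤ) (C := W) hx)
    have := (hm.tmul hy.inc).tmul hz.inc
    rw [add_assoc] at this
    exact this
  coact_d := LinearMap.congr_fun (f := coactW M.X ∘ₗ D M)
    (g := TensorProduct.map (D M) LinearMap.id ∘ₗ coactW M.X) <| ext
    (fun m => by
      rw [LinearMap.comp_apply, LinearMap.comp_apply, D_one, coactW_tmul, coactW_tmul,
        comulLin_one, TensorProduct.assoc_symm_tmul, TensorProduct.assoc_symm_tmul,
        TensorProduct.map_tmul, D_one]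
      rfl)
    (fun m k x => by
      rw [LinearMap.comp_apply, LinearMap.comp_apply, D_cons, map_add, coactW_tmul, coactW_tmul,
        coactW_tmul, comulLin_cons, TensorProduct.tmul_add, TensorProduct.tmul_add, map_add,
        map_add, map_add, TensorProduct.assoc_symm_tmul, TensorProduct.assoc_symm_tmul,
        TensorProduct.map_tmul, D_one, add_assoc]
      refine congrArg₂ (· + ·) rfl ?_
      induction comulLin x with
      | zero => simp
      | add s t hs ht =>
        simp only [map_add, TensorProduct.tmul_add] at hs ht ⊢
        rw [← hs, ← ht]
        abel
      | tmul y z =>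
        rw [consL_tmul, TensorProduct.assoc_symm_tmul, TensorProduct.assoc_symm_tmul,
          TensorProduct.assoc_symm_tmul, TensorProduct.map_tmul, D_cons, TensorProduct.add_tmul]
        rfl)
  coassoc := by
    refine LinearMap.congr_fun (f := (TensorProduct.assoc ℚ (M.X ⊗[ℚ] W) W W).toLinearMap ∘ₗ
      TensorProduct.map (coactW M.X) LinearMap.id ∘ₗ coactW M.X)
      (g := TensorProduct.map LinearMap.id comulLin ∘ₗ coactW M.X)
      (TensorProduct.ext' fun m x => ?_)
    have k1 : ∀ t : W ⊗[ℚ] W,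
        TensorProduct.assoc ℚ (M.X ⊗[ℚ] W) W W (TensorProduct.map (coactW M.X) LinearMap.id
          ((TensorProduct.assoc ℚ M.X W W).symm (m ⊗ₜ t))) =
        (TensorProduct.assoc ℚ M.X W (W ⊗[ℚ] W)).symm (m ⊗ₜ
          TensorProduct.assoc ℚ _ _ _ (TensorProduct.map comulLin LinearMap.id t)) := by
      intro t
      induction t with
      | zero => simp
      | add s t hs ht => simp only [map_add, TensorProduct.tmul_add, hs, ht]
      | tmul y z =>
        rw [TensorProduct.assoc_symm_tmul, TensorProduct.map_tmul, TensorProduct.map_tmul,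
          coactW_tmul, LinearMap.id_apply]
        induction comulLin y with
        | zero => simp
        | add s t hs ht => simp only [map_add, TensorProduct.tmul_add, TensorProduct.add_tmul, hs, ht]
        | tmul y' z' => rfl
    have k2 : ∀ t : W ⊗[ℚ] W,
        TensorProduct.map LinearMap.id comulLin
          ((TensorProduct.assoc ℚ M.X W W).symm (m ⊗ₜ t)) =
        (TensorProduct.assoc ℚ M.X W (W ⊗[ℚ] W)).symm (m ⊗ₜ
          (TensorProduct.map LinearMap.id comulLin t)) := by
      intro t
      induction t with
      | zero => simp
      | add s t hs ht => simp only [map_add, TensorProduct.tmul_add, hs, ht]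
      | tmul y z => rfl
    simp only [LinearMap.comp_apply, LinearEquiv.coe_coe, coactW_tmul]
    rw [k1, k2, coassoc_wd]
  coact_counit := by
    refine LinearMap.congr_fun (f := TensorProduct.map LinearMap.id counitLin ∘ₗ coactW M.X)
      (g := (TensorProduct.mk ℚ _ ℚ).flip 1) (TensorProduct.ext' fun m x => ?_)
    have k : ∀ t : W ⊗[ℚ] W, TensorProduct.map LinearMap.id counitLin
          ((TensorProduct.assoc ℚ M.X W W).symm (m ⊗ₜ t)) =
        (TensorProduct.assoc ℚ M.X W ℚ).symm (m ⊗ₜ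
          (TensorProduct.map LinearMap.id counitLin t)) := by
      intro t
      induction t with
      | zero => simp
      | add s t hs ht => simp only [map_add, TensorProduct.tmul_add, hs, ht]
      | tmul y z => rfl
    rw [LinearMap.comp_apply, coactW_tmul, k, lTensor_counit]
    rfl

variable {M N P}

/-- The bar construction on morphisms. -/
def map (f : M ⟶ N) : obj M ⟶ obj N where
  toLin := TensorProduct.map f.toLin LinearMap.id
  map_hom := Grading.tensor_map (s := fun i => i) fun i j m x hm hx => (f.map_hom i m hm).tmul hx
  map_d := LinearMap.congr_fun (f := TensorProduct.map f.toLin LinearMap.id ∘ₗ D M)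
    (g := D N ∘ₗ TensorProduct.map f.toLin LinearMap.id) <| ext
      (fun m => by
        simp only [LinearMap.comp_apply, D_one, TensorProduct.map_tmul, f.map_d,
          LinearMap.id_apply])
      (fun m k x => by
        simp only [LinearMap.comp_apply, D_cons, TensorProduct.map_tmul, f.map_d, map_add,
          LinearMap.id_apply, f.map_act])
  map_coact := by
    refine LinearMap.congr_fun (f := coactW N.X ∘ₗ TensorProduct.map f.toLin LinearMap.id)
      (g := TensorProduct.map (TensorProduct.map f.toLin LinearMap.id) LinearMap.id ∘ₗ
        coactW M.X) (TensorProduct.ext' fun m x => ?_)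
    rw [LinearMap.comp_apply, LinearMap.comp_apply, TensorProduct.map_tmul, coactW_tmul,
      coactW_tmul, LinearMap.id_apply]
    induction comulLin x with
    | zero => simp
    | add s t hs ht => simp only [map_add, TensorProduct.tmul_add, hs, ht]
    | tmul y z => rfl

end Hkm

/-- The functor `M ↦ (M ⊗ B(Ẽ/ℚ)) ⊗ ℚ` to DG comodules, defined by the bar construction. -/
def hkm : DGMod ⥤ DGComod ℤ Hkm.W where
  obj := Hkm.obj
  map := Hkm.map
  map_id _ := DGComod.hom_ext TensorProduct.map_id
  map_comp _ _ := DGComod.hom_ext (TensorProduct.ext' fun _ _ => rfl)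

namespace Hkm
open Words
variable (M N P : DGMod)

/-- `(m ⊗ u) ⊗ (n ⊗ v) ↦ (m ⊗ n) ⊗ u v`. -/
def muLin : (M.X ⊗[ℚ] W) ⊗[ℚ] (N.X ⊗[ℚ] W) →ₗ[ℚ] (M.tens N).X ⊗[ℚ] W :=
  TensorProduct.map (TensorProduct.lift DGMod.tm) LinearMap.id ∘ₗ cmb M.X N.X W

theorem muLin_tmul (m : M.X) (n : N.X) (x y : W) :
    muLin M N ((m ⊗ₜ x) ⊗ₜ (n ⊗ₜ y)) = DGMod.tm m n ⊗ₜ (x * y) := rfl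

theorem W_mul (k l : ℕ) (x y : W) :
    cons k x * cons l y = cons k (x * cons l y) + cons l (cons k x * y) := by
  rw [cons_mul_cons, zero_smul, add_zero]

theorem ext₂ {V X Y : Type} [AddCommGroup X] [Module ℚ X] [AddCommGroup Y] [Module ℚ Y]
    [AddCommGroup V] [Module ℚ V] {f g : (X ⊗[ℚ] W) ⊗[ℚ] (Y ⊗[ℚ] W) →ₗ[ℚ] V}
    (h : ∀ m x n y, f ((m ⊗ₜ wd x) ⊗ₜ (n ⊗ₜ wd y)) = g ((m ⊗ₜ wd x) ⊗ₜ (n ⊗ₜ wd y))) : f = g := by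
  refine TensorProduct.ext_fourfold' fun m x n y => ?_
  refine LinearMap.congr_fun
    (f := f ∘ₗ (TensorProduct.mk ℚ _ _).flip (n ⊗ₜ y) ∘ₗ TensorProduct.mk ℚ X W m)
    (g := g ∘ₗ (TensorProduct.mk ℚ _ _).flip (n ⊗ₜ y) ∘ₗ TensorProduct.mk ℚ X W m)
    (lin_ext fun u => ?_) x
  exact LinearMap.congr_fun
    (f := f ∘ₗ TensorProduct.mk ℚ _ _ (m ⊗ₜ wd u) ∘ₗ TensorProduct.mk ℚ Y W n)
    (g := g ∘ₗ TensorProduct.mk ℚ _ _ (m ⊗ₜ wd u) ∘ₗ TensorProduct.mk ℚ Y W n)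
    (lin_ext fun v => h m u n v) y

theorem sign_obj (m : M.X) (x : W) : (M.gr.tensor (cgr ℤ W)).sign (m ⊗ₜ x) = M.gr.sign m ⊗ₜ x := by
  have h : ((cgr ℤ W).sign : W →ₗ[ℚ] W) = LinearMap.id := Grading.ext_hom (cgr ℤ W) fun i x hx => by
    rw [Grading.sign_apply hx]
    rcases Grading.inc_isHom hx with rfl | ⟨h1, -⟩
    · simp
    · rw [h1]; simp
  have := Grading.sign_tmul M.gr (cgr ℤ W) m x
  rw [h] at this
  exact this

theorem muLin_d (t : (M.X ⊗[ℚ] W) ⊗[ℚ] (N.X ⊗[ℚ] W)) :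
    muLin M N ((M.gr.tensor (cgr ℤ W)).dT (D M) (D N) t) = D (M.tens N) (muLin M N t) := by
  refine LinearMap.congr_fun (f := muLin M N ∘ₗ (M.gr.tensor (cgr ℤ W)).dT (D M) (D N))
    (g := D (M.tens N) ∘ₗ muLin M N) (ext₂ fun m x n y => ?_) t
  rw [LinearMap.comp_apply, LinearMap.comp_apply, muLin_tmul, Grading.dT_tmul, sign_obj]
  have hb : ∀ l, (DGMod.tm (M.gr.sign m) (N.act (e l) n) : (M.tens N).X) =
      (M.tens N).act (e l) (DGMod.tm m n) := fun l => by
    rw [← DGMod.tm_bal, Grading.sign_sign, DGMod.tm_act]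
  cases x with
  | nil =>
    rw [← one_def, D_one, one_mul]
    cases y with
    | nil =>
      rw [← one_def, D_one, D_one, map_add, muLin_tmul, muLin_tmul, one_mul, DGMod.tm_d,
        TensorProduct.add_tmul]
    | cons l v =>
      rw [← cons_wd, D_cons, D_cons, TensorProduct.tmul_add, map_add, map_add, muLin_tmul,
        muLin_tmul, muLin_tmul, one_mul, one_mul, DGMod.tm_d, TensorProduct.add_tmul, hb]
      abel
  | cons k u =>
    cases y with
    | nil =>
      rw [← one_def, D_one, mul_one, ← cons_wd, D_cons, D_cons, TensorProduct.add_tmul, map_add,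
        map_add, muLin_tmul, muLin_tmul, muLin_tmul, mul_one, mul_one, DGMod.tm_d,
        TensorProduct.add_tmul, DGMod.tm_act]
      abel
    | cons l v =>
      rw [← cons_wd, ← cons_wd, W_mul, D_cons, D_cons, TensorProduct.tmul_add (DGMod.tm m n),
        map_add (D (M.tens N)), D_cons, D_cons, TensorProduct.add_tmul, TensorProduct.tmul_add,
        map_add, map_add, map_add, muLin_tmul, muLin_tmul, muLin_tmul, muLin_tmul, W_mul,
        DGMod.tm_d, hb, ← DGMod.tm_act]
      simp only [TensorProduct.add_tmul, TensorProduct.tmul_add]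
      abel

theorem muLin_coact (t : (M.X ⊗[ℚ] W) ⊗[ℚ] (N.X ⊗[ℚ] W)) :
    coactW (M.tens N).X (muLin M N t) =
      TensorProduct.map (muLin M N) LinearMap.id (coactT (coactW M.X) (coactW N.X) t) := by
  refine LinearMap.congr_fun (f := coactW (M.tens N).X ∘ₗ muLin M N)
    (g := TensorProduct.map (muLin M N) LinearMap.id ∘ₗ coactT (coactW M.X) (coactW N.X))
    (TensorProduct.ext_fourfold' fun m x n y => ?_) t
  rw [LinearMap.comp_apply, LinearMap.comp_apply, muLin_tmul, coactT_tmul, coactW_tmul,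
    coactW_tmul, coactW_tmul, show comulLin (x * y) = comulLin x * comulLin y from
      map_mul comulAlg x y]
  induction comulLin x with
  | zero => simp
  | add s t hs ht => simp only [map_add, TensorProduct.tmul_add, TensorProduct.add_tmul, add_mul,
      hs, ht]
  | tmul a b =>
    induction comulLin y with
    | zero => simp
    | add s t hs ht => simp only [map_add, TensorProduct.tmul_add, mul_add, hs, ht]
    | tmul c d =>
      rw [Algebra.TensorProduct.tmul_mul_tmul, TensorProduct.assoc_symm_tmul,
        TensorProduct.assoc_symm_tmul, TensorProduct.assoc_symm_tmul, cmb_tmul,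
        TensorProduct.map_tmul, muLin_tmul]
      rfl

/-- The lax monoidal structure map. -/
def mu : obj M ⊗ obj N ⟶ obj (M ⊗ N) where
  toLin := muLin M N
  map_hom := by
    refine Grading.tensor_map (s := fun i => i) (G := (obj M).gr) (H := (obj N).gr)
      (fun i j s t hs ht => ?_)
    refine Grading.tensor_map (s := fun i => i + j) (G := M.gr) (H := cgr ℤ W)
      (f := muLin M N ∘ₗ (TensorProduct.mk ℚ _ _).flip t) (fun i i' m x hm hx => ?_) i s hs
    refine Grading.tensor_map (s := fun j => i + i' + j) (G := N.gr) (H := cgr ℤ W)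
      (f := muLin M N ∘ₗ TensorProduct.mk ℚ _ _ (m ⊗ₜ x)) (fun j j' n y hn hy => ?_) j t ht
    have hxy : (cgr ℤ W).IsHom (i' + j') (x * y) := by
      rcases Grading.inc_isHom hx with rfl | ⟨h1, h2⟩
      · rw [zero_mul]; exact Grading.IsHom.zero _ _
      rcases Grading.inc_isHom hy with rfl | ⟨h3, h4⟩
      · rw [mul_zero]; exact Grading.IsHom.zero _ _
      have := (GradedBialgebra.mul_hom h2 h4).inc
      convert this using 1
      exact Prod.ext (by simp [h1, h3]) rfl
    have := (DGMod.tm_isHom hm hn).tmul hxy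
    rw [add_add_add_comm] at this
    exact this
  map_d := muLin_d M N
  map_coact := muLin_coact M N

/-- `1 ↦ 1 ⊗ ∅`. -/
def epsLin : ℚ →ₗ[ℚ] DGMod.unit.X ⊗[ℚ] W :=
  LinearMap.toSpanSingleton ℚ _ (DGMod.uone ⊗ₜ (1 : W))

theorem epsLin_one : epsLin 1 = DGMod.uone ⊗ₜ (1 : W) := one_smul _ _

theorem epsLin_hom (i : ℤ × ℤ) (a : ℚ) (ha : (Grading.unit (ℤ × ℤ)).IsHom i a) :
    (DGMod.unit.gr.tensor (cgr ℤ W)).IsHom i (epsLin a) := by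
  rcases Cx.unit_isHom ha with rfl | rfl
  · rw [map_zero]; exact Grading.IsHom.zero _ _
  · have h0 : (DGMod.unit.gr.tensor (cgr ℤ W)).IsHom (0 + 0) (DGMod.uone ⊗ₜ (1 : W)) :=
      DGMod.uone_isHom.tmul (GradedBialgebra.one_hom (J := ℤ) (C := W)).inc
    rw [add_zero] at h0
    exact h0.smul a

theorem epsLin_d (a : ℚ) : D DGMod.unit (epsLin a) = 0 := by
  refine LinearMap.congr_fun (f := D DGMod.unit ∘ₗ epsLin) (g := 0) (LinearMap.ext_ring ?_) a
  rw [LinearMap.comp_apply, epsLin_one, D_one, DGMod.uone_d, TensorProduct.zero_tmul]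
  rfl

theorem epsLin_coact (a : ℚ) : coactW DGMod.unit.X (epsLin a) =
    TensorProduct.map epsLin LinearMap.id (a ⊗ₜ[ℚ] (1 : W)) := by
  refine LinearMap.congr_fun (f := coactW DGMod.unit.X ∘ₗ epsLin)
    (g := TensorProduct.map epsLin LinearMap.id ∘ₗ (TensorProduct.mk ℚ ℚ W).flip 1)
    (LinearMap.ext_ring ?_) a
  rw [LinearMap.comp_apply, LinearMap.comp_apply, epsLin_one, coactW_tmul, comulLin_one,
    LinearMap.flip_apply, TensorProduct.mk_apply, TensorProduct.map_tmul, epsLin_one]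
  rfl

/-- The lax unit. -/
def eps : 𝟙_ (DGComod ℤ W) ⟶ obj (𝟙_ DGMod) where
  toLin := epsLin
  map_hom := epsLin_hom
  map_d a := (map_zero epsLin).trans (epsLin_d a).symm
  map_coact := epsLin_coact

end Hkm

instance : hkm.LaxMonoidal where
  ε := Hkm.eps
  μ := Hkm.mu
  μ_natural_left {M M'} f N := DGComod.hom_ext (TensorProduct.ext_fourfold' fun m x n y => rfl)
  μ_natural_right {M M'} N f := DGComod.hom_ext (TensorProduct.ext_fourfold' fun m x n y => rfl)
  associativity M N P := DGComod.hom_ext <| TensorProduct.ext <|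
    TensorProduct.ext_fourfold' fun m x n y => TensorProduct.ext' fun p z => by
      change (DGMod.tm m (DGMod.tm n p) : (M.tens (N.tens P)).X) ⊗ₜ[ℚ] (x * y * z) =
        (DGMod.tm m (DGMod.tm n p) : (M.tens (N.tens P)).X) ⊗ₜ[ℚ] (x * (y * z))
      rw [mul_assoc]
  left_unitality M := DGComod.hom_ext <| TensorProduct.ext <| LinearMap.ext_ring <|
    TensorProduct.ext' fun m x => by
      change (1 : ℚ) • (m ⊗ₜ x) = TensorProduct.map (DGMod.lunit M).hom.toLin LinearMap.id
        (Hkm.muLin DGMod.unit M (Hkm.epsLin 1 ⊗ₜ (m ⊗ₜ x)))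
      rw [Hkm.epsLin_one, Hkm.muLin_tmul, TensorProduct.map_tmul, DGMod.lunit_hom_one, one_mul,
        one_smul]
      rfl
  right_unitality M := DGComod.hom_ext <| TensorProduct.ext <| TensorProduct.ext' fun m x =>
    LinearMap.ext_ring <| by
      change (1 : ℚ) • (m ⊗ₜ x) = TensorProduct.map (DGMod.runit M).hom.toLin LinearMap.id
        (Hkm.muLin M DGMod.unit ((m ⊗ₜ x) ⊗ₜ Hkm.epsLin 1))
      rw [Hkm.epsLin_one, Hkm.muLin_tmul, TensorProduct.map_tmul, DGMod.runit_hom_one, mul_one,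
        one_smul]
      rfl

namespace Grading
section
variable {Γ Γ' M N : Type} [AddCommGroup M] [Module ℚ M] [AddCommGroup N] [Module ℚ N]

/-- Relabelling the degrees of a grading. -/
def coarsen (p : Γ → Γ') (G : Grading Γ M) : Grading Γ' M :=
  ofSpan (Finsupp.lmapDomain M ℚ p ∘ₗ G.comp) <| by
    rw [eq_top_iff, ← G.span_isHom]
    refine Submodule.span_mono ?_
    rintro m ⟨j, hm⟩
    refine ⟨p j, ?_⟩
    unfold IsHom at hm
    simp [hm]

theorem IsHom.coarsen {G : Grading Γ M} {j : Γ} {m : M} (p : Γ → Γ') (hm : G.IsHom j m) :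
    (G.coarsen p).IsHom (p j) m := by
  unfold IsHom at hm
  change Finsupp.lmapDomain M ℚ p (G.comp m) = _
  simp [hm]

theorem coarsen_map {Γ'' : Type} {p : Γ → Γ'} {G : Grading Γ M} {K : Grading Γ'' N} {f : M →ₗ[ℚ] N}
    {s : Γ' → Γ''} (h : ∀ i m, G.IsHom i m → K.IsHom (s (p i)) (f m)) (k : Γ') (t : M)
    (ht : (G.coarsen p).IsHom k t) : K.IsHom (s k) (f t) := by
  refine map_of_span G.span_isHom ?_ k t ht
  rintro m ⟨i, hm⟩
  exact ⟨p i, hm.coarsen p, h i m hm⟩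

/-- Two linear maps on a tensor product agree on the elements of degree `k` if they agree on the
tensors `m ⊗ n` of degree `k`. -/
theorem tensor_eq_of {Γ M N V : Type} [AddCommGroup Γ] [AddCommGroup M] [Module ℚ M]
    [AddCommGroup N] [Module ℚ N] [AddCommGroup V] [Module ℚ V] {G : Grading Γ M}
    {H : Grading Γ N} {f g : M ⊗[ℚ] N →ₗ[ℚ] V} {k : Γ}
    (h : ∀ i j m n, G.IsHom i m → H.IsHom j n → i + j = k → f (m ⊗ₜ n) = g (m ⊗ₜ n))
    {t : M ⊗[ℚ] N} (ht : (G.tensor H).IsHom k t) : f t = g t := by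
  have key : f ∘ₗ Finsupp.lapply k ∘ₗ (G.tensor H).comp =
      g ∘ₗ Finsupp.lapply k ∘ₗ (G.tensor H).comp := by
    refine LinearMap.ext_on (span_tmul_of_span G.span_isHom H.span_isHom) ?_
    rintro _ ⟨m, ⟨i, hm⟩, n, ⟨j, hn⟩, rfl⟩
    have h1 : (G.tensor H).comp (m ⊗ₜ n) = Finsupp.single (i + j) (m ⊗ₜ n) := hm.tmul hn
    classical
    rw [LinearMap.comp_apply, LinearMap.comp_apply, LinearMap.comp_apply, LinearMap.comp_apply, h1,
      Finsupp.lapply_apply, Finsupp.single_apply]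
    split_ifs with hk
    · exact h i j m n hm hn hk
    · rw [map_zero, map_zero]
  have h2 := LinearMap.congr_fun key t
  have h3 : (G.tensor H).comp t = Finsupp.single k t := ht
  rw [LinearMap.comp_apply, LinearMap.comp_apply, LinearMap.comp_apply, LinearMap.comp_apply, h3,
    Finsupp.lapply_apply, Finsupp.single_eq_same] at h2
  exact h2

/-- Everything in degree `0`. -/
def trivial (M : Type) [AddCommGroup M] [Module ℚ M] : Grading PUnit M :=
  ofSpan (Finsupp.lsingle PUnit.unit) <| by
    rw [eq_top_iff]; intro m _; exact Submodule.subset_span ⟨PUnit.unit, rfl⟩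

theorem trivial_isHom {M : Type} [AddCommGroup M] [Module ℚ M] (i : PUnit) (m : M) :
    (trivial M).IsHom i m := rfl

end
end Grading

/-- The algebra of functions on the semidirect product of the multiplicative group with the spectrum
of `C`: Laurent polynomials with coefficients in `C`. -/
def OG (C : Type) [CommRing C] : Type := AddMonoidAlgebra C ℤ

namespace OG
variable {C : Type} [CommRing C] [Bialgebra ℚ C] [GradedBialgebra ℤ C]

instance : CommRing (OG C) := inferInstanceAs (CommRing (AddMonoidAlgebra C ℤ))
instance : Algebra ℚ (OG C) := inferInstanceAs (Algebra ℚ (AddMonoidAlgebra C ℤ))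

/-- The monomial `c t ^ a`. -/
def mon (a : ℤ) : C →ₗ[ℚ] OG C := AddMonoidAlgebra.lsingle a

theorem mon_mul (a b : ℤ) (x y : C) : mon a x * mon b y = mon (a + b) (x * y) :=
  AddMonoidAlgebra.single_mul_single a b x y

theorem one_eq : (1 : OG C) = mon 0 1 := AddMonoidAlgebra.one_def

theorem lin_ext {V : Type} [AddCommGroup V] [Module ℚ V] {f g : OG C →ₗ[ℚ] V}
    (h : ∀ a c, f (mon a c) = g (mon a c)) : f = g :=
  AddMonoidAlgebra.lhom_ext' (f := f) (g := g) fun a => LinearMap.ext (h a)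

/-- Linear maps out of the Laurent polynomials. -/
def lift {V : Type} [AddCommGroup V] [Module ℚ V] (f : ℤ → C →ₗ[ℚ] V) : OG C →ₗ[ℚ] V :=
  Finsupp.lsum ℚ f ∘ₗ (AddMonoidAlgebra.coeffLinearEquiv ℚ : AddMonoidAlgebra C ℤ ≃ₗ[ℚ] _).toLinearMap

theorem lift_mon {V : Type} [AddCommGroup V] [Module ℚ V] (f : ℤ → C →ₗ[ℚ] V) (a : ℤ) (c : C) :
    lift f (mon a c) = f a c := by
  change Finsupp.lsum ℚ f (Finsupp.single a c) = _
  simp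

section coaction
variable {N : Type} [AddCommGroup N] [Module ℚ N]

/-- For a graded vector space `N`, the map `n ⊗ c ↦ n ⊗ c t ^ |n|`. -/
def shift (K : Grading ℤ N) : N ⊗[ℚ] C →ₗ[ℚ] N ⊗[ℚ] OG C :=
  TensorProduct.lift ((Finsupp.lsum ℚ fun j : ℤ =>
    (TensorProduct.mk ℚ N (OG C)).compl₂ (mon j)) ∘ₗ K.comp)

theorem shift_tmul {K : Grading ℤ N} {j : ℤ} {n : N} (hn : K.IsHom j n) (c : C) :
    shift K (n ⊗ₜ c) = n ⊗ₜ mon j c := by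
  unfold Grading.IsHom at hn
  simp [shift, hn]

end coaction

/-- The grading of the Laurent polynomials with `|c t ^ a| = a + |c|`. -/
def gr : Grading ℤ (OG C) :=
  Grading.ofSpan (lift fun a =>
      Finsupp.lmapDomain (OG C) ℚ (fun j : ℤ => a + j) ∘ₗ Finsupp.mapRange.linearMap (mon a) ∘ₗ
        (GradedBialgebra.gr : Grading ℤ C).comp) <| by
    set S : Submodule ℚ (OG C) := Submodule.span ℚ _ with hS
    have h : S.mkQ = 0 := lin_ext fun a => LinearMap.congr_fun
      (f := S.mkQ ∘ₗ mon a) (g := 0)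
      ((GradedBialgebra.gr : Grading ℤ C).ext_hom fun j c hc => by
        refine (Submodule.Quotient.mk_eq_zero _).mpr (Submodule.subset_span ⟨a + j, ?_⟩)
        unfold Grading.IsHom at hc
        rw [lift_mon]
        simp [hc])
    rw [← Submodule.ker_mkQ S, h, LinearMap.ker_zero]

theorem mon_isHom (a : ℤ) {j : ℤ} {c : C} (hc : (GradedBialgebra.gr : Grading ℤ C).IsHom j c) :
    (gr : Grading ℤ (OG C)).IsHom (a + j) (mon a c) := by
  unfold Grading.IsHom at hc
  refine (lift_mon _ a c).trans ?_
  simp [hc]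

/-- The coaction `c t ^ a ↦ Σ c₀ t ^ a ⊗ c₁` of `C`. -/
def coactC : OG C →ₗ[ℚ] OG C ⊗[ℚ] C :=
  lift fun a => TensorProduct.map (mon a) LinearMap.id ∘ₗ Coalgebra.comul

theorem coactC_mon (a : ℤ) (c : C) :
    coactC (mon a c) = TensorProduct.map (mon a) LinearMap.id (Coalgebra.comul (R := ℚ) c) :=
  lift_mon _ a c

/-- The coproduct `c t ^ a ↦ Σ c₀ t ^ a ⊗ c₁ t ^ (a + |c₀|)`. -/
def comulLin : OG C →ₗ[ℚ] OG C ⊗[ℚ] OG C := shift gr ∘ₗ coactC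

/-- The counit `c t ^ a ↦ ε c`. -/
def counitLin : OG C →ₗ[ℚ] ℚ := lift fun _ => Coalgebra.counit

theorem counitLin_mon (a : ℤ) (c : C) :
    counitLin (mon a c) = Coalgebra.counit (R := ℚ) c := lift_mon _ a c

section coaction
variable {N : Type} [AddCommGroup N] [Module ℚ N] {K : Grading ℤ N} {ρ : N →ₗ[ℚ] N ⊗[ℚ] C}

/-- The coaction `n ↦ Σ n₀ ⊗ n₁ t ^ |n₀|`. -/
def pcoact (K : Grading ℤ N) (ρ : N →ₗ[ℚ] N ⊗[ℚ] C) : N →ₗ[ℚ] N ⊗[ℚ] OG C := shift K ∘ₗ ρ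

/-- `n ⊗ (x ⊗ y) ↦ n ⊗ (x t ^ |n| ⊗ y t ^ (|n| + |x|))`. -/
def shift₂ (K : Grading ℤ N) : N ⊗[ℚ] (C ⊗[ℚ] C) →ₗ[ℚ] N ⊗[ℚ] (OG C ⊗[ℚ] OG C) :=
  TensorProduct.map LinearMap.id (shift gr) ∘ₗ
    (TensorProduct.assoc ℚ N (OG C) C).toLinearMap ∘ₗ
      TensorProduct.map (shift K) LinearMap.id ∘ₗ (TensorProduct.assoc ℚ N C C).symm.toLinearMap

theorem shift₂_tmul {n : N} {j : ℤ} (hn : K.IsHom j n) (s : C ⊗[ℚ] C) :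
    shift₂ K (n ⊗ₜ s) = n ⊗ₜ shift gr (TensorProduct.map (mon j) LinearMap.id s) := by
  induction s with
  | zero => simp
  | add s t hs ht => simp only [TensorProduct.tmul_add, map_add, hs, ht]
  | tmul x y =>
    change TensorProduct.map LinearMap.id (shift gr) (TensorProduct.assoc ℚ N (OG C) C
      (shift K (n ⊗ₜ[ℚ] x) ⊗ₜ[ℚ] y)) = _
    rw [shift_tmul hn]
    rfl

theorem pcoact_coassoc (hK : ∀ j n, K.IsHom j n → (K.tensor (GradedBialgebra.gr : Grading ℤ C)).IsHom
    j (ρ n))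
    (h : ∀ n, TensorProduct.assoc ℚ N C C (TensorProduct.map ρ LinearMap.id (ρ n)) =
      TensorProduct.map LinearMap.id (Coalgebra.comul (R := ℚ)) (ρ n)) (n : N) :
    TensorProduct.assoc ℚ N (OG C) (OG C)
        (TensorProduct.map (pcoact K ρ) LinearMap.id (pcoact K ρ n)) =
      TensorProduct.map LinearMap.id comulLin (pcoact K ρ n) := by
  have c2 : TensorProduct.map LinearMap.id (comulLin : OG C →ₗ[ℚ] OG C ⊗[ℚ] OG C) ∘ₗ
        (shift K : N ⊗[ℚ] C →ₗ[ℚ] N ⊗[ℚ] OG C) =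
      shift₂ K ∘ₗ TensorProduct.map LinearMap.id (Coalgebra.comul (R := ℚ) (A := C)) := by
    refine LinearMap.ext_on (Grading.span_tmul_of_span K.span_isHom
      (GradedBialgebra.gr : Grading ℤ C).span_isHom) ?_
    rintro _ ⟨m, ⟨i, hm⟩, c, ⟨j, hc⟩, rfl⟩
    rw [LinearMap.comp_apply, LinearMap.comp_apply, shift_tmul hm, TensorProduct.map_tmul,
      TensorProduct.map_tmul, LinearMap.id_apply, shift₂_tmul hm, comulLin, LinearMap.comp_apply,
      coactC_mon]
  have c1 : (TensorProduct.assoc ℚ N (OG C) (OG C)).toLinearMap ∘ₗ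
      TensorProduct.map (pcoact K ρ) LinearMap.id ∘ₗ shift K =
      shift₂ K ∘ₗ (TensorProduct.assoc ℚ N C C).toLinearMap ∘ₗ
        TensorProduct.map ρ LinearMap.id := by
    refine LinearMap.ext_on (Grading.span_tmul_of_span K.span_isHom
      (GradedBialgebra.gr : Grading ℤ C).span_isHom) ?_
    rintro _ ⟨m, ⟨i, hm⟩, c, ⟨j, hc⟩, rfl⟩
    simp only [LinearMap.comp_apply, LinearEquiv.coe_coe]
    rw [shift_tmul hm, TensorProduct.map_tmul, TensorProduct.map_tmul, LinearMap.id_apply,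
      LinearMap.id_apply, pcoact, LinearMap.comp_apply]
    refine Grading.tensor_eq_of (k := i) (G := K) (H := (GradedBialgebra.gr : Grading ℤ C))
      (f := (TensorProduct.assoc ℚ N (OG C) (OG C)).toLinearMap ∘ₗ
        (TensorProduct.mk ℚ _ _).flip (mon i c) ∘ₗ shift K)
      (g := shift₂ K ∘ₗ (TensorProduct.assoc ℚ N C C).toLinearMap ∘ₗ
        (TensorProduct.mk ℚ _ _).flip c) (fun a b m x hm hx hab => ?_) (hK i m hm)
    change TensorProduct.assoc ℚ N (OG C) (OG C) (shift K (m ⊗ₜ x) ⊗ₜ mon i c) =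
      shift₂ K (m ⊗ₜ (x ⊗ₜ c))
    rw [shift_tmul hm, shift₂_tmul hm, TensorProduct.map_tmul, LinearMap.id_apply,
      shift_tmul (mon_isHom a hx), hab]
    rfl
  have e1 := LinearMap.congr_fun c1 (ρ n)
  have e2 := LinearMap.congr_fun c2 (ρ n)
  simp only [LinearMap.comp_apply, LinearEquiv.coe_coe] at e1 e2
  rw [h, ← e2] at e1
  exact e1

theorem pcoact_counit (h : ∀ n, TensorProduct.map LinearMap.id (Coalgebra.counit (R := ℚ)) (ρ n) =
    n ⊗ₜ[ℚ] (1 : ℚ)) (n : N) :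
    TensorProduct.map LinearMap.id counitLin (pcoact K ρ n) = n ⊗ₜ[ℚ] (1 : ℚ) := by
  have c : TensorProduct.map LinearMap.id counitLin ∘ₗ shift K =
      TensorProduct.map (LinearMap.id : N →ₗ[ℚ] N) (Coalgebra.counit (R := ℚ) (A := C)) := by
    refine LinearMap.ext_on (Grading.span_tmul_of_span K.span_isHom
      (GradedBialgebra.gr : Grading ℤ C).span_isHom) ?_
    rintro _ ⟨m, ⟨i, hm⟩, c, ⟨j, hc⟩, rfl⟩
    rw [LinearMap.comp_apply, shift_tmul hm, TensorProduct.map_tmul, TensorProduct.map_tmul,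
      counitLin_mon]
  rw [← h n, ← c]
  rfl

end coaction

theorem coactC_isHom (j : ℤ) (x : OG C) (hx : (gr : Grading ℤ (OG C)).IsHom j x) :
    ((gr : Grading ℤ (OG C)).tensor GradedBialgebra.gr).IsHom j (coactC x) := by
  have hS : Submodule.span ℚ {x : OG C | ∃ a j c, (GradedBialgebra.gr : Grading ℤ C).IsHom j c ∧
      x = mon a c} = ⊤ := by
    set S : Submodule ℚ (OG C) := Submodule.span ℚ _ with hS
    have h : S.mkQ = 0 := lin_ext fun a => LinearMap.congr_fun
      (f := S.mkQ ∘ₗ mon a) (g := 0)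
      ((GradedBialgebra.gr : Grading ℤ C).ext_hom fun j c hc =>
        (Submodule.Quotient.mk_eq_zero _).mpr (Submodule.subset_span ⟨a, j, c, hc, rfl⟩))
    rw [← Submodule.ker_mkQ S, h, LinearMap.ker_zero]
  refine Grading.map_of_span (s := fun i => i) hS ?_ j x hx
  rintro _ ⟨a, j, c, hc, rfl⟩
  refine ⟨a + j, mon_isHom a hc, ?_⟩
  rw [coactC_mon]
  refine Grading.tensor_map (s := fun i => a + i) (f := TensorProduct.map (mon a) LinearMap.id)
    (fun i i' m n hm hn => ?_) j _ (GradedBialgebra.comul_hom hc)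
  have := (mon_isHom a hm).tmul hn
  rwa [add_assoc] at this

theorem coactC_coassoc (x : OG C) :
    TensorProduct.assoc ℚ (OG C) C C (TensorProduct.map coactC LinearMap.id (coactC x)) =
      TensorProduct.map LinearMap.id (Coalgebra.comul (R := ℚ)) (coactC x) := by
  refine LinearMap.congr_fun (f := (TensorProduct.assoc ℚ (OG C) C C).toLinearMap ∘ₗ
      TensorProduct.map coactC LinearMap.id ∘ₗ coactC)
    (g := TensorProduct.map LinearMap.id (Coalgebra.comul (R := ℚ)) ∘ₗ coactC)
    (lin_ext fun a c => ?_) x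
  simp only [LinearMap.comp_apply, LinearEquiv.coe_coe, coactC_mon]
  have k1 : ∀ t : C ⊗[ℚ] C, TensorProduct.assoc ℚ (OG C) C C (TensorProduct.map coactC LinearMap.id
      (TensorProduct.map (mon a) LinearMap.id t)) = TensorProduct.map (mon a) LinearMap.id
        (TensorProduct.assoc ℚ C C C (TensorProduct.map Coalgebra.comul LinearMap.id t)) := by
    intro t
    induction t with
    | zero => simp
    | add s t hs ht => simp only [map_add, hs, ht]
    | tmul x y =>
      rw [TensorProduct.map_tmul, TensorProduct.map_tmul, TensorProduct.map_tmul, coactC_mon,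
        LinearMap.id_apply]
      induction Coalgebra.comul (R := ℚ) x with
      | zero => simp
      | add s t hs ht => simp only [map_add, TensorProduct.add_tmul, hs, ht]
      | tmul x y => rfl
  have k2 : ∀ t : C ⊗[ℚ] C, TensorProduct.map LinearMap.id (Coalgebra.comul (R := ℚ))
      (TensorProduct.map (mon a) LinearMap.id t) = TensorProduct.map (mon a) LinearMap.id
        (TensorProduct.map LinearMap.id (Coalgebra.comul (R := ℚ)) t) := by
    intro t
    induction t with
    | zero => simp
    | add s t hs ht => simp only [map_add, hs, ht]
    | tmul x y => rfl
  rw [k1, k2]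
  exact congrArg _ (Coalgebra.coassoc_apply c)

theorem coactC_counit (x : OG C) :
    TensorProduct.map LinearMap.id (Coalgebra.counit (R := ℚ)) (coactC x) = x ⊗ₜ[ℚ] (1 : ℚ) := by
  refine LinearMap.congr_fun
    (f := TensorProduct.map LinearMap.id (Coalgebra.counit (R := ℚ)) ∘ₗ coactC)
    (g := (TensorProduct.mk ℚ _ ℚ).flip 1) (lin_ext fun a c => ?_) x
  rw [LinearMap.comp_apply, coactC_mon]
  have k : ∀ t : C ⊗[ℚ] C, TensorProduct.map LinearMap.id (Coalgebra.counit (R := ℚ))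
      (TensorProduct.map (mon a) LinearMap.id t) = TensorProduct.map (mon a) LinearMap.id
        (TensorProduct.map LinearMap.id (Coalgebra.counit (R := ℚ)) t) := by
    intro t
    induction t with
    | zero => simp
    | add s t hs ht => simp only [map_add, hs, ht]
    | tmul x y => rfl
  rw [k]
  have h2 : TensorProduct.map LinearMap.id (Coalgebra.counit (R := ℚ)) (Coalgebra.comul (R := ℚ) c) =
    c ⊗ₜ[ℚ] (1 : ℚ) := Coalgebra.lTensor_counit_comul c
  rw [h2]
  rfl

theorem comulLin_mon (a : ℤ) (c : C) : comulLin (mon a c) =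
    shift gr (TensorProduct.map (mon a) LinearMap.id (Coalgebra.comul (R := ℚ) c)) := by
  rw [comulLin, LinearMap.comp_apply, coactC_mon]

theorem comulLin_one : comulLin (1 : OG C) = 1 ⊗ₜ 1 := by
  rw [one_eq, comulLin_mon, Bialgebra.comul_one, Algebra.TensorProduct.one_def,
    TensorProduct.map_tmul, LinearMap.id_apply,
    shift_tmul (mon_isHom 0 (GradedBialgebra.one_hom (J := ℤ) (C := C))), add_zero]

theorem shift_mul (a b : ℤ) (s t : C ⊗[ℚ] C) :
    shift gr (TensorProduct.map (mon (a + b)) LinearMap.id (s * t)) =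
      shift gr (TensorProduct.map (mon a) LinearMap.id s) *
        shift gr (TensorProduct.map (mon b) LinearMap.id t) := by
  have hS := Grading.span_tmul_of_span (GradedBialgebra.gr : Grading ℤ C).span_isHom
    (GradedBialgebra.gr : Grading ℤ C).span_isHom
  refine LinearMap.congr_fun (f := shift gr ∘ₗ TensorProduct.map (mon (a + b)) LinearMap.id ∘ₗ
      LinearMap.mulRight ℚ t)
    (g := LinearMap.mulRight ℚ (shift gr (TensorProduct.map (mon b) LinearMap.id t)) ∘ₗ shift gr ∘ₗ
      TensorProduct.map (mon a) LinearMap.id) (LinearMap.ext_on hS ?_) s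
  rintro _ ⟨x, ⟨i, hx⟩, y, ⟨j, hy⟩, rfl⟩
  refine LinearMap.congr_fun (f := shift gr ∘ₗ TensorProduct.map (mon (a + b)) LinearMap.id ∘ₗ
      LinearMap.mulLeft ℚ (x ⊗ₜ y))
    (g := LinearMap.mulLeft ℚ (shift gr (TensorProduct.map (mon a) LinearMap.id (x ⊗ₜ y))) ∘ₗ
      shift gr ∘ₗ TensorProduct.map (mon b) LinearMap.id) (LinearMap.ext_on hS ?_) t
  rintro _ ⟨x', ⟨i', hx'⟩, y', ⟨j', hy'⟩, rfl⟩
  simp only [LinearMap.comp_apply, LinearMap.mulLeft_apply, Algebra.TensorProduct.tmul_mul_tmul,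
    TensorProduct.map_tmul, LinearMap.id_apply]
  rw [shift_tmul (mon_isHom _ (GradedBialgebra.mul_hom hx hx')), shift_tmul (mon_isHom _ hx),
    shift_tmul (mon_isHom _ hx'), Algebra.TensorProduct.tmul_mul_tmul, mon_mul, mon_mul,
    add_add_add_comm]

/-- The coproduct, as a homomorphism of algebras. -/
def comulAlg : OG C →ₐ[ℚ] OG C ⊗[ℚ] OG C :=
  AlgHom.ofLinearMap comulLin comulLin_one fun x y => by
    refine LinearMap.congr_fun (f := comulLin ∘ₗ LinearMap.mulRight ℚ y)
      (g := LinearMap.mulRight ℚ (comulLin y) ∘ₗ comulLin) (lin_ext fun a c => ?_) x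
    refine LinearMap.congr_fun (f := comulLin ∘ₗ LinearMap.mulLeft ℚ (mon a c))
      (g := LinearMap.mulLeft ℚ (comulLin (mon a c)) ∘ₗ comulLin) (lin_ext fun b c' => ?_) y
    simp only [LinearMap.comp_apply, LinearMap.mulLeft_apply]
    rw [mon_mul, comulLin_mon, Bialgebra.comul_mul, shift_mul, comulLin_mon, comulLin_mon]

/-- The counit, as a homomorphism of algebras. -/
def counitAlg : OG C →ₐ[ℚ] ℚ :=
  AlgHom.ofLinearMap counitLin (by rw [one_eq, counitLin_mon, Bialgebra.counit_one]) fun x y => by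
    refine LinearMap.congr_fun (f := counitLin ∘ₗ LinearMap.mulRight ℚ y)
      (g := LinearMap.mulRight ℚ (counitLin y) ∘ₗ counitLin) (lin_ext fun a c => ?_) x
    refine LinearMap.congr_fun (f := counitLin ∘ₗ LinearMap.mulLeft ℚ (mon a c))
      (g := LinearMap.mulLeft ℚ (counitLin (mon a c)) ∘ₗ counitLin) (lin_ext fun b c' => ?_) y
    simp only [LinearMap.comp_apply, LinearMap.mulLeft_apply]
    rw [mon_mul, counitLin_mon, Bialgebra.counit_mul, counitLin_mon, counitLin_mon]

theorem rTensor_counit (x : OG C) :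
    TensorProduct.map counitLin LinearMap.id (comulLin x) = (1 : ℚ) ⊗ₜ[ℚ] x := by
  refine LinearMap.congr_fun (f := TensorProduct.map counitLin LinearMap.id ∘ₗ comulLin)
    (g := TensorProduct.mk ℚ ℚ _ 1) (lin_ext fun a c => ?_) x
  rw [LinearMap.comp_apply, comulLin_mon]
  have k : TensorProduct.map (counitLin : OG C →ₗ[ℚ] ℚ) LinearMap.id ∘ₗ
        (shift gr : OG C ⊗[ℚ] C →ₗ[ℚ] OG C ⊗[ℚ] OG C) ∘ₗ
          TensorProduct.map (mon a : C →ₗ[ℚ] OG C) LinearMap.id =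
      TensorProduct.map LinearMap.id (mon a : C →ₗ[ℚ] OG C) ∘ₗ
        TensorProduct.map (Coalgebra.counit (R := ℚ) (A := C)) LinearMap.id := by
    refine LinearMap.ext_on (Grading.span_tmul_of_span
      (GradedBialgebra.gr : Grading ℤ C).span_isHom
      (GradedBialgebra.gr : Grading ℤ C).span_isHom) ?_
    rintro _ ⟨y, ⟨i, hy⟩, z, ⟨j, hz⟩, rfl⟩
    simp only [LinearMap.comp_apply, TensorProduct.map_tmul, LinearMap.id_apply]
    rw [shift_tmul (mon_isHom a hy), TensorProduct.map_tmul, counitLin_mon, LinearMap.id_apply]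
    rcases Cx.unit_isHom' (GradedBialgebra.counit_hom (J := ℤ) (C := C) hy) with h | rfl
    · rw [h, TensorProduct.zero_tmul, TensorProduct.zero_tmul]
    · rw [add_zero]
  have h2 : TensorProduct.map (Coalgebra.counit (R := ℚ)) LinearMap.id (Coalgebra.comul (R := ℚ) c) =
    (1 : ℚ) ⊗ₜ[ℚ] c := Coalgebra.rTensor_counit_comul c
  have := LinearMap.congr_fun k (Coalgebra.comul (R := ℚ) c)
  simp only [LinearMap.comp_apply] at this
  rw [this, h2]
  rfl

instance : Bialgebra ℚ (OG C) :=
  Bialgebra.ofAlgHom comulAlg counitAlg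
    (AlgHom.ext (pcoact_coassoc coactC_isHom coactC_coassoc))
    (AlgHom.ext rTensor_counit) (AlgHom.ext (pcoact_counit coactC_counit))

instance : GradedBialgebra PUnit (OG C) where
  gr := Grading.trivial _
  one_hom := rfl
  mul_hom _ _ := rfl
  comul_hom {i x} _ := by
    have h : ((Grading.trivial (OG C)).tensor (Grading.trivial (OG C))).comp =
        Finsupp.lsingle PUnit.unit := TensorProduct.ext' fun x y =>
      Grading.IsHom.tmul (Grading.trivial_isHom PUnit.unit x) (Grading.trivial_isHom PUnit.unit y)
    exact LinearMap.congr_fun h _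
  counit_hom _ := rfl

end OG

namespace OG
variable {C : Type} [CommRing C] [Bialgebra ℚ C] [GradedBialgebra ℤ C]

theorem shift_map {N N' : Type} [AddCommGroup N] [Module ℚ N] [AddCommGroup N'] [Module ℚ N']
    {K : Grading ℤ N} {K' : Grading ℤ N'} {f : N →ₗ[ℚ] N'}
    (hf : ∀ j n, K.IsHom j n → K'.IsHom j (f n)) (t : N ⊗[ℚ] C) :
    shift K' (TensorProduct.map f LinearMap.id t) =
      TensorProduct.map f LinearMap.id (shift K t) := by
  refine LinearMap.congr_fun (f := shift K' ∘ₗ TensorProduct.map f LinearMap.id)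
    (g := TensorProduct.map f LinearMap.id ∘ₗ shift K) (LinearMap.ext_on
      (Grading.span_tmul_of_span K.span_isHom (GradedBialgebra.gr : Grading ℤ C).span_isHom) ?_) t
  rintro _ ⟨m, ⟨i, hm⟩, c, ⟨j, hc⟩, rfl⟩
  rw [LinearMap.comp_apply, LinearMap.comp_apply, TensorProduct.map_tmul, shift_tmul hm,
    shift_tmul (hf i m hm), TensorProduct.map_tmul, LinearMap.id_apply, LinearMap.id_apply]

/-- The weight grading of a complex of graded comodules. -/
abbrev wt (N : Cx ℤ) : Grading ℤ N.X := N.gr.coarsen Prod.snd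

theorem wt_map {M N : Cx ℤ} {f : M.X →ₗ[ℚ] N.X} {k : ℤ}
    (hf : ∀ i m, M.gr.IsHom i m → N.gr.IsHom (i + (k, 0)) (f m)) (j : ℤ) (m : M.X)
    (hm : (wt M).IsHom j m) : (wt N).IsHom j (f m) :=
  Grading.coarsen_map (s := fun i => i) (fun i m hm => by
    have := (hf i m hm).coarsen Prod.snd
    rwa [Prod.snd_add, add_zero] at this) j m hm

theorem wt_coact (N : DGComod ℤ C) (j : ℤ) (n : N.X) (hn : (wt N.toCx).IsHom j n) :
    ((wt N.toCx).tensor (GradedBialgebra.gr : Grading ℤ C)).IsHom j (N.coact n) := by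
  refine Grading.coarsen_map (s := fun i => i) (fun i n hn => ?_) j n hn
  refine Grading.tensor_map (s := Prod.snd) (f := LinearMap.id) (G := N.gr) (H := cgr ℤ C)
    (fun a b m x hm hx => ?_) i _ (N.coact_hom i n hn)
  rcases Grading.inc_isHom hx with rfl | ⟨-, h2⟩
  · rw [TensorProduct.tmul_zero, map_zero]; exact Grading.IsHom.zero _ _
  · exact (hm.coarsen Prod.snd).tmul h2

end OG

/-- Representations of the semidirect product of the multiplicative group with the spectrum of `C`
from graded comodules over `C`: the same complex, where the weight is now encoded in the coaction
`n ↦ Σ n₀ ⊗ n₁ t ^ |n₀|`. -/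
def pbw (C : Type) [CommRing C] [Bialgebra ℚ C] [GradedBialgebra ℤ C] :
    DGComod ℤ C ⥤ DGComod PUnit (OG C) where
  obj N :=
    { X := N.X
      gr := N.gr.coarsen fun i => (i.1, PUnit.unit)
      d := N.d
      d_hom := Grading.coarsen_map (s := fun i => i + (-1, 0)) fun i n hn =>
        (N.d_hom i n hn).coarsen fun i => (i.1, PUnit.unit)
      d_d := N.d_d
      coact := OG.pcoact (OG.wt N.toCx) N.coact
      coact_hom := Grading.coarsen_map (s := fun i => i) fun i n hn => by
        refine Grading.tensor_map (s := fun i => (i.1, PUnit.unit))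
          (f := OG.shift (OG.wt N.toCx)) (G := N.gr) (H := cgr ℤ C)
          (fun a b m x hm hx => ?_) i _ (N.coact_hom i n hn)
        rcases Grading.inc_isHom hx with rfl | ⟨h1, h2⟩
        · rw [TensorProduct.tmul_zero, map_zero]; exact Grading.IsHom.zero _ _
        · rw [OG.shift_tmul (hm.coarsen Prod.snd)]
          have h3 : (cgr PUnit (OG C)).IsHom (0, PUnit.unit) (OG.mon a.2 x) :=
            Grading.IsHom.inc (G := (GradedBialgebra.gr : Grading PUnit (OG C))) rfl
          have := (hm.coarsen fun i => (i.1, PUnit.unit)).tmul h3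
          rw [Prod.fst_add, h1]
          exact this
      coact_d := fun n => by
        have h := OG.shift_map (C := C) (K := OG.wt N.toCx) (K' := OG.wt N.toCx)
          (OG.wt_map N.d_hom) (N.coact n)
        rw [← N.coact_d] at h
        exact h
      coassoc := OG.pcoact_coassoc (OG.wt_coact N) N.coassoc
      coact_counit := OG.pcoact_counit N.coact_counit }
  map {M N} f :=
    { toLin := f.toLin
      map_hom := Grading.coarsen_map (s := fun i => i) fun i n hn =>
        (f.map_hom i n hn).coarsen fun i => (i.1, PUnit.unit)
      map_d := f.map_d
      map_coact := fun m => by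
        have h := OG.shift_map (C := C) (K := OG.wt M.toCx) (K' := OG.wt N.toCx)
          (OG.wt_map (k := 0) fun i m hm => by
            have := f.map_hom i m hm
            rwa [← add_zero i] at this) (M.coact m)
        rw [← f.map_coact] at h
        exact h }
  map_id _ := rfl
  map_comp _ _ := rfl

namespace Push
variable {N C C' : Type} [AddCommGroup N] [Module ℚ N] [CommRing C] [Bialgebra ℚ C]
  [CommRing C'] [Bialgebra ℚ C'] {φ : C →ₗ[ℚ] C'} {ρ : N →ₗ[ℚ] N ⊗[ℚ] C}

theorem coassoc (hφ : ∀ x, Coalgebra.comul (R := ℚ) (φ x) =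
      TensorProduct.map φ φ (Coalgebra.comul (R := ℚ) x))
    (h : ∀ n, TensorProduct.assoc ℚ N C C (TensorProduct.map ρ LinearMap.id (ρ n)) =
      TensorProduct.map LinearMap.id (Coalgebra.comul (R := ℚ)) (ρ n)) (n : N) :
    TensorProduct.assoc ℚ N C' C' (TensorProduct.map (TensorProduct.map LinearMap.id φ ∘ₗ ρ)
        LinearMap.id ((TensorProduct.map LinearMap.id φ ∘ₗ ρ) n)) =
      TensorProduct.map LinearMap.id (Coalgebra.comul (R := ℚ))
        ((TensorProduct.map LinearMap.id φ ∘ₗ ρ) n) := by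
  have k1 : ∀ t : N ⊗[ℚ] C, TensorProduct.assoc ℚ N C' C' (TensorProduct.map
      (TensorProduct.map LinearMap.id φ ∘ₗ ρ) LinearMap.id (TensorProduct.map LinearMap.id φ t)) =
      TensorProduct.map LinearMap.id (TensorProduct.map φ φ)
        (TensorProduct.assoc ℚ N C C (TensorProduct.map ρ LinearMap.id t)) := by
    intro t
    induction t with
    | zero => simp
    | add s t hs ht => simp only [map_add, hs, ht]
    | tmul m x =>
      rw [TensorProduct.map_tmul, TensorProduct.map_tmul, TensorProduct.map_tmul,
        LinearMap.comp_apply]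
      simp only [LinearMap.id_apply]
      induction ρ m with
      | zero => simp
      | add s t hs ht => simp only [map_add, TensorProduct.add_tmul, hs, ht]
      | tmul x y => rfl
  have k2 : ∀ t : N ⊗[ℚ] C, TensorProduct.map LinearMap.id (Coalgebra.comul (R := ℚ))
      (TensorProduct.map LinearMap.id φ t) =
      TensorProduct.map LinearMap.id (TensorProduct.map φ φ)
        (TensorProduct.map LinearMap.id (Coalgebra.comul (R := ℚ)) t) := by
    intro t
    induction t with
    | zero => simp
    | add s t hs ht => simp only [map_add, hs, ht]
    | tmul m x => simp only [TensorProduct.map_tmul, LinearMap.id_apply, hφ]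
  rw [LinearMap.comp_apply, k1, k2, h]

theorem counit (hφ : ∀ x, Coalgebra.counit (R := ℚ) (φ x) = Coalgebra.counit (R := ℚ) x)
    (h : ∀ n, TensorProduct.map LinearMap.id (Coalgebra.counit (R := ℚ)) (ρ n) =
      n ⊗ₜ[ℚ] (1 : ℚ)) (n : N) :
    TensorProduct.map LinearMap.id (Coalgebra.counit (R := ℚ))
      ((TensorProduct.map LinearMap.id φ ∘ₗ ρ) n) = n ⊗ₜ[ℚ] (1 : ℚ) := by
  have k : ∀ t : N ⊗[ℚ] C, TensorProduct.map LinearMap.id (Coalgebra.counit (R := ℚ))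
      (TensorProduct.map LinearMap.id φ t) =
      TensorProduct.map LinearMap.id (Coalgebra.counit (R := ℚ)) t := by
    intro t
    induction t with
    | zero => simp
    | add s t hs ht => simp only [map_add, hs, ht]
    | tmul m x => simp only [TensorProduct.map_tmul, LinearMap.id_apply, hφ]
  rw [LinearMap.comp_apply, k, h]

theorem natural {N' : Type} [AddCommGroup N'] [Module ℚ N'] (f : N →ₗ[ℚ] N') (t : N ⊗[ℚ] C) :
    TensorProduct.map LinearMap.id φ (TensorProduct.map f LinearMap.id t) =
      TensorProduct.map f LinearMap.id (TensorProduct.map LinearMap.id φ t) :=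
  LinearMap.congr_fun (f := TensorProduct.map LinearMap.id φ ∘ₗ TensorProduct.map f LinearMap.id)
    (g := TensorProduct.map f LinearMap.id ∘ₗ TensorProduct.map LinearMap.id φ)
    (TensorProduct.ext' fun _ _ => rfl) t

end Push

/-- The graded comodules obtained by pushing the coaction forward along a degree preserving linear
map `φ` which is a homomorphism of coalgebras. -/
def push {J C C' : Type} [AddCommGroup J] [CommRing C] [Bialgebra ℚ C] [GradedBialgebra J C]
    [CommRing C'] [Bialgebra ℚ C'] [GradedBialgebra J C'] (φ : C →ₗ[ℚ] C')
    (hc : ∀ x, Coalgebra.comul (R := ℚ) (φ x) =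
      TensorProduct.map φ φ (Coalgebra.comul (R := ℚ) x))
    (hu : ∀ x, Coalgebra.counit (R := ℚ) (φ x) = Coalgebra.counit (R := ℚ) x)
    (hφ : ∀ j x, (GradedBialgebra.gr : Grading J C).IsHom j x →
      (GradedBialgebra.gr : Grading J C').IsHom j (φ x)) :
    DGComod J C ⥤ DGComod J C' where
  obj N :=
    { N.toCx with
      coact := TensorProduct.map LinearMap.id φ ∘ₗ N.coact
      coact_hom := fun i n hn => by
        refine Grading.tensor_map (s := fun i => i) (G := N.gr) (H := cgr J C)
          (f := TensorProduct.map LinearMap.id φ) (fun a b m x hm hx => ?_) i _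
          (N.coact_hom i n hn)
        exact hm.tmul (Grading.inc_map (s := fun i => i) (f := φ)
          (fun j x hx => (hφ j x hx).inc) b x hx)
      coact_d := fun n => by
        rw [LinearMap.comp_apply, LinearMap.comp_apply, N.coact_d]
        exact Push.natural _ _
      coassoc := Push.coassoc hc N.coassoc
      coact_counit := Push.counit hu N.coact_counit }
  map {M N} f :=
    { f.toHom with
      map_coact := fun m => by
        change TensorProduct.map LinearMap.id φ (N.coact (f.toLin m)) =
          TensorProduct.map f.toLin LinearMap.id (TensorProduct.map LinearMap.id φ (M.coact m))
        rw [f.map_coact]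
        exact Push.natural _ _ }
  map_id _ := rfl
  map_comp _ _ := rfl

namespace DGMod

/-- The trivial module `ℚ`, on which every `e_{2k+1}` acts as zero. -/
def triv : DGMod where
  toCx := Cx.one ℤ
  act := (Algebra.lmul ℚ ℚ).comp (TrivSqZeroExt.fstHom ℚ ℚ (ℕ →₀ ℚ))
  act_hom k i m _ := by
    have h : (Algebra.lmul ℚ ℚ).comp (TrivSqZeroExt.fstHom ℚ ℚ (ℕ →₀ ℚ)) (e k) m = 0 :=
      zero_mul m
    rw [h]
    exact Grading.IsHom.zero _ _
  d_act k m := by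
    refine Eq.trans ?_ (neg_zero (G := ℚ)).symm |>.trans ?_
    · rfl
    · exact congrArg Neg.neg (zero_mul (0 : ℚ)).symm

/-- A scalar, as an element of the trivial module. -/
def tv : ℚ →ₗ[ℚ] triv.X := (LinearMap.id : ℚ →ₗ[ℚ] ℚ)

theorem triv_act (k : ℕ) (a : ℚ) : triv.act (e k) (tv a) = 0 := zero_mul a
theorem triv_d (a : ℚ) : triv.d (tv a) = 0 := rfl
theorem tv_isHom {i : ℤ × ℤ} {a : ℚ} (ha : (Grading.unit (ℤ × ℤ)).IsHom i a) :
    triv.gr.IsHom i (tv a) := ha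

end DGMod

namespace Hkm
open Words
variable (M : DGMod)

/-- `m ⊗ ∅ ↦ m ⊗ 1`, and `m ⊗ u ↦ 0` for the other words `u`. -/
def augLin : M.X ⊗[ℚ] W →ₗ[ℚ] (M.tens DGMod.triv).X :=
  TensorProduct.lift ((DGMod.tm (M := M) (N := DGMod.triv)).compl₂ (DGMod.tv ∘ₗ counitLin))

theorem augLin_tmul (m : M.X) (x : W) :
    augLin M (m ⊗ₜ x) = DGMod.tm m (DGMod.tv (counitLin x)) := rfl

/-- The comparison map from the bar construction to the tensor product `M ⊗ ℚ` over the
square-zero extension. -/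
def aug : DGComod.forget.obj (hkm.obj M) ⟶ DGMod.forget.obj (M ⊗ DGMod.triv) where
  toLin := augLin M
  map_hom := by
    refine Grading.tensor_map (s := fun i => i) (G := M.gr) (H := cgr ℤ W) (f := augLin M)
      fun i j m x hm hx => ?_
    rw [augLin_tmul]
    have h : (Grading.unit (ℤ × ℤ)).IsHom j (counitLin x) :=
      Grading.inc_map (s := fun j => j) (G := (gr : Grading ℤ W)) (f := counitLin)
        (fun j x hx => by
          rcases Cx.unit_isHom' (GradedBialgebra.counit_hom (J := ℤ) (C := W) hx) with h | rfl
          · rw [show counitLin x = 0 from h]; exact Grading.IsHom.zero _ _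
          · rfl) j x hx
    exact DGMod.tm_isHom (M := M) (N := DGMod.triv) hm (DGMod.tv_isHom h)
  map_d := LinearMap.congr_fun (f := augLin M ∘ₗ D M) (g := (M.tens DGMod.triv).d ∘ₗ augLin M) <|
    ext (fun m => by
        rw [LinearMap.comp_apply, LinearMap.comp_apply, D_one, augLin_tmul, augLin_tmul,
          DGMod.tm_d, DGMod.triv_d, map_zero, add_zero])
      (fun m k x => by
        rw [LinearMap.comp_apply, LinearMap.comp_apply, D_cons, map_add, augLin_tmul, augLin_tmul,
          augLin_tmul, counit_cons]
        have h := DGMod.tm_bal (M := M) (N := DGMod.triv) k (M.gr.sign m) (DGMod.tv (counitLin x))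
        rw [Grading.sign_sign, DGMod.triv_act, map_zero] at h
        rw [h, map_zero, map_zero, map_zero, add_zero, map_zero])

end Hkm

/-- The quasi-symmetric functions: words with the quasi-shuffle product. The letter `k` is dual to
the generator `Z_{2(k+1)}` of the noncommutative symmetric functions. -/
abbrev QS : Type := Words 1

/-- The exponential of a word: the sum over all compositions `(i₁, …, i_l)` of its length of
`1 / (i₁! ⋯ i_l!)` times the word that is obtained by merging the first `i₁` letters, the next `i₂`
letters, and so on. Letters are merged by adding their weights. -/
def expWord (u : List ℕ) : QS :=
  ∑ c : Composition u.length, ((c.blocks.map fun i => ((i.factorial : ℚ))⁻¹).prod) •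
    Words.wd ((u.splitWrtComposition c).map fun l => (l.map (· + 1)).sum - 1)

/-- The bialgebra `B` is a Hopf algebra. -/
def HasAntipode (B : Type) [CommRing B] [Bialgebra ℚ B] : Prop :=
  ∃ S : B →ₗ[ℚ] B, ∀ x : B,
    LinearMap.mul' ℚ B (TensorProduct.map S LinearMap.id (Coalgebra.comul (R := ℚ) x)) =
      algebraMap ℚ B (Coalgebra.counit (R := ℚ) x) ∧
    LinearMap.mul' ℚ B (TensorProduct.map LinearMap.id S (Coalgebra.comul (R := ℚ) x)) =
      algebraMap ℚ B (Coalgebra.counit (R := ℚ) x)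

/-- The algebra of noncommutative symmetric functions: the free algebra on
`Z_2, Z_4, Z_6, …`. -/
abbrev NSymm : Type := FreeAlgebra ℚ ℕ

namespace NSymm

/-- `Z_{2k}`, where `Z_0 = 1`. -/
def Z : ℕ → NSymm
  | 0 => 1
  | k + 1 => FreeAlgebra.ι ℚ k

/-- The coproduct `Z_{2k} ↦ Σ_{i+j=k} Z_{2i} ⊗ Z_{2j}`. -/
def comul : NSymm →ₐ[ℚ] NSymm ⊗[ℚ] NSymm :=
  FreeAlgebra.lift ℚ fun k => ∑ p ∈ Finset.HasAntidiagonal.antidiagonal (k + 1), Z p.1 ⊗ₜ[ℚ] Z p.2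

/-- The counit `Z_{2k} ↦ 0` for `k > 0`. -/
def counit : NSymm →ₐ[ℚ] ℚ := FreeAlgebra.lift ℚ fun _ => 0

/-- The monomial `Z_{2(u₁+1)} Z_{2(u₂+1)} ⋯`. -/
def mono (u : List ℕ) : NSymm := (u.map (FreeAlgebra.ι ℚ)).prod

/-- The elements of weight `n`, where `Z_{2k}` has weight `k`. -/
def deg (n : ℤ) : Submodule ℚ NSymm := Submodule.span ℚ {x | ∃ u, Words.weight u = n ∧ x = mono u}

/-- `x` is primitive. -/
def Prim (x : NSymm) : Prop := comul x = x ⊗ₜ 1 + 1 ⊗ₜ x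

/-- The induced pairing `⟨x ⊗ y, s ⊗ t⟩ = ⟨x, s⟩ ⟨y, t⟩`. -/
def pair₂ (p : NSymm →ₗ[ℚ] Module.Dual ℚ QS) :
    NSymm ⊗[ℚ] NSymm →ₗ[ℚ] Module.Dual ℚ (QS ⊗[ℚ] QS) :=
  TensorProduct.dualDistrib ℚ QS QS ∘ₗ TensorProduct.map p p

end NSymm

/-- The graded comodules obtained by pushing the coaction forward along an isomorphism of graded
bialgebras. -/
def pushEquiv {J C C' : Type} [AddCommGroup J] [CommRing C] [Bialgebra ℚ C] [GradedBialgebra J C]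
    [CommRing C'] [Bialgebra ℚ C'] [GradedBialgebra J C'] (E : C ≃ₐc[ℚ] C')
    (hE : ∀ j x, (GradedBialgebra.gr : Grading J C).IsHom j x →
      (GradedBialgebra.gr : Grading J C').IsHom j (E x)) :
    DGComod J C ⥤ DGComod J C' :=
  push (E : C →ₗ[ℚ] C') (fun x => (CoalgHomClass.map_comp_comul_apply E x).symm)
    (fun x => CoalgHomClass.counit_comp_apply E x) hE

/-- The bounded derived category of DG modules. -/
abbrev DbMod : Type 1 := DGMod.derBounded.FullSubcategory

/-- The bounded derived category of graded comodules. -/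
abbrev DbComod (J C : Type) [AddCommGroup J] [CommRing C] [Bialgebra ℚ C] [GradedBialgebra J C] :
    Type 1 := (DGComod.derBounded J C).FullSubcategory

/-- The free Lie algebra `𝔣` on one generator of each weight `k + 1`. -/
abbrev FLie : Type := FreeLieAlgebra ℚ ℕ

end HKM
end

noncomputable section

namespace HKM


section localization
universe v₁ v₂ v₃ u₁ u₂ u₃
variable {C : Type u₁} {D : Type u₂} {E : Type u₃} [Category.{v₁} C] [Category.{v₂} D]
  [Category.{v₃} E]

open Functor in
/-- A morphism of localizers is a localized equivalence if it has an inverse up to isomorphism in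
the localized categories. -/
theorem isLocalizedEquivalence_of_iso {W₁ : MorphismProperty C} {W₂ : MorphismProperty D}
    (Φ : LocalizerMorphism W₁ W₂) (Ψ : LocalizerMorphism W₂ W₁)
    (e₁ : (Φ.functor ⋙ Ψ.functor) ⋙ W₁.Q ≅ W₁.Q) (e₂ : (Ψ.functor ⋙ Φ.functor) ⋙ W₂.Q ≅ W₂.Q) :
    Φ.IsLocalizedEquivalence where
  isEquivalence := by
    refine (Localization.equivalence W₁.Q W₁ W₂.Q W₂ (Φ.functor ⋙ W₂.Q)
      (Φ.localizedFunctor W₁.Q W₂.Q)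
      (Ψ.functor ⋙ W₁.Q) (Ψ.localizedFunctor W₂.Q W₁.Q) ?_ ?_).isEquivalence_functor
    · exact Functor.associator _ _ _ ≪≫
        isoWhiskerLeft _ (CatCommSq.iso Ψ.functor W₂.Q W₁.Q _).symm ≪≫
        (Functor.associator _ _ _).symm ≪≫ e₁
    · exact Functor.associator _ _ _ ≪≫
        isoWhiskerLeft _ (CatCommSq.iso Φ.functor W₁.Q W₂.Q _).symm ≪≫
        (Functor.associator _ _ _).symm ≪≫ e₂

/-- A natural transformation with components in `W` becomes invertible after localization. -/
def isoOfApp {W : MorphismProperty D} {F G : C ⥤ D} (η : F ⟶ G) (h : ∀ X, W (η.app X)) :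
    F ⋙ W.Q ≅ G ⋙ W.Q :=
  NatIso.ofComponents (fun X => Localization.isoOfHom W.Q W (η.app X) (h X)) fun f => by
    simp only [Localization.isoOfHom_hom, Functor.comp_map, ← Functor.map_comp, η.naturality]

variable [MonoidalCategory C] [MonoidalCategory D] [MonoidalCategory E]

open Functor.LaxMonoidal Functor.OplaxMonoidal in
/-- A functor which lifts a braided functor along a braided localization functor is braided. -/
theorem lift_braided [BraidedCategory C] [BraidedCategory D] [BraidedCategory E]
    (L : C ⥤ D) (W : MorphismProperty C) [L.IsLocalization W] [L.Braided]
    (F : D ⥤ E) (G : C ⥤ E) [G.Braided] [W.ContainsIdentities] [Localization.Lifting L W G F]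
    (X Y : D) :
    letI := Localization.Monoidal.functorMonoidalOfComp L W F G
    μ F X Y ≫ F.map (β_ X Y).hom = (β_ (F.obj X) (F.obj Y)).hom ≫ μ F Y X := by
  let := Localization.Monoidal.functorMonoidalOfComp L W F G
  let e := Localization.Lifting.iso L W G F
  have : L.EssSurj := Localization.essSurj L W
  have key : ∀ X Y : C, μ F (L.obj X) (L.obj Y) ≫ F.map (β_ (L.obj X) (L.obj Y)).hom =
      (β_ (F.obj (L.obj X)) (F.obj (L.obj Y))).hom ≫ μ F (L.obj Y) (L.obj X) := by
    intro X Y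
    have h1 : (β_ (L.obj X) (L.obj Y)).hom = μ L X Y ≫ L.map (β_ X Y).hom ≫ δ L Y X := by
      simp
    have h2 := e.inv.naturality (β_ X Y).hom
    dsimp at h2
    rw [Localization.Monoidal.functorMonoidalOfComp_μ L W F G X Y,
      Localization.Monoidal.functorMonoidalOfComp_μ L W F G Y X, h1]
    simp only [Functor.map_comp, Category.assoc]
    rw [← F.map_comp_assoc (δ L X Y), Functor.Monoidal.δ_μ, F.map_id, Category.id_comp]
    rw [← BraidedCategory.braiding_naturality_assoc, ← Functor.LaxBraided.braided_assoc]
    change _ ≫ _ ≫ e.inv.app _ ≫ _ = _ ≫ _ ≫ _ ≫ e.inv.app _ ≫ _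
    rw [reassoc_of% h2]
  have hX := L.objObjPreimageIso X
  have hY := L.objObjPreimageIso Y
  have n1 := μ_natural F hX.hom hY.hom
  have n2 := μ_natural F hY.hom hX.hom
  rw [← cancel_epi (F.map hX.hom ⊗ₘ F.map hY.hom), ← Category.assoc, n1, Category.assoc,
    ← F.map_comp, BraidedCategory.braiding_naturality, F.map_comp, reassoc_of% key,
    ← n2, BraidedCategory.braiding_naturality_assoc]

/-- The braided structure on a functor which lifts a braided functor. -/
@[reducible] def braidedOfComp [BraidedCategory C] [BraidedCategory D] [BraidedCategory E]
    (L : C ⥤ D) (W : MorphismProperty C) [L.IsLocalization W] [L.Braided]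
    (F : D ⥤ E) (G : C ⥤ E) [G.Braided] [W.ContainsIdentities] [Localization.Lifting L W G F] :
    F.Braided :=
  { Localization.Monoidal.functorMonoidalOfComp L W F G with
    braided := lift_braided L W F G }

/-- A lax braided functor with invertible structure maps is braided. -/
@[reducible] def braidedOfLax [BraidedCategory C] [BraidedCategory D] (F : C ⥤ D) [F.LaxBraided]
    [IsIso (Functor.LaxMonoidal.ε F)] [∀ X Y, IsIso (Functor.LaxMonoidal.μ F X Y)] : F.Braided :=
  { Functor.Monoidal.ofLaxMonoidal F with
    braided := Functor.LaxBraided.braided }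

/-- A monoidal functor with values in a monoidal full subcategory. -/
@[reducible] def liftMonoidal (P : ObjectProperty D) [P.IsMonoidal] (F : C ⥤ D) [F.Monoidal]
    (h : ∀ X, P (F.obj X)) : (P.lift F h).Monoidal :=
  Functor.CoreMonoidal.toMonoidal
    { εIso := P.isoMk (Functor.Monoidal.εIso F)
      μIso X Y := P.isoMk (Functor.Monoidal.μIso F X Y)
      μIso_hom_natural_left f Y := P.ι.map_injective (Functor.LaxMonoidal.μ_natural_left F f Y)
      μIso_hom_natural_right X f := P.ι.map_injective (Functor.LaxMonoidal.μ_natural_right F X f)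
      associativity X Y Z := P.ι.map_injective (Functor.LaxMonoidal.associativity F X Y Z)
      left_unitality X := P.ι.map_injective (Functor.LaxMonoidal.left_unitality F X)
      right_unitality X := P.ι.map_injective (Functor.LaxMonoidal.right_unitality F X) }

/-- A braided functor with values in a monoidal full subcategory. -/
@[reducible] def liftBraided [BraidedCategory C] [BraidedCategory D] (P : ObjectProperty D)
    [P.IsMonoidal] (F : C ⥤ D) [F.Braided] (h : ∀ X, P (F.obj X)) : (P.lift F h).Braided :=
  { liftMonoidal P F h with
    braided := fun X Y => P.ι.map_injective (Functor.LaxBraided.braided (F := F) X Y) }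

/-- The factorization through the full subcategory is monoidal. -/
theorem liftBraided_isMonoidal [BraidedCategory C] [BraidedCategory D] (P : ObjectProperty D)
    [P.IsMonoidal] (F : C ⥤ D) [F.Braided] (h : ∀ X, P (F.obj X)) :
    letI := liftBraided P F h
    (P.liftCompιIso F h).hom.IsMonoidal := by
  let := liftBraided P F h
  refine ⟨?_, fun X Y => ?_⟩
  · change ((𝟙 _ ≫ Functor.LaxMonoidal.ε F) ≫ 𝟙 _ : _) = _
    rw [Category.comp_id, Category.id_comp]
  · change ((𝟙 _ ≫ Functor.LaxMonoidal.μ F X Y) ≫ 𝟙 _ : _) = (𝟙 _ ⊗ₘ 𝟙 _) ≫ _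
    rw [Category.comp_id, Category.id_comp, MonoidalCategory.id_tensorHom_id, Category.id_comp]

end localization



section linear
variable {X Y Z : Type} [AddCommGroup X] [Module ℚ X] [AddCommGroup Y] [Module ℚ Y]
  [AddCommGroup Z] [Module ℚ Z]

/-- Elements that are boundaries up to a locally nilpotent operator are boundaries. -/
theorem exists_of_nilpotent (D ν : X →ₗ[ℚ] X) (S : Set X)
    (h : ∀ x ∈ S, ∃ z, D z = x - ν x) (hS : ∀ x ∈ S, ν x ∈ S) (n : ℕ) (x : X) (hx : x ∈ S)
    (hn : (ν ^ n) x = 0) : ∃ z, D z = x := by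
  induction n generalizing x with
  | zero => exact ⟨0, by rw [map_zero]; exact hn.symm⟩
  | succ n ih =>
    obtain ⟨z, hz⟩ := h x hx
    obtain ⟨w, hw⟩ := ih (ν x) (hS x hx) (by rwa [pow_succ] at hn)
    exact ⟨z + w, by rw [map_add, hz, hw, sub_add_cancel]⟩

theorem IsQis.comp {f : X →ₗ[ℚ] Y} {g : Y →ₗ[ℚ] Z} {d : X →ₗ[ℚ] X} {d' : Y →ₗ[ℚ] Y}
    {d'' : Z →ₗ[ℚ] Z} (hf : IsQis f d d') (hg : IsQis g d' d'')
    (cf : ∀ x, f (d x) = d' (f x)) (cg : ∀ y, g (d' y) = d'' (g y)) : IsQis (g ∘ₗ f) d d'' := by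
  refine ⟨fun x h0 hy => ?_, fun z h0 => ?_⟩
  · exact hf.inj x h0 (hg.inj _ (by rw [← cf, h0, map_zero]) hy)
  · obtain ⟨y, h1, w, hw⟩ := hg.surj z h0
    obtain ⟨x, h2, v, hv⟩ := hf.surj y h1
    refine ⟨x, h2, w + g v, ?_⟩
    rw [map_add, hw, ← cg, hv, map_sub, LinearMap.comp_apply]
    abel

theorem IsQis.of_comp_left {f : X →ₗ[ℚ] Y} {g : Y →ₗ[ℚ] Z} {d : X →ₗ[ℚ] X} {d' : Y →ₗ[ℚ] Y}
    {d'' : Z →ₗ[ℚ] Z} (hg : IsQis g d' d'') (h : IsQis (g ∘ₗ f) d d'')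
    (cf : ∀ x, f (d x) = d' (f x)) (cg : ∀ y, g (d' y) = d'' (g y)) : IsQis f d d' := by
  refine ⟨fun x h0 ⟨y, hy⟩ => ?_, fun y h0 => ?_⟩
  · exact h.inj x h0 ⟨g y, by rw [← cg, hy]; rfl⟩
  · obtain ⟨x, h1, w, hw⟩ := h.surj (g y) (by rw [← cg, h0, map_zero])
    obtain ⟨z, hz⟩ := hg.inj (y - f x) (by rw [map_sub, h0, ← cf, h1, map_zero, sub_zero])
      ⟨w, by rw [hw, map_sub]; rfl⟩
    exact ⟨x, h1, z, hz⟩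

theorem IsQis.of_comp_right {f : X →ₗ[ℚ] Y} {g : Y →ₗ[ℚ] Z} {d : X →ₗ[ℚ] X} {d' : Y →ₗ[ℚ] Y}
    {d'' : Z →ₗ[ℚ] Z} (hf : IsQis f d d') (h : IsQis (g ∘ₗ f) d d'')
    (cf : ∀ x, f (d x) = d' (f x)) (cg : ∀ y, g (d' y) = d'' (g y)) : IsQis g d' d'' := by
  refine ⟨fun y h0 ⟨z, hz⟩ => ?_, fun z h0 => ?_⟩
  · obtain ⟨x, h1, v, hv⟩ := hf.surj y h0
    obtain ⟨w, hw⟩ := h.inj x h1 ⟨z - g v, by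
      rw [map_sub, hz, ← cg, hv, map_sub, LinearMap.comp_apply, sub_sub_cancel]⟩
    exact ⟨v + f w, by rw [map_add, hv, ← cf, hw, sub_add_cancel]⟩
  · obtain ⟨x, h1, w, hw⟩ := h.surj z h0
    exact ⟨f x, by rw [← cf, h1, map_zero], w, hw⟩

theorem IsQis.of_bijective {f : X →ₗ[ℚ] Y} {d : X →ₗ[ℚ] X} {d' : Y →ₗ[ℚ] Y}
    (hf : Function.Bijective f) (cf : ∀ x, f (d x) = d' (f x)) : IsQis f d d' := by
  refine ⟨fun x _ ⟨y, hy⟩ => ?_, fun y h0 => ?_⟩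
  · obtain ⟨z, rfl⟩ := hf.2 y
    exact ⟨z, hf.1 (by rw [cf, hy])⟩
  · obtain ⟨x, rfl⟩ := hf.2 y
    exact ⟨x, hf.1 (by rw [cf, h0, map_zero]), 0, by rw [map_zero, sub_self]⟩

/-- A chain map with a right inverse whose kernel is acyclic. -/
theorem IsQis.of_section {f : X →ₗ[ℚ] Y} {d : X →ₗ[ℚ] X} {d' : Y →ₗ[ℚ] Y} (g : Y →ₗ[ℚ] X)
    (cf : ∀ x, f (d x) = d' (f x)) (cg : ∀ y, g (d' y) = d (g y)) (hfg : ∀ y, f (g y) = y)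
    (h : ∀ x, d x = 0 → f x = 0 → ∃ z, d z = x) : IsQis f d d' := by
  refine ⟨fun x h0 ⟨y, hy⟩ => ?_, fun y h0 => ⟨g y, by rw [← cg, h0, map_zero], 0, by
    rw [hfg, sub_self, map_zero]⟩⟩
  have h1 : d' (f x) = 0 := by rw [← cf, h0, map_zero]
  obtain ⟨z, hz⟩ := h (x - g (f x)) (by rw [map_sub, h0, ← cg, h1, map_zero, sub_zero])
    (by rw [map_sub, hfg, sub_self])
  exact ⟨z + g y, by rw [map_add, hz, ← cg, hy, sub_add_cancel]⟩

end linear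

section twisted
variable {N Q Q' Q'' : Type} [AddCommGroup N] [Module ℚ N] [AddCommGroup Q] [Module ℚ Q]
  [AddCommGroup Q'] [Module ℚ Q'] [AddCommGroup Q''] [Module ℚ Q'']

/-- `n ⊗ q ↦ Σ ∂ₖ n ⊗ aₖ q`. -/
def tw (p : N →ₗ[ℚ] (ℕ →₀ N)) (a : ℕ → Q →ₗ[ℚ] Q') : N ⊗[ℚ] Q →ₗ[ℚ] N ⊗[ℚ] Q' :=
  TensorProduct.lift ((Finsupp.lsum ℚ fun k : ℕ => (TensorProduct.mk ℚ N Q').compl₂ (a k)) ∘ₗ p)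

theorem tw_tmul (p : N →ₗ[ℚ] (ℕ →₀ N)) (a : ℕ → Q →ₗ[ℚ] Q') (n : N) (q : Q) :
    tw p a (n ⊗ₜ q) = (p n).sum fun k x => x ⊗ₜ a k q := by
  simp [tw, Finsupp.sum]

theorem map_tw {p : N →ₗ[ℚ] (ℕ →₀ N)} {s : N →ₗ[ℚ] N} (hs : ∀ n k, p (s n) k = s (p n k))
    (a : ℕ → Q →ₗ[ℚ] Q') (t : N ⊗[ℚ] Q) :
    TensorProduct.map s LinearMap.id (tw p a t) =
      tw p a (TensorProduct.map s LinearMap.id t) := by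
  refine LinearMap.congr_fun (f := TensorProduct.map s LinearMap.id ∘ₗ tw p a)
    (g := tw p a ∘ₗ TensorProduct.map s LinearMap.id) (TensorProduct.ext' fun n q => ?_) t
  have h : p (s n) = Finsupp.mapRange.linearMap s (p n) := by
    ext k; simp [hs]
  simp only [LinearMap.comp_apply, TensorProduct.map_tmul, tw_tmul, LinearMap.id_apply, h]
  rw [Finsupp.mapRange.linearMap_apply, Finsupp.sum_mapRange_index (by simp), Finsupp.sum,
    map_sum]
  rfl

theorem map_tw_right (p : N →ₗ[ℚ] (ℕ →₀ N)) (a : ℕ → Q →ₗ[ℚ] Q') (g : Q' →ₗ[ℚ] Q'')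
    (t : N ⊗[ℚ] Q) :
    TensorProduct.map LinearMap.id g (tw p a t) = tw p (fun k => g ∘ₗ a k) t := by
  refine LinearMap.congr_fun (f := TensorProduct.map LinearMap.id g ∘ₗ tw p a)
    (g := tw p fun k => g ∘ₗ a k) (TensorProduct.ext' fun n q => ?_) t
  simp only [LinearMap.comp_apply, tw_tmul, Finsupp.sum, map_sum, TensorProduct.map_tmul,
    LinearMap.id_apply]

theorem tw_map_right (p : N →ₗ[ℚ] (ℕ →₀ N)) (a : ℕ → Q' →ₗ[ℚ] Q'') (g : Q →ₗ[ℚ] Q')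
    (t : N ⊗[ℚ] Q) :
    tw p a (TensorProduct.map LinearMap.id g t) = tw p (fun k => a k ∘ₗ g) t := by
  refine LinearMap.congr_fun (f := tw p a ∘ₗ TensorProduct.map LinearMap.id g)
    (g := tw p fun k => a k ∘ₗ g) (TensorProduct.ext' fun n q => ?_) t
  simp only [LinearMap.comp_apply, tw_tmul, TensorProduct.map_tmul, LinearMap.id_apply]

theorem tw_add (p : N →ₗ[ℚ] (ℕ →₀ N)) (a b : ℕ → Q →ₗ[ℚ] Q') (t : N ⊗[ℚ] Q) :
    tw p (fun k => a k + b k) t = tw p a t + tw p b t := by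
  refine LinearMap.congr_fun (f := tw p (fun k => a k + b k)) (g := tw p a + tw p b)
    (TensorProduct.ext' fun n q => ?_) t
  simp only [LinearMap.add_apply, tw_tmul, TensorProduct.tmul_add, Finsupp.sum,
    Finset.sum_add_distrib]

theorem tw_zero (p : N →ₗ[ℚ] (ℕ →₀ N)) (t : N ⊗[ℚ] Q) :
    tw p (fun _ => (0 : Q →ₗ[ℚ] Q')) t = 0 := by
  refine LinearMap.congr_fun (f := tw p fun _ => (0 : Q →ₗ[ℚ] Q')) (g := 0)
    (TensorProduct.ext' fun n q => ?_) t
  simp [tw_tmul]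

theorem tw_tw {p : N →ₗ[ℚ] (ℕ →₀ N)} {a : ℕ → Q →ₗ[ℚ] Q'} {b : ℕ → Q' →ₗ[ℚ] Q''}
    (h : ∀ k l q, b l (a k q) = 0) (t : N ⊗[ℚ] Q) : tw p b (tw p a t) = 0 := by
  refine LinearMap.congr_fun (f := tw p b ∘ₗ tw p a) (g := 0)
    (TensorProduct.ext' fun n q => ?_) t
  simp [tw_tmul, Finsupp.sum, h]

/-- The elements on which all `m`-fold composites of the operators `∂ₖ` vanish. -/
def nilp (p : N →ₗ[ℚ] (ℕ →₀ N)) : ℕ → N → Prop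
  | 0, n => n = 0
  | m + 1, n => ∀ k, nilp p m (p n k)

theorem nilp_zero (p : N →ₗ[ℚ] (ℕ →₀ N)) (m : ℕ) : nilp p m 0 := by
  induction m with
  | zero => rfl
  | succ m ih => intro k; simpa using ih

theorem nilp_succ {p : N →ₗ[ℚ] (ℕ →₀ N)} (m : ℕ) (n : N) (h : nilp p m n) : nilp p (m + 1) n := by
  induction m generalizing n with
  | zero => rw [show n = 0 from h]; exact nilp_zero p 1
  | succ m ih => exact fun k => ih _ (h k)

theorem tw_pow {p : N →ₗ[ℚ] (ℕ →₀ N)} (a : ℕ → Q →ₗ[ℚ] Q) (m : ℕ) (n : N) (h : nilp p m n)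
    (q : Q) : (tw p a ^ m) (n ⊗ₜ q) = 0 := by
  induction m generalizing n q with
  | zero => rw [show n = 0 from h, TensorProduct.zero_tmul]; rfl
  | succ m ih =>
    rw [pow_succ, Module.End.mul_apply, tw_tmul, Finsupp.sum, map_sum]
    exact Finset.sum_eq_zero fun k _ => ih _ (h k) _

theorem tw_nilpotent {p : N →ₗ[ℚ] (ℕ →₀ N)} (hp : ∀ n, ∃ m, nilp p m n)
    (a : ℕ → Q →ₗ[ℚ] Q) (t : N ⊗[ℚ] Q) : ∃ m, (tw p a ^ m) t = 0 := by
  induction t with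
  | zero => exact ⟨0, map_zero _⟩
  | tmul n q =>
    obtain ⟨m, hm⟩ := hp n
    exact ⟨m, tw_pow a m n hm q⟩
  | add x y hx hy =>
    obtain ⟨i, hi⟩ := hx
    obtain ⟨j, hj⟩ := hy
    refine ⟨i + j, ?_⟩
    rw [map_add, add_comm i j, pow_add, Module.End.mul_apply, hi, map_zero, ← pow_add,
      add_comm j i, pow_add, Module.End.mul_apply, hj, map_zero, add_zero]

/-- The differential of a twisted tensor product,
`n ⊗ q ↦ d n ⊗ q + s n ⊗ d q + Σ s ∂ₖ n ⊗ aₖ q`. -/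
def twD (d s : N →ₗ[ℚ] N) (p : N →ₗ[ℚ] (ℕ →₀ N)) (δ : Q →ₗ[ℚ] Q) (a : ℕ → Q →ₗ[ℚ] Q) :
    N ⊗[ℚ] Q →ₗ[ℚ] N ⊗[ℚ] Q :=
  TensorProduct.map d LinearMap.id +
    TensorProduct.map s LinearMap.id ∘ₗ (TensorProduct.map LinearMap.id δ + tw p a)

/-- The data of a comodule which enter into a twisted tensor product. -/
structure TwData (d s : N →ₗ[ℚ] N) (p : N →ₗ[ℚ] (ℕ →₀ N)) : Prop where
  dd : ∀ n, d (d n) = 0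
  ss : ∀ n, s (s n) = n
  sd : ∀ n, s (d n) = - d (s n)
  ps : ∀ n k, p (s n) k = s (p n k)
  pd : ∀ n k, p (d n) k = d (p n k)
  nil : ∀ n, ∃ m, nilp p m n

variable {d s : N →ₗ[ℚ] N} {p : N →ₗ[ℚ] (ℕ →₀ N)}

theorem twD_map {δ : Q →ₗ[ℚ] Q} {a : ℕ → Q →ₗ[ℚ] Q} {δ' : Q' →ₗ[ℚ] Q'} {a' : ℕ → Q' →ₗ[ℚ] Q'}
    {f : Q →ₗ[ℚ] Q'} (hδ : ∀ q, f (δ q) = δ' (f q)) (ha : ∀ k q, f (a k q) = a' k (f q))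
    (t : N ⊗[ℚ] Q) : TensorProduct.map LinearMap.id f (twD d s p δ a t) =
      twD d s p δ' a' (TensorProduct.map LinearMap.id f t) := by
  refine LinearMap.congr_fun (f := TensorProduct.map LinearMap.id f ∘ₗ twD d s p δ a)
    (g := twD d s p δ' a' ∘ₗ TensorProduct.map LinearMap.id f)
    (TensorProduct.ext' fun n q => ?_) t
  have h : TensorProduct.map LinearMap.id f (TensorProduct.map s LinearMap.id (tw p a (n ⊗ₜ q))) =
      TensorProduct.map s LinearMap.id (tw p a' (n ⊗ₜ[ℚ] f q)) := by
    have e : ∀ t : N ⊗[ℚ] Q, TensorProduct.map LinearMap.id f (TensorProduct.map s LinearMap.id t) =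
        TensorProduct.map s LinearMap.id (TensorProduct.map LinearMap.id f t) := fun t => by
      rw [← LinearMap.comp_apply, ← LinearMap.comp_apply, ← TensorProduct.map_comp,
        ← TensorProduct.map_comp]
      rfl
    rw [e, map_tw_right]
    have h2 : n ⊗ₜ[ℚ] f q = TensorProduct.map LinearMap.id f (n ⊗ₜ q) := rfl
    rw [h2, tw_map_right]
    congr 3
    funext k
    exact LinearMap.ext (ha k)
  simp only [LinearMap.comp_apply, twD, LinearMap.add_apply, TensorProduct.map_tmul, map_add, h,
    LinearMap.id_apply, hδ]

theorem twD_twD (h : TwData d s p) {δ : Q →ₗ[ℚ] Q} {a : ℕ → Q →ₗ[ℚ] Q} (hδ : ∀ q, δ (δ q) = 0)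
    (hδa : ∀ k q, δ (a k q) = - a k (δ q)) (haa : ∀ k l q, a l (a k q) = 0) (t : N ⊗[ℚ] Q) :
    twD d s p δ a (twD d s p δ a t) = 0 := by
  let A : N ⊗[ℚ] Q →ₗ[ℚ] N ⊗[ℚ] Q := TensorProduct.map d LinearMap.id
  let S : N ⊗[ℚ] Q →ₗ[ℚ] N ⊗[ℚ] Q := TensorProduct.map s LinearMap.id
  let B : N ⊗[ℚ] Q →ₗ[ℚ] N ⊗[ℚ] Q := TensorProduct.map LinearMap.id δ
  have hAA : ∀ t, A (A t) = 0 := LinearMap.congr_fun (f := A ∘ₗ A) (g := 0)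
    (TensorProduct.ext' fun n q => by simp [A, h.dd])
  have hSA : ∀ t, S (A t) = - A (S t) := LinearMap.congr_fun (f := S ∘ₗ A) (g := - (A ∘ₗ S))
    (TensorProduct.ext' fun n q => by simp [A, S, h.sd, TensorProduct.neg_tmul])
  have hSS : ∀ t, S (S t) = t := LinearMap.congr_fun (f := S ∘ₗ S) (g := LinearMap.id)
    (TensorProduct.ext' fun n q => by simp [S, h.ss])
  have hBS : ∀ t, B (S t) = S (B t) := LinearMap.congr_fun (f := B ∘ₗ S) (g := S ∘ₗ B)
    (TensorProduct.ext' fun n q => by simp [S, B])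
  have hBA : ∀ t, B (A t) = A (B t) := LinearMap.congr_fun (f := B ∘ₗ A) (g := A ∘ₗ B)
    (TensorProduct.ext' fun n q => by simp [A, B])
  have hBB : ∀ t, B (B t) = 0 := LinearMap.congr_fun (f := B ∘ₗ B) (g := 0)
    (TensorProduct.ext' fun n q => by simp [B, hδ])
  have hTS : ∀ t, tw p a (S t) = S (tw p a t) := fun t => (map_tw h.ps a t).symm
  have hTA : ∀ t, tw p a (A t) = A (tw p a t) := fun t => (map_tw h.pd a t).symm
  have hTB : ∀ t, tw p a (B t) = - B (tw p a t) := fun t => by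
    have e : (fun k => δ ∘ₗ a k) = fun k => (-1 : Q →ₗ[ℚ] Q) ∘ₗ (a k ∘ₗ δ) := by
      funext k; ext q; simp [hδa]
    simp only [B]
    rw [tw_map_right, map_tw_right, e, ← map_tw_right, ← map_neg, eq_comm]
    refine LinearMap.congr_fun (f := TensorProduct.map LinearMap.id (-1 : Q →ₗ[ℚ] Q) ∘ₗ (-LinearMap.id))
      (g := LinearMap.id) (TensorProduct.ext' fun n q => ?_) _
    simp [TensorProduct.tmul_neg]
  have hTT : ∀ t, tw p a (tw p a t) = 0 := tw_tw haa
  change A (A t + S (B t + tw p a t)) + S (B (A t + S (B t + tw p a t)) +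
    tw p a (A t + S (B t + tw p a t))) = 0
  simp only [map_add, hAA, hSA, hSS, hBS, hBA, hBB, hTS, hTA, hTB, hTT, map_neg]
  abel

/-- A twisted tensor product with a contractible complex is acyclic. -/
theorem twD_acyclic (h : TwData d s p) {δ : Q →ₗ[ℚ] Q} {a : ℕ → Q →ₗ[ℚ] Q} (hδ : ∀ q, δ (δ q) = 0)
    (hδa : ∀ k q, δ (a k q) = - a k (δ q)) (haa : ∀ k l q, a l (a k q) = 0)
    (H : Q →ₗ[ℚ] Q) (hH : ∀ q, δ (H q) + H (δ q) = q) (t : N ⊗[ℚ] Q)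
    (ht : twD d s p δ a t = 0) : ∃ z, twD d s p δ a z = t := by
  let A : N ⊗[ℚ] Q →ₗ[ℚ] N ⊗[ℚ] Q := TensorProduct.map d LinearMap.id
  let S : N ⊗[ℚ] Q →ₗ[ℚ] N ⊗[ℚ] Q := TensorProduct.map s LinearMap.id
  let B : N ⊗[ℚ] Q →ₗ[ℚ] N ⊗[ℚ] Q := TensorProduct.map LinearMap.id δ
  let K : N ⊗[ℚ] Q →ₗ[ℚ] N ⊗[ℚ] Q := TensorProduct.map LinearMap.id H
  let b : ℕ → Q →ₗ[ℚ] Q := fun k => - (a k ∘ₗ H + H ∘ₗ a k)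
  have hSA : ∀ t, S (A t) = - A (S t) := LinearMap.congr_fun (f := S ∘ₗ A) (g := - (A ∘ₗ S))
    (TensorProduct.ext' fun n q => by simp [A, S, h.sd, TensorProduct.neg_tmul])
  have hSS : ∀ t, S (S t) = t := LinearMap.congr_fun (f := S ∘ₗ S) (g := LinearMap.id)
    (TensorProduct.ext' fun n q => by simp [S, h.ss])
  have hBS : ∀ t, B (S t) = S (B t) := LinearMap.congr_fun (f := B ∘ₗ S) (g := S ∘ₗ B)
    (TensorProduct.ext' fun n q => by simp [S, B])
  have hKS : ∀ t, K (S t) = S (K t) := LinearMap.congr_fun (f := K ∘ₗ S) (g := S ∘ₗ K)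
    (TensorProduct.ext' fun n q => by simp [S, K])
  have hKA : ∀ t, K (A t) = A (K t) := LinearMap.congr_fun (f := K ∘ₗ A) (g := A ∘ₗ K)
    (TensorProduct.ext' fun n q => by simp [A, K])
  have hBK : ∀ t, B (K t) = t - K (B t) := LinearMap.congr_fun (f := B ∘ₗ K)
    (g := LinearMap.id - K ∘ₗ B)
    (TensorProduct.ext' fun n q => by
      simp only [B, K, LinearMap.comp_apply, TensorProduct.map_tmul, LinearMap.id_apply,
        LinearMap.sub_apply]
      rw [← TensorProduct.tmul_sub, ← eq_sub_of_add_eq (hH q)])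
  have hTS : ∀ t, tw p a (S t) = S (tw p a t) := fun t => (map_tw h.ps a t).symm
  have hT : ∀ t, tw p b t = - (tw p a (K t) + K (tw p a t)) := fun t => by
    simp only [K]
    rw [tw_map_right, map_tw_right, ← tw_add, eq_neg_iff_add_eq_zero, ← tw_add, ← tw_zero p t]
    congr 2
    funext k
    exact neg_add_cancel _
  have key : ∀ t, twD d s p δ a (S (K t)) + S (K (twD d s p δ a t)) = t - tw p b t := fun t => by
    change A (S (K t)) + S (B (S (K t)) + tw p a (S (K t))) +
      S (K (A t + S (B t + tw p a t))) = _
    simp only [map_add, hSA, hSS, hBS, hKS, hKA, hBK, hTS, hT, map_sub]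
    abel
  obtain ⟨m, hm⟩ := tw_nilpotent h.nil b t
  refine exists_of_nilpotent _ (tw p b) {t | twD d s p δ a t = 0} (fun x hx => ⟨S (K x), ?_⟩)
    (fun x hx => ?_) m t ht hm
  · have := key x
    rwa [show twD d s p δ a x = 0 from hx, map_zero, map_zero, add_zero] at this
  · have h1 := key x
    rw [show twD d s p δ a x = 0 from hx, map_zero, map_zero, add_zero] at h1
    have h2 : tw p b x = x - twD d s p δ a (S (K x)) := by rw [h1]; abel
    change twD d s p δ a _ = 0
    rw [h2, map_sub, show twD d s p δ a x = 0 from hx, twD_twD h hδ hδa haa, sub_zero]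

/-- Twisted tensor products preserve quasi-isomorphisms. -/
theorem twD_isQis (h : TwData d s p) {δ : Q →ₗ[ℚ] Q} {a : ℕ → Q →ₗ[ℚ] Q} {δ' : Q' →ₗ[ℚ] Q'}
    {a' : ℕ → Q' →ₗ[ℚ] Q'} {f : Q →ₗ[ℚ] Q'} (hf : IsQis f δ δ') (hδ : ∀ q, δ (δ q) = 0)
    (hδa : ∀ k q, δ (a k q) = - a k (δ q)) (haa : ∀ k l q, a l (a k q) = 0)
    (hδ' : ∀ q, δ' (δ' q) = 0)
    (hδa' : ∀ k q, δ' (a' k q) = - a' k (δ' q)) (haa' : ∀ k l q, a' l (a' k q) = 0)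
    (cf : ∀ q, f (δ q) = δ' (f q)) (ca : ∀ k q, f (a k q) = a' k (f q)) :
    IsQis (TensorProduct.map (LinearMap.id : N →ₗ[ℚ] N) f) (twD d s p δ a) (twD d s p δ' a') := by
  let Δ : Q × Q' →ₗ[ℚ] Q × Q' := LinearMap.prod (δ ∘ₗ LinearMap.fst ℚ Q Q')
    (f ∘ₗ LinearMap.fst ℚ Q Q' - δ' ∘ₗ LinearMap.snd ℚ Q Q')
  let α : ℕ → Q × Q' →ₗ[ℚ] Q × Q' := fun k => LinearMap.prod (a k ∘ₗ LinearMap.fst ℚ Q Q')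
    (- (a' k ∘ₗ LinearMap.snd ℚ Q Q'))
  have hΔ : ∀ x y, Δ (x, y) = (δ x, f x - δ' y) := fun x y => rfl
  have hα : ∀ k x y, α k (x, y) = (a k x, - a' k y) := fun k x y => rfl
  have hΔΔ : ∀ z, Δ (Δ z) = 0 := by
    rintro ⟨x, y⟩
    rw [hΔ, hΔ, hδ, cf, map_sub, hδ']
    simp
  obtain ⟨H, hH⟩ := exists_contraction Δ
    (by
      rintro ⟨x, y⟩ h0
      rw [hΔ, Prod.mk_eq_zero] at h0
      obtain ⟨z, hz⟩ := hf.inj x h0.1 ⟨y, (sub_eq_zero.mp h0.2).symm⟩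
      obtain ⟨x', h1, w, hw⟩ := hf.surj (f z - y) (by
        rw [map_sub, ← cf, hz, h0.2])
      refine ⟨(z - x', w), ?_⟩
      rw [hΔ, map_sub, h1, hz, sub_zero, hw, map_sub]
      exact Prod.ext rfl (by simp)) hΔΔ
  have acyc := twD_acyclic (a := α) h hΔΔ
    (by rintro k ⟨x, y⟩; rw [hα, hΔ, hΔ, hα, hδa, map_neg δ', hδa', ca, map_sub]; simp)
    (by rintro k l ⟨x, y⟩; rw [hα, hα, haa, map_neg, haa']; simp) H hH
  let S : N ⊗[ℚ] Q' →ₗ[ℚ] N ⊗[ℚ] Q' := TensorProduct.map s LinearMap.id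
  have hSS : ∀ t, S (S t) = t := LinearMap.congr_fun (f := S ∘ₗ S) (g := LinearMap.id)
    (TensorProduct.ext' fun n q => by simp [S, h.ss])
  let i₁ : N ⊗[ℚ] Q →ₗ[ℚ] N ⊗[ℚ] (Q × Q') :=
    TensorProduct.map LinearMap.id (LinearMap.inl ℚ Q Q')
  let i₂ : N ⊗[ℚ] Q' →ₗ[ℚ] N ⊗[ℚ] (Q × Q') :=
    TensorProduct.map LinearMap.id (LinearMap.inr ℚ Q Q')
  let p₁ : N ⊗[ℚ] (Q × Q') →ₗ[ℚ] N ⊗[ℚ] Q := TensorProduct.map LinearMap.id (LinearMap.fst ℚ Q Q')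
  let p₂ : N ⊗[ℚ] (Q × Q') →ₗ[ℚ] N ⊗[ℚ] Q' := TensorProduct.map LinearMap.id (LinearMap.snd ℚ Q Q')
  let F : N ⊗[ℚ] Q →ₗ[ℚ] N ⊗[ℚ] Q' := TensorProduct.map LinearMap.id f
  have hcF : ∀ t, F (twD d s p δ a t) = twD d s p δ' a' (F t) := twD_map cf ca
  have hi : ∀ t, i₁ (p₁ t) + i₂ (p₂ t) = t := LinearMap.congr_fun
    (f := i₁ ∘ₗ p₁ + i₂ ∘ₗ p₂) (g := LinearMap.id) (TensorProduct.ext' fun n q => by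
      simp [i₁, i₂, p₁, p₂, ← TensorProduct.tmul_add])
  have h11 : ∀ t, p₁ (i₁ t) = t := LinearMap.congr_fun
    (f := p₁ ∘ₗ i₁) (g := LinearMap.id) (TensorProduct.ext' fun n q => by simp [i₁, p₁])
  have h22 : ∀ t, p₂ (i₂ t) = t := LinearMap.congr_fun
    (f := p₂ ∘ₗ i₂) (g := LinearMap.id) (TensorProduct.ext' fun n q => by simp [i₂, p₂])
  have h12 : ∀ t, p₁ (i₂ t) = 0 := LinearMap.congr_fun
    (f := p₁ ∘ₗ i₂) (g := 0) (TensorProduct.ext' fun n q => by simp [i₂, p₁])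
  have h21 : ∀ t, p₂ (i₁ t) = 0 := LinearMap.congr_fun
    (f := p₂ ∘ₗ i₁) (g := 0) (TensorProduct.ext' fun n q => by simp [i₁, p₂])
  let D := twD d s p Δ α
  have D1 : ∀ t, p₁ (D t) = twD d s p δ a (p₁ t) := fun t =>
    twD_map (f := LinearMap.fst ℚ Q Q') (fun _ => rfl) (fun _ _ => rfl) t
  have D2 : ∀ t, p₂ (D t) = S (F (p₁ t) - twD d s p δ' a' (S (p₂ t))) := by
    refine LinearMap.congr_fun (f := p₂ ∘ₗ D)
      (g := S ∘ₗ (F ∘ₗ p₁ - twD d s p δ' a' ∘ₗ S ∘ₗ p₂)) (TensorProduct.ext' fun n z => ?_)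
    obtain ⟨x, y⟩ := z
    have e1 : S (F (p₁ (n ⊗ₜ (x, y)))) = s n ⊗ₜ f x := rfl
    have e2 : S (p₂ (n ⊗ₜ (x, y))) = s n ⊗ₜ y := rfl
    have e3 : S (twD d s p δ' a' (s n ⊗ₜ y)) =
        - (d n ⊗ₜ y) + s n ⊗ₜ δ' y + S (tw p a' (n ⊗ₜ y)) := by
      have hT : tw p a' (s n ⊗ₜ y) = S (tw p a' (n ⊗ₜ y)) := (map_tw h.ps a' (n ⊗ₜ y)).symm
      change S (d (s n) ⊗ₜ y + S (s n ⊗ₜ δ' y + tw p a' (s n ⊗ₜ y))) = _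
      rw [map_add, hSS, hT, ← add_assoc]
      congr 2
      change s (d (s n)) ⊗ₜ y = _
      rw [h.sd, h.ss, TensorProduct.neg_tmul]
    have e4 : p₂ (D (n ⊗ₜ (x, y))) = d n ⊗ₜ y + s n ⊗ₜ (f x - δ' y) - S (tw p a' (n ⊗ₜ y)) := by
      change p₂ (d n ⊗ₜ (x, y) + TensorProduct.map s LinearMap.id (n ⊗ₜ (Δ (x, y)) +
        tw p α (n ⊗ₜ (x, y)))) = _
      rw [map_add, map_add, map_add, sub_eq_add_neg, ← add_assoc]
      congr 1
      have e5 : ∀ t, p₂ (TensorProduct.map s LinearMap.id t) = S (p₂ t) := LinearMap.congr_fun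
        (f := p₂ ∘ₗ TensorProduct.map s LinearMap.id) (g := S ∘ₗ p₂)
        (TensorProduct.ext' fun n q => rfl)
      rw [e5, ← map_neg]
      congr 1
      change TensorProduct.map LinearMap.id (LinearMap.snd ℚ Q Q') _ = _
      rw [map_tw_right, tw_tmul, tw_tmul, Finsupp.sum, Finsupp.sum, ← Finset.sum_neg_distrib]
      refine Finset.sum_congr rfl fun k _ => ?_
      change _ ⊗ₜ (- a' k y) = _
      rw [TensorProduct.tmul_neg]
    rw [LinearMap.comp_apply, e4]
    change _ = S (F (p₁ (n ⊗ₜ (x, y))) - twD d s p δ' a' (S (p₂ (n ⊗ₜ (x, y)))))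
    rw [map_sub, e1, e2, e3, TensorProduct.tmul_sub]
    abel
  have Dext : ∀ t u, p₁ t = p₁ u → p₂ t = p₂ u → t = u := fun t u h1 h2 => by
    rw [← hi t, ← hi u, h1, h2]
  refine ⟨fun x hx ⟨y, hy⟩ => ?_, fun y hy => ?_⟩
  · have hxy : D (i₁ x + i₂ (S y)) = 0 := Dext _ _
      (by rw [D1, map_add, h11, h12, add_zero, hx, map_zero])
      (by rw [D2, map_add p₁, map_add p₂, h11, h12, h21, h22, zero_add, add_zero, hSS, hy, sub_self,
        map_zero, map_zero])
    obtain ⟨z, hz⟩ := acyc _ hxy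
    refine ⟨p₁ z, ?_⟩
    rw [← D1]
    change p₁ (twD d s p Δ α z) = x
    rw [hz, map_add, h11, h12, add_zero]
  · have hxy : D (i₂ (S y)) = 0 := Dext _ _
      (by rw [D1, h12, map_zero, map_zero])
      (by rw [D2, h12, h22, hSS, hy, map_zero, sub_self, map_zero, map_zero])
    obtain ⟨z, hz⟩ := acyc _ hxy
    refine ⟨p₁ z, ?_, - S (p₂ z), ?_⟩
    · rw [← D1]
      change p₁ (twD d s p Δ α z) = 0
      rw [hz, h12]
    · have := congrArg (fun t => S (p₂ t)) hz
      simp only [h22, hSS] at this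
      change S (p₂ (D z)) = y at this
      rw [D2, hSS] at this
      rw [← this, map_neg]
      change _ = F (p₁ z) - _ - F (p₁ z)
      abel

end twisted


namespace Words
variable {lam : ℚ}

/-- The coefficient of a word. -/
def co (u : List ℕ) : Words lam →ₗ[ℚ] ℚ := basis.coord u

theorem co_wd (u v : List ℕ) : co u (wd v : Words lam) = if v = u then 1 else 0 := by
  classical
  change (basis : Module.Basis _ ℚ (Words lam)).repr (wd v) u = _
  rw [← basis_apply, Module.Basis.repr_self, Finsupp.single_apply]

theorem co_nil : (co [] : Words lam →ₗ[ℚ] ℚ) = counitLin := lin_ext fun u => by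
  rw [co_wd, counitLin, lift_wd]

theorem co_cons_cons (k : ℕ) (u : List ℕ) (j : ℕ) (x : Words lam) :
    co (k :: u) (cons j x) = if j = k then co u x else 0 := by
  split_ifs with h
  · subst h
    refine LinearMap.congr_fun (f := co (j :: u) ∘ₗ cons j) (g := co u) (lin_ext fun v => ?_) x
    rw [LinearMap.comp_apply, cons_wd, co_wd, co_wd]
    simp
  · refine LinearMap.congr_fun (f := co (k :: u) ∘ₗ cons j) (g := 0) (lin_ext fun v => ?_) x
    rw [LinearMap.comp_apply, cons_wd, co_wd]
    simp [h]

theorem co_isHom {j : ℤ} {x : Words lam} (hx : gr.IsHom j x) (u : List ℕ) :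
    co u x = 0 ∨ j = weight u := by
  have h : (Grading.unit ℤ).IsHom (j - weight u) (co u x) := by
    refine Grading.map_of_span (s := fun j => j - weight u) span_wd ?_ j x hx
    rintro _ ⟨v, rfl⟩
    refine ⟨weight v, wd_isHom v, ?_⟩
    rw [co_wd]
    split_ifs with h
    · rw [h, sub_self]; rfl
    · exact Grading.IsHom.zero _ _
  exact (Cx.unit_isHom' h).imp id sub_eq_zero.mp

/-- The convolution product of linear functionals. -/
def conv {C : Type} [AddCommGroup C] [Module ℚ C] (Δ : C →ₗ[ℚ] C ⊗[ℚ] C) (φ ψ : C →ₗ[ℚ] ℚ) :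
    C →ₗ[ℚ] ℚ := LinearMap.mul' ℚ ℚ ∘ₗ TensorProduct.map φ ψ ∘ₗ Δ

theorem conv_co (u v : List ℕ) :
    conv (comulLin (lam := lam)) (co u) (co v) = co (u ++ v) := lin_ext fun w => by
  induction w generalizing u with
  | nil =>
    rw [← one_def, conv, LinearMap.comp_apply, LinearMap.comp_apply, comulLin_one,
      TensorProduct.map_tmul, LinearMap.mul'_apply, one_def, co_wd, co_wd, co_wd]
    cases u <;> cases v <;> simp
  | cons a w ih =>
    rw [← cons_wd, conv, LinearMap.comp_apply, LinearMap.comp_apply, comulLin_cons, map_add,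
      map_add, TensorProduct.map_tmul, LinearMap.mul'_apply]
    have h : ∀ t : Words lam ⊗[ℚ] Words lam, LinearMap.mul' ℚ ℚ (TensorProduct.map (co u) (co v)
        (consL a t)) = match u with
        | [] => 0
        | k :: u => if a = k then LinearMap.mul' ℚ ℚ (TensorProduct.map (co u) (co v) t)
          else 0 := by
      intro t
      induction t with
      | zero => cases u <;> simp
      | add s t hs ht =>
        rw [map_add, map_add, map_add, hs, ht]
        cases u with
        | nil => simp
        | cons k u => dsimp only; split_ifs with hk <;> simp
      | tmul x y =>
        rw [consL_tmul, TensorProduct.map_tmul, LinearMap.mul'_apply]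
        cases u with
        | nil => rw [co_nil, counit_cons, zero_mul]
        | cons k u => rw [co_cons_cons]; split_ifs with hk <;> simp [hk]
    rw [h]
    cases u with
    | nil =>
      simp only [one_def, co_wd]
      simp
    | cons k u =>
      have ih' := ih u
      rw [conv, LinearMap.comp_apply, LinearMap.comp_apply] at ih'
      dsimp only
      rw [ih', one_def, co_wd, List.cons_append, co_cons_cons]
      simp

section coef
variable {X : Type} [AddCommGroup X] [Module ℚ X]

/-- `n ⊗ x ↦ φ x n`. -/
def contract {C : Type} [AddCommGroup C] [Module ℚ C] (φ : C →ₗ[ℚ] ℚ) : X ⊗[ℚ] C →ₗ[ℚ] X :=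
  (TensorProduct.rid ℚ X).toLinearMap ∘ₗ TensorProduct.map LinearMap.id φ

theorem contract_tmul {C : Type} [AddCommGroup C] [Module ℚ C] (φ : C →ₗ[ℚ] ℚ) (m : X) (c : C) :
    contract φ (m ⊗ₜ c) = φ c • m := rfl

theorem map_contract {C Y : Type} [AddCommGroup C] [Module ℚ C] [AddCommGroup Y] [Module ℚ Y]
    (f : X →ₗ[ℚ] Y) (φ : C →ₗ[ℚ] ℚ) (t : X ⊗[ℚ] C) :
    f (contract φ t) = contract φ (TensorProduct.map f LinearMap.id t) :=
  LinearMap.congr_fun (f := f ∘ₗ contract φ)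
    (g := contract φ ∘ₗ TensorProduct.map f LinearMap.id) (TensorProduct.ext' fun m x => by
      simp [contract_tmul]) t

/-- The coefficients of the words. -/
def coef (X : Type) [AddCommGroup X] [Module ℚ X] : X ⊗[ℚ] Words lam ≃ₗ[ℚ] (List ℕ →₀ X) :=
  TensorProduct.congr (LinearEquiv.refl ℚ X) basis.repr ≪≫ₗ
    TensorProduct.finsuppScalarRight ℚ ℚ X (List ℕ)

theorem coef_tmul (m : X) (x : Words lam) (u : List ℕ) : coef X (m ⊗ₜ x) u = co u x • m := by
  simp [coef, co]

theorem coef_apply (t : X ⊗[ℚ] Words lam) (u : List ℕ) : coef X t u = contract (co u) t := by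
  refine LinearMap.congr_fun (f := Finsupp.lapply u ∘ₗ (coef (lam := lam) X).toLinearMap)
    (g := contract (co u)) (TensorProduct.ext' fun m x => ?_) t
  exact coef_tmul m x u

theorem eq_of_contract {s t : X ⊗[ℚ] Words lam} (h : ∀ u, contract (co u) s = contract (co u) t) :
    s = t := (coef X).injective (Finsupp.ext fun u => by rw [coef_apply, coef_apply, h])

end coef
end Words

namespace DGComod
variable {J C : Type} [AddCommGroup J] [CommRing C] [Bialgebra ℚ C] [GradedBialgebra J C]

/-- The action of the linear functionals on a comodule. -/
def op (N : DGComod J C) (φ : C →ₗ[ℚ] ℚ) : N.X →ₗ[ℚ] N.X := Words.contract φ ∘ₗ N.coact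

theorem op_op (N : DGComod J C) (φ ψ : C →ₗ[ℚ] ℚ) (n : N.X) :
    N.op φ (N.op ψ n) = N.op (Words.conv Coalgebra.comul φ ψ) n := by
  have h1 : ∀ t : N.X ⊗[ℚ] C, N.op φ (Words.contract ψ t) = Words.contract
      (LinearMap.mul' ℚ ℚ ∘ₗ TensorProduct.map φ ψ) (TensorProduct.assoc ℚ N.X C C
        (TensorProduct.map N.coact LinearMap.id t)) := by
    intro t
    induction t with
    | zero => simp
    | add s t hs ht => simp only [map_add, hs, ht]
    | tmul m x =>
      rw [Words.contract_tmul, map_smul, TensorProduct.map_tmul, op, LinearMap.comp_apply,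
        LinearMap.id_apply]
      induction N.coact m with
      | zero => simp
      | add s t hs ht => simp only [map_add, smul_add, TensorProduct.add_tmul, hs, ht]
      | tmul a b =>
        rw [TensorProduct.assoc_tmul, Words.contract_tmul, Words.contract_tmul, smul_smul]
        simp [mul_comm]
  have h2 : ∀ t : N.X ⊗[ℚ] C, Words.contract (LinearMap.mul' ℚ ℚ ∘ₗ TensorProduct.map φ ψ)
      (TensorProduct.map LinearMap.id (Coalgebra.comul (R := ℚ)) t) =
      Words.contract (Words.conv Coalgebra.comul φ ψ) t := by
    intro t
    induction t with
    | zero => simp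
    | add s t hs ht => simp only [map_add, hs, ht]
    | tmul m x => rfl
  exact (h1 (N.coact n)).trans (by rw [N.coassoc, h2]; rfl)

theorem op_counit (N : DGComod J C) (n : N.X) : N.op Coalgebra.counit n = n := by
  rw [op, LinearMap.comp_apply, Words.contract, LinearMap.comp_apply, N.coact_counit]
  simp

theorem op_map {N N' : DGComod J C} (f : N ⟶ N') (φ : C →ₗ[ℚ] ℚ) (n : N.X) :
    f.toLin (N.op φ n) = N'.op φ (f.toLin n) := by
  rw [op, op, LinearMap.comp_apply, LinearMap.comp_apply, f.map_coact, Words.map_contract]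

theorem op_d (N : DGComod J C) (φ : C →ₗ[ℚ] ℚ) (n : N.X) : N.op φ (N.d n) = N.d (N.op φ n) := by
  rw [op, LinearMap.comp_apply, LinearMap.comp_apply, N.coact_d, Words.map_contract]

theorem coact_sign (N : DGComod J C) (n : N.X) :
    N.coact (N.gr.sign n) = TensorProduct.map N.gr.sign LinearMap.id (N.coact n) := by
  rw [← Grading.sign_even (H := N.gr.tensor (cgr J C)) N.coact_hom, Grading.sign_tensor]
  congr 2
  refine Grading.ext_hom (cgr J C) fun i x hx => ?_
  rw [Grading.sign_apply hx]
  rcases Grading.inc_isHom hx with rfl | ⟨h1, -⟩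
  · simp
  · rw [h1]; simp

theorem op_sign (N : DGComod J C) (φ : C →ₗ[ℚ] ℚ) (n : N.X) :
    N.op φ (N.gr.sign n) = N.gr.sign (N.op φ n) := by
  rw [op, LinearMap.comp_apply, LinearMap.comp_apply, N.coact_sign, Words.map_contract]

end DGComod

namespace Cobar
open Words Hkm
variable (N N' : DGComod ℤ W)

/-- The operators `∂ₖ` on a comodule, the coefficients of the words of length one in the coaction. -/
def p : N.X →ₗ[ℚ] (ℕ →₀ N.X) :=
  Finsupp.lcomapDomain (fun k : ℕ => [k]) (fun _ _ h => by simpa using h) ∘ₗ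
    (coef N.X).toLinearMap ∘ₗ N.coact

theorem p_apply (n : N.X) (k : ℕ) : p N n k = N.op (co [k]) n := coef_apply _ _

theorem op_co_isHom {i : ℤ × ℤ} {n : N.X} (hn : N.gr.IsHom i n) (u : List ℕ) :
    N.gr.IsHom (i - (0, weight u)) (N.op (co u) n) := by
  refine Grading.tensor_map (s := fun i => i - (0, weight u)) (f := contract (co u)) (G := N.gr)
    (H := cgr ℤ W) (fun a b m x hm hx => ?_) i _ (N.coact_hom i n hn)
  rw [contract_tmul]
  rcases Grading.inc_isHom hx with rfl | ⟨h1, h2⟩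
  · rw [map_zero, zero_smul]; exact Grading.IsHom.zero _ _
  rcases co_isHom h2 u with h | h
  · rw [h, zero_smul]; exact Grading.IsHom.zero _ _
  · rw [← h, show b = (0, b.2) from Prod.ext h1 rfl, add_sub_cancel_right]
    exact hm.smul _

theorem op_co_co (n : N.X) (u v : List ℕ) : N.op (co u) (N.op (co v) n) = N.op (co (u ++ v)) n := by
  rw [DGComod.op_op, ← conv_co]
  rfl

theorem nilp_p (m : ℕ) (n : N.X) (h : ∀ u : List ℕ, m ≤ u.length → N.op (co u) n = 0) :
    nilp (p N) m n := by
  induction m generalizing n with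
  | zero =>
    have := h [] le_rfl
    rw [co_nil] at this
    rw [← N.op_counit n]
    exact this
  | succ m ih =>
    refine fun k => ih _ fun u hu => ?_
    rw [p_apply, op_co_co]
    exact h _ (by simpa using hu)

theorem exists_nilp (n : N.X) : ∃ m, nilp (p N) m n := by
  let s := (coef N.X (N.coact n)).support
  refine ⟨s.sup List.length + 1, nilp_p N _ n fun u hu => ?_⟩
  by_contra h0
  have hs : u ∈ s := by
    rw [Finsupp.mem_support_iff, coef_apply]
    exact h0
  have := Finset.le_sup (f := List.length) hs
  omega

theorem twData : TwData N.d N.gr.sign (p N) where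
  dd := N.d_d
  ss := N.gr.sign_sign
  sd := Cx.sign_d N.toCx
  ps n k := by rw [p_apply, p_apply, N.op_sign]
  pd n k := by rw [p_apply, p_apply, N.op_d]
  nil := exists_nilp N

end Cobar

/-- The five lemma for mapping cones. -/
theorem IsQis.cone {X X' Y Y' : Type} [AddCommGroup X] [Module ℚ X] [AddCommGroup X'] [Module ℚ X']
    [AddCommGroup Y] [Module ℚ Y] [AddCommGroup Y'] [Module ℚ Y'] {f : X →ₗ[ℚ] X'}
    {g : Y →ₗ[ℚ] Y'} {d : X →ₗ[ℚ] X} {d' : X' →ₗ[ℚ] X'} {δ : Y →ₗ[ℚ] Y} {δ' : Y' →ₗ[ℚ] Y'}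
    {b : X →ₗ[ℚ] Y} {b' : X' →ₗ[ℚ] Y'} (hf : IsQis f d d') (hg : IsQis g δ δ')
    (cf : ∀ x, f (d x) = d' (f x)) (cg : ∀ y, g (δ y) = δ' (g y))
    (cb : ∀ x, b (d x) = δ (b x)) (cb' : ∀ x, b' (d' x) = δ' (b' x))
    (h : ∀ x, g (b x) = b' (f x)) {D : X × Y →ₗ[ℚ] X × Y} {D' : X' × Y' →ₗ[ℚ] X' × Y'}
    (hD : ∀ x y, D (x, y) = (d x, - b x - δ y)) (hD' : ∀ x y, D' (x, y) = (d' x, - b' x - δ' y)) :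
    IsQis (LinearMap.prodMap f g) D D' := by
  refine ⟨?_, ?_⟩
  · rintro ⟨n, x⟩ h0 ⟨⟨n', x'⟩, h1⟩
    rw [hD, Prod.mk_eq_zero] at h0
    rw [hD', LinearMap.prodMap_apply, Prod.mk.injEq] at h1
    obtain ⟨z, hz⟩ := hf.inj n h0.1 ⟨n', h1.1⟩
    obtain ⟨w, hw, v, hv⟩ := hf.surj (n' - f z) (by rw [map_sub, h1.1, ← cf, hz, sub_self])
    obtain ⟨y, hy⟩ := hg.inj (x + b z + b w)
      (by
        rw [map_add, map_add, ← cb, ← cb, hz, hw, map_zero, add_zero, add_comm]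
        have := h0.2
        rw [← neg_add', neg_eq_zero] at this
        exact this)
      ⟨- (b' v + x'), by
        have e1 : b' (d' v) = b' n' - b' (f z) - b' (f w) := by rw [hv, map_sub, map_sub]
        rw [map_neg, map_add, map_add, map_add, h, h, ← cb', e1, ← h1.2]
        abel⟩
    refine ⟨(z + w, - y), ?_⟩
    rw [hD, map_add, map_add, map_neg, hz, hw, hy]
    exact Prod.ext (by simp) (by simp only; abel)
  · rintro ⟨n', x'⟩ h0
    rw [hD', Prod.mk_eq_zero] at h0
    obtain ⟨n, hn, z, hz⟩ := hf.surj n' h0.1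
    obtain ⟨y, hy⟩ := hg.inj (b n) (by rw [← cb, hn, map_zero]) ⟨- x' - b' z, by
      have e1 : - b' n' - δ' x' = 0 := h0.2
      have e2 : δ' (b' z) = b' n' - b' (f n) := by rw [← cb', hz, map_sub]
      rw [map_sub, map_neg, e2, h, ← sub_eq_zero, ← e1]
      abel⟩
    obtain ⟨w, hw, v, hv⟩ := hg.surj (x' + g y + b' z) (by
      have e2 : δ' (b' z) = b' n' - b' (f n) := by rw [← cb', hz, map_sub]
      rw [map_add, map_add, ← cg, hy, e2, h, ← neg_eq_zero, ← h0.2]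
      abel)
    refine ⟨(n, - y + w), ?_, (z, - v), ?_⟩
    · rw [hD, hn, map_add, map_neg, hy, hw]
      exact Prod.ext rfl (by simp)
    · rw [hD', LinearMap.prodMap_apply, hz, map_neg, hv, map_add, map_neg]
      exact Prod.ext rfl (by simp only [Prod.snd_sub]; abel)

theorem IsQis.mapRange {X Y ι : Type} [AddCommGroup X] [Module ℚ X] [AddCommGroup Y] [Module ℚ Y]
    {f : X →ₗ[ℚ] Y} {d : X →ₗ[ℚ] X} {d' : Y →ₗ[ℚ] Y} (hf : IsQis f d d')
    (cf : ∀ x, f (d x) = d' (f x)) (hd : ∀ x, d (d x) = 0) (hd' : ∀ y, d' (d' y) = 0) :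
    IsQis (Finsupp.mapRange.linearMap (α := ι) f) (Finsupp.mapRange.linearMap d)
      (Finsupp.mapRange.linearMap d') := by
  obtain ⟨g, h, k, h1, h2, h3⟩ := hf.isHtpyEquiv cf hd hd'
  refine IsHtpyEquiv.isQis ⟨Finsupp.mapRange.linearMap g, Finsupp.mapRange.linearMap h,
    Finsupp.mapRange.linearMap k, fun y => ?_, fun x => ?_, fun y => ?_⟩
  · ext i; simpa using h1 (y i)
  · ext i; simpa using h2 (x i)
  · ext i; simpa using h3 (y i)

namespace Grading
variable {Γ M : Type} [AddCommGroup M] [Module ℚ M]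

/-- The components of an element of the direct sum of `M` and shifted copies of `M`. -/
def coneComp (G : Grading Γ M) (s : ℕ → Γ → Γ) : M × (ℕ →₀ M) →ₗ[ℚ] (Γ →₀ M × (ℕ →₀ M)) :=
  Finsupp.mapRange.linearMap (LinearMap.inl ℚ M (ℕ →₀ M)) ∘ₗ G.comp ∘ₗ LinearMap.fst ℚ _ _ +
    (Finsupp.lsum ℚ fun k => Finsupp.lmapDomain _ ℚ (s k) ∘ₗ
      Finsupp.mapRange.linearMap (LinearMap.inr ℚ M (ℕ →₀ M) ∘ₗ Finsupp.lsingle k) ∘ₗ G.comp) ∘ₗ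
      LinearMap.snd ℚ _ _

theorem coneComp_fst {G : Grading Γ M} (s : ℕ → Γ → Γ) {i : Γ} {m : M} (hm : G.IsHom i m) :
    coneComp G s (m, 0) = Finsupp.single i (m, 0) := by
  unfold IsHom at hm
  simp [coneComp, hm]

theorem coneComp_snd {G : Grading Γ M} (s : ℕ → Γ → Γ) {i : Γ} {m : M} (hm : G.IsHom i m) (k : ℕ) :
    coneComp G s (0, Finsupp.single k m) = Finsupp.single (s k i) (0, Finsupp.single k m) := by
  unfold IsHom at hm
  simp [coneComp, hm]

theorem cone_ext {V : Type} [AddCommGroup V] [Module ℚ V] {f g : M × (ℕ →₀ M) →ₗ[ℚ] V}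
    (h1 : ∀ m, f (m, 0) = g (m, 0))
    (h2 : ∀ k m, f (0, Finsupp.single k m) = g (0, Finsupp.single k m)) : f = g :=
  LinearMap.prod_ext (LinearMap.ext h1) (Finsupp.lhom_ext h2)

theorem span_cone {S : Set M} (hS : Submodule.span ℚ S = ⊤) : Submodule.span ℚ
    {t : M × (ℕ →₀ M) | (∃ m ∈ S, t = (m, 0)) ∨ ∃ k, ∃ m ∈ S, t = (0, Finsupp.single k m)} = ⊤ := by
  set R : Submodule ℚ (M × (ℕ →₀ M)) := Submodule.span ℚ _ with hR
  have h : R.mkQ = 0 := cone_ext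
    (fun m => LinearMap.congr_fun (f := R.mkQ ∘ₗ LinearMap.inl ℚ _ _) (g := 0)
      (LinearMap.ext_on hS fun m hm => (Submodule.Quotient.mk_eq_zero _).mpr
        (Submodule.subset_span (Or.inl ⟨m, hm, rfl⟩))) m)
    (fun k m => LinearMap.congr_fun (f := R.mkQ ∘ₗ LinearMap.inr ℚ _ _ ∘ₗ Finsupp.lsingle k) (g := 0)
      (LinearMap.ext_on hS fun m hm => (Submodule.Quotient.mk_eq_zero _).mpr
        (Submodule.subset_span (Or.inr ⟨k, m, hm, rfl⟩))) m)
  rw [← Submodule.ker_mkQ R, h, LinearMap.ker_zero]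

/-- The grading of the direct sum of `M` and shifted copies of `M`. -/
def cone (G : Grading Γ M) (s : ℕ → Γ → Γ) : Grading Γ (M × (ℕ →₀ M)) :=
  ofSpan (coneComp G s) <| by
    rw [eq_top_iff, ← span_cone G.span_isHom]
    refine Submodule.span_mono ?_
    rintro _ (⟨m, ⟨i, hm⟩, rfl⟩ | ⟨k, m, ⟨i, hm⟩, rfl⟩)
    · exact ⟨i, coneComp_fst s hm⟩
    · exact ⟨s k i, coneComp_snd s hm k⟩

theorem IsHom.cone_fst {G : Grading Γ M} (s : ℕ → Γ → Γ) {i : Γ} {m : M} (hm : G.IsHom i m) :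
    (G.cone s).IsHom i (m, 0) := coneComp_fst s hm

theorem IsHom.cone_snd {G : Grading Γ M} (s : ℕ → Γ → Γ) {i : Γ} {m : M} (hm : G.IsHom i m)
    (k : ℕ) : (G.cone s).IsHom (s k i) (0, Finsupp.single k m) := coneComp_snd s hm k

theorem cone_map {Γ' V : Type} [AddCommGroup V] [Module ℚ V] {G : Grading Γ M} {s : ℕ → Γ → Γ}
    {K : Grading Γ' V} {f : M × (ℕ →₀ M) →ₗ[ℚ] V} {r : Γ → Γ'}
    (h1 : ∀ i m, G.IsHom i m → K.IsHom (r i) (f (m, 0)))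
    (h2 : ∀ k i m, G.IsHom i m → K.IsHom (r (s k i)) (f (0, Finsupp.single k m))) (i : Γ)
    (t : M × (ℕ →₀ M)) (ht : (G.cone s).IsHom i t) : K.IsHom (r i) (f t) := by
  refine map_of_span (span_cone G.span_isHom) ?_ i t ht
  rintro _ (⟨m, ⟨i, hm⟩, rfl⟩ | ⟨k, m, ⟨i, hm⟩, rfl⟩)
  · exact ⟨i, hm.cone_fst s, h1 i m hm⟩
  · exact ⟨s k i, hm.cone_snd s k, h2 k i m hm⟩

end Grading

namespace DGMod

theorem act_ext {M N : DGMod} {f : M.X →ₗ[ℚ] N.X}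
    (h : ∀ k m, f (M.act (e k) m) = N.act (e k) (f m)) (a : Etilde) (m : M.X) :
    f (M.act a m) = N.act a (f m) := by
  refine LinearMap.congr_fun (f := f ∘ₗ LinearMap.flip M.act.toLinearMap m)
    (g := LinearMap.flip N.act.toLinearMap (f m)) (Etilde.linearMap_ext ?_ fun k => h k m) a
  simp

/-- An action of the square-zero extension from operators with vanishing products. -/
def actOf {X : Type} [AddCommGroup X] [Module ℚ X] (E : ℕ → Module.End ℚ X)
    (h : ∀ k l, E k * E l = 0) : Etilde →ₐ[ℚ] Module.End ℚ X :=
  TrivSqZeroExt.liftEquivOfComm ⟨Finsupp.lsum ℚ fun k => LinearMap.toSpanSingleton ℚ _ (E k),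
    fun x y => by
      induction x using Finsupp.induction_linear with
      | zero => simp
      | add x x' hx hx' => rw [map_add, add_mul, hx, hx', add_zero]
      | single k a =>
        induction y using Finsupp.induction_linear with
        | zero => simp
        | add y y' hy hy' => rw [map_add, mul_add, hy, hy', add_zero]
        | single l b => simp [h]⟩

theorem actOf_e {X : Type} [AddCommGroup X] [Module ℚ X] (E : ℕ → Module.End ℚ X)
    (h : ∀ k l, E k * E l = 0) (k : ℕ) : actOf E h (e k) = E k := by
  simp [actOf, e]

end DGMod

namespace Cobar
open Words Hkm
variable (N N' : DGComod ℤ W)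

/-- The differential `(n, x) ↦ (d n, - ∂ n - d x)`. -/
def D : N.X × (ℕ →₀ N.X) →ₗ[ℚ] N.X × (ℕ →₀ N.X) :=
  LinearMap.prod (N.d ∘ₗ LinearMap.fst ℚ _ _)
    (- (p N ∘ₗ LinearMap.fst ℚ _ _) - Finsupp.mapRange.linearMap N.d ∘ₗ LinearMap.snd ℚ _ _)

theorem D_apply (n : N.X) (x : ℕ →₀ N.X) :
    D N (n, x) = (N.d n, - p N n - Finsupp.mapRange.linearMap N.d x) := rfl

theorem p_d (n : N.X) : p N (N.d n) = Finsupp.mapRange.linearMap N.d (p N n) :=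
  Finsupp.ext fun k => by
    rw [Finsupp.mapRange.linearMap_apply, Finsupp.mapRange_apply]
    exact (twData N).pd n k

/-- The operators `(n, x) ↦ (0, n)`, with `n` in the `k`-th place. -/
def E (k : ℕ) : Module.End ℚ (N.X × (ℕ →₀ N.X)) :=
  LinearMap.inr ℚ _ _ ∘ₗ Finsupp.lsingle k ∘ₗ LinearMap.fst ℚ _ _

theorem E_mul_E (k l : ℕ) : E N k * E N l = 0 := by
  ext x <;> simp [E]

theorem snd_eq_sum (x : ℕ →₀ N.X) : ((0 : N.X), x) = x.sum fun k n => (0, Finsupp.single k n) := by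
  conv_lhs => rw [← Finsupp.sum_single x]
  exact map_sum (LinearMap.inr ℚ N.X (ℕ →₀ N.X)) _ _

theorem snd_isHom {s : ℕ → ℤ × ℤ → ℤ × ℤ} {i : ℤ × ℤ} {x : ℕ →₀ N.X}
    (h : ∀ k, ∃ j, s k j = i ∧ N.gr.IsHom j (x k)) : (N.gr.cone s).IsHom i (0, x) := by
  rw [snd_eq_sum]
  refine Grading.IsHom.sum fun k _ => ?_
  obtain ⟨j, rfl, h2⟩ := h k
  exact h2.cone_snd s k

/-- The cobar construction of a comodule. -/
def obj : DGMod where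
  X := N.X × (ℕ →₀ N.X)
  gr := N.gr.cone fun k i => i + (-1, (k : ℤ) + 1)
  d := D N
  d_hom := Grading.cone_map (r := fun i => i + (-1, 0))
    (fun i m hm => by
      rw [D_apply, map_zero, sub_zero, show (N.d m, - p N m) = (N.d m, 0) + (0, - p N m) by simp]
      refine Grading.IsHom.add ((N.d_hom i m hm).cone_fst _) (snd_isHom N fun k => ?_)
      refine ⟨i - (0, weight [k]), ?_, ?_⟩
      · refine Prod.ext ?_ ?_ <;> simp [weight]
      · rw [Finsupp.neg_apply, p_apply, ← neg_one_smul ℚ]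
        exact (op_co_isHom N hm [k]).smul _)
    (fun k i m hm => by
      rw [D_apply, map_zero, map_zero, neg_zero, zero_sub, Finsupp.mapRange.linearMap_apply,
        Finsupp.mapRange_single, ← Finsupp.single_neg, ← map_neg N.d, ← neg_one_smul ℚ m, add_right_comm]
      exact (N.d_hom i _ (hm.smul _)).cone_snd _ k)
  d_d := by
    rintro ⟨n, x⟩
    rw [D_apply, D_apply, N.d_d, p_d, map_sub, map_neg]
    refine Prod.ext rfl ?_
    ext k
    simp [N.d_d]
  act := DGMod.actOf (E N) (E_mul_E N)
  act_hom k := by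
    rw [DGMod.actOf_e]
    refine Grading.cone_map (r := fun i => i + (-1, (k : ℤ) + 1)) (fun i m hm => ?_)
      (fun l i m hm => ?_)
    · exact hm.cone_snd _ k
    · rw [show E N k (0, Finsupp.single l m) = 0 by simp [E]]
      exact Grading.IsHom.zero _ _
  d_act k := by
    rintro ⟨n, x⟩
    rw [DGMod.actOf_e]
    change D N (0, Finsupp.single k n) = - (0, Finsupp.single k (N.d n))
    rw [D_apply]
    simp

theorem act_e (k : ℕ) (n : N.X) (x : ℕ →₀ N.X) :
    (obj N).act (e k) (n, x) = (0, Finsupp.single k n) := by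
  change DGMod.actOf (E N) (E_mul_E N) (e k) _ = _
  rw [DGMod.actOf_e]
  rfl

variable {N N'}

theorem map_fst (f : N ⟶ N') (n : N.X) :
    LinearMap.prodMap f.toLin (Finsupp.mapRange.linearMap (α := ℕ) f.toLin) (n, 0) =
      (f.toLin n, 0) := by
  rw [LinearMap.prodMap_apply, map_zero]

theorem map_snd (f : N ⟶ N') (k : ℕ) (n : N.X) :
    LinearMap.prodMap f.toLin (Finsupp.mapRange.linearMap (α := ℕ) f.toLin)
      (0, Finsupp.single k n) = (0, Finsupp.single k (f.toLin n)) := by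
  rw [LinearMap.prodMap_apply, map_zero, Finsupp.mapRange.linearMap_apply, Finsupp.mapRange_single]

/-- The cobar construction on morphisms. -/
def map (f : N ⟶ N') : obj N ⟶ obj N' where
  toLin := LinearMap.prodMap f.toLin (Finsupp.mapRange.linearMap f.toLin)
  map_hom := Grading.cone_map (r := fun i => i)
    (fun i m hm => by
      have := (f.map_hom i m hm).cone_fst fun k i => i + (-1, (k : ℤ) + 1)
      rwa [← map_fst] at this)
    (fun k i m hm => by
      have := (f.map_hom i m hm).cone_snd (fun k i => i + (-1, (k : ℤ) + 1)) k
      rwa [← map_snd] at this)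
  map_d := by
    rintro ⟨n, x⟩
    change LinearMap.prodMap _ _ (D N (n, x)) = D N' (_, _)
    rw [D_apply, D_apply, LinearMap.prodMap_apply, f.map_d]
    refine Prod.ext rfl (Finsupp.ext fun k => ?_)
    simp [p_apply, DGComod.op_map, f.map_d]
  map_act := DGMod.act_ext (M := obj N) (N := obj N') fun k => by
    rintro ⟨n, x⟩
    rw [act_e]
    exact (map_snd f k n).trans (act_e N' k _ _).symm

theorem p_map (f : N ⟶ N') (n : N.X) :
    Finsupp.mapRange.linearMap f.toLin (p N n) = p N' (f.toLin n) := by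
  ext k
  simp [p_apply, DGComod.op_map]

theorem map_qis (f : N ⟶ N') (hf : DGComod.qis ℤ W f) : DGMod.qis (map f) := by
  have hf' : IsQis f.toLin N.d N'.d := hf
  exact IsQis.cone hf' (hf'.mapRange f.map_d N.d_d N'.d_d) f.map_d
    (fun x => by ext k; simp [f.map_d]) (p_d N) (p_d N') (p_map f) (D_apply N) (D_apply N')

end Cobar

/-- The cobar construction, as a functor. -/
def cobar : DGComod ℤ Hkm.W ⥤ DGMod where
  obj := Cobar.obj
  map := Cobar.map
  map_id N := DGMod.hom_ext fun ⟨n, x⟩ => by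
    change (n, Finsupp.mapRange.linearMap LinearMap.id x) = (n, x)
    rw [Finsupp.mapRange.linearMap_id]
    rfl
  map_comp f g := DGMod.hom_ext fun ⟨n, x⟩ => by
    refine Prod.ext rfl ?_
    change Finsupp.mapRange.linearMap (g.toLin ∘ₗ f.toLin) x = _
    rw [Finsupp.mapRange.linearMap_comp]
    rfl

namespace Cobar
open Words Hkm DGMod
variable (N : DGComod ℤ W) (Q Q' : DGMod)

/-- `n`, as an element of the cobar construction. -/
def inl : N.X →ₗ[ℚ] (obj N).X := LinearMap.inl ℚ N.X (ℕ →₀ N.X)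

theorem inl_isHom {i : ℤ × ℤ} {n : N.X} (hn : N.gr.IsHom i n) : (obj N).gr.IsHom i (inl N n) :=
  hn.cone_fst _

theorem sign_inl (n : N.X) : (obj N).gr.sign (inl N n) = inl N (N.gr.sign n) :=
  Grading.sign_even (H := (obj N).gr) (f := inl N) (fun _ _ => inl_isHom N) n

theorem act_inl (k : ℕ) (n : N.X) :
    (obj N).act (e k) (inl N n) = ((0, Finsupp.single k n) : N.X × (ℕ →₀ N.X)) := act_e N k n 0

/-- Linear maps on the cobar construction are determined on the elements `n` and `eₖ n`. -/
theorem ext {V : Type} [AddCommGroup V] [Module ℚ V] {f g : (obj N).X →ₗ[ℚ] V}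
    (h1 : ∀ n, f (inl N n) = g (inl N n))
    (h2 : ∀ k n, f ((obj N).act (e k) (inl N n)) = g ((obj N).act (e k) (inl N n))) : f = g :=
  Grading.cone_ext h1 fun k n => by
    have := h2 k n
    rwa [act_inl] at this

theorem d_inl (n : N.X) : (obj N).d (inl N n) =
    inl N (N.d n) - (p N n).sum fun k x => (obj N).act (e k) (inl N x) := by
  have h : ((p N n).sum fun k x => (obj N).act (e k) (inl N x)) =
      ((0, p N n) : N.X × (ℕ →₀ N.X)) := by
    rw [snd_eq_sum]
    exact Finsupp.sum_congr fun k _ => act_inl N k _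
  rw [h]
  change D N (n, 0) = ((N.d n, 0) : N.X × (ℕ →₀ N.X)) - (0, p N n)
  rw [D_apply, map_zero, sub_zero]
  exact Prod.ext (sub_zero _).symm (zero_sub _).symm

/-- Linear maps out of the cobar construction. -/
def lift {V : Type} [AddCommGroup V] [Module ℚ V] (f : N.X →ₗ[ℚ] V) (g : ℕ → N.X →ₗ[ℚ] V) :
    (obj N).X →ₗ[ℚ] V := LinearMap.coprod f (Finsupp.lsum ℚ g)

theorem lift_inl {V : Type} [AddCommGroup V] [Module ℚ V] (f : N.X →ₗ[ℚ] V) (g : ℕ → N.X →ₗ[ℚ] V)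
    (n : N.X) : lift N f g (inl N n) = f n := by
  change f n + Finsupp.lsum ℚ g 0 = _
  rw [map_zero, add_zero]

theorem lift_act {V : Type} [AddCommGroup V] [Module ℚ V] (f : N.X →ₗ[ℚ] V) (g : ℕ → N.X →ₗ[ℚ] V)
    (k : ℕ) (n : N.X) : lift N f g ((obj N).act (e k) (inl N n)) = g k n := by
  rw [act_inl]
  change f 0 + Finsupp.lsum ℚ g (Finsupp.single k n) = _
  simp

/-- The differential on `N ⊗ Q` which corresponds to the tensor product of `Q` with the cobar
construction of `N`. -/
def tD : N.X ⊗[ℚ] Q.X →ₗ[ℚ] N.X ⊗[ℚ] Q.X :=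
  twD N.d N.gr.sign (p N) Q.d fun k => - Q.act (e k)

/-- `n ⊗ q ↦ n ⊗ q`. -/
def tΦ : N.X ⊗[ℚ] Q.X →ₗ[ℚ] (tens (obj N) Q).X :=
  TensorProduct.lift ((tm : (obj N).X →ₗ[ℚ] Q.X →ₗ[ℚ] _) ∘ₗ inl N)

theorem tΦ_tmul (n : N.X) (q : Q.X) : tΦ N Q (n ⊗ₜ q) = tm (inl N n) q := rfl

/-- The bilinear map which induces the inverse of `tΦ`. -/
def tB : (obj N).X →ₗ[ℚ] Q.X →ₗ[ℚ] N.X ⊗[ℚ] Q.X :=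
  lift N (TensorProduct.mk ℚ N.X Q.X) fun k =>
    (TensorProduct.mk ℚ N.X Q.X).compl₁₂ N.gr.sign (Q.act (e k))

theorem tB_inl (n : N.X) (q : Q.X) : tB N Q (inl N n) q = n ⊗ₜ q :=
  LinearMap.congr_fun (lift_inl N (TensorProduct.mk ℚ N.X Q.X) _ n) q

theorem tB_act (k : ℕ) (n : N.X) (q : Q.X) :
    tB N Q ((obj N).act (e k) (inl N n)) q = N.gr.sign n ⊗ₜ Q.act (e k) q :=
  LinearMap.congr_fun (lift_act N (TensorProduct.mk ℚ N.X Q.X) (fun k =>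
    (TensorProduct.mk ℚ N.X Q.X).compl₁₂ N.gr.sign (Q.act (e k))) k n) q

/-- The inverse of `tΦ`. -/
def tΨ : (tens (obj N) Q).X →ₗ[ℚ] N.X ⊗[ℚ] Q.X :=
  DGMod.lift (tB N Q) fun k m q => by
    refine LinearMap.congr_fun (f := (tB N Q).flip q ∘ₗ (obj N).act (e k) ∘ₗ (obj N).gr.sign)
      (g := (tB N Q).flip (Q.act (e k) q)) (ext N (fun n => ?_) (fun l n => ?_)) m
    · simp only [LinearMap.comp_apply, LinearMap.flip_apply, sign_inl, tB_act, tB_inl,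
        Grading.sign_sign]
    · simp only [LinearMap.comp_apply, LinearMap.flip_apply, tB_act, sign_act_e, map_neg,
        act_ee, neg_zero, map_zero, TensorProduct.tmul_zero]

theorem tΨ_inl (n : N.X) (q : Q.X) : tΨ N Q (tm (inl N n) q) = n ⊗ₜ q :=
  tB_inl N Q n q

theorem tΨ_act (k : ℕ) (n : N.X) (q : Q.X) :
    tΨ N Q (tm ((obj N).act (e k) (inl N n)) q) = N.gr.sign n ⊗ₜ Q.act (e k) q :=
  tB_act N Q k n q

theorem tΦ_bijective : Function.Bijective (tΦ N Q) := by
  have h1 : ∀ t, tΨ N Q (tΦ N Q t) = t :=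
    LinearMap.congr_fun (f := tΨ N Q ∘ₗ tΦ N Q) (g := LinearMap.id)
      (TensorProduct.ext' fun n q => by
        rw [LinearMap.comp_apply, tΦ_tmul, tΨ_inl]
        rfl)
  have h2 : ∀ t, tΦ N Q (tΨ N Q t) = t :=
    LinearMap.congr_fun (f := tΦ N Q ∘ₗ tΨ N Q) (g := LinearMap.id) (tm_ext fun m q =>
      LinearMap.congr_fun (f := (tΦ N Q ∘ₗ tΨ N Q) ∘ₗ tm.flip q) (g := tm.flip q)
        (ext N (fun n => by
            rw [LinearMap.comp_apply, LinearMap.comp_apply, LinearMap.flip_apply, tΨ_inl]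
            rfl)
          fun k n => by
            rw [LinearMap.comp_apply, LinearMap.comp_apply, LinearMap.flip_apply, tΨ_act,
              tΦ_tmul, ← tm_bal,
              sign_inl, Grading.sign_sign]) m)
  exact ⟨Function.LeftInverse.injective h1, Function.RightInverse.surjective h2⟩

theorem tΦ_d (t : N.X ⊗[ℚ] Q.X) : tΦ N Q (tD N Q t) = (tens (obj N) Q).d (tΦ N Q t) := by
  refine LinearMap.congr_fun (f := tΦ N Q ∘ₗ tD N Q) (g := (tens (obj N) Q).d ∘ₗ tΦ N Q)
    (TensorProduct.ext' fun n q => ?_) t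
  rw [LinearMap.comp_apply, LinearMap.comp_apply, tΦ_tmul, tm_d, d_inl, sign_inl, map_sub,
    LinearMap.sub_apply]
  have h : tΦ N Q (TensorProduct.map N.gr.sign LinearMap.id
      (tw (p N) (fun k => - Q.act (e k)) (n ⊗ₜ q))) =
      - tm ((p N n).sum fun k x => (obj N).act (e k) (inl N x)) q := by
    rw [tw_tmul, Finsupp.sum, Finsupp.sum, map_sum, map_sum, map_sum, LinearMap.sum_apply,
      ← Finset.sum_neg_distrib]
    refine Finset.sum_congr rfl fun k _ => ?_
    rw [TensorProduct.map_tmul, LinearMap.id_apply, tΦ_tmul, LinearMap.neg_apply, map_neg, ← tm_bal,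
      sign_inl, Grading.sign_sign]
  change tΦ N Q (N.d n ⊗ₜ q + TensorProduct.map N.gr.sign LinearMap.id (n ⊗ₜ Q.d q + _)) = _
  rw [map_add, map_add, map_add, h, TensorProduct.map_tmul, tΦ_tmul, tΦ_tmul]
  simp only [LinearMap.id_apply]
  abel

theorem kflat_obj : kflat (obj N) := by
  intro Q Q' f hf
  have hf' : IsQis f.toLin Q.d Q'.d := hf
  have h1 : IsQis (TensorProduct.map LinearMap.id f.toLin) (tD N Q) (tD N Q') :=
    twD_isQis (twData N) hf' Q.d_d (fun k q => by simp [Q.d_act])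
      (fun k l q => by simp [DGMod.act_ee]) Q'.d_d (fun k q => by simp [Q'.d_act])
      (fun k l q => by simp [DGMod.act_ee]) f.map_d (fun k q => by simp [f.map_act])
  have hΦ : IsQis (tΦ N Q) (tD N Q) (tens (obj N) Q).d :=
    IsQis.of_bijective (tΦ_bijective N Q) (tΦ_d N Q)
  have hΦ' : IsQis (tΦ N Q') (tD N Q') (tens (obj N) Q').d :=
    IsQis.of_bijective (tΦ_bijective N Q') (tΦ_d N Q')
  have c1 : ∀ t, TensorProduct.map LinearMap.id f.toLin (tD N Q t) =
      tD N Q' (TensorProduct.map LinearMap.id f.toLin t) :=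
    twD_map f.map_d fun k q => by simp [f.map_act]
  have h2 := h1.comp hΦ' c1 (tΦ_d N Q')
  have e : tΦ N Q' ∘ₗ TensorProduct.map LinearMap.id f.toLin = tensLin (𝟙 (obj N)) f ∘ₗ tΦ N Q :=
    TensorProduct.ext' fun n q => rfl
  rw [e] at h2
  exact IsQis.of_comp_right hΦ h2 (tΦ_d N Q) (tensHom (𝟙 (obj N)) f).map_d

end Cobar

namespace Hkm
open Words DGMod

/-- Removing the first letter. -/
def uncons : W →ₗ[ℚ] (ℕ →₀ W) := Words.lift fun
  | [] => 0
  | k :: u => Finsupp.single k (wd u)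

theorem uncons_one : uncons 1 = 0 := lift_wd _ []

theorem uncons_cons (k : ℕ) (x : W) : uncons (cons k x) = Finsupp.single k x := by
  refine LinearMap.congr_fun (f := uncons ∘ₗ cons k) (g := Finsupp.lsingle k)
    (lin_ext fun u => ?_) x
  rw [LinearMap.comp_apply, cons_wd]
  exact lift_wd _ (k :: u)

theorem nilp_add {N : Type} [AddCommGroup N] [Module ℚ N] {p : N →ₗ[ℚ] (ℕ →₀ N)} (m : ℕ) {x y : N}
    (hx : nilp p m x) (hy : nilp p m y) : nilp p m (x + y) := by
  induction m generalizing x y with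
  | zero => rw [show x = 0 from hx, show y = 0 from hy, add_zero]; exact rfl
  | succ m ih =>
    intro k
    rw [map_add, Finsupp.add_apply]
    exact ih (hx k) (hy k)

theorem nilp_smul {N : Type} [AddCommGroup N] [Module ℚ N] {p : N →ₗ[ℚ] (ℕ →₀ N)} (m : ℕ) {x : N}
    (a : ℚ) (hx : nilp p m x) : nilp p m (a • x) := by
  induction m generalizing x with
  | zero => rw [show x = 0 from hx, smul_zero]; exact rfl
  | succ m ih =>
    intro k
    rw [map_smul, Finsupp.smul_apply]
    exact ih (hx k)

theorem nilp_le {N : Type} [AddCommGroup N] [Module ℚ N] {p : N →ₗ[ℚ] (ℕ →₀ N)} {m m' : ℕ}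
    (hm : m ≤ m') {x : N} (hx : nilp p m x) : nilp p m' x := by
  induction hm with
  | refl => exact hx
  | step _ ih => exact nilp_succ _ _ ih

theorem nilp_uncons (u : List ℕ) : nilp uncons (u.length + 1) (wd u) := by
  induction u with
  | nil => intro k; rw [← one_def, uncons_one]; exact rfl
  | cons a u ih =>
    intro k
    rw [← cons_wd, uncons_cons, Finsupp.single_apply]
    split_ifs
    · exact ih
    · exact nilp_zero _ _

theorem twData : TwData (N := W) 0 LinearMap.id uncons where
  dd _ := rfl
  ss _ := rfl
  sd _ := by simp
  ps _ _ := rfl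
  pd _ _ := by simp
  nil x := by
    have hx : x ∈ Submodule.span ℚ (Set.range (wd : List ℕ → W)) := by rw [span_wd]; trivial
    induction hx using Submodule.span_induction with
    | mem x h => obtain ⟨u, rfl⟩ := h; exact ⟨_, nilp_uncons u⟩
    | zero => exact ⟨0, rfl⟩
    | add x y _ _ hx hy =>
      obtain ⟨m, hm⟩ := hx
      obtain ⟨m', hm'⟩ := hy
      exact ⟨max m m', nilp_add _ (nilp_le (le_max_left _ _) hm) (nilp_le (le_max_right _ _) hm')⟩
    | smul a x _ hx => obtain ⟨m, hm⟩ := hx; exact ⟨m, nilp_smul m a hm⟩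

variable (M : DGMod)

theorem comm_D (t : W ⊗[ℚ] M.X) : TensorProduct.comm ℚ W M.X
    (twD (N := W) 0 LinearMap.id uncons M.d (fun k => M.act (e k)) t) =
      D M (TensorProduct.comm ℚ W M.X t) := by
  refine LinearMap.congr_fun (f := (TensorProduct.comm ℚ W M.X).toLinearMap ∘ₗ
    twD (N := W) 0 LinearMap.id uncons M.d (fun k => M.act (e k)))
    (g := D M ∘ₗ (TensorProduct.comm ℚ W M.X).toLinearMap) (TensorProduct.ext (lin_ext fun u =>
      LinearMap.ext fun m => ?_)) t
  change TensorProduct.comm ℚ W M.X ((0 : W) ⊗ₜ m + TensorProduct.map LinearMap.id LinearMap.id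
    (wd u ⊗ₜ M.d m + tw uncons _ (wd u ⊗ₜ m))) = D M (m ⊗ₜ wd u)
  rw [TensorProduct.zero_tmul, zero_add, TensorProduct.map_id, LinearMap.id_apply, map_add, tw_tmul]
  cases u with
  | nil => rw [← one_def, uncons_one, D_one]; simp
  | cons k u => rw [← cons_wd, uncons_cons, D_cons]; simp

variable {M} in
theorem map_qis {M' : DGMod} (f : M ⟶ M') (hf : qis f) : DGComod.qis ℤ W (hkm.map f) := by
  have hf' : IsQis f.toLin M.d M'.d := hf
  have h1 := twD_isQis twData (f := f.toLin) (a := fun k => M.act (e k))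
    (a' := fun k => M'.act (e k)) hf' M.d_d M.d_act (fun k l q => act_ee _ _ _ _)
    M'.d_d M'.d_act (fun k l q => act_ee _ _ _ _) f.map_d (fun k q => f.map_act _ _)
  have b : ∀ M : DGMod, IsQis (TensorProduct.comm ℚ W M.X).toLinearMap
      (twD (N := W) 0 LinearMap.id uncons M.d (fun k => M.act (e k))) (D M) := fun M =>
    IsQis.of_bijective (TensorProduct.comm ℚ W M.X).bijective (comm_D M)
  have h2 := h1.comp (b M') (twD_map f.map_d fun k q => f.map_act _ _) (comm_D M')
  have e : (TensorProduct.comm ℚ W M'.X).toLinearMap ∘ₗ TensorProduct.map LinearMap.id f.toLin =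
      TensorProduct.map f.toLin LinearMap.id ∘ₗ (TensorProduct.comm ℚ W M.X).toLinearMap :=
    TensorProduct.ext' fun n q => rfl
  rw [e] at h2
  exact IsQis.of_comp_right (b M) h2 (comm_D M) (map f).map_d

end Hkm

namespace Words
variable {lam : ℚ}

theorem eq_of_co {x y : Words lam} (h : ∀ u, co u x = co u y) : x = y :=
  basis.repr.injective (Finsupp.ext h)

theorem co_contract (u v : List ℕ) (x : Words lam) :
    co u (contract (co v) (comulLin x)) = co (u ++ v) x := by
  rw [← conv_co, conv, LinearMap.comp_apply, LinearMap.comp_apply, map_contract, contract]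
  induction comulLin x with
  | zero => simp
  | add s t hs ht => simp only [map_add, hs, ht]
  | tmul x y => simp [mul_comm]

/-- Putting a letter behind. -/
def snoc (k : ℕ) : Words lam →ₗ[ℚ] Words lam := lift fun u => wd (u ++ [k])

theorem snoc_wd (k : ℕ) (u : List ℕ) : snoc k (wd u : Words lam) = wd (u ++ [k]) := lift_wd _ _

theorem snoc_one (k : ℕ) : snoc k (1 : Words lam) = cons k 1 := by
  rw [one_def, snoc_wd, cons_wd]
  rfl

theorem snoc_cons (k j : ℕ) (x : Words lam) : snoc k (cons j x) = cons j (snoc k x) :=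
  LinearMap.congr_fun (f := snoc k ∘ₗ cons j) (g := cons j ∘ₗ snoc k) (lin_ext fun u => by
    simp only [LinearMap.comp_apply, cons_wd, snoc_wd]
    rfl) x

theorem counit_snoc (k : ℕ) (x : Words lam) : counitLin (snoc k x) = 0 :=
  LinearMap.congr_fun (f := counitLin ∘ₗ snoc k) (g := 0) (lin_ext fun u => by
    rw [LinearMap.comp_apply, snoc_wd, counitLin, lift_wd]
    simp) x

theorem counit_one' : counitLin (1 : Words lam) = 1 := map_one counitAlg

theorem contract_snoc (k l : ℕ) (x : Words lam) :
    contract (co [l]) (comulLin (snoc k x)) = if k = l then x else 0 := by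
  refine eq_of_co fun v => ?_
  rw [co_contract]
  have h : co (v ++ [l]) ∘ₗ snoc k = if k = l then co (lam := lam) v else 0 := by
    refine lin_ext fun u => ?_
    rw [LinearMap.comp_apply, snoc_wd, co_wd]
    by_cases hk : k = l
    · subst hk
      rw [if_pos rfl, co_wd]
      simp
    · rw [if_neg hk, if_neg]
      · rfl
      · intro h
        have := List.append_inj_right' h rfl
        simp at this
        exact hk this
  have := LinearMap.congr_fun h x
  rw [LinearMap.comp_apply] at this
  rw [this]
  split_ifs
  · rfl
  · rw [map_zero]; rfl

theorem contract_one (l : ℕ) : contract (co [l]) (comulLin (1 : Words lam)) = 0 := by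
  rw [comulLin_one, contract_tmul, one_def, co_wd]
  simp

end Words

namespace Hkm
open Words DGMod
variable (M : DGMod)

/-- Linear maps on `M ⊗ W` are determined on the elements `m ⊗ ∅` and `m ⊗ u k`. -/
theorem ext_snoc {V X : Type} [AddCommGroup X] [Module ℚ X] [AddCommGroup V] [Module ℚ V]
    {f g : X ⊗[ℚ] W →ₗ[ℚ] V} (h1 : ∀ m, f (m ⊗ₜ 1) = g (m ⊗ₜ 1))
    (h2 : ∀ m k x, f (m ⊗ₜ snoc k x) = g (m ⊗ₜ snoc k x)) : f = g :=
  TensorProduct.ext' fun m x => LinearMap.congr_fun (f := f ∘ₗ TensorProduct.mk ℚ X W m)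
    (g := g ∘ₗ TensorProduct.mk ℚ X W m) (lin_ext fun u => by
      rcases List.eq_nil_or_concat' u with rfl | ⟨u, k, rfl⟩
      · exact h1 m
      · rw [← snoc_wd]; exact h2 m k _) x

/-- `m ⊗ u ↦ m ⊗ u k`. -/
def snocT (k : ℕ) : M.X ⊗[ℚ] W →ₗ[ℚ] M.X ⊗[ℚ] W := TensorProduct.map LinearMap.id (snoc k)

theorem snocT_tmul (k : ℕ) (m : M.X) (x : W) : snocT M k (m ⊗ₜ x) = m ⊗ₜ snoc k x := rfl

/-- `m ⊗ ∅ ↦ m`. -/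
def aug₀ : M.X ⊗[ℚ] W →ₗ[ℚ] M.X := contract counitLin

theorem aug₀_tmul (m : M.X) (x : W) : aug₀ M (m ⊗ₜ x) = counitLin x • m := rfl

/-- The operators `∂ₖ` on the bar construction. -/
def pW : M.X ⊗[ℚ] W →ₗ[ℚ] (ℕ →₀ M.X ⊗[ℚ] W) := Cobar.p (obj M)

theorem pW_tmul (m : M.X) (x : W) (l : ℕ) :
    pW M (m ⊗ₜ x) l = m ⊗ₜ contract (co [l]) (comulLin x) := by
  refine (Cobar.p_apply (obj M) (m ⊗ₜ[ℚ] x) l).trans ?_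
  change contract _ (coactW M.X _) = _
  rw [coactW_tmul]
  induction comulLin x with
  | zero => simp
  | add s t hs ht => simp only [map_add, TensorProduct.tmul_add, hs, ht]
  | tmul x y =>
    rw [TensorProduct.assoc_symm_tmul, contract_tmul, contract_tmul, TensorProduct.tmul_smul]

theorem p_snocT (k : ℕ) (t : M.X ⊗[ℚ] W) :
    pW M (snocT M k t) = Finsupp.single k t := by
  refine LinearMap.congr_fun (f := pW M ∘ₗ snocT M k) (g := Finsupp.lsingle k)
    (TensorProduct.ext' fun m x => Finsupp.ext fun l => ?_) t
  rw [LinearMap.comp_apply, snocT_tmul, pW_tmul, contract_snoc,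
    Finsupp.lsingle_apply, Finsupp.single_apply]
  split_ifs
  · rfl
  · rw [TensorProduct.tmul_zero]

theorem p_one (m : M.X) : pW M (m ⊗ₜ[ℚ] (1 : W)) = 0 := by
  ext l
  rw [pW_tmul, contract_one, TensorProduct.tmul_zero]
  rfl

theorem aug₀_p (m : M.X) (k : ℕ) (x : W) :
    Finsupp.mapRange.linearMap (aug₀ M) (pW M (m ⊗ₜ cons k x)) =
      Finsupp.single k (counitLin x • m) := by
  ext l
  rw [Finsupp.mapRange.linearMap_apply, Finsupp.mapRange_apply, pW_tmul, aug₀_tmul,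
    ← co_nil, co_contract, List.nil_append, co_cons_cons, Finsupp.single_apply]
  split_ifs
  · rfl
  · rw [zero_smul]

theorem snocT_sum (y : M.X ⊗[ℚ] W) :
    ((pW M y).sum fun k z => snocT M k z) = y - aug₀ M y ⊗ₜ 1 := by
  refine LinearMap.congr_fun (f := Finsupp.lsum ℚ (fun k => snocT M k) ∘ₗ pW M)
    (g := LinearMap.id - (TensorProduct.mk ℚ M.X W).flip 1 ∘ₗ aug₀ M) (ext_snoc (fun m => ?_)
      fun m k x => ?_) y
  · rw [LinearMap.comp_apply, p_one, map_zero, LinearMap.sub_apply, LinearMap.comp_apply, aug₀_tmul,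
      counit_one', one_smul]
    exact (sub_self _).symm
  · rw [LinearMap.comp_apply, ← snocT_tmul, p_snocT, Finsupp.lsum_single, LinearMap.sub_apply,
      LinearMap.comp_apply, snocT_tmul, aug₀_tmul, counit_snoc, zero_smul, map_zero, sub_zero]
    rfl

theorem D_snocT (k : ℕ) (y : M.X ⊗[ℚ] W) :
    D M (snocT M k y) = snocT M k (D M y) + M.act (e k) (aug₀ M y) ⊗ₜ 1 := by
  refine LinearMap.congr_fun (f := D M ∘ₗ snocT M k) (g := snocT M k ∘ₗ D M +
    (TensorProduct.mk ℚ M.X W).flip 1 ∘ₗ M.act (e k) ∘ₗ aug₀ M) (ext (fun m => ?_)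
      fun m j x => ?_) y
  · simp only [LinearMap.comp_apply, LinearMap.add_apply]
    rw [snocT_tmul, snoc_one, D_cons, D_one, snocT_tmul, snoc_one, aug₀_tmul, counit_one', one_smul]
    rfl
  · simp only [LinearMap.comp_apply, LinearMap.add_apply]
    rw [snocT_tmul, snoc_cons, D_cons, D_cons, map_add, snocT_tmul, snocT_tmul, snoc_cons, aug₀_tmul,
      counit_cons, zero_smul, map_zero, map_zero, add_zero]

theorem aug₀_D (y : M.X ⊗[ℚ] W) : aug₀ M (D M y) =
    M.d (aug₀ M y) + (pW M y).sum fun k z => M.act (e k) (aug₀ M z) := by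
  refine LinearMap.congr_fun (f := aug₀ M ∘ₗ D M) (g := M.d ∘ₗ aug₀ M +
    Finsupp.lsum ℚ (fun k => M.act (e k) ∘ₗ aug₀ M) ∘ₗ pW M) (ext (fun m => ?_)
      fun m j x => ?_) y
  · rw [LinearMap.comp_apply, D_one, aug₀_tmul, counit_one', one_smul, LinearMap.add_apply,
      LinearMap.comp_apply, LinearMap.comp_apply, p_one, map_zero, add_zero, aug₀_tmul, counit_one',
      one_smul]
  · have h : Finsupp.lsum ℚ (fun k => M.act (e k) ∘ₗ aug₀ M) =
        Finsupp.lsum ℚ (fun k => M.act (e k)) ∘ₗ Finsupp.mapRange.linearMap (aug₀ M) :=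
      Finsupp.lhom_ext fun k z => by simp
    rw [LinearMap.comp_apply, D_cons, map_add, aug₀_tmul, aug₀_tmul, counit_cons, zero_smul, zero_add,
      LinearMap.add_apply, LinearMap.comp_apply, LinearMap.comp_apply, h, LinearMap.comp_apply,
      aug₀_p, Finsupp.lsum_single, aug₀_tmul, counit_cons, zero_smul, map_zero, zero_add, map_smul]

end Hkm

namespace Cobar
open Words Hkm DGMod
variable (M : DGMod)

/-- The counit of the bar and cobar constructions, as a linear map. -/
def cLin : (Cobar.obj (Hkm.obj M)).X →ₗ[ℚ] M.X :=
  lift (Hkm.obj M) (aug₀ M) fun k => M.act (e k) ∘ₗ aug₀ M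

theorem cLin_inl (y : M.X ⊗[ℚ] W) : cLin M (inl (Hkm.obj M) y) = aug₀ M y := lift_inl _ _ _ _

theorem cLin_e (k : ℕ) (y : M.X ⊗[ℚ] W) :
    cLin M ((Cobar.obj (Hkm.obj M)).act (e k) (inl (Hkm.obj M) y)) = M.act (e k) (aug₀ M y) :=
  lift_act (Hkm.obj M) (aug₀ M) (fun k => M.act (e k) ∘ₗ aug₀ M) k y

theorem cLin_act (k : ℕ) (z : (Cobar.obj (Hkm.obj M)).X) :
    cLin M ((Cobar.obj (Hkm.obj M)).act (e k) z) = M.act (e k) (cLin M z) :=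
  LinearMap.congr_fun (f := cLin M ∘ₗ (Cobar.obj (Hkm.obj M)).act (e k))
    (g := M.act (e k) ∘ₗ cLin M) (ext (Hkm.obj M)
      (fun y => (cLin_e M k y).trans (congrArg _ (cLin_inl M y).symm))
      fun l y => by
        rw [LinearMap.comp_apply, LinearMap.comp_apply, act_ee, map_zero]
        exact ((congrArg (M.act (e k)) (cLin_e M l y)).trans (act_ee _ _ _ _)).symm) z

theorem d_inl_obj (y : M.X ⊗[ℚ] W) :
    (Cobar.obj (Hkm.obj M)).d (inl (Hkm.obj M) y) = inl (Hkm.obj M) (Hkm.D M y) -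
      (pW M y).sum fun k x => (Cobar.obj (Hkm.obj M)).act (e k) (inl (Hkm.obj M) x) :=
  d_inl _ _

theorem cLin_d_inl (y : M.X ⊗[ℚ] W) :
    cLin M ((Cobar.obj (Hkm.obj M)).d (inl (Hkm.obj M) y)) = M.d (aug₀ M y) := by
  rw [d_inl_obj, map_sub, Finsupp.sum, map_sum, cLin_inl, aug₀_D, sub_eq_iff_eq_add]
  congr 1
  exact Finset.sum_congr rfl fun k _ => (cLin_e M k _).symm

theorem aug₀_isHom (i : ℤ × ℤ) (y : M.X ⊗[ℚ] W) (hy : (M.gr.tensor (cgr ℤ W)).IsHom i y) :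
    M.gr.IsHom i (aug₀ M y) := by
  refine Grading.tensor_map (s := fun i => i) (fun a b m x hm hx => ?_) i y hy
  rw [aug₀_tmul]
  rcases Grading.inc_isHom hx with rfl | ⟨h1, h2⟩
  · rw [map_zero, zero_smul]; exact Grading.IsHom.zero _ _
  rw [← co_nil]
  rcases co_isHom h2 [] with h | h
  · rw [h, zero_smul]; exact Grading.IsHom.zero _ _
  · rw [show b = 0 from Prod.ext h1 h, add_zero]
    exact hm.smul _

/-- The counit of the bar and cobar constructions. -/
def counit : cobar.obj (hkm.obj M) ⟶ M where
  toLin := cLin M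
  map_hom := Grading.cone_map (r := fun i => i) (G := (Hkm.obj M).gr)
    (fun i y hy => (congrArg (M.gr.IsHom i) (cLin_inl M y)).mpr (aug₀_isHom M i y hy))
    (fun k i y hy => by
      have h := (act_inl (Hkm.obj M) k y).symm
      rw [h]
      exact (congrArg (M.gr.IsHom _) (cLin_e M k y)).mpr (M.act_hom k i _ (aug₀_isHom M i y hy)))
  map_d := LinearMap.congr_fun (f := cLin M ∘ₗ (Cobar.obj (Hkm.obj M)).d)
    (g := M.d ∘ₗ cLin M) (ext (Hkm.obj M)
      (fun y => (cLin_d_inl M y).trans (congrArg M.d (cLin_inl M y).symm))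
      fun k y => by
        rw [LinearMap.comp_apply, LinearMap.comp_apply, DGMod.d_act, map_neg, cLin_act, cLin_act,
          M.d_act]
        exact congrArg (fun z => - M.act (e k) z)
          ((cLin_d_inl M y).trans (congrArg M.d (cLin_inl M y).symm)))
  map_act := act_ext (cLin_act M)

theorem counit_natural {M M' : DGMod} (f : M ⟶ M') :
    cobar.map (hkm.map f) ≫ counit M' = counit M ≫ f := by
  have h0 : ∀ y, aug₀ M' (TensorProduct.map f.toLin LinearMap.id y) = f.toLin (aug₀ M y) :=
    fun y => (map_contract f.toLin counitLin y).symm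
  have h1 : ∀ (k : ℕ) (z : (Cobar.obj (Hkm.obj M)).X), (Cobar.map (Hkm.map f)).toLin
      ((Cobar.obj (Hkm.obj M)).act (e k) z) =
      (Cobar.obj (Hkm.obj M')).act (e k) ((Cobar.map (Hkm.map f)).toLin z) :=
    fun k z => (Cobar.map (Hkm.map f)).map_act _ _
  have h2 : ∀ y : M.X ⊗[ℚ] W, (Cobar.map (Hkm.map f)).toLin (inl (Hkm.obj M) y) =
      inl (Hkm.obj M') (TensorProduct.map f.toLin LinearMap.id y) :=
    fun y => map_fst (Hkm.map f) y
  refine DGMod.hom_ext (LinearMap.congr_fun (f := cLin M' ∘ₗ (Cobar.map (Hkm.map f)).toLin)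
    (g := f.toLin ∘ₗ cLin M) (ext (Hkm.obj M) (fun y => ?_) fun k y => ?_))
  · exact (congrArg (cLin M') (h2 y)).trans ((cLin_inl M' _).trans ((h0 y).trans
      (congrArg f.toLin (cLin_inl M y).symm)))
  · rw [LinearMap.comp_apply, LinearMap.comp_apply, cLin_act, h1, cLin_act, f.map_act]
    congr 1
    exact (congrArg (cLin M') (h2 y)).trans ((cLin_inl M' _).trans ((h0 y).trans
      (congrArg f.toLin (cLin_inl M y).symm)))

/-- The homotopy which contracts the kernel of the counit. -/
def h : (Cobar.obj (Hkm.obj M)).X →ₗ[ℚ] (Cobar.obj (Hkm.obj M)).X :=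
  lift (Hkm.obj M) 0 fun k => - (inl (Hkm.obj M) ∘ₗ snocT M k)

theorem h_inl (y : M.X ⊗[ℚ] W) : h M (inl (Hkm.obj M) y) = 0 := lift_inl _ _ _ _

theorem h_e (k : ℕ) (y : M.X ⊗[ℚ] W) :
    h M ((Cobar.obj (Hkm.obj M)).act (e k) (inl (Hkm.obj M) y)) =
      - inl (Hkm.obj M) (snocT M k y) :=
  lift_act (Hkm.obj M) 0 (fun k => - (inl (Hkm.obj M) ∘ₗ snocT M k)) k y

theorem h_spec_inl (y : M.X ⊗[ℚ] W) :
    (Cobar.obj (Hkm.obj M)).d (h M (inl (Hkm.obj M) y)) +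
      h M ((Cobar.obj (Hkm.obj M)).d (inl (Hkm.obj M) y)) =
      inl (Hkm.obj M) y - inl (Hkm.obj M) (aug₀ M y ⊗ₜ[ℚ] (1 : W)) := by
  rw [h_inl, map_zero, zero_add, d_inl_obj, map_sub, h_inl, zero_sub, Finsupp.sum, map_sum,
    ← Finset.sum_neg_distrib]
  refine Eq.trans (b := inl (Hkm.obj M) (y - aug₀ M y ⊗ₜ[ℚ] (1 : W))) ?_ (map_sub _ _ _)
  rw [← snocT_sum, Finsupp.sum]
  refine Eq.trans ?_ (map_sum _ _ _).symm
  exact Finset.sum_congr rfl fun k _ => by rw [h_e, neg_neg]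

theorem h_spec_e (k : ℕ) (y : M.X ⊗[ℚ] W) :
    (Cobar.obj (Hkm.obj M)).d (h M ((Cobar.obj (Hkm.obj M)).act (e k) (inl (Hkm.obj M) y))) +
      h M ((Cobar.obj (Hkm.obj M)).d ((Cobar.obj (Hkm.obj M)).act (e k)
        (inl (Hkm.obj M) y))) = (Cobar.obj (Hkm.obj M)).act (e k) (inl (Hkm.obj M) y) -
        inl (Hkm.obj M) (M.act (e k) (aug₀ M y) ⊗ₜ[ℚ] (1 : W)) := by
  have e1 : (Cobar.obj (Hkm.obj M)).act (e k) ((pW M y).sum fun k x =>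
      (Cobar.obj (Hkm.obj M)).act (e k) (inl (Hkm.obj M) x)) = 0 := by
    rw [Finsupp.sum, map_sum]
    exact Finset.sum_eq_zero fun l _ => act_ee _ _ _ _
  have e2 : ((pW M (snocT M k y)).sum fun k x =>
      (Cobar.obj (Hkm.obj M)).act (e k) (inl (Hkm.obj M) x)) =
      (Cobar.obj (Hkm.obj M)).act (e k) (inl (Hkm.obj M) y) := by
    rw [p_snocT, Finsupp.sum_single_index]
    exact (congrArg _ (map_zero (inl (Hkm.obj M)))).trans (map_zero _)
  have e3 : inl (Hkm.obj M) (Hkm.D M (snocT M k y)) = inl (Hkm.obj M) (snocT M k (Hkm.D M y)) +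
      inl (Hkm.obj M) (M.act (e k) (aug₀ M y) ⊗ₜ[ℚ] (1 : W)) := by
    rw [D_snocT]
    exact map_add _ _ _
  have e4 : (Cobar.obj (Hkm.obj M)).d (inl (Hkm.obj M) (snocT M k y)) =
      inl (Hkm.obj M) (snocT M k (Hkm.D M y)) +
      inl (Hkm.obj M) (M.act (e k) (aug₀ M y) ⊗ₜ[ℚ] (1 : W)) -
      (Cobar.obj (Hkm.obj M)).act (e k) (inl (Hkm.obj M) y) := by
    rw [d_inl_obj, e2, e3]
  rw [h_e, DGMod.d_act, d_inl_obj, map_sub, e1, sub_zero, map_neg, map_neg, h_e, e4]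
  abel

theorem h_spec (z : (Cobar.obj (Hkm.obj M)).X) :
    (Cobar.obj (Hkm.obj M)).d (h M z) + h M ((Cobar.obj (Hkm.obj M)).d z) =
      z - inl (Hkm.obj M) (cLin M z ⊗ₜ[ℚ] (1 : W)) := by
  refine LinearMap.congr_fun (f := (Cobar.obj (Hkm.obj M)).d ∘ₗ h M +
    h M ∘ₗ (Cobar.obj (Hkm.obj M)).d) (g := LinearMap.id - (inl (Hkm.obj M) ∘ₗ
      (TensorProduct.mk ℚ M.X W).flip 1) ∘ₗ cLin M) (ext (Hkm.obj M)
        (fun y => (h_spec_inl M y).trans ?_) fun k y => (h_spec_e M k y).trans ?_) z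
  · exact congrArg (fun m => inl (Hkm.obj M) y - inl (Hkm.obj M) (m ⊗ₜ[ℚ] (1 : W)))
      (cLin_inl M y).symm
  · exact congrArg (fun m => (Cobar.obj (Hkm.obj M)).act (e k) (inl (Hkm.obj M) y) -
      inl (Hkm.obj M) (m ⊗ₜ[ℚ] (1 : W))) (cLin_e M k y).symm

theorem d_section (m : M.X) : inl (Hkm.obj M) (M.d m ⊗ₜ[ℚ] (1 : W)) =
    (Cobar.obj (Hkm.obj M)).d (inl (Hkm.obj M) (m ⊗ₜ[ℚ] (1 : W))) := by
  rw [d_inl_obj, p_one, Finsupp.sum_zero_index, sub_zero, D_one]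

theorem cLin_section (m : M.X) : cLin M (inl (Hkm.obj M) (m ⊗ₜ[ℚ] (1 : W))) = m := by
  rw [cLin_inl, aug₀_tmul, counit_one', one_smul]

theorem counit_qis : DGMod.qis (counit M) := by
  refine IsQis.of_section (inl (Hkm.obj M) ∘ₗ (TensorProduct.mk ℚ M.X W).flip 1) (counit M).map_d
    (d_section M) (cLin_section M) fun z h0 h1 => ⟨h M z, ?_⟩
  have h2 := h_spec M z
  have h3 : cLin M z = 0 := h1
  have h4 : (Cobar.obj (Hkm.obj M)).d z = 0 := h0
  rw [h3, h4, map_zero, add_zero, TensorProduct.zero_tmul] at h2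
  exact h2.trans ((congrArg (z - ·) (map_zero (inl (Hkm.obj M)))).trans (sub_zero z))

end Cobar

namespace Hkm
open Words DGMod
variable (M : DGMod)

/-- Removing the first letter. -/
def behead (X : Type) [AddCommGroup X] [Module ℚ X] : X ⊗[ℚ] W →ₗ[ℚ] (ℕ →₀ X ⊗[ℚ] W) :=
  (TensorProduct.finsuppRight ℚ ℚ X W ℕ).toLinearMap ∘ₗ TensorProduct.map LinearMap.id uncons

theorem behead_one {X : Type} [AddCommGroup X] [Module ℚ X] (m : X) :
    behead X (m ⊗ₜ 1) = 0 := by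
  simp [behead, uncons_one]

theorem behead_cons {X : Type} [AddCommGroup X] [Module ℚ X] (m : X) (k : ℕ) (x : W) :
    behead X (m ⊗ₜ cons k x) = Finsupp.single k (m ⊗ₜ x) := by
  simp [behead, uncons_cons]

theorem contract_co_cons_one {X : Type} [AddCommGroup X] [Module ℚ X] (k : ℕ) (u : List ℕ)
    (m : X) : contract (co (k :: u)) (m ⊗ₜ (1 : W)) = 0 := by
  rw [contract_tmul, one_def, co_wd, if_neg (by simp), zero_smul]

theorem contract_behead {X : Type} [AddCommGroup X] [Module ℚ X] (k : ℕ) (u : List ℕ)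
    (y : X ⊗[ℚ] W) : contract (co u) (behead X y k) = contract (co (k :: u)) y :=
  LinearMap.congr_fun (f := contract (co u) ∘ₗ Finsupp.lapply k ∘ₗ behead X)
    (g := contract (co (k :: u))) (Hkm.ext
      (fun m => by
        rw [LinearMap.comp_apply, LinearMap.comp_apply, behead_one, contract_co_cons_one]
        exact map_zero _)
      fun m j x => by
        rw [LinearMap.comp_apply, LinearMap.comp_apply, behead_cons, contract_tmul, co_cons_cons,
          Finsupp.lapply_apply, Finsupp.single_apply]
        split_ifs
        · rfl
        · rw [map_zero, zero_smul]) y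

theorem contract_D (u : List ℕ) (y : M.X ⊗[ℚ] W) : contract (co u) (D M y) =
    M.d (contract (co u) y) + Finsupp.lsum ℚ (fun k => M.act (e k))
      (Finsupp.mapRange.linearMap (contract (co u)) (behead M.X y)) :=
  LinearMap.congr_fun (f := contract (co u) ∘ₗ D M) (g := M.d ∘ₗ contract (co u) +
    Finsupp.lsum ℚ (fun k => M.act (e k)) ∘ₗ Finsupp.mapRange.linearMap (contract (co u)) ∘ₗ
      behead M.X) (Hkm.ext
      (fun m => by
        simp only [LinearMap.comp_apply, LinearMap.add_apply]
        rw [D_one, behead_one, map_zero, map_zero, add_zero, contract_tmul, contract_tmul, map_smul])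
      fun m k x => by
        simp only [LinearMap.comp_apply, LinearMap.add_apply]
        rw [D_cons, behead_cons, map_add, contract_tmul, contract_tmul, contract_tmul, map_smul,
          Finsupp.mapRange.linearMap_apply, Finsupp.mapRange_single, Finsupp.lsum_single,
          contract_tmul, map_smul]) y

end Hkm

namespace Cobar
open Words Hkm DGMod
variable (N : DGComod ℤ W)

/-- The unit of the bar and cobar constructions, as a linear map. -/
def uLin : N.X →ₗ[ℚ] (Cobar.obj N).X ⊗[ℚ] W :=
  TensorProduct.map (inl N) LinearMap.id ∘ₗ N.coact

theorem contract_uLin (u : List ℕ) (n : N.X) :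
    contract (co u) (uLin N n) = inl N (N.op (co u) n) := (map_contract _ _ _).symm

theorem mapRange_behead (u : List ℕ) (n : N.X) :
    Finsupp.mapRange.linearMap (contract (co u)) (behead (Cobar.obj N).X (uLin N n)) =
      Finsupp.mapRange.linearMap (inl N) (p N (N.op (co u) n)) := by
  ext1 k
  rw [Finsupp.mapRange.linearMap_apply, Finsupp.mapRange_apply, Finsupp.mapRange.linearMap_apply,
    Finsupp.mapRange_apply, contract_behead, contract_uLin, p_apply, op_co_co]
  rfl

theorem lsum_mapRange (x : ℕ →₀ N.X) :
    Finsupp.lsum ℚ (fun k => (Cobar.obj N).act (e k)) (Finsupp.mapRange.linearMap (inl N) x) =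
      x.sum fun k x => (Cobar.obj N).act (e k) (inl N x) := by
  rw [Finsupp.mapRange.linearMap_apply, Finsupp.lsum_apply,
    Finsupp.sum_mapRange_index fun k => map_zero _]

theorem uLin_d (n : N.X) : uLin N (N.d n) = Hkm.D (Cobar.obj N) (uLin N n) := by
  refine eq_of_contract fun u => ?_
  rw [contract_D, contract_uLin, contract_uLin, mapRange_behead, lsum_mapRange, d_inl,
    sub_add_cancel, DGComod.op_d]

theorem uLin_coact (n : N.X) : coactW (Cobar.obj N).X (uLin N n) =
    TensorProduct.map (uLin N) LinearMap.id (N.coact n) := by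
  have h := N.coassoc n
  rw [← LinearEquiv.eq_symm_apply] at h
  have e1 : ∀ t : N.X ⊗[ℚ] W, TensorProduct.map (uLin N) LinearMap.id t =
      TensorProduct.map (TensorProduct.map (inl N) LinearMap.id) LinearMap.id
        (TensorProduct.map N.coact LinearMap.id t) := fun t => by
    rw [← LinearMap.comp_apply, ← TensorProduct.map_comp]
    rfl
  rw [e1, h]
  refine LinearMap.congr_fun (f := coactW (Cobar.obj N).X ∘ₗ TensorProduct.map (inl N) LinearMap.id)
    (g := TensorProduct.map (TensorProduct.map (inl N) LinearMap.id) LinearMap.id ∘ₗ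
      (TensorProduct.assoc ℚ N.X W W).symm.toLinearMap ∘ₗ TensorProduct.map LinearMap.id comulLin)
    (TensorProduct.ext' fun m x => ?_) (N.coact n)
  simp only [LinearMap.comp_apply, TensorProduct.map_tmul, LinearMap.id_apply]
  rw [coactW_tmul]
  induction comulLin x with
  | zero => simp
  | add s t hs ht => simp only [map_add, TensorProduct.tmul_add, hs, ht]
  | tmul x y => rfl

/-- The unit of the bar and cobar constructions. -/
def unit : N ⟶ hkm.obj (cobar.obj N) where
  toLin := uLin N
  map_hom i n hn := Grading.tensor_map (s := fun i => i) (G := N.gr) (H := cgr ℤ W)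
    (f := TensorProduct.map (inl N) LinearMap.id)
    (fun _ _ _ _ hm hx => (inl_isHom N hm).tmul hx) i _ (N.coact_hom i n hn)
  map_d := uLin_d N
  map_coact := uLin_coact N

theorem unit_natural {N' : DGComod ℤ W} (f : N ⟶ N') :
    unit N ≫ hkm.map (cobar.map f) = f ≫ unit N' := by
  refine DGComod.hom_ext (LinearMap.ext fun n => ?_)
  change TensorProduct.map (Cobar.map f).toLin LinearMap.id (TensorProduct.map (inl N) LinearMap.id
    (N.coact n)) = TensorProduct.map (inl N') LinearMap.id (N'.coact (f.toLin n))
  rw [f.map_coact]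
  refine LinearMap.congr_fun (f := TensorProduct.map (Cobar.map f).toLin LinearMap.id ∘ₗ
    TensorProduct.map (inl N) LinearMap.id) (g := TensorProduct.map (inl N') LinearMap.id ∘ₗ
      TensorProduct.map f.toLin LinearMap.id) (TensorProduct.ext' fun m x => ?_) (N.coact n)
  exact congrArg (· ⊗ₜ[ℚ] x) (map_fst f m)

theorem unit_obj_counit (M : DGMod) :
    unit (hkm.obj M) ≫ hkm.map (counit M) = 𝟙 (hkm.obj M) := by
  refine DGComod.hom_ext (Eq.trans ?_ (TensorProduct.ext' (fun m x => ?_) :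
    TensorProduct.map (aug₀ M) LinearMap.id ∘ₗ coactW M.X = LinearMap.id))
  · change TensorProduct.map (cLin M) LinearMap.id ∘ₗ TensorProduct.map (inl (Hkm.obj M))
      LinearMap.id ∘ₗ coactW M.X = _
    refine LinearMap.ext fun z => LinearMap.congr_fun (f := TensorProduct.map (cLin M) LinearMap.id ∘ₗ
      TensorProduct.map (inl (Hkm.obj M)) LinearMap.id) (g := TensorProduct.map (aug₀ M) LinearMap.id)
      (TensorProduct.ext' fun y x => ?_) (coactW M.X z)
    exact congrArg (· ⊗ₜ[ℚ] x) (cLin_inl M y)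
  · rw [LinearMap.comp_apply, coactW_tmul]
    have h := Words.rTensor_counit x
    have e1 : ∀ t : W ⊗[ℚ] W, TensorProduct.map (aug₀ M) LinearMap.id
        ((TensorProduct.assoc ℚ M.X W W).symm (m ⊗ₜ[ℚ] t)) = m ⊗ₜ[ℚ]
          (TensorProduct.lid ℚ W (TensorProduct.map counitLin LinearMap.id t)) := fun t => by
      induction t with
      | zero => simp
      | add s t hs ht => simp only [map_add, TensorProduct.tmul_add, hs, ht]
      | tmul x y =>
        rw [TensorProduct.assoc_symm_tmul, TensorProduct.map_tmul, aug₀_tmul, TensorProduct.map_tmul,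
          TensorProduct.lid_tmul, TensorProduct.smul_tmul]
    rw [e1, h]
    simp

/-- The unit, followed by the comparison map. -/
theorem augLin_uLin (n : N.X) : augLin (Cobar.obj N) (uLin N n) =
    tΦ N triv (n ⊗ₜ[ℚ] tv 1) := by
  have h := N.coact_counit n
  rw [tΦ_tmul]
  have e1 : ∀ t : N.X ⊗[ℚ] W, augLin (Cobar.obj N) (TensorProduct.map (inl N) LinearMap.id t) =
      tΦ N triv (TensorProduct.map LinearMap.id tv
        (TensorProduct.map LinearMap.id (Coalgebra.counit (R := ℚ)) t)) := fun t => by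
    induction t with
    | zero => simp only [map_zero]
    | add s t hs ht => simp only [map_add, hs, ht]
    | tmul m x => rfl
  refine (e1 _).trans ?_
  rw [h]
  rfl

theorem augLin_uLin_bijective : Function.Bijective (augLin (Cobar.obj N) ∘ₗ uLin N) := by
  have h : (augLin (Cobar.obj N) ∘ₗ uLin N) = tΦ N triv ∘ₗ
      (TensorProduct.rid ℚ N.X).symm.toLinearMap := LinearMap.ext fun n => augLin_uLin N n
  rw [h]
  exact (tΦ_bijective N triv).comp (TensorProduct.rid ℚ N.X).symm.bijective

theorem isQis_augLin_uLin :
    IsQis (augLin (Cobar.obj N) ∘ₗ uLin N) N.d (tens (Cobar.obj N) triv).d :=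
  IsQis.of_bijective (augLin_uLin_bijective N) fun n =>
    (congrArg (augLin (Cobar.obj N)) (uLin_d N n)).trans ((aug (Cobar.obj N)).map_d (uLin N n))

theorem unit_obj_qis (M : DGMod) : DGComod.qis ℤ W (unit (hkm.obj M)) := by
  have h1 : DGComod.qis ℤ W (hkm.map (counit M)) := Hkm.map_qis _ (counit_qis M)
  have h2 : DGComod.qis ℤ W (unit (hkm.obj M) ≫ hkm.map (counit M)) := by
    rw [unit_obj_counit]
    exact (Cx.qis ℤ).id_mem _
  exact IsQis.of_comp_left h1 h2 (unit (hkm.obj M)).map_d (hkm.map (counit M)).map_d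

end Cobar

namespace Hkm
open DGMod

theorem whiskerRight_triv_qis {M M' : DGMod} (f : M ⟶ M') (hM : kflat M) (hM' : kflat M')
    (hf : qis f) : qis (f ▷ triv) := by
  let c := Cobar.counit triv
  have hc : qis c := Cobar.counit_qis triv
  have h1 : qis (f ▷ cobar.obj (hkm.obj triv)) := by
    have h := Cobar.kflat_obj (hkm.obj triv) f hf
    have h2 := (MorphismProperty.cancel_left_of_respectsIso qis
      (β_ M (cobar.obj (hkm.obj triv))).hom _).mpr h
    have h3 := BraidedCategory.braiding_naturality_left f (cobar.obj (hkm.obj triv))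
    have h4 : qis (f ▷ (cobar.obj (hkm.obj triv)) ≫ (β_ M' (cobar.obj (hkm.obj triv))).hom) := by
      rw [h3]; exact h2
    exact (MorphismProperty.cancel_right_of_respectsIso qis _ _).mp h4
  have h2 : qis (M ◁ c ≫ f ▷ triv) := by
    rw [whisker_exchange]
    exact qis.comp_mem _ _ h1 (hM' c hc)
  exact IsQis.of_comp_right (hM c hc) h2 (M ◁ c).map_d (f ▷ triv).map_d

theorem aug_natural {M M' : DGMod} (f : M ⟶ M') :
    (augLin M' ∘ₗ (hkm.map f).toLin) = (f ▷ triv).toLin ∘ₗ augLin M :=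
  TensorProduct.ext' fun _ _ => rfl

/-- For `K`-flat modules the bar construction is the derived tensor product with `ℚ`. -/
theorem aug_qis (M : DGMod) (hM : kflat M) : Cx.qis ℤ (aug M) := by
  let c := Cobar.counit M
  have hc : qis c := Cobar.counit_qis M
  have h1 : IsQis (augLin (Cobar.obj (hkm.obj M))) (Hkm.D _) (tens (Cobar.obj (hkm.obj M)) triv).d :=
    IsQis.of_comp_right (Cobar.unit_obj_qis M) (Cobar.isQis_augLin_uLin (hkm.obj M))
      (Cobar.unit (hkm.obj M)).map_d (aug (Cobar.obj (hkm.obj M))).map_d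
  have h2 := h1.comp (whiskerRight_triv_qis c (Cobar.kflat_obj _) hM hc)
    (aug (Cobar.obj (hkm.obj M))).map_d (c ▷ triv).map_d
  have h3 : IsQis (augLin M ∘ₗ (hkm.map c).toLin) (Hkm.D _) (tens M triv).d := by
    rw [aug_natural]; exact h2
  exact IsQis.of_comp_right (Hkm.map_qis c hc) h3 (hkm.map c).map_d (aug M).map_d

end Hkm

theorem Cobar.unit_qis (N : DGComod ℤ Hkm.W) : DGComod.qis ℤ Hkm.W (Cobar.unit N) :=
  IsQis.of_comp_left (Hkm.aug_qis _ (Cobar.kflat_obj N)) (Cobar.isQis_augLin_uLin N)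
    (Cobar.unit N).map_d (Hkm.aug (Cobar.obj N)).map_d

namespace DGMod
variable {M N : DGMod} {V : Type} [AddCommGroup V] [Module ℚ V]

/-- `m ↦ m ⊗ 1`. -/
def rmk (M : DGMod) : M.X →ₗ[ℚ] (tens M triv).X := tm.flip (tv 1)

theorem rmk_act (k : ℕ) (m : M.X) : rmk M (M.act (e k) m) = 0 := by
  have h := tm_bal k (M.gr.sign m) (tv 1)
  rw [Grading.sign_sign, triv_act, map_zero] at h
  exact h

theorem tm_tv (m : M.X) (a : ℚ) : tm m (tv a) = a • rmk M m := by
  conv_lhs => rw [← mul_one a, ← smul_eq_mul, map_smul, map_smul]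
  rfl

theorem rmk_ext {f g : (tens M triv).X →ₗ[ℚ] V} (h : ∀ m, f (rmk M m) = g (rmk M m)) : f = g :=
  tm_ext fun m (a : ℚ) => by
    change f (tm m (tv a)) = g (tm m (tv a))
    rw [tm_tv, map_smul, map_smul, h]

/-- Linear maps out of `M ⊗ ℚ`. -/
def rlift (f : M.X →ₗ[ℚ] V) (h : ∀ k m, f (M.act (e k) m) = 0) : (tens M triv).X →ₗ[ℚ] V :=
  lift ((LinearMap.lsmul ℚ V).flip ∘ₗ f : M.X →ₗ[ℚ] ℚ →ₗ[ℚ] V) fun k m (n : ℚ) => by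
    change n • f (M.act (e k) (M.gr.sign m)) = (id (triv.act (e k) n) : ℚ) • f m
    rw [h, smul_zero]
    exact (zero_smul ℚ (f m)).symm.trans (congrArg (fun a : ℚ => a • f m) (triv_act k n).symm)

theorem rlift_rmk (f : M.X →ₗ[ℚ] V) (h : ∀ k m, f (M.act (e k) m) = 0) (m : M.X) :
    rlift f h (rmk M m) = f m := one_smul ℚ (f m)

theorem rmk_d (m : M.X) : (tens M triv).d (rmk M m) = rmk M (M.d m) := by
  refine (tm_d m (tv 1)).trans ?_
  rw [triv_d, map_zero, add_zero]
  rfl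

theorem rmk_sign (m : M.X) : (tens M triv).gr.sign (rmk M m) = rmk M (M.gr.sign m) := by
  refine (tm_sign m (tv 1)).trans ?_
  rw [show triv.gr.sign (tv 1) = tv 1 from Grading.sign_unit 1]
  rfl

variable (M N)

/-- `m ⊗ n ↦ (m ⊗ 1) ⊗ (n ⊗ 1)`. -/
def splitAux : (tens M N).X →ₗ[ℚ] (tens M triv).X ⊗[ℚ] (tens N triv).X :=
  lift ((TensorProduct.mk ℚ _ _).compl₁₂ (rmk M) (rmk N)) fun k m n => by
    change rmk M _ ⊗ₜ[ℚ] rmk N n = rmk M m ⊗ₜ[ℚ] rmk N _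
    rw [rmk_act, rmk_act, TensorProduct.zero_tmul, TensorProduct.tmul_zero]

/-- `(m ⊗ n) ⊗ 1 ↦ (m ⊗ 1) ⊗ (n ⊗ 1)`. -/
def split : (tens (tens M N) triv).X →ₗ[ℚ] (tens M triv).X ⊗[ℚ] (tens N triv).X :=
  rlift (splitAux M N) fun k t => by
    refine LinearMap.congr_fun (f := splitAux M N ∘ₗ (tens M N).act (e k)) (g := 0)
      (tm_ext fun m n => ?_) t
    change rmk M (M.act (e k) m) ⊗ₜ[ℚ] rmk N n = 0
    rw [rmk_act, TensorProduct.zero_tmul]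

theorem split_rmk (m : M.X) (n : N.X) :
    split M N (rmk (tens M N) (tm m n)) = rmk M m ⊗ₜ[ℚ] rmk N n := rlift_rmk _ _ _

/-- `m, n ⊗ 1 ↦ (m ⊗ n) ⊗ 1`. -/
def unsplitAux : (tens N triv).X →ₗ[ℚ] M.X →ₗ[ℚ] (tens (tens M N) triv).X :=
  rlift (tm.compr₂ (rmk (tens M N))).flip fun k n => by
    refine LinearMap.ext fun m => ?_
    change rmk (tens M N) (tm m (N.act (e k) n)) = 0
    rw [← tm_bal, ← tm_act, rmk_act]

theorem unsplitAux_rmk (m : M.X) (n : N.X) :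
    unsplitAux M N (rmk N n) m = rmk (tens M N) (tm m n) :=
  LinearMap.congr_fun (rlift_rmk (tm.compr₂ (rmk (tens M N))).flip _ n) m

theorem unsplitAux_act (k : ℕ) (m : M.X) : (unsplitAux M N).flip (M.act (e k) m) = 0 :=
  rmk_ext fun n => by
    rw [LinearMap.flip_apply, unsplitAux_rmk, ← tm_act, rmk_act]
    rfl

/-- The inverse of `split`. -/
def unsplit : (tens M triv).X ⊗[ℚ] (tens N triv).X →ₗ[ℚ] (tens (tens M N) triv).X :=
  TensorProduct.lift (rlift (unsplitAux M N).flip (unsplitAux_act M N))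

theorem unsplit_rmk (m : M.X) (n : N.X) :
    unsplit M N (rmk M m ⊗ₜ[ℚ] rmk N n) = rmk (tens M N) (tm m n) :=
  (LinearMap.congr_fun (rlift_rmk _ (unsplitAux_act M N) m) (rmk N n)).trans
    (unsplitAux_rmk M N m n)

theorem rmk_ext₂ {f g : (tens (tens M N) triv).X →ₗ[ℚ] V}
    (h : ∀ m n, f (rmk _ (tm m n)) = g (rmk _ (tm m n))) : f = g :=
  rmk_ext fun t => LinearMap.congr_fun (f := f ∘ₗ rmk _) (g := g ∘ₗ rmk _) (tm_ext h) t

theorem split_bijective : Function.Bijective (split M N) := by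
  refine Function.bijective_iff_has_inverse.mpr ⟨unsplit M N, fun t => ?_, fun t => ?_⟩
  · refine LinearMap.congr_fun (f := unsplit M N ∘ₗ split M N) (g := LinearMap.id)
      (rmk_ext₂ M N fun m n => ?_) t
    rw [LinearMap.comp_apply, split_rmk, unsplit_rmk]
    rfl
  · refine LinearMap.congr_fun (f := split M N ∘ₗ unsplit M N) (g := LinearMap.id)
      (TensorProduct.ext (rmk_ext fun m => rmk_ext fun n => ?_)) t
    change split M N (unsplit M N (rmk M m ⊗ₜ[ℚ] rmk N n)) = _
    rw [unsplit_rmk, split_rmk]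
    rfl

theorem split_d (t : (tens (tens M N) triv).X) : split M N ((tens (tens M N) triv).d t) =
    (tens M triv).gr.dT (tens M triv).d (tens N triv).d (split M N t) := by
  refine LinearMap.congr_fun (f := split M N ∘ₗ (tens (tens M N) triv).d)
    (g := (tens M triv).gr.dT (tens M triv).d (tens N triv).d ∘ₗ split M N)
      (rmk_ext₂ M N fun m n => ?_) t
  rw [LinearMap.comp_apply, LinearMap.comp_apply, rmk_d, tm_d, map_add, map_add, split_rmk,
    split_rmk, split_rmk, Grading.dT_tmul, rmk_d, rmk_d, rmk_sign]

end DGMod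

namespace Hkm
open DGMod Words
variable {M N : DGMod}

theorem split_augLin_muLin : split M N ∘ₗ augLin (tens M N) ∘ₗ muLin M N =
    TensorProduct.map (augLin M) (augLin N) := by
  refine TensorProduct.ext_fourfold' fun m x n y => ?_
  rw [LinearMap.comp_apply, LinearMap.comp_apply, muLin_tmul, augLin_tmul, TensorProduct.map_tmul,
    augLin_tmul, augLin_tmul, tm_tv, tm_tv, tm_tv, map_smul, split_rmk, TensorProduct.smul_tmul_smul]
  congr 1
  exact map_mul counitAlg x y

theorem mu_qis (hM : kflat M) (hN : kflat N) : DGComod.qis ℤ W (mu M N) := by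
  have h1 : Cx.qis ℤ (aug M ⊗ₘ aug N) :=
    MorphismProperty.tensorHom_mem _ _ _ (aug_qis M hM) (aug_qis N hN)
  have h2 : IsQis (split M N ∘ₗ augLin (tens M N) ∘ₗ muLin M N)
      (obj M ⊗ obj N).d ((tens M triv).gr.dT (tens M triv).d (tens N triv).d) := by
    rw [split_augLin_muLin]
    exact h1
  have h3 : IsQis (augLin (tens M N) ∘ₗ muLin M N) (obj M ⊗ obj N).d (tens (tens M N) triv).d :=
    IsQis.of_comp_left (IsQis.of_bijective (split_bijective M N) (split_d M N)) h2
      (fun t => (congrArg (augLin (tens M N)) ((mu M N).map_d t)).trans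
        ((aug (tens M N)).map_d (muLin M N t))) (split_d M N)
  exact IsQis.of_comp_left (aug_qis _ (kflat.prop_tensor hM hN)) h3 (mu M N).map_d
    (aug (tens M N)).map_d

theorem counit_unit_triv (a : ℚ) : augLin (𝟙_ DGMod) (epsLin a) = a • rmk DGMod.unit uone := by
  rw [epsLin, LinearMap.toSpanSingleton_apply, map_smul]
  refine congrArg (a • ·) ((augLin_tmul _ _ _).trans ?_)
  rw [counit_one']
  rfl

theorem eps_qis : DGComod.qis ℤ W eps := by
  have hb : Function.Bijective (augLin (𝟙_ DGMod) ∘ₗ epsLin) := by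
    have h : ∀ a : ℚ, (DGMod.lunit triv).hom.toLin ((augLin (𝟙_ DGMod) ∘ₗ epsLin) a) = tv a :=
      fun a => by
        refine (congrArg _ (counit_unit_triv a)).trans ?_
        rw [map_smul]
        refine (congrArg (a • ·) (DGMod.lunit_hom_one triv (tv 1))).trans ?_
        rw [← map_smul, smul_eq_mul, mul_one]
    refine ⟨fun a b hab => ?_, fun y => ?_⟩
    · have := congrArg (DGMod.lunit triv).hom.toLin hab
      rwa [h, h] at this
    · have hi : Function.Injective (DGMod.lunit triv).hom.toLin :=
        Function.LeftInverse.injective (g := (DGMod.lunit triv).inv.toLin) fun x =>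
          LinearMap.congr_fun (congrArg (fun f => (DGMod.Hom.toHom f).toLin)
            (DGMod.lunit triv).hom_inv_id) x
      exact ⟨(DGMod.lunit triv).hom.toLin y, hi (h _)⟩
  exact IsQis.of_comp_left (aug_qis _ kflat.prop_unit) (IsQis.of_bijective hb fun a =>
    (congrArg (augLin (𝟙_ DGMod)) (eps.map_d a)).trans ((aug (𝟙_ DGMod)).map_d (epsLin a)))
    eps.map_d (aug (𝟙_ DGMod)).map_d

theorem muLin_swap (t : (M.X ⊗[ℚ] W) ⊗[ℚ] (N.X ⊗[ℚ] W)) :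
    TensorProduct.map (swapLin M N) LinearMap.id (muLin M N t) = muLin N M
      (Grading.swap (M.gr.tensor (cgr ℤ W)) (N.gr.tensor (cgr ℤ W)) t) := by
  refine LinearMap.congr_fun (f := TensorProduct.map (swapLin M N) LinearMap.id ∘ₗ muLin M N)
    (g := muLin N M ∘ₗ Grading.swap (M.gr.tensor (cgr ℤ W)) (N.gr.tensor (cgr ℤ W)))
      (TensorProduct.ext_fourfold' fun m x n y => ?_) t
  rw [LinearMap.comp_apply, LinearMap.comp_apply, muLin_tmul, TensorProduct.map_tmul, swapLin_tm,
    Grading.swap_tmul, sign_obj, sign_obj, map_smul, map_sub, map_add, map_add, muLin_tmul,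
    muLin_tmul, muLin_tmul, muLin_tmul, mul_comm y x, LinearMap.id_apply]
  rw [← TensorProduct.add_tmul, ← TensorProduct.add_tmul, ← TensorProduct.sub_tmul,
    ← TensorProduct.smul_tmul']

end Hkm

instance : hkm.LaxBraided where
  braided _ _ := DGComod.hom_ext (LinearMap.ext Hkm.muLin_swap)

namespace Grading
section
variable {Γ Γ' M N : Type} [AddCommGroup M] [Module ℚ M] [AddCommGroup N] [Module ℚ N]

theorem IsHom.comp_eq {G : Grading Γ M} {i : Γ} {m : M} (hm : G.IsHom i m) : G.comp m i = m := by
  unfold IsHom at hm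
  rw [hm, Finsupp.single_eq_same]

theorem comp_map {G : Grading Γ M} {K : Grading Γ' N} {f : M →ₗ[ℚ] N} {s : Γ → Γ'}
    (hs : Function.Injective s) (h : ∀ i m, G.IsHom i m → K.IsHom (s i) (f m)) (i : Γ) (m : M) :
    K.comp (f m) (s i) = f (G.comp m i) := by
  refine LinearMap.congr_fun (f := Finsupp.lapply (s i) ∘ₗ K.comp ∘ₗ f)
    (g := f ∘ₗ Finsupp.lapply i ∘ₗ G.comp) (G.ext_hom fun j m hm => ?_) m
  have h1 := h j m hm
  unfold IsHom at hm h1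
  classical
  simp only [LinearMap.comp_apply, Finsupp.lapply_apply, hm, h1, Finsupp.single_apply]
  by_cases hj : j = i
  · rw [if_pos hj, if_pos (congrArg s hj)]
  · rw [if_neg hj, if_neg fun h => hj (hs h), map_zero]

/-- The part of a linear map which changes the degree by `δ`. -/
def homPart [AddCommGroup Γ] (G : Grading Γ M) (K : Grading Γ N) (δ : Γ) (f : M →ₗ[ℚ] N) :
    M →ₗ[ℚ] N :=
  Finsupp.lsum ℚ (fun i => Finsupp.lapply (i + δ) ∘ₗ K.comp ∘ₗ f) ∘ₗ G.comp

theorem homPart_apply [AddCommGroup Γ] {G : Grading Γ M} (K : Grading Γ N) (δ : Γ)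
    (f : M →ₗ[ℚ] N) {i : Γ} {m : M} (hm : G.IsHom i m) :
    homPart G K δ f m = K.comp (f m) (i + δ) := by
  unfold IsHom at hm
  simp [homPart, hm]

theorem homPart_isHom [AddCommGroup Γ] {G : Grading Γ M} (K : Grading Γ N) (δ : Γ)
    (f : M →ₗ[ℚ] N) {i : Γ} {m : M} (hm : G.IsHom i m) :
    K.IsHom (i + δ) (homPart G K δ f m) := by
  rw [homPart_apply K δ f hm]
  exact K.isHom_comp _ _

end
end Grading

namespace Cx
variable {J : Type} [AddCommGroup J]

theorem down_up (i : ℤ × J) : i + (-1, 0) + (1, 0) = i := Prod.ext (by simp) (by simp)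

theorem up_down (i : ℤ × J) : i + (1, 0) + (-1, 0) = i := Prod.ext (by simp) (by simp)

/-- A partial inverse of the differential. -/
theorem exists_partial_inverse (M : Cx J) : ∃ h : M.X →ₗ[ℚ] M.X,
    (∀ i m, M.gr.IsHom i m → M.gr.IsHom (i + (1, 0)) (h m)) ∧ ∀ m, M.d (h (M.d m)) = M.d m := by
  obtain ⟨g, hg⟩ := M.d.rangeRestrict.exists_rightInverse_of_surjective M.d.range_rangeRestrict
  obtain ⟨g', hg'⟩ := g.exists_extend
  have h0 : ∀ m, M.d (g' (M.d m)) = M.d m := fun m => by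
    have h1 : g' (M.d m) = g (M.d.rangeRestrict m) := LinearMap.congr_fun hg' (M.d.rangeRestrict m)
    rw [h1]
    exact congrArg Subtype.val (LinearMap.congr_fun hg (M.d.rangeRestrict m))
  refine ⟨Grading.homPart M.gr M.gr (1, 0) g', fun i m hm => Grading.homPart_isHom _ _ _ hm,
    fun m => ?_⟩
  refine LinearMap.congr_fun (f := M.d ∘ₗ Grading.homPart M.gr M.gr (1, 0) g' ∘ₗ M.d) (g := M.d)
    (M.gr.ext_hom fun i m hm => ?_) m
  have h1 := M.d_hom i m hm
  rw [LinearMap.comp_apply, LinearMap.comp_apply, Grading.homPart_apply _ _ _ h1,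
    ← Grading.comp_map (s := fun i => i + (-1, 0)) (add_left_injective _) M.d_hom, h0]
  have e : i + ((-1 : ℤ), (0 : J)) + (1, 0) + (-1, 0) = i + (-1, 0) := by
    rw [add_assoc, add_assoc]
    simp
  exact (congrArg _ e).trans h1.comp_eq

/-- A bounded complex is homotopy equivalent to a complex which vanishes outside a bounded range of
degrees. -/
theorem exists_homotopy (M : Cx J) {a b : ℤ}
    (hb : ∀ i m, M.gr.IsHom i m → M.d m = 0 → i.1 < a ∨ b < i.1 → ∃ z, M.d z = m) :
    ∃ h : M.X →ₗ[ℚ] M.X, (∀ i m, M.gr.IsHom i m → M.gr.IsHom (i + (1, 0)) (h m)) ∧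
      ∀ i m, M.gr.IsHom i m → i.1 < a ∨ b < i.1 → m - M.d (h m) - h (M.d m) = 0 := by
  obtain ⟨h, h1, h2⟩ := M.exists_partial_inverse
  have hh : ∀ i m, M.gr.IsHom i m → M.gr.IsHom i (M.d (h m)) ∧ M.gr.IsHom i (h (M.d m)) :=
    fun i m hm => by
      have e1 := M.d_hom _ _ (h1 i m hm)
      have e2 := h1 _ _ (M.d_hom i m hm)
      rw [up_down] at e1
      rw [down_up] at e2
      exact ⟨e1, e2⟩
  let e : M.X →ₗ[ℚ] M.X := LinearMap.id - M.d ∘ₗ h - h ∘ₗ M.d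
  have he : ∀ m, e m = m - M.d (h m) - h (M.d m) := fun _ => rfl
  have hd : ∀ m, M.d (e m) = 0 := fun m => by
    rw [he, map_sub, map_sub, M.d_d, h2, sub_zero, sub_self]
  have hd' : ∀ m, e (M.d m) = 0 := fun m => by
    rw [he, M.d_d, h2, map_zero, sub_zero, sub_self]
  refine ⟨h ∘ₗ (LinearMap.id + e), fun i m hm => ?_, fun i m hm hi => ?_⟩
  · refine h1 i _ (hm.add ?_)
    rw [he]
    exact (hm.sub (hh i m hm).1).sub (hh i m hm).2
  · have h3 : M.gr.IsHom i (e m) := by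
      rw [he]
      exact (hm.sub (hh i m hm).1).sub (hh i m hm).2
    obtain ⟨z, hz⟩ := hb i _ h3 (hd m) hi
    have h4 : e (e m) = 0 := by rw [← hz, hd']
    rw [he (e m), hd, map_zero, sub_zero, he m] at h4
    simp only [LinearMap.comp_apply, LinearMap.add_apply, LinearMap.id_apply, hd', add_zero, map_add]
    rw [← h4, he m]
    abel

theorem bounded_of_homotopy (M : Cx J) (a b : ℤ) (h ν : M.X →ₗ[ℚ] M.X)
    (h1 : ∀ i m, M.gr.IsHom i m → M.gr.IsHom (i + (1, 0)) (h m))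
    (h2 : ∀ i m, M.gr.IsHom i m → i.1 < a ∨ b < i.1 → M.d m = 0 →
      M.d (h m) = m - ν m ∧ ∃ n, (ν ^ n) m = 0) : bounded J M := by
  refine ⟨a, b, fun i m hm h0 hi => ?_⟩
  obtain ⟨n, hn⟩ := (h2 i m hm hi h0).2
  refine exists_of_nilpotent M.d ν {m | M.gr.IsHom i m ∧ M.d m = 0}
    (fun x hx => ⟨h x, (h2 i x hx.1 hi hx.2).1⟩) (fun x hx => ?_) n m ⟨hm, h0⟩ hn
  have h3 := (h2 i x hx.1 hi hx.2).1
  have h4 : ν x = x - M.d (h x) := by rw [h3, sub_sub_cancel]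
  have h5 := M.d_hom _ _ (h1 i x hx.1)
  rw [up_down] at h5
  rw [h4]
  exact ⟨hx.1.sub h5, by rw [map_sub, M.d_d, hx.2, sub_zero]⟩

theorem bounded_of_qis {M N : Cx J} (f : M ⟶ N) (hf : qis J f) (h : bounded J M) : bounded J N := by
  obtain ⟨a, b, h⟩ := h
  refine ⟨a, b, fun i y hy h0 hi => ?_⟩
  obtain ⟨x, h1, z, hz⟩ := hf.surj y h0
  have hd : ∀ (M : Cx J) m, M.gr.comp (M.d m) i = M.d (M.gr.comp m (i + (1, 0))) := fun M m => by
    rw [← Grading.comp_map (s := fun i => i + (-1, 0)) (add_left_injective _) M.d_hom, up_down]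
  have h2 : M.d (M.gr.comp x i) = 0 := by
    rw [← Grading.comp_map (s := fun i => i + (-1, 0)) (add_left_injective _) M.d_hom, h1, map_zero]
    rfl
  obtain ⟨w, hw⟩ := h i _ (M.gr.isHom_comp _ _) h2 hi
  have h3 := DFunLike.congr_fun (congrArg N.gr.comp hz) i
  rw [hd, map_sub, Finsupp.sub_apply, hy.comp_eq,
    Grading.comp_map (s := fun i => i) Function.injective_id f.map_hom, ← hw, f.map_d] at h3
  exact ⟨N.gr.comp z (i + (1, 0)) + f.toLin w, by rw [map_add, h3, sub_add_cancel]⟩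

theorem bounded_tens {M N : Cx J} (hM : bounded J M) (hN : bounded J N) : bounded J (tens M N) := by
  obtain ⟨a, b, hM⟩ := hM
  obtain ⟨a', b', hN⟩ := hN
  obtain ⟨h, h1, h2⟩ := M.exists_homotopy hM
  obtain ⟨k, k1, k2⟩ := N.exists_homotopy hN
  let π : M.X →ₗ[ℚ] M.X := LinearMap.id - M.d ∘ₗ h - h ∘ₗ M.d
  let ρ : N.X →ₗ[ℚ] N.X := LinearMap.id - N.d ∘ₗ k - k ∘ₗ N.d
  have hπ : ∀ i m, M.gr.IsHom i m → M.gr.IsHom i (π m) := fun i m hm => by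
    have e1 := M.d_hom _ _ (h1 i m hm)
    have e2 := h1 _ _ (M.d_hom i m hm)
    rw [up_down] at e1
    rw [down_up] at e2
    exact (hm.sub e1).sub e2
  have hs : ∀ m, M.gr.sign (h m) = - h (M.gr.sign m) := fun m => by
    refine LinearMap.congr_fun (f := M.gr.sign ∘ₗ h) (g := - (h ∘ₗ M.gr.sign))
      (M.gr.ext_hom fun i m hm => ?_) m
    rw [LinearMap.comp_apply, LinearMap.neg_apply, LinearMap.comp_apply, Grading.sign_apply hm,
      Grading.sign_apply (h1 i m hm), map_smul, ← neg_smul]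
    congr 1
    rw [Prod.fst_add, zpow_add₀ (by norm_num)]
    simp
  have hsπ : ∀ m, M.gr.sign (π m) = π (M.gr.sign m) := Grading.sign_even hπ
  have hdπ : ∀ m, M.d (π m) = π (M.d m) := fun m => by
    simp only [π, LinearMap.sub_apply, LinearMap.comp_apply, LinearMap.id_apply, map_sub, M.d_d,
      map_zero, sub_zero]
  refine bounded_of_homotopy _ (a + a') (b + b')
    (TensorProduct.map h LinearMap.id + TensorProduct.map (π ∘ₗ M.gr.sign) k)
    (TensorProduct.map π ρ) (Grading.tensor_map (s := fun i => i + (1, 0)) fun i j m n hm hn => ?_)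
    fun i t ht hi h0 => ?_
  · rw [LinearMap.add_apply, TensorProduct.map_tmul, TensorProduct.map_tmul]
    have e1 := (h1 i m hm).tmul hn
    have e2 := (hπ i _ (Grading.sign_hom hm)).tmul (k1 j n hn)
    rw [add_right_comm] at e1
    rw [← add_assoc] at e2
    exact e1.add e2
  · have key : M.gr.dT M.d N.d ∘ₗ (TensorProduct.map h LinearMap.id +
        TensorProduct.map (π ∘ₗ M.gr.sign) k) + (TensorProduct.map h LinearMap.id +
        TensorProduct.map (π ∘ₗ M.gr.sign) k) ∘ₗ M.gr.dT M.d N.d =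
        LinearMap.id - TensorProduct.map π ρ := by
      refine TensorProduct.ext' fun m n => ?_
      simp only [LinearMap.add_apply, LinearMap.comp_apply, LinearMap.sub_apply,
        TensorProduct.map_tmul, LinearMap.id_apply, map_add, Grading.dT_tmul, sign_d, hs, hsπ,
        Grading.sign_sign, hdπ, map_neg, TensorProduct.neg_tmul]
      rw [show ρ n = n - N.d (k n) - k (N.d n) from rfl]
      conv_rhs => rw [show m ⊗ₜ[ℚ] n = (π m + M.d (h m) + h (M.d m)) ⊗ₜ[ℚ] n by
        congr 1; simp only [π, LinearMap.sub_apply, LinearMap.comp_apply, LinearMap.id_apply]; abel]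
      simp only [TensorProduct.add_tmul, TensorProduct.tmul_sub]
      abel
    have h4 : TensorProduct.map π ρ t = 0 := by
      refine Grading.tensor_eq_of (g := 0) (fun p q m n hm hn hpq => ?_) ht
      rw [TensorProduct.map_tmul, LinearMap.zero_apply]
      by_cases hp : p.1 < a ∨ b < p.1
      · rw [show π m = 0 from h2 p m hm hp, TensorProduct.zero_tmul]
      · have h5 : q.1 < a' ∨ b' < q.1 := by
          rw [← hpq, Prod.fst_add] at hi
          omega
        rw [show ρ n = 0 from k2 q n hn h5, TensorProduct.tmul_zero]
    have h6 := LinearMap.congr_fun key t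
    have h7 : M.gr.dT M.d N.d t = 0 := h0
    rw [LinearMap.add_apply, LinearMap.comp_apply, LinearMap.comp_apply, h7, map_zero,
      add_zero] at h6
    exact ⟨h6, 1, by rw [pow_one]; exact h4⟩

end Cx

theorem Grading.cone_eq_zero {Γ M V : Type} [AddCommGroup M] [Module ℚ M] [AddCommGroup V]
    [Module ℚ V] {G : Grading Γ M} {s : ℕ → Γ → Γ} {f : M × (ℕ →₀ M) →ₗ[ℚ] V} {i : Γ}
    (h1 : ∀ m, G.IsHom i m → f (m, 0) = 0)
    (h2 : ∀ k j m, G.IsHom j m → s k j = i → f (0, Finsupp.single k m) = 0)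
    (t : M × (ℕ →₀ M)) (ht : (G.cone s).IsHom i t) : f t = 0 := by
  have h3 : f ∘ₗ Finsupp.lapply i ∘ₗ (G.cone s).comp = 0 := by
    classical
    refine LinearMap.ext_on (span_cone G.span_isHom) ?_
    rintro _ (⟨m, ⟨j, hm⟩, rfl⟩ | ⟨k, m, ⟨j, hm⟩, rfl⟩)
    · have h : (G.cone s).comp (m, 0) = Finsupp.single j (m, 0) := hm.cone_fst s
      rw [LinearMap.comp_apply, LinearMap.comp_apply, h, Finsupp.lapply_apply, Finsupp.single_apply]
      split_ifs with hj
      · exact h1 m (hj ▸ hm)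
      · exact map_zero f
    · have h : (G.cone s).comp (0, Finsupp.single k m) =
          Finsupp.single (s k j) (0, Finsupp.single k m) := hm.cone_snd s k
      rw [LinearMap.comp_apply, LinearMap.comp_apply, h, Finsupp.lapply_apply, Finsupp.single_apply]
      split_ifs with hj
      · exact h2 k j m hm hj
      · exact map_zero f
  have h4 := LinearMap.congr_fun h3 t
  rwa [LinearMap.comp_apply, LinearMap.comp_apply, Finsupp.lapply_apply, ht.comp_eq] at h4

namespace Hkm
open Words DGMod
variable (M : DGMod)

theorem bounded_obj (hM : Cx.bounded ℤ (DGMod.forget.obj M)) : Cx.bounded ℤ (obj M).toCx := by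
  obtain ⟨a, b, hM⟩ := hM
  obtain ⟨h, h1, h2⟩ := M.toCx.exists_homotopy hM
  let c : ℕ → M.X →ₗ[ℚ] M.X := fun k => - (M.act (e k) ∘ₗ h + h ∘ₗ M.act (e k))
  let π : M.X →ₗ[ℚ] M.X := LinearMap.id - M.d ∘ₗ h - h ∘ₗ M.d
  let C := TensorProduct.comm ℚ W M.X
  let ν : M.X ⊗[ℚ] W →ₗ[ℚ] M.X ⊗[ℚ] W := C.toLinearMap ∘ₗ tw uncons c ∘ₗ C.symm.toLinearMap
  have hν : ∀ n t, (ν ^ n) t = C ((tw uncons c ^ n) (C.symm t)) := fun n => by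
    induction n with
    | zero => intro t; exact (C.apply_symm_apply t).symm
    | succ n ih =>
      intro t
      rw [pow_succ, Module.End.mul_apply, ih, pow_succ, Module.End.mul_apply]
      congr 2
      exact C.symm_apply_apply _
  have hc : ∀ (g : M.X →ₗ[ℚ] M.X) t, C (TensorProduct.map LinearMap.id g t) =
      TensorProduct.map g LinearMap.id (C t) := fun g t =>
    LinearMap.congr_fun (f := C.toLinearMap ∘ₗ TensorProduct.map LinearMap.id g)
      (g := TensorProduct.map g LinearMap.id ∘ₗ C.toLinearMap) (TensorProduct.ext' fun _ _ => rfl) t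
  have key : ∀ t : W ⊗[ℚ] M.X,
      twD 0 LinearMap.id uncons M.d (fun k => M.act (e k)) (TensorProduct.map LinearMap.id h t) +
      TensorProduct.map LinearMap.id h (twD 0 LinearMap.id uncons M.d (fun k => M.act (e k)) t) =
      t - TensorProduct.map LinearMap.id π t - tw uncons c t := by
    intro t
    have e1 : ∀ t : W ⊗[ℚ] M.X, twD 0 LinearMap.id uncons M.d (fun k => M.act (e k)) t =
        TensorProduct.map LinearMap.id M.d t + tw uncons (fun k => M.act (e k)) t := fun t => by
      simp only [twD, LinearMap.add_apply, LinearMap.comp_apply, TensorProduct.map_zero_left,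
        zero_add, TensorProduct.map_id, LinearMap.id_apply]
    have e2 : tw uncons (fun k => M.act (e k) ∘ₗ h) t + tw uncons (fun k => h ∘ₗ M.act (e k)) t +
        tw uncons c t = 0 := by
      rw [← tw_add, ← tw_add, show (fun k => M.act (e k) ∘ₗ h + h ∘ₗ M.act (e k) + c k) =
        fun _ => (0 : M.X →ₗ[ℚ] M.X) from funext fun k => add_neg_cancel _]
      exact tw_zero uncons t
    have e3 : TensorProduct.map LinearMap.id M.d (TensorProduct.map LinearMap.id h t) +
        TensorProduct.map LinearMap.id h (TensorProduct.map LinearMap.id M.d t) =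
        t - TensorProduct.map LinearMap.id π t := by
      refine LinearMap.congr_fun (f := TensorProduct.map LinearMap.id M.d ∘ₗ
        TensorProduct.map LinearMap.id h + TensorProduct.map LinearMap.id h ∘ₗ
        TensorProduct.map LinearMap.id M.d) (g := LinearMap.id - TensorProduct.map LinearMap.id π)
        (TensorProduct.ext' fun x m => ?_) t
      simp only [LinearMap.add_apply, LinearMap.comp_apply, LinearMap.sub_apply,
        TensorProduct.map_tmul, LinearMap.id_apply, π, TensorProduct.tmul_sub]
      abel
    rw [e1, e1, map_add, tw_map_right, map_tw_right, sub_eq_add_neg, ← e3,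
      ← eq_neg_of_add_eq_zero_left e2]
    abel
  refine Cx.bounded_of_homotopy _ a b (TensorProduct.map h LinearMap.id) ν
    (Grading.tensor_map (s := fun i => i + (1, 0)) (G := M.gr) (H := cgr ℤ W)
      fun i j m x hm hx => ?_) fun i t ht hi h0 => ⟨?_, ?_⟩
  · have e1 := (h1 i m hm).tmul hx
    rw [add_right_comm] at e1
    exact e1
  · obtain ⟨s, rfl⟩ := C.surjective t
    have h3 : D M (C s) = 0 := h0
    have h4 : TensorProduct.map π LinearMap.id (C s) = 0 := by
      refine Grading.tensor_eq_of (G := M.gr) (H := cgr ℤ W) (g := 0)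
        (fun p q m x hm hx hpq => ?_) ht
      rw [TensorProduct.map_tmul, LinearMap.zero_apply]
      rcases Grading.inc_isHom hx with rfl | ⟨h5, -⟩
      · exact TensorProduct.tmul_zero _ _
      · rw [show π m = 0 from h2 p m hm (by
          rw [← hpq, Prod.fst_add, h5, add_zero] at hi
          exact hi), TensorProduct.zero_tmul]
    have h6 := congrArg C (key s)
    rw [map_add, map_sub, map_sub, comm_D, hc, hc, hc, comm_D, h3, map_zero, add_zero, h4,
      sub_zero] at h6
    refine h6.trans (congrArg (fun x => C s - C (tw uncons c x)) (C.symm_apply_apply s).symm)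
  · obtain ⟨n, hn⟩ := tw_nilpotent twData.nil c (C.symm t)
    exact ⟨n, (hν n t).trans ((congrArg C hn).trans (map_zero C))⟩

end Hkm

namespace Cobar
open Words
variable (N : DGComod ℤ Hkm.W)

theorem bounded_obj (hN : Cx.bounded ℤ N.toCx) : Cx.bounded ℤ (DGMod.forget.obj (obj N)) := by
  obtain ⟨a, b, hN⟩ := hN
  obtain ⟨h, h1, h2⟩ := N.toCx.exists_homotopy hN
  let H : N.X × (ℕ →₀ N.X) →ₗ[ℚ] N.X × (ℕ →₀ N.X) :=
    LinearMap.prodMap h (- Finsupp.mapRange.linearMap h)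
  let ν : N.X × (ℕ →₀ N.X) →ₗ[ℚ] N.X × (ℕ →₀ N.X) := LinearMap.id - D N ∘ₗ H - H ∘ₗ D N
  have hH1 : ∀ n, H (n, 0) = (h n, 0) := fun n => by simp [H]
  have hH2 : ∀ k n, H (0, Finsupp.single k n) = (0, Finsupp.single k (- h n)) := fun k n => by
    simp [H]
  have hHg : ∀ i t, (obj N).gr.IsHom i t → (obj N).gr.IsHom (i + (1, 0)) (H t) :=
    Grading.cone_map (r := fun i => i + (1, 0)) (fun i m hm =>
      (congrArg ((obj N).gr.IsHom _) (hH1 m)).mpr ((h1 i m hm).cone_fst _)) fun k i m hm => by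
      have := ((h1 i m hm).smul (-1)).cone_snd (fun k i => i + (-1, (k : ℤ) + 1)) k
      rw [neg_one_smul, add_right_comm] at this
      exact (congrArg ((obj N).gr.IsHom _) (hH2 k m)).mpr this
  have hνg : ∀ i t, (obj N).gr.IsHom i t → (obj N).gr.IsHom i (ν t) := fun i t ht => by
    have e1 := (obj N).d_hom _ _ (hHg i t ht)
    have e2 := hHg _ _ ((obj N).d_hom i t ht)
    rw [Cx.up_down] at e1
    rw [Cx.down_up] at e2
    exact (ht.sub e1).sub e2
  have hν2 : ∀ k n, ν (0, Finsupp.single k n) =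
      (0, Finsupp.single k (n - N.d (h n) - h (N.d n))) := fun k n => by
    have hD : ∀ n, D N (0, Finsupp.single k n) = (0, Finsupp.single k (- N.d n)) := fun n => by
      rw [D_apply]
      simp
    simp only [ν, LinearMap.sub_apply, LinearMap.comp_apply, LinearMap.id_apply, hH2, hD, map_neg,
      neg_neg, Prod.mk_sub_mk, sub_zero, ← Finsupp.single_sub]
  have hν1 : ∀ n, (ν (n, 0)).1 = n - N.d (h n) - h (N.d n) := fun n => by
    simp only [ν, LinearMap.sub_apply, LinearMap.comp_apply, LinearMap.id_apply, hH1, D_apply]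
    rfl
  have hz2 : ∀ i : ℤ × ℤ, i.1 < a - 1 ∨ b < i.1 → ∀ t, (obj N).gr.IsHom i t →
      ν (0, t.2) = 0 := fun i hi t ht => by
    refine Grading.cone_eq_zero (f := ν ∘ₗ LinearMap.inr ℚ _ _ ∘ₗ LinearMap.snd ℚ _ _)
      (fun m hm => ?_) (fun k j m hm hj => ?_) t ht
    · exact map_zero ν
    · refine (hν2 k m).trans ?_
      rw [h2 j m hm (by
        rw [← hj] at hi
        simp only [Prod.fst_add] at hi
        omega), Finsupp.single_zero]
      rfl
  have hz1 : ∀ i : ℤ × ℤ, i.1 < a - 1 ∨ b < i.1 → ∀ t, (obj N).gr.IsHom i t →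
      (ν t).1 = 0 := fun i hi t ht => by
    refine Grading.cone_eq_zero (f := LinearMap.fst ℚ _ _ ∘ₗ ν)
      (fun m hm => ?_) (fun k j m hm hj => ?_) t ht
    · exact (hν1 m).trans (h2 i m hm (by omega))
    · exact congrArg Prod.fst (hν2 k m)
  have e1 : ∀ t, D N t = 0 → D N (H t) = t - ν t := fun t h3 => by
    have h4 : ν t = t - D N (H t) - H (D N t) := rfl
    rw [h4, h3, map_zero, sub_zero, sub_sub_cancel]
  have e2 : ∀ t, (ν t).1 = 0 → ν (0, (ν t).2) = 0 → (ν ^ 2) t = 0 := fun t h3 h4 => by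
    rw [pow_two, Module.End.mul_apply]
    rwa [show ((0 : N.X), (ν t).2) = ν t from Prod.ext h3.symm rfl] at h4
  exact Cx.bounded_of_homotopy _ (a - 1) b H ν hHg fun i t ht hi h0 =>
    ⟨e1 t h0, 2, e2 t (hz1 i hi t ht) (hz2 i hi _ (hνg i t ht))⟩

end Cobar

section
open Functor

/-- The cobar construction, with values in the `K`-flat modules. -/
def cobarFlat : DGComod ℤ Hkm.W ⥤ DGMod.kflat.FullSubcategory :=
  DGMod.kflat.lift cobar Cobar.kflat_obj

/-- The `K`-flat resolutions by the bar and cobar constructions. -/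
def resLocalizer : LocalizerMorphism DGMod.qis DGMod.flatQis where
  functor := hkm ⋙ cobarFlat
  map _ _ f hf := Cobar.map_qis (hkm.map f) (Hkm.map_qis f hf)

/-- The bar construction of the `K`-flat modules. -/
def barLocalizer : LocalizerMorphism DGMod.flatQis (DGComod.qis ℤ Hkm.W) where
  functor := DGMod.kflat.ι ⋙ hkm
  map _ _ f hf := Hkm.map_qis f.hom hf

/-- The cobar construction. -/
def cobarLocalizer : LocalizerMorphism (DGComod.qis ℤ Hkm.W) DGMod.flatQis where
  functor := cobarFlat
  map _ _ f hf := Cobar.map_qis f hf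

/-- The counit, as a natural transformation. -/
def counitNat : hkm ⋙ cobar ⟶ 𝟭 DGMod where
  app := Cobar.counit
  naturality _ _ f := Cobar.counit_natural f

/-- The counit, for `K`-flat modules. -/
def counitFlat : (DGMod.kflat.ι ⋙ hkm) ⋙ cobarFlat ⟶ 𝟭 _ where
  app M := ObjectProperty.homMk (Cobar.counit M.obj)
  naturality _ _ f := DGMod.kflat.ι.map_injective (Cobar.counit_natural f.hom)

/-- The unit, as a natural transformation. -/
def unitNat : 𝟭 _ ⟶ (cobarFlat ⋙ DGMod.kflat.ι ⋙ hkm) where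
  app := Cobar.unit
  naturality N _ f := (Cobar.unit_natural N f).symm

theorem flatLocalizer_isLocalizedEquivalence : DGMod.flatLocalizer.IsLocalizedEquivalence :=
  isLocalizedEquivalence_of_iso DGMod.flatLocalizer resLocalizer
    (isoOfApp (W := DGMod.flatQis) counitFlat fun M => Cobar.counit_qis M.obj)
    (isoOfApp (W := DGMod.qis) counitNat fun M => Cobar.counit_qis M)

theorem barLocalizer_isLocalizedEquivalence : barLocalizer.IsLocalizedEquivalence :=
  isLocalizedEquivalence_of_iso barLocalizer cobarLocalizer
    (isoOfApp (W := DGMod.flatQis) counitFlat fun M => Cobar.counit_qis M.obj)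
    (isoOfApp (W := DGComod.qis ℤ Hkm.W) unitNat fun N => Cobar.unit_qis N).symm

/-- The bar construction of `K`-flat modules, in the derived category. -/
abbrev barDer : DGMod.kflat.FullSubcategory ⥤ DGComod.Der ℤ Hkm.W :=
  DGMod.kflat.ι ⋙ hkm ⋙ DGComod.toDer ℤ Hkm.W

theorem isIso_toDer_map {J C : Type} [AddCommGroup J] [CommRing C] [Bialgebra ℚ C]
    [GradedBialgebra J C] {M N : DGComod J C} (f : M ⟶ N) (hf : DGComod.qis J C f) :
    IsIso ((DGComod.toDer J C).map f) :=
  Localization.inverts (DGComod.toDer J C) (DGComod.qis J C) f hf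

theorem barDer_inverts : DGMod.flatQis.IsInvertedBy barDer :=
  fun _ _ f hf => isIso_toDer_map (hkm.map f.hom) (Hkm.map_qis f.hom hf)

instance : IsIso (LaxMonoidal.ε barDer) := by
  have : IsIso ((DGComod.toDer ℤ Hkm.W).map (LaxMonoidal.ε hkm)) := isIso_toDer_map _ Hkm.eps_qis
  rw [LaxMonoidal.comp_ε, LaxMonoidal.comp_ε]
  infer_instance

instance (M N : DGMod.kflat.FullSubcategory) : IsIso (LaxMonoidal.μ barDer M N) := by
  have : IsIso ((DGComod.toDer ℤ Hkm.W).map (LaxMonoidal.μ hkm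
      (DGMod.kflat.ι.obj M) (DGMod.kflat.ι.obj N))) :=
    isIso_toDer_map _ (Hkm.mu_qis M.property N.property)
  rw [LaxMonoidal.comp_μ, LaxMonoidal.comp_μ]
  infer_instance

instance : barDer.Braided := braidedOfLax barDer

/-- The functor on the derived categories induced by the bar construction. -/
def barFunctor : DGMod.Der ⥤ DGComod.Der ℤ Hkm.W :=
  Localization.lift barDer barDer_inverts DGMod.toDer

instance : Localization.Lifting DGMod.toDer DGMod.flatQis barDer barFunctor :=
  Localization.liftingLift barDer barDer_inverts DGMod.toDer

instance : barFunctor.Braided := braidedOfComp DGMod.toDer DGMod.flatQis barFunctor barDer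

/-- The derived functor is the bar construction on `K`-flat modules. -/
def barFunctorIso : DGMod.toDer ⋙ barFunctor ≅ barDer :=
  Localization.Lifting.iso DGMod.toDer DGMod.flatQis barDer barFunctor

instance : NatTrans.IsMonoidal barFunctorIso.hom :=
  Localization.Monoidal.lifting_isMonoidal DGMod.toDer DGMod.flatQis barFunctor barDer

instance : barFunctor.IsEquivalence := by
  have := barLocalizer_isLocalizedEquivalence
  have : CatCommSq barLocalizer.functor DGMod.toDer (DGComod.toDer ℤ Hkm.W) barFunctor :=
    ⟨barFunctorIso.symm⟩
  exact barLocalizer.isEquivalence DGMod.toDer (DGComod.toDer ℤ Hkm.W) barFunctor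

end

section
open Functor

theorem Cx.bounded_one (J : Type) [AddCommGroup J] : Cx.bounded J (Cx.one J) := by
  refine ⟨0, 0, fun i a ha _ hi => ⟨0, ?_⟩⟩
  rcases Cx.unit_isHom ha with h | rfl
  · rw [map_zero]; exact h.symm
  · simp at hi

theorem DGComod.derBounded_isMonoidal (J C : Type) [AddCommGroup J] [CommRing C] [Bialgebra ℚ C]
    [GradedBialgebra J C] : (DGComod.derBounded J C).IsMonoidal where
  prop_unit := ⟨𝟙_ _, Cx.bounded_one J, ⟨(Monoidal.εIso (DGComod.toDer J C)).symm⟩⟩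
  prop_tensor := by
    rintro M N ⟨X, hX, ⟨e⟩⟩ ⟨Y, hY, ⟨e'⟩⟩
    exact ⟨X ⊗ Y, Cx.bounded_tens hX hY, ⟨(Monoidal.μIso (DGComod.toDer J C) X Y).symm ≪≫ (e ⊗ᵢ e')⟩⟩

namespace DGMod

theorem bounded_of_bounded_hkm {M : DGMod} (h : Cx.bounded ℤ (hkm.obj M).toCx) :
    Cx.bounded ℤ (forget.obj M) :=
  Cx.bounded_of_qis (forget.map (Cobar.counit M)) (Cobar.counit_qis M) (Cobar.bounded_obj _ h)

theorem bounded_tens {M N : DGMod} (hM : kflat M) (hN : kflat N)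
    (bM : Cx.bounded ℤ (forget.obj M)) (bN : Cx.bounded ℤ (forget.obj N)) :
    Cx.bounded ℤ (forget.obj (M ⊗ N)) :=
  bounded_of_bounded_hkm (Cx.bounded_of_qis (DGComod.forget.map (Hkm.mu M N)) (Hkm.mu_qis hM hN)
    (Cx.bounded_tens (Hkm.bounded_obj M bM) (Hkm.bounded_obj N bN)))

theorem bounded_unit : Cx.bounded ℤ (forget.obj (𝟙_ DGMod)) :=
  bounded_of_bounded_hkm (Cx.bounded_of_qis (DGComod.forget.map Hkm.eps) Hkm.eps_qis
    (Cx.bounded_one ℤ))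

theorem derBounded_isMonoidal : derBounded.IsMonoidal where
  prop_unit := ⟨𝟙_ _, bounded_unit, ⟨(Monoidal.εIso toDer).symm⟩⟩
  prop_tensor := by
    rintro M N ⟨X, hX, ⟨e⟩⟩ ⟨Y, hY, ⟨e'⟩⟩
    exact ⟨X ⊗ Y, bounded_tens X.property Y.property hX hY,
      ⟨(Monoidal.μIso toDer X Y).symm ≪≫ (e ⊗ᵢ e')⟩⟩

end DGMod

instance : DGMod.derBounded.IsMonoidal := DGMod.derBounded_isMonoidal

instance (J C : Type) [AddCommGroup J] [CommRing C] [Bialgebra ℚ C] [GradedBialgebra J C] :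
    (DGComod.derBounded J C).IsMonoidal := DGComod.derBounded_isMonoidal J C

theorem barFunctor_bounded {M : DGMod.Der} (h : DGMod.derBounded M) :
    DGComod.derBounded ℤ Hkm.W (barFunctor.obj M) := by
  obtain ⟨X, hX, ⟨e⟩⟩ := h
  exact ⟨hkm.obj X.obj, Hkm.bounded_obj X.obj hX,
    ⟨(barFunctorIso.app X).symm ≪≫ barFunctor.mapIso e⟩⟩

/-- The derived functor on the bounded derived category. -/
def barBounded : DbMod ⥤ DbComod ℤ Hkm.W :=
  (DGComod.derBounded ℤ Hkm.W).lift (DGMod.derBounded.ι ⋙ barFunctor) fun M =>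
    barFunctor_bounded M.property

instance : barBounded.Braided := liftBraided _ _ _

/-- The derived functor on the bounded derived category is a restriction. -/
def barBoundedIso : barBounded ⋙ (DGComod.derBounded ℤ Hkm.W).ι ≅ DGMod.derBounded.ι ⋙ barFunctor :=
  ObjectProperty.liftCompιIso _ _ _

instance : NatTrans.IsMonoidal barBoundedIso.hom := liftBraided_isMonoidal _ _ _

instance : barBounded.IsEquivalence where
  faithful := inferInstanceAs ((DGComod.derBounded ℤ Hkm.W).lift _ _).Faithful
  full := inferInstanceAs ((DGComod.derBounded ℤ Hkm.W).lift _ _).Full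
  essSurj := ⟨fun N => by
    obtain ⟨X, hX, ⟨e⟩⟩ := N.property
    have := isIso_toDer_map _ (Cobar.unit_qis X)
    refine ⟨⟨DGMod.toDer.obj (cobarFlat.obj X), cobarFlat.obj X, Cobar.bounded_obj X hX,
      ⟨Iso.refl _⟩⟩, ⟨ObjectProperty.isoMk _ ?_⟩⟩
    exact barFunctorIso.app (cobarFlat.obj X) ≪≫
      (asIso ((DGComod.toDer ℤ Hkm.W).map (Cobar.unit X))).symm ≪≫ e⟩

end

/-- The sum over all decompositions of a list into consecutive blocks, of the composites of the
operators attached to the blocks. -/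
def blockSum {M : Type} [AddCommGroup M] [Module ℚ M] (g : List ℕ → M →ₗ[ℚ] M) (m : M) :
    List ℕ → M
  | [] => m
  | a :: u => ∑ i ∈ Finset.range (u.length + 1),
      g ((a :: u).take (i + 1)) (blockSum g m (u.drop i))
termination_by u => u.length

section blockSum
variable {M : Type} [AddCommGroup M] [Module ℚ M] (g : List ℕ → M →ₗ[ℚ] M) (m : M)

/-- The lists of positive numbers with given sum. -/
def compositionLists (n : ℕ) : Finset (List ℕ) :=
  Finset.univ.image (Composition.blocks : Composition n → List ℕ)

theorem mem_compositionLists {n : ℕ} {l : List ℕ} :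
    l ∈ compositionLists n ↔ (∀ i ∈ l, 0 < i) ∧ l.sum = n := by
  simp only [compositionLists, Finset.mem_image, Finset.mem_univ, true_and]
  constructor
  · rintro ⟨c, rfl⟩
    exact ⟨fun i hi => c.blocks_pos hi, c.blocks_sum⟩
  · rintro ⟨h1, h2⟩
    exact ⟨⟨l, fun {i} hi => h1 i hi, h2⟩, rfl⟩

theorem sum_compositionLists_succ (n : ℕ) (F : List ℕ → M) :
    ∑ l ∈ compositionLists (n + 1), F l =
      ∑ i ∈ Finset.range (n + 1), ∑ l ∈ compositionLists (n - i), F ((i + 1) :: l) := by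
  rw [Finset.sum_sigma']
  symm
  refine Finset.sum_bij' (i := fun p _ => (p.1 + 1) :: p.2)
    (j := fun l _ => ⟨l.head! - 1, l.tail⟩) ?_ ?_ ?_ ?_ ?_
  · rintro ⟨i, l⟩ h
    simp only [Finset.mem_sigma, Finset.mem_range, mem_compositionLists] at h ⊢
    refine ⟨fun j hj => ?_, ?_⟩
    · rcases List.mem_cons.mp hj with rfl | hj
      · omega
      · exact h.2.1 j hj
    · rw [List.sum_cons, h.2.2]
      omega
  · rintro l h
    rw [mem_compositionLists] at h
    cases l with
    | nil => simp at h
    | cons i l =>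
      have h0 := h.1 i (by simp)
      have h1 := h.2
      rw [List.sum_cons] at h1
      simp only [Finset.mem_sigma, Finset.mem_range, mem_compositionLists, List.head!_cons,
        List.tail_cons]
      refine ⟨by omega, fun j hj => h.1 j (by simp [hj]), by omega⟩
  · rintro ⟨i, l⟩ h
    simp
  · rintro l h
    rw [mem_compositionLists] at h
    cases l with
    | nil => simp at h
    | cons i l =>
      have h0 := h.1 i (by simp)
      simp only [List.head!_cons, List.tail_cons]
      congr 1
      omega
  · rintro ⟨i, l⟩ h
    rfl

theorem blockSum_eq (n : ℕ) (u : List ℕ) (hu : u.length = n) :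
    blockSum g m u = ∑ l ∈ compositionLists n,
      (u.splitWrtCompositionAux l).foldr (fun w x => g w x) m := by
  induction n using Nat.strong_induction_on generalizing u with
  | _ n ih =>
    cases u with
    | nil =>
      have h : compositionLists n = {[]} := by
        ext l
        rw [mem_compositionLists, Finset.mem_singleton]
        constructor
        · rintro ⟨h1, h2⟩
          cases l with
          | nil => rfl
          | cons i l =>
            have := h1 i (by simp)
            simp at h2 hu
            omega
        · rintro rfl
          simpa using hu
      rw [h, Finset.sum_singleton, blockSum]
      rfl
    | cons a u =>
      obtain rfl : u.length + 1 = n := hu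
      rw [blockSum, sum_compositionLists_succ]
      refine Finset.sum_congr rfl fun i hi => ?_
      rw [ih (u.length - i) (by omega) (u.drop i) (by simp), map_sum]
      refine Finset.sum_congr rfl fun l _ => ?_
      rw [List.splitWrtCompositionAux_cons, List.foldr_cons, List.drop_succ_cons]

theorem blockSum_eq_sum_composition (u : List ℕ) :
    blockSum g m u = ∑ c : Composition u.length,
      (u.splitWrtComposition c).foldr (fun w x => g w x) m := by
  rw [blockSum_eq g m u.length u rfl, compositionLists, Finset.sum_image]
  · rfl
  · intro c _ c' _ h
    exact Composition.ext h

end blockSum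

namespace Words
variable {lam : ℚ}

theorem comulLin_wd (u : List ℕ) : comulLin (wd u : Words lam) =
    ∑ i ∈ Finset.range (u.length + 1), wd (u.take i) ⊗ₜ wd (u.drop i) := by
  induction u with
  | nil => simp [comulLin, deconc]
  | cons a u ih =>
    rw [← cons_wd, comulLin_cons, ih, List.length_cons, Finset.sum_range_succ' _ (u.length + 1),
      add_comm, map_sum]
    simp only [consL_tmul, cons_wd]
    rfl

theorem comulLin_wd_cons (a : ℕ) (u : List ℕ) : comulLin (wd (a :: u) : Words lam) =
    wd [] ⊗ₜ wd (a :: u) + ∑ i ∈ Finset.range (u.length + 1),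
      wd ((a :: u).take (i + 1)) ⊗ₜ wd (u.drop i) := by
  rw [comulLin_wd, List.length_cons, Finset.sum_range_succ', add_comm]
  rfl

/-- A map which is a right inverse for convolution. -/
def antiR : Words lam →ₗ[ℚ] Words lam :=
  lift (blockSum (fun w => -LinearMap.mulLeft ℚ (wd w)) 1)

/-- A map which is a left inverse for convolution. -/
def antiL : Words lam →ₗ[ℚ] Words lam :=
  lift fun u => blockSum (fun w => -LinearMap.mulLeft ℚ (wd w.reverse)) 1 u.reverse

theorem convUnit_cons (a : ℕ) (u : List ℕ) :
    algebraMap ℚ (Words lam) (counitLin (wd (a :: u) : Words lam)) = 0 := by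
  rw [← cons_wd, counit_cons, map_zero]

theorem antiR_inverse (x : Words lam) :
    LinearMap.mul' ℚ (Words lam) (TensorProduct.map LinearMap.id antiR (comulLin x)) =
      algebraMap ℚ (Words lam) (counitLin x) := by
  refine LinearMap.congr_fun (f := LinearMap.mul' ℚ (Words lam) ∘ₗ
    TensorProduct.map LinearMap.id antiR ∘ₗ comulLin)
    (g := Algebra.linearMap ℚ (Words lam) ∘ₗ counitLin) (lin_ext fun u => ?_) x
  rw [LinearMap.comp_apply, LinearMap.comp_apply, LinearMap.comp_apply, Algebra.linearMap_apply]
  cases u with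
  | nil =>
    have h : (antiR 1 : Words lam) = 1 := by rw [one_def, antiR, lift_wd, blockSum]; rfl
    rw [← one_def, comulLin_one, TensorProduct.map_tmul, h]
    rw [LinearMap.mul'_apply, LinearMap.id_apply, one_mul]
    exact ((counitAlg (lam := lam)).map_one ▸ (map_one (algebraMap ℚ (Words lam))).symm :)
  | cons a u =>
    rw [convUnit_cons, comulLin_wd_cons, map_add, map_add, map_sum, map_sum,
      TensorProduct.map_tmul, LinearMap.mul'_apply, LinearMap.id_apply, ← one_def, one_mul, antiR,
      lift_wd, blockSum, ← Finset.sum_add_distrib]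
    refine Finset.sum_eq_zero fun i _ => ?_
    rw [TensorProduct.map_tmul, LinearMap.mul'_apply, lift_wd]
    simp

theorem antiL_inverse (x : Words lam) :
    LinearMap.mul' ℚ (Words lam) (TensorProduct.map antiL LinearMap.id (comulLin x)) =
      algebraMap ℚ (Words lam) (counitLin x) := by
  refine LinearMap.congr_fun (f := LinearMap.mul' ℚ (Words lam) ∘ₗ
    TensorProduct.map antiL LinearMap.id ∘ₗ comulLin)
    (g := Algebra.linearMap ℚ (Words lam) ∘ₗ counitLin) (lin_ext fun u => ?_) x
  rw [LinearMap.comp_apply, LinearMap.comp_apply, LinearMap.comp_apply, Algebra.linearMap_apply]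
  obtain ⟨u, rfl⟩ := List.reverse_surjective u
  cases u with
  | nil =>
    have h : (antiL 1 : Words lam) = 1 := by
      rw [one_def, antiL, lift_wd, List.reverse_nil, blockSum]
      rfl
    rw [List.reverse_nil, ← one_def, comulLin_one, TensorProduct.map_tmul, h]
    rw [LinearMap.mul'_apply, LinearMap.id_apply, one_mul]
    exact ((counitAlg (lam := lam)).map_one ▸ (map_one (algebraMap ℚ (Words lam))).symm :)
  | cons a u =>
    have hc : algebraMap ℚ (Words lam) (counitLin (wd (a :: u).reverse : Words lam)) = 0 := by
      simp [counitLin]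
    rw [hc, comulLin_wd, ← Finset.sum_range_reflect, map_sum, map_sum, Finset.sum_range_succ']
    simp only [TensorProduct.map_tmul, LinearMap.mul'_apply, LinearMap.id_apply, antiL, lift_wd,
      List.length_reverse, List.length_cons]
    rw [List.drop_of_length_le (by simp), ← one_def, mul_one, List.take_of_length_le (by simp),
      List.reverse_reverse, blockSum, ← Finset.sum_add_distrib]
    refine Finset.sum_eq_zero fun i hi => ?_
    rw [Finset.mem_range] at hi
    have e1 : ((a :: u).reverse.take (u.length + 1 + 1 - 1 - (i + 1))).reverse = u.drop i := by
      rw [List.take_reverse, List.reverse_reverse]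
      rw [List.length_cons, show u.length + 1 - (u.length + 1 + 1 - 1 - (i + 1)) = i + 1 by omega]
      rfl
    have e2 : (a :: u).reverse.drop (u.length + 1 + 1 - 1 - (i + 1)) =
        ((a :: u).take (i + 1)).reverse := by
      rw [List.drop_reverse, List.length_cons,
        show u.length + 1 - (u.length + 1 + 1 - 1 - (i + 1)) = i + 1 by omega]
    rw [e1, e2]
    simp [mul_comm]

end Words

/-- A left and a right inverse of the identity for convolution agree. -/
theorem hasAntipode_of_inverses {B : Type} [CommRing B] [Bialgebra ℚ B] (L R : B →ₗ[ℚ] B)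
    (hL : ∀ x, LinearMap.mul' ℚ B (TensorProduct.map L LinearMap.id (Coalgebra.comul (R := ℚ) x)) =
      algebraMap ℚ B (Coalgebra.counit (R := ℚ) x))
    (hR : ∀ x, LinearMap.mul' ℚ B (TensorProduct.map LinearMap.id R (Coalgebra.comul (R := ℚ) x)) =
      algebraMap ℚ B (Coalgebra.counit (R := ℚ) x)) : HasAntipode B := by
  have h1 : WithConv.toConv L * WithConv.toConv (LinearMap.id : B →ₗ[ℚ] B) = 1 := by
    ext x
    exact hL x
  have h2 : WithConv.toConv (LinearMap.id : B →ₗ[ℚ] B) * WithConv.toConv R = 1 := by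
    ext x
    exact hR x
  have h3 : L = R := WithConv.toConv_injective (left_inv_eq_right_inv h1 h2)
  subst h3
  exact ⟨L, fun x => ⟨hL x, hR x⟩⟩

theorem Words.hasAntipode (lam : ℚ) : HasAntipode (Words lam) :=
  hasAntipode_of_inverses _ _ antiL_inverse antiR_inverse

namespace Words
variable {lam : ℚ}

theorem mul_wd_cons (a b : ℕ) (u v : List ℕ) : (wd (a :: u) * wd (b :: v) : Words lam) =
    cons a (wd u * wd (b :: v)) + cons b (wd (a :: u) * wd v) +
      lam • cons (a + b + 1) (wd u * wd v) := by
  simp only [← cons_wd]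
  exact cons_mul_cons a b _ _

/-- The weight of a word, as a natural number. -/
def natWt (u : List ℕ) : ℕ := (u.map (· + 1)).sum

theorem natWt_cons (a : ℕ) (u : List ℕ) : natWt (a :: u) = a + 1 + natWt u := by
  simp [natWt]

theorem weight_eq_natWt (u : List ℕ) : weight u = natWt u := by
  induction u with
  | nil => rfl
  | cons a u ih => rw [weight, ih, natWt_cons]; push_cast; ring

theorem weight_append (u v : List ℕ) : weight (u ++ v) = weight u + weight v := by
  simp [weight_eq_natWt, natWt]

open Polynomial in
/-- The map that sends a word `u` of length `n` and weight `w` to `c n X ^ w`. -/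
def lenPoly (c : ℕ → ℚ) : Words lam →ₗ[ℚ] ℚ[X] := lift fun u => c u.length • X ^ natWt u

open Polynomial in
theorem lenPoly_cons (c : ℕ → ℚ) (a : ℕ) (x : Words lam) :
    lenPoly c (cons a x) = X ^ (a + 1) * lenPoly (fun n => c (n + 1)) x := by
  refine LinearMap.congr_fun (f := lenPoly c ∘ₗ cons a)
    (g := LinearMap.mulLeft ℚ (X ^ (a + 1)) ∘ₗ lenPoly (fun n => c (n + 1)))
    (lin_ext fun u => ?_) x
  simp only [LinearMap.comp_apply, cons_wd, lenPoly, lift_wd, LinearMap.mulLeft_apply,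
    List.length_cons, natWt_cons, mul_smul_comm, pow_add]

open Polynomial in
theorem lenPoly_mul (c : ℕ → ℚ) (u v : List ℕ) :
    lenPoly c (wd u * wd v : Words 0) =
      (c (u.length + v.length) * ((u.length + v.length).choose u.length : ℚ)) •
        X ^ (natWt u + natWt v) := by
  match u, v with
  | [], v => rw [← one_def, one_mul, lenPoly, lift_wd]; simp [natWt]
  | a :: u, [] => rw [← one_def, mul_one, lenPoly, lift_wd]; simp [natWt]
  | a :: u, b :: v =>
    rw [mul_wd_cons, zero_smul, add_zero, map_add, lenPoly_cons, lenPoly_cons,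
      lenPoly_mul _ u (b :: v), lenPoly_mul _ (a :: u) v]
    have h : ((u.length + 1 + (v.length + 1)).choose (u.length + 1) : ℚ) =
        ((u.length + (v.length + 1)).choose u.length : ℚ) +
          ((u.length + 1 + v.length).choose (u.length + 1) : ℚ) := by
      rw [show u.length + 1 + (v.length + 1) = u.length + (v.length + 1) + 1 by ring,
        Nat.choose_succ_succ, show u.length + 1 + v.length = u.length + (v.length + 1) by ring]
      push_cast
      ring
    have h1 : u.length + (v.length + 1) + 1 = u.length + 1 + (v.length + 1) := by ring
    have h2 : u.length + 1 + v.length + 1 = u.length + 1 + (v.length + 1) := by ring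
    simp only [List.length_cons, natWt_cons, h, h1, h2, mul_smul_comm, mul_add, add_smul]
    congr 2
    · ring
    · ring
termination_by u.length + v.length

open Polynomial in
/-- The homomorphism `u ↦ X ^ |u| / n!`, for words of length `n`. -/
def expPoly : Words 0 →ₐ[ℚ] ℚ[X] :=
  algHom (lenPoly fun n => (n.factorial : ℚ)⁻¹) (by simp [one_def, lenPoly, natWt])
    fun u v => by
      rw [lenPoly_mul, lenPoly, lift_wd, lift_wd, smul_mul_smul_comm, pow_add]
      congr 1
      have h := Nat.add_choose_mul_factorial_mul_factorial u.length v.length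
      have h0 := Nat.factorial_ne_zero (u.length + v.length)
      have h1 := Nat.factorial_ne_zero u.length
      have h2 := Nat.factorial_ne_zero v.length
      have h' : ((u.length + v.length).choose u.length : ℚ) * u.length.factorial *
          v.length.factorial = (u.length + v.length).factorial := by
        rw [Nat.choose_symm_add]; exact_mod_cast h
      field_simp
      linear_combination h'

open Polynomial in
theorem expPoly_wd (u : List ℕ) :
    expPoly (wd u) = (u.length.factorial : ℚ)⁻¹ • (X : ℚ[X]) ^ natWt u := lift_wd _ _

open Polynomial in
/-- The linear map that sends the word with a single letter `k` to `X ^ (k + 1)`. -/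
def letterPolyLin : QS →ₗ[ℚ] ℚ[X] := lift fun u => if u.length < 2 then X ^ natWt u else 0

open Polynomial in
theorem letterPolyLin_cons (a : ℕ) (x : QS) :
    letterPolyLin (cons a x) = counitLin x • X ^ (a + 1) := by
  refine LinearMap.congr_fun (f := letterPolyLin ∘ₗ cons a)
    (g := counitLin.smulRight (X ^ (a + 1))) (lin_ext fun u => ?_) x
  rw [LinearMap.comp_apply, LinearMap.smulRight_apply, cons_wd]
  cases u with
  | nil => simp [letterPolyLin, counitLin, natWt]
  | cons b u => simp [letterPolyLin, counitLin]

open Polynomial in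
/-- The homomorphism that sends the word with a single letter `k` to `X ^ (k + 1)`, and the longer
words to `0`. -/
def letterPoly : QS →ₐ[ℚ] ℚ[X] :=
  algHom letterPolyLin (by simp [one_def, letterPolyLin, natWt]) fun u v => by
    have h1 : letterPolyLin 1 = 1 := by simp [one_def, letterPolyLin, natWt]
    match u, v with
    | [], v => rw [← one_def, one_mul, h1, one_mul]
    | a :: u, [] => rw [← one_def, mul_one, h1, mul_one]
    | a :: u, b :: v =>
      rw [mul_wd_cons, one_smul, map_add, map_add, ← cons_wd, ← cons_wd]
      simp only [letterPolyLin_cons]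
      have hm : ∀ x y : QS, counitLin (x * y) = counitLin x * counitLin y :=
        map_mul (counitAlg (lam := 1))
      rw [hm, hm, hm, counit_cons, counit_cons, mul_zero, zero_mul, zero_smul, zero_smul, zero_add,
        zero_add, smul_mul_smul_comm, ← pow_add]
      congr 2
      ring

theorem co_letter (k : ℕ) (x : QS) : co [k] x = (letterPoly x).coeff (k + 1) := by
  refine LinearMap.congr_fun (f := co [k])
    (g := Polynomial.lcoeff ℚ (k + 1) ∘ₗ letterPoly.toLinearMap) (lin_ext fun u => ?_) x
  have h : letterPoly (wd u) = if u.length < 2 then Polynomial.X ^ natWt u else 0 := lift_wd _ _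
  rw [co_wd, LinearMap.comp_apply, AlgHom.toLinearMap_apply, h, Polynomial.lcoeff_apply]
  match u with
  | [] => simp [natWt, Polynomial.coeff_one]
  | [a] => simp [natWt, Polynomial.coeff_X_pow, eq_comm]
  | a :: b :: u => simp

/-- The operator that puts the merged letters of a block, divided by a factorial, in front. -/
def expBlock (w : List ℕ) : QS →ₗ[ℚ] QS := ((w.length.factorial : ℚ))⁻¹ • cons (natWt w - 1)

/-- The exponential, as a linear map. -/
def expLin : Words 0 →ₗ[ℚ] QS := lift (blockSum expBlock 1)

theorem expLin_one : expLin 1 = 1 := by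
  rw [one_def, expLin, lift_wd, blockSum]

theorem expLin_cons (a : ℕ) (u : List ℕ) : expLin (wd (a :: u)) =
    ∑ i ∈ Finset.range (u.length + 1),
      expBlock ((a :: u).take (i + 1)) (expLin (wd (u.drop i))) := by
  simp only [expLin, lift_wd]
  rw [blockSum]

theorem expLin_wd (u : List ℕ) : expLin (wd u) = expWord u := by
  rw [expLin, lift_wd, blockSum_eq_sum_composition, expWord]
  refine Finset.sum_congr rfl fun c _ => ?_
  have h : ∀ L : List (List ℕ), L.foldr (fun w x => expBlock w x) (1 : QS) =
      ((L.map List.length).map fun i => ((i.factorial : ℚ))⁻¹).prod •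
        wd (L.map fun l => (l.map (· + 1)).sum - 1) := by
    intro L
    induction L with
    | nil => simp [one_def]
    | cons w L ih =>
      rw [List.foldr_cons, ih, expBlock, LinearMap.smul_apply, map_smul, cons_wd, smul_smul]
      simp [natWt]
  rw [h, List.map_length_splitWrtComposition]

theorem counit_expLin (x : Words 0) : counitLin (expLin x) = counitLin x := by
  refine LinearMap.congr_fun (f := counitLin ∘ₗ expLin) (g := counitLin) (lin_ext fun u => ?_) x
  rw [LinearMap.comp_apply]
  cases u with
  | nil => rw [← one_def, expLin_one]; simp [counitLin, one_def]
  | cons a u =>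
    rw [expLin_cons, map_sum, ← cons_wd, counit_cons]
    refine Finset.sum_eq_zero fun i _ => ?_
    rw [expBlock, LinearMap.smul_apply, map_smul, counit_cons, smul_zero]

/-- The functionals that determine the exponential. -/
def expCo (k : ℕ) : Words 0 →ₗ[ℚ] ℚ := Polynomial.lcoeff ℚ (k + 1) ∘ₗ expPoly.toLinearMap

theorem co_cons_expLin (k : ℕ) (v : List ℕ) :
    co (k :: v) ∘ₗ expLin = conv comulLin (expCo k) (co v ∘ₗ expLin) := by
  refine lin_ext fun u => ?_
  rw [conv, LinearMap.comp_apply, LinearMap.comp_apply, LinearMap.comp_apply]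
  cases u with
  | nil =>
    rw [← one_def, expLin_one, comulLin_one, TensorProduct.map_tmul, LinearMap.mul'_apply,
      expCo, LinearMap.comp_apply (Polynomial.lcoeff ℚ (k + 1)), AlgHom.toLinearMap_apply, map_one expPoly, one_def, co_wd]
    simp [Polynomial.coeff_one]
  | cons a u =>
    rw [expLin_cons, comulLin_wd_cons, map_add, map_add, map_sum, map_sum, map_sum,
      TensorProduct.map_tmul, LinearMap.mul'_apply]
    have h0 : expCo k (wd []) = 0 := by
      rw [expCo, LinearMap.comp_apply, AlgHom.toLinearMap_apply, expPoly_wd]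
      simp [natWt, Polynomial.coeff_one]
    rw [h0, zero_mul, zero_add]
    refine Finset.sum_congr rfl fun i _ => ?_
    rw [TensorProduct.map_tmul, LinearMap.mul'_apply, LinearMap.comp_apply, expBlock,
      LinearMap.smul_apply, map_smul, co_cons_cons, expCo, LinearMap.comp_apply,
      AlgHom.toLinearMap_apply, expPoly_wd, map_smul, Polynomial.lcoeff_apply,
      Polynomial.coeff_X_pow, List.take_succ_cons, natWt_cons]
    simp only [smul_eq_mul, mul_assoc]
    congr 1
    by_cases hk : a + natWt (List.take i u) = k
    · rw [if_pos (by omega), if_pos (by omega), one_mul]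
    · rw [if_neg (by omega), if_neg (by omega), zero_mul]

theorem letterPoly_expLin (x : Words 0) : letterPoly (expLin x) = expPoly x := by
  ext n
  cases n with
  | zero =>
    refine LinearMap.congr_fun (f := Polynomial.lcoeff ℚ 0 ∘ₗ letterPoly.toLinearMap ∘ₗ expLin)
      (g := Polynomial.lcoeff ℚ 0 ∘ₗ expPoly.toLinearMap) (lin_ext fun u => ?_) x
    cases u with
    | nil =>
      simp only [LinearMap.comp_apply, ← one_def, expLin_one, AlgHom.toLinearMap_apply, map_one]
    | cons a u =>
      have h : ∀ (b : ℕ) (y : QS), letterPoly (cons b y) = counitLin y • Polynomial.X ^ (b + 1) :=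
        letterPolyLin_cons
      simp only [LinearMap.comp_apply, AlgHom.toLinearMap_apply, expLin_cons, map_sum, expBlock,
        LinearMap.smul_apply, map_smul, h, expPoly_wd, natWt_cons, Polynomial.lcoeff_apply,
        Polynomial.coeff_X_pow]
      rw [if_neg (by omega), smul_zero]
      refine Finset.sum_eq_zero fun i _ => ?_
      rw [if_neg (by omega), smul_zero, smul_zero]
  | succ k =>
    rw [← co_letter]
    have h1 := LinearMap.congr_fun (co_cons_expLin k []) x
    rw [LinearMap.comp_apply] at h1
    rw [h1]
    have h2 : co [] ∘ₗ expLin = Coalgebra.counit (R := ℚ) (A := Words 0) := by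
      rw [co_nil]
      exact LinearMap.ext counit_expLin
    rw [h2]
    have h3 := mul_one (WithConv.toConv (expCo k))
    exact LinearMap.congr_fun (congrArg WithConv.ofConv h3) x

theorem conv_assoc {C : Type} [AddCommGroup C] [Module ℚ C] [Coalgebra ℚ C] (φ ψ χ : C →ₗ[ℚ] ℚ) :
    conv Coalgebra.comul (conv Coalgebra.comul φ ψ) χ =
      conv Coalgebra.comul φ (conv Coalgebra.comul ψ χ) :=
  congrArg WithConv.ofConv (mul_assoc (WithConv.toConv φ) (WithConv.toConv ψ) (WithConv.toConv χ))

theorem conv_counit_left {C : Type} [AddCommGroup C] [Module ℚ C] [Coalgebra ℚ C]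
    (φ : C →ₗ[ℚ] ℚ) : conv Coalgebra.comul Coalgebra.counit φ = φ :=
  congrArg WithConv.ofConv (one_mul (WithConv.toConv φ))

theorem conv_comp {C : Type} [AddCommGroup C] [Module ℚ C] [Coalgebra ℚ C] {B : Type}
    [AddCommGroup B] [Module ℚ B] [Coalgebra ℚ B] (φ ψ : C →ₗ[ℚ] ℚ) (f : B →ₗc[ℚ] C) :
    conv Coalgebra.comul φ ψ ∘ₗ f.toLinearMap =
      conv Coalgebra.comul (φ ∘ₗ f.toLinearMap) (ψ ∘ₗ f.toLinearMap) :=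
  LinearMap.convMul_comp_coalgHom_distrib (WithConv.toConv φ) (WithConv.toConv ψ) f

theorem conv_co_expLin (u v : List ℕ) :
    conv comulLin (co u ∘ₗ expLin) (co v ∘ₗ expLin) = co (u ++ v) ∘ₗ expLin := by
  induction u with
  | nil =>
    have h : co [] ∘ₗ expLin = Coalgebra.counit (R := ℚ) (A := Words 0) := by
      rw [co_nil]
      exact LinearMap.ext counit_expLin
    rw [h]
    exact conv_counit_left _
  | cons k u ih =>
    rw [co_cons_expLin, List.cons_append, co_cons_expLin, ← ih]
    exact conv_assoc _ _ _

theorem eq_of_co₂ {s t : Words lam ⊗[ℚ] Words lam}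
    (h : ∀ u v, LinearMap.mul' ℚ ℚ (TensorProduct.map (co u) (co v) s) =
      LinearMap.mul' ℚ ℚ (TensorProduct.map (co u) (co v) t)) : s = t := by
  have h1 : ∀ u v (r : Words lam ⊗[ℚ] Words lam),
      LinearMap.mul' ℚ ℚ (TensorProduct.map (co u) (co v) r) = co u (contract (co v) r) := by
    intro u v r
    induction r with
    | zero => simp
    | add x y hx hy => simp only [map_add, hx, hy]
    | tmul x y => simp [contract_tmul, mul_comm]
  refine eq_of_contract fun v => eq_of_co fun u => ?_
  rw [← h1, ← h1, h]

theorem comul_expLin (x : Words 0) :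
    comulLin (expLin x) = TensorProduct.map expLin expLin (comulLin x) := by
  refine eq_of_co₂ fun u v => ?_
  have h1 := LinearMap.congr_fun (conv_co (lam := 1) u v) (expLin x)
  have h2 := LinearMap.congr_fun (conv_co_expLin u v) x
  rw [conv, LinearMap.comp_apply, LinearMap.comp_apply] at h1 h2
  rw [TensorProduct.map_comp] at h2
  exact h1.trans h2.symm

theorem coalgHom_ext {B : Type} [AddCommGroup B] [Module ℚ B] [Coalgebra ℚ B]
    {f g : B →ₗc[ℚ] Words lam} (h : ∀ k x, co [k] (f x) = co [k] (g x)) : f = g := by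
  have key : ∀ u, co u ∘ₗ f.toLinearMap = co u ∘ₗ g.toLinearMap := by
    intro u
    induction u with
    | nil =>
      rw [co_nil]
      exact f.counit_comp.trans g.counit_comp.symm
    | cons k u ih =>
      have h1 : co (k :: u) = conv Coalgebra.comul (co [k]) (co u : Words lam →ₗ[ℚ] ℚ) :=
        (conv_co [k] u).symm
      rw [h1, conv_comp, conv_comp, ih]
      congr 1
      exact LinearMap.ext (h k)
  exact DFunLike.ext _ _ fun x => eq_of_co fun u => LinearMap.congr_fun (key u) x

/-- The exponential, as a homomorphism of coalgebras. -/
def expCoalg : Words 0 →ₗc[ℚ] QS :=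
  { expLin with
    counit_comp := LinearMap.ext counit_expLin
    map_comp_comul := LinearMap.ext fun x => (comul_expLin x).symm }

theorem expLin_mul (x y : Words 0) : expLin (x * y) = expLin x * expLin y := by
  have h : expCoalg.comp (Bialgebra.mulCoalgHom ℚ (Words 0)) =
      (Bialgebra.mulCoalgHom ℚ QS).comp (Coalgebra.TensorProduct.map expCoalg expCoalg) := by
    refine coalgHom_ext fun k t => ?_
    have h1 : co [k] ∘ₗ expLin ∘ₗ LinearMap.mul' ℚ (Words 0) =
        co [k] ∘ₗ LinearMap.mul' ℚ QS ∘ₗ TensorProduct.map expLin expLin :=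
      TensorProduct.ext' fun x y => by
        simp only [LinearMap.comp_apply, TensorProduct.map_tmul, LinearMap.mul'_apply, co_letter,
          letterPoly_expLin, map_mul]
    exact LinearMap.congr_fun h1 t
  exact DFunLike.congr_fun h (x ⊗ₜ y)

/-- The exponential, as a homomorphism of bialgebras. -/
def expHom : Words 0 →ₐc[ℚ] QS :=
  BialgHom.ofAlgHom (algHom expLin expLin_one fun _ _ => expLin_mul _ _)
    (AlgHom.ext counit_expLin) (AlgHom.ext fun x => (comul_expLin x).symm)

theorem expLin_isHom (j : ℤ) (x : Words 0) (hx : gr.IsHom j x) : gr.IsHom j (expLin x) := by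
  refine Grading.map_of_span (s := fun i => i) span_wd ?_ j x hx
  rintro _ ⟨u, rfl⟩
  refine ⟨weight u, wd_isHom u, ?_⟩
  clear hx
  induction h : u.length using Nat.strong_induction_on generalizing u with
  | _ n ih =>
    subst h
    cases u with
    | nil => rw [← one_def, expLin_one]; exact wd_isHom []
    | cons a u =>
      rw [expLin_cons]
      refine Grading.IsHom.sum fun i _ => ?_
      have h1 := ih (u.drop i).length (by simp) (u.drop i) rfl
      have h2 := cons_isHom (natWt ((a :: u).take (i + 1)) - 1) h1
      have h3 : ((natWt ((a :: u).take (i + 1)) - 1 : ℕ) : ℤ) + 1 + weight (u.drop i) =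
          weight (a :: u) := by
        have h4 := weight_append ((a :: u).take (i + 1)) (u.drop i)
        have h5 : (a :: u).take (i + 1) ++ u.drop i = a :: u := List.take_append_drop (i + 1) (a :: u)
        rw [h5, weight_eq_natWt ((a :: u).take (i + 1))] at h4
        rw [h4]
        have h6 : 0 < natWt ((a :: u).take (i + 1)) := by
          rw [List.take_succ_cons, natWt_cons]; omega
        omega
      rw [h3] at h2
      exact h2.smul _

/-- The span of the words of length less than `n`. -/
def shorter (lam : ℚ) (n : ℕ) : Submodule ℚ (Words lam) :=
  Submodule.span ℚ {x | ∃ u : List ℕ, u.length < n ∧ x = wd u}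

theorem shorter_mono {m n : ℕ} (h : m ≤ n) : shorter lam m ≤ shorter lam n :=
  Submodule.span_mono fun _ ⟨u, hu, hx⟩ => ⟨u, hu.trans_le h, hx⟩

theorem cons_shorter (a n : ℕ) {x : Words lam} (hx : x ∈ shorter lam n) :
    cons a x ∈ shorter lam (n + 1) := by
  have : shorter lam n ≤ (shorter lam (n + 1)).comap (cons a) := by
    rw [shorter, Submodule.span_le]
    rintro _ ⟨u, hu, rfl⟩
    rw [SetLike.mem_coe, Submodule.mem_comap, cons_wd]
    exact Submodule.subset_span ⟨a :: u, by simpa using hu, rfl⟩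
  exact this hx

theorem expLin_sub_shorter (n : ℕ) (u : List ℕ) (hu : u.length = n) :
    expLin (wd u) - wd u ∈ shorter 1 n := by
  induction n using Nat.strong_induction_on generalizing u with
  | _ n ih =>
    cases u with
    | nil => rw [← one_def, expLin_one, ← one_def, sub_self]; exact Submodule.zero_mem _
    | cons a u =>
      obtain rfl : u.length + 1 = n := hu
      have h1 : ∀ v : List ℕ, v.length < u.length + 1 → expLin (wd v) ∈ shorter 1 (v.length + 1) :=
        fun v hv => by
          have := Submodule.add_mem _ (shorter_mono (Nat.le_succ _) (ih v.length hv v rfl))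
            (Submodule.subset_span ⟨v, Nat.lt_succ_self _, rfl⟩ : wd v ∈ shorter 1 (v.length + 1))
          rwa [sub_add_cancel] at this
      rw [expLin_cons, Finset.sum_range_succ', add_sub_assoc]
      refine Submodule.add_mem _ (Submodule.sum_mem _ fun i hi => ?_) ?_
      · rw [Finset.mem_range] at hi
        have h2 := h1 (u.drop (i + 1)) (by simp)
        have h3 := cons_shorter (natWt ((a :: u).take (i + 1 + 1)) - 1) _ h2
        exact Submodule.smul_mem _ _ (shorter_mono (by simp; omega) h3)
      · have h2 := cons_shorter a _ (ih u.length (by omega) u rfl)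
        rw [map_sub, cons_wd] at h2
        convert h2 using 2
        simp [expBlock, natWt]

theorem expLin_surjective : Function.Surjective expLin := by
  rw [← LinearMap.range_eq_top, eq_top_iff, ← span_wd, Submodule.span_le]
  rintro _ ⟨u, rfl⟩
  rw [SetLike.mem_coe]
  induction h : u.length using Nat.strong_induction_on generalizing u with
  | _ n ih =>
    have h1 : shorter 1 n ≤ LinearMap.range expLin := by
      rw [shorter, Submodule.span_le]
      rintro _ ⟨v, hv, rfl⟩
      exact ih v.length hv v rfl
    have := Submodule.sub_mem _ (LinearMap.mem_range_self expLin (wd u))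
      (h1 (expLin_sub_shorter n u h))
    rwa [sub_sub_cancel] at this

theorem expLin_injective : Function.Injective expLin := by
  let r : QS →ₗ[ℚ] Words 0 := lift wd
  have hr : ∀ u, r (wd u) = wd u := lift_wd _
  have h1 : ∀ n, ∀ x ∈ shorter 0 n, expLin x = 0 → x = 0 := by
    intro n
    induction n with
    | zero =>
      intro x hx _
      have h0 : shorter 0 0 = ⊥ := by
        rw [eq_bot_iff, shorter, Submodule.span_le]
        rintro _ ⟨u, hu, rfl⟩
        exact absurd hu (Nat.not_lt_zero _)
      rwa [h0, Submodule.mem_bot] at hx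
    | succ n ih =>
      intro x hx h
      refine ih x ?_ h
      have h2 : shorter 0 (n + 1) ≤ (shorter 0 n).comap (r ∘ₗ expLin - LinearMap.id) := by
        rw [shorter, Submodule.span_le]
        rintro _ ⟨u, hu, rfl⟩
        have h3 : shorter 1 u.length ≤ (shorter 0 n).comap r := by
          rw [shorter, Submodule.span_le]
          rintro _ ⟨v, hv, rfl⟩
          rw [SetLike.mem_coe, Submodule.mem_comap, hr]
          exact Submodule.subset_span ⟨v, by omega, rfl⟩
        have h4 := h3 (expLin_sub_shorter _ u rfl)
        rw [Submodule.mem_comap, map_sub, hr] at h4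
        exact h4
      have h5 := h2 hx
      rw [Submodule.mem_comap, LinearMap.sub_apply, LinearMap.comp_apply, h, map_zero,
        zero_sub, LinearMap.id_apply] at h5
      exact (Submodule.neg_mem_iff _).mp h5
  have h2 : ∀ x, ∃ n, x ∈ shorter 0 n := by
    intro x
    have hx : x ∈ Submodule.span ℚ (Set.range (wd : List ℕ → Words 0)) := by
      rw [span_wd]; exact Submodule.mem_top
    induction hx using Submodule.span_induction with
    | mem x hx =>
      obtain ⟨u, rfl⟩ := hx
      exact ⟨u.length + 1, Submodule.subset_span ⟨u, Nat.lt_succ_self _, rfl⟩⟩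
    | zero => exact ⟨0, Submodule.zero_mem _⟩
    | add x y _ _ hx hy =>
      obtain ⟨m, hm⟩ := hx
      obtain ⟨n, hn⟩ := hy
      exact ⟨max m n, Submodule.add_mem _ (shorter_mono (le_max_left _ _) hm)
        (shorter_mono (le_max_right _ _) hn)⟩
    | smul a x _ hx =>
      obtain ⟨m, hm⟩ := hx
      exact ⟨m, Submodule.smul_mem _ a hm⟩
  rw [← LinearMap.ker_eq_bot, eq_bot_iff]
  intro x hx
  obtain ⟨n, hn⟩ := h2 x
  exact h1 n x hn hx

/-- Hoffman's exponential, as an isomorphism of bialgebras. -/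
def expEquiv : Words 0 ≃ₐc[ℚ] QS :=
  BialgEquiv.ofBijective expHom ⟨expLin_injective, expLin_surjective⟩

theorem expEquiv_wd (u : List ℕ) : expEquiv (wd u) = expWord u := expLin_wd u

theorem expEquiv_isHom (j : ℤ) (x : Words 0)
    (hx : (GradedBialgebra.gr : Grading ℤ (Words 0)).IsHom j x) :
    (GradedBialgebra.gr : Grading ℤ QS).IsHom j (expEquiv x) := expLin_isHom j x hx
end Words

namespace OG
variable {C : Type} [CommRing C] [Bialgebra ℚ C] [GradedBialgebra ℤ C]

/-- The antipode `f t ^ a ↦ S f t ^ (-a - |f|)`. -/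
def anti (S : C →ₗ[ℚ] C) : OG C →ₗ[ℚ] OG C :=
  lift fun a => (Finsupp.lsum ℚ fun j : ℤ => mon (-a - j) ∘ₗ S) ∘ₗ
    (GradedBialgebra.gr : Grading ℤ C).comp

theorem anti_mon (S : C →ₗ[ℚ] C) (a : ℤ) {j : ℤ} {c : C}
    (hc : (GradedBialgebra.gr : Grading ℤ C).IsHom j c) :
    anti S (mon a c) = mon (-a - j) (S c) := by
  unfold Grading.IsHom at hc
  rw [anti, lift_mon]
  simp [hc]

theorem algebraMap_eq (r : ℚ) : algebraMap ℚ (OG C) r = mon 0 (algebraMap ℚ C r) := by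
  rw [Algebra.algebraMap_eq_smul_one, Algebra.algebraMap_eq_smul_one, map_smul, one_eq]

theorem ext_comul {V : Type} [AddCommGroup V] [Module ℚ V] {a : ℤ} {f : OG C ⊗[ℚ] OG C →ₗ[ℚ] V}
    {g : C ⊗[ℚ] C →ₗ[ℚ] V}
    (h : ∀ i j x y, (GradedBialgebra.gr : Grading ℤ C).IsHom i x →
      (GradedBialgebra.gr : Grading ℤ C).IsHom j y →
      f (mon a x ⊗ₜ mon (a + i) y) = g (x ⊗ₜ y)) (c : C) :
    f (comulLin (mon a c)) = g (Coalgebra.comul (R := ℚ) c) := by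
  rw [comulLin_mon]
  refine LinearMap.congr_fun (f := f ∘ₗ shift gr ∘ₗ TensorProduct.map (mon a) LinearMap.id)
    (g := g) (LinearMap.ext_on (Grading.span_tmul_of_span
      (GradedBialgebra.gr : Grading ℤ C).span_isHom
      (GradedBialgebra.gr : Grading ℤ C).span_isHom) ?_) (Coalgebra.comul (R := ℚ) c)
  rintro _ ⟨y, ⟨i, hy⟩, z, ⟨j, hz⟩, rfl⟩
  rw [LinearMap.comp_apply, LinearMap.comp_apply, TensorProduct.map_tmul, LinearMap.id_apply,
    shift_tmul (mon_isHom a hy)]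
  exact h i j y z hy hz

theorem eq_zero_of_counit {j : ℤ} {c : C} (hc : (GradedBialgebra.gr : Grading ℤ C).IsHom j c) :
    Coalgebra.counit (R := ℚ) c = 0 ∨ j = 0 :=
  Cx.unit_isHom' (GradedBialgebra.counit_hom (J := ℤ) (C := C) hc)

theorem hasAntipode (h : HasAntipode C) : HasAntipode (OG C) := by
  obtain ⟨S, hS⟩ := h
  refine ⟨anti S, fun x => ⟨?_, ?_⟩⟩
  · refine LinearMap.congr_fun (f := LinearMap.mul' ℚ (OG C) ∘ₗ
      TensorProduct.map (anti S) LinearMap.id ∘ₗ comulLin)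
      (g := Algebra.linearMap ℚ (OG C) ∘ₗ counitLin) (lin_ext fun a c => ?_) x
    rw [LinearMap.comp_apply, LinearMap.comp_apply, LinearMap.comp_apply, counitLin_mon,
      Algebra.linearMap_apply, algebraMap_eq, ← (hS c).1]
    refine ext_comul (f := LinearMap.mul' ℚ (OG C) ∘ₗ TensorProduct.map (anti S) LinearMap.id)
      (g := mon 0 ∘ₗ LinearMap.mul' ℚ C ∘ₗ TensorProduct.map S LinearMap.id)
      (fun i j x y hx hy => ?_) c
    simp only [LinearMap.comp_apply, TensorProduct.map_tmul, LinearMap.mul'_apply,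
      LinearMap.id_apply]
    rw [anti_mon S a hx, mon_mul]
    congr 2
    ring
  · refine LinearMap.congr_fun (f := LinearMap.mul' ℚ (OG C) ∘ₗ
      TensorProduct.map LinearMap.id (anti S) ∘ₗ comulLin)
      (g := Algebra.linearMap ℚ (OG C) ∘ₗ counitLin) (lin_ext fun a => LinearMap.congr_fun
        (f := (LinearMap.mul' ℚ (OG C) ∘ₗ
          TensorProduct.map LinearMap.id (anti S) ∘ₗ comulLin) ∘ₗ mon a)
        (g := (Algebra.linearMap ℚ (OG C) ∘ₗ counitLin) ∘ₗ mon a)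
        ((GradedBialgebra.gr : Grading ℤ C).ext_hom fun j c hc => ?_)) x
    simp only [LinearMap.comp_apply]
    have h1 : algebraMap ℚ (OG C) (counitLin (mon a c)) =
        mon (-j) (algebraMap ℚ C (Coalgebra.counit (R := ℚ) c)) := by
      rw [counitLin_mon, algebraMap_eq]
      rcases eq_zero_of_counit hc with h0 | rfl
      · rw [h0, map_zero, map_zero, map_zero]
      · rw [neg_zero]
    rw [Algebra.linearMap_apply, h1, ← (hS c).2, comulLin_mon]
    refine Grading.tensor_eq_of (G := (GradedBialgebra.gr : Grading ℤ C))
      (H := (GradedBialgebra.gr : Grading ℤ C)) (f := LinearMap.mul' ℚ (OG C) ∘ₗ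
        TensorProduct.map LinearMap.id (anti S) ∘ₗ shift gr ∘ₗ
          TensorProduct.map (mon a) LinearMap.id)
      (g := mon (-j) ∘ₗ LinearMap.mul' ℚ C ∘ₗ TensorProduct.map LinearMap.id S)
      (fun i k x y hx hy hik => ?_) (GradedBialgebra.comul_hom hc)
    simp only [LinearMap.comp_apply, TensorProduct.map_tmul, LinearMap.mul'_apply,
      LinearMap.id_apply]
    rw [shift_tmul (mon_isHom a hx), TensorProduct.map_tmul, LinearMap.mul'_apply,
      LinearMap.id_apply, anti_mon S _ hy, mon_mul, ← hik]
    congr 2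
    ring

end OG

namespace Grading
variable {Γ Γ₁ Γ₂ M : Type} [AddCommGroup M] [Module ℚ M]

theorem eq_of_isHom {G H : Grading Γ M} (h : ∀ i m, G.IsHom i m → H.IsHom i m) : G = H := by
  have : G.comp = H.comp := G.ext_hom fun i m hm => (show G.comp m = _ from hm).trans (h i m hm).symm
  cases G; cases H; cases this; rfl

theorem isHom_of_coarsen {G : Grading Γ M} {p : Γ → Γ₁} {q : Γ → Γ₂} {k : Γ}
    (hk : ∀ l, p l = p k → q l = q k → l = k) {m : M} (h1 : (G.coarsen p).IsHom (p k) m)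
    (h2 : (G.coarsen q).IsHom (q k) m) : G.IsHom k m := by
  have key : Finsupp.lapply (p k) ∘ₗ (G.coarsen p).comp ∘ₗ Finsupp.lapply (q k) ∘ₗ
      (G.coarsen q).comp = Finsupp.lapply k ∘ₗ G.comp := by
    classical
    refine G.ext_hom fun l m hm => ?_
    have a1 : (G.coarsen p).comp m = Finsupp.single (p l) m := hm.coarsen p
    have a2 : (G.coarsen q).comp m = Finsupp.single (q l) m := hm.coarsen q
    have a3 : G.comp m = Finsupp.single l m := hm
    simp only [LinearMap.comp_apply, a2, a3, Finsupp.lapply_apply, Finsupp.single_apply]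
    split_ifs with b1 b2 b2
    · rw [a1, b2, Finsupp.single_eq_same]
    · rw [a1, Finsupp.single_apply, if_neg fun b3 => b2 (hk l b3 b1)]
    · exact absurd (b2 ▸ rfl) b1
    · simp
  have h3 := LinearMap.congr_fun key m
  have a1 : (G.coarsen p).comp m = Finsupp.single (p k) m := h1
  have a2 : (G.coarsen q).comp m = Finsupp.single (q k) m := h2
  simp only [LinearMap.comp_apply, a2, Finsupp.lapply_apply, Finsupp.single_eq_same, a1] at h3
  rw [h3]
  exact G.isHom_comp k m

section combine
variable (G : Grading Γ₁ M) (H : Grading Γ₂ M) (r : Γ₁ → Γ₂ → Γ)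

/-- The components with respect to two gradings. -/
def combineComp : M →ₗ[ℚ] (Γ →₀ M) :=
  (Finsupp.lsum ℚ fun j => Finsupp.lmapDomain M ℚ (fun i => r i j) ∘ₗ G.comp) ∘ₗ H.comp

theorem combineComp_apply {G : Grading Γ₁ M} {H : Grading Γ₂ M} {i : Γ₁} {j : Γ₂} {m : M}
    (h1 : G.IsHom i m) (h2 : H.IsHom j m) :
    combineComp G H r m = Finsupp.single (r i j) m := by
  unfold IsHom at h1 h2
  simp [combineComp, h1, h2]

/-- The common refinement of two compatible gradings. -/
def combine (h : ∀ i m j, G.IsHom i m → G.IsHom i (H.comp m j)) : Grading Γ M :=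
  ofSpan (combineComp G H r) <| by
    rw [eq_top_iff, ← G.span_isHom, Submodule.span_le]
    rintro m ⟨i, hm⟩
    rw [← H.sum_comp m]
    exact Submodule.sum_mem _ fun j _ => Submodule.subset_span
      ⟨r i j, combineComp_apply r (h i m j hm) (H.isHom_comp j m)⟩

variable {G H} {h : ∀ i m j, G.IsHom i m → G.IsHom i (H.comp m j)}

theorem combine_isHom {i : Γ₁} {j : Γ₂} {m : M} (h1 : G.IsHom i m) (h2 : H.IsHom j m) :
    (combine G H r h).IsHom (r i j) m := combineComp_apply r h1 h2

theorem combine_coarsen_fst (p : Γ → Γ₁) (hp : ∀ i j, p (r i j) = i) :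
    (combine G H r h).coarsen p = G := by
  refine (eq_of_isHom fun i m hm => ?_).symm
  rw [← H.sum_comp m]
  refine IsHom.sum fun j _ => ?_
  have := (combine_isHom r (h := h) (h i m j hm) (H.isHom_comp j m)).coarsen p
  rwa [hp] at this

theorem combine_coarsen_snd (q : Γ → Γ₂) (hq : ∀ i j, q (r i j) = j) :
    (combine G H r h).coarsen q = H := by
  refine (eq_of_isHom fun j m hm => ?_).symm
  have hc : ∀ i, H.IsHom j (G.comp m i) := by
    intro i
    have key : Finsupp.lapply j ∘ₗ H.comp ∘ₗ Finsupp.lapply i ∘ₗ G.comp =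
        Finsupp.lapply i ∘ₗ G.comp ∘ₗ Finsupp.lapply j ∘ₗ H.comp := by
      classical
      refine G.ext_hom fun k m hm => ?_
      have a1 : G.comp m = Finsupp.single k m := hm
      have a2 : G.comp (H.comp m j) = Finsupp.single k (H.comp m j) := h k m j hm
      simp only [LinearMap.comp_apply, a1, a2, Finsupp.lapply_apply, Finsupp.single_apply]
      split_ifs
      · rfl
      · simp
    have h1 := LinearMap.congr_fun key m
    have a1 : H.comp m = Finsupp.single j m := hm
    simp only [LinearMap.comp_apply, a1, Finsupp.lapply_apply, Finsupp.single_eq_same] at h1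
    rw [← h1]
    exact H.isHom_comp j _
  rw [← G.sum_comp m]
  refine IsHom.sum fun i _ => ?_
  have := (combine_isHom r (h := h) (G.isHom_comp i m) (hc i)).coarsen q
  rwa [hq] at this

end combine
end Grading

theorem contract_counit_comm_comul {C : Type} [AddCommGroup C] [Module ℚ C] [Coalgebra ℚ C]
    (c : C) : Words.contract Coalgebra.counit
      (TensorProduct.comm ℚ C C (Coalgebra.comul (R := ℚ) c)) = c := by
  have h : ∀ t : C ⊗[ℚ] C, Words.contract (Coalgebra.counit (R := ℚ) (A := C))
      (TensorProduct.comm ℚ C C t) =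
      TensorProduct.lid ℚ C (LinearMap.rTensor C (Coalgebra.counit (R := ℚ)) t) := by
    intro t
    induction t with
    | zero => simp
    | add s t hs ht => simp only [map_add, hs, ht]
    | tmul x y => rfl
  rw [h, Coalgebra.rTensor_counit_comul, TensorProduct.lid_tmul, one_smul]

namespace OG
variable {C : Type} [CommRing C] [Bialgebra ℚ C] [GradedBialgebra ℤ C]

/-- The counit of the coefficient of `t ^ i`. -/
def wtFun (i : ℤ) : OG C →ₗ[ℚ] ℚ := lift fun a => if a = i then Coalgebra.counit else 0

theorem wtFun_mon (i a : ℤ) (c : C) :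
    wtFun i (mon a c) = if a = i then Coalgebra.counit (R := ℚ) c else 0 := by
  rw [wtFun, lift_mon]
  split_ifs <;> rfl

/-- The value at `t = 1`. -/
def evalOne : OG C →ₗ[ℚ] C := lift fun _ => LinearMap.id

theorem evalOne_mon (a : ℤ) (c : C) : evalOne (mon a c) = c := lift_mon _ a c

/-- The coefficient of `t ^ i`. -/
def coeffAt (i : ℤ) : OG C →ₗ[ℚ] C := lift fun a => if a = i then LinearMap.id else 0

theorem coeffAt_mon (i a : ℤ) (c : C) : coeffAt i (mon a c) = if a = i then c else 0 := by
  rw [coeffAt, lift_mon]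
  split_ifs <;> rfl

theorem conv_wtFun (i j : ℤ) : Words.conv (Coalgebra.comul (A := OG C)) (wtFun i) (wtFun j) =
    if i = j then (wtFun i : OG C →ₗ[ℚ] ℚ) else 0 := by
  refine lin_ext fun a c => ?_
  have h1 := ext_comul (a := a) (f := LinearMap.mul' ℚ ℚ ∘ₗ TensorProduct.map (wtFun i) (wtFun j))
    (g := if a = i ∧ a = j then LinearMap.mul' ℚ ℚ ∘ₗ TensorProduct.map
      (Coalgebra.counit (R := ℚ) (A := C)) (Coalgebra.counit (R := ℚ) (A := C)) else 0)
    (fun k l x y hx hy => by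
      rw [LinearMap.comp_apply, TensorProduct.map_tmul, LinearMap.mul'_apply, wtFun_mon, wtFun_mon]
      rcases eq_zero_of_counit hx with h0 | rfl
      · rw [h0]
        split_ifs <;> simp [h0]
      · rw [add_zero]
        by_cases h1 : a = i
        · by_cases h2 : a = j
          · rw [if_pos h1, if_pos h2, if_pos ⟨h1, h2⟩]
            rfl
          · rw [if_neg h2, if_neg (show ¬ (a = i ∧ a = j) from fun h => h2 h.2), mul_zero]
            rfl
        · rw [if_neg h1, if_neg (show ¬ (a = i ∧ a = j) from fun h => h1 h.1), zero_mul]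
          rfl) c
  refine h1.trans ?_
  have h2 : LinearMap.mul' ℚ ℚ (TensorProduct.map
      (Coalgebra.counit (R := ℚ) (A := C)) (Coalgebra.counit (R := ℚ) (A := C))
      (Coalgebra.comul (R := ℚ) c)) = Coalgebra.counit (R := ℚ) c :=
    LinearMap.congr_fun (Words.conv_counit_left (Coalgebra.counit (R := ℚ) (A := C))) c
  by_cases hij : i = j
  · subst hij
    rw [if_pos rfl, wtFun_mon]
    by_cases ha : a = i
    · rw [if_pos ⟨ha, ha⟩, if_pos ha]
      exact h2
    · rw [if_neg fun h => ha h.1, if_neg ha]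
      rfl
  · rw [if_neg hij, if_neg fun h => hij (h.1.symm.trans h.2)]
    rfl

section
variable {N : Type} [AddCommGroup N] [Module ℚ N]

theorem evalOne_shift (K : Grading ℤ N) (t : N ⊗[ℚ] C) :
    TensorProduct.map LinearMap.id evalOne (shift K t) = t := by
  refine LinearMap.congr_fun (f := TensorProduct.map LinearMap.id evalOne ∘ₗ shift K)
    (g := LinearMap.id) (LinearMap.ext_on (Grading.span_tmul_of_span K.span_isHom
      (GradedBialgebra.gr : Grading ℤ C).span_isHom) ?_) t
  rintro _ ⟨m, ⟨i, hm⟩, c, -, rfl⟩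
  rw [LinearMap.comp_apply, shift_tmul hm, TensorProduct.map_tmul, evalOne_mon]
  rfl

theorem contract_wtFun_shift (K : Grading ℤ N) (i : ℤ) (t : N ⊗[ℚ] C) :
    Words.contract (wtFun i) (shift K t) = K.comp (Words.contract Coalgebra.counit t) i := by
  classical
  refine LinearMap.congr_fun (f := Words.contract (wtFun i) ∘ₗ shift K)
    (g := Finsupp.lapply i ∘ₗ K.comp ∘ₗ Words.contract Coalgebra.counit)
    (LinearMap.ext_on (Grading.span_tmul_of_span K.span_isHom
      (GradedBialgebra.gr : Grading ℤ C).span_isHom) ?_) t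
  rintro _ ⟨m, ⟨j, hm⟩, c, -, rfl⟩
  have h : K.comp m = Finsupp.single j m := hm
  rw [LinearMap.comp_apply, shift_tmul hm, Words.contract_tmul, wtFun_mon, LinearMap.comp_apply,
    LinearMap.comp_apply, Words.contract_tmul, map_smul, h, Finsupp.lapply_apply,
    Finsupp.smul_apply, Finsupp.single_apply]
  split_ifs <;> simp

theorem coeffAt_shift (K : Grading ℤ N) (i : ℤ) (t : N ⊗[ℚ] C) :
    TensorProduct.map LinearMap.id (coeffAt i) (shift K t) =
      TensorProduct.map (Finsupp.lapply i ∘ₗ K.comp) LinearMap.id t := by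
  classical
  refine LinearMap.congr_fun (f := TensorProduct.map LinearMap.id (coeffAt i) ∘ₗ shift K)
    (g := TensorProduct.map (Finsupp.lapply i ∘ₗ K.comp) LinearMap.id)
    (LinearMap.ext_on (Grading.span_tmul_of_span K.span_isHom
      (GradedBialgebra.gr : Grading ℤ C).span_isHom) ?_) t
  rintro _ ⟨m, ⟨j, hm⟩, c, -, rfl⟩
  have h : K.comp m = Finsupp.single j m := hm
  rw [LinearMap.comp_apply, shift_tmul hm, TensorProduct.map_tmul, TensorProduct.map_tmul,
    coeffAt_mon, LinearMap.comp_apply, h, Finsupp.lapply_apply, Finsupp.single_apply]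
  split_ifs <;> simp

/-- Elements of `N ⊗ OG C` are determined by their coefficients. -/
theorem eq_of_coeffAt {s t : N ⊗[ℚ] OG C}
    (h : ∀ i, TensorProduct.map LinearMap.id (coeffAt i) s =
      TensorProduct.map LinearMap.id (coeffAt i) t) : s = t := by
  let F : N ⊗[ℚ] OG C ≃ₗ[ℚ] (ℤ →₀ N ⊗[ℚ] C) := TensorProduct.congr (LinearEquiv.refl ℚ N)
    (AddMonoidAlgebra.coeffLinearEquiv ℚ : AddMonoidAlgebra C ℤ ≃ₗ[ℚ] _) ≪≫ₗ
      TensorProduct.finsuppRight ℚ ℚ N C ℤ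
  have hF : ∀ i t, F t i = TensorProduct.map LinearMap.id (coeffAt i) t := fun i t => by
    refine LinearMap.congr_fun (f := Finsupp.lapply i ∘ₗ F.toLinearMap)
      (g := TensorProduct.map LinearMap.id (coeffAt i)) (TensorProduct.ext' fun m x => ?_) t
    have h1 : coeffAt i = Finsupp.lapply i ∘ₗ
        (AddMonoidAlgebra.coeffLinearEquiv ℚ : AddMonoidAlgebra C ℤ ≃ₗ[ℚ] _).toLinearMap := by
      refine lin_ext fun a c => ?_
      rw [coeffAt_mon]
      exact (Finsupp.single_apply).symm
    rw [TensorProduct.map_tmul, h1]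
    change TensorProduct.finsuppRight ℚ ℚ N C ℤ (m ⊗ₜ
      (AddMonoidAlgebra.coeffLinearEquiv ℚ : AddMonoidAlgebra C ℤ ≃ₗ[ℚ] _) x) i = _
    rw [TensorProduct.finsuppRight_apply_tmul_apply]
    rfl
  exact F.injective (Finsupp.ext fun i => by rw [hF, hF, h])

end

/-- The components for the weights, of an element of `N ⊗ OG C`. -/
def wtComp (N : Type) [AddCommGroup N] [Module ℚ N] : N ⊗[ℚ] OG C →ₗ[ℚ] (ℤ →₀ N) :=
  TensorProduct.lift (LinearMap.flip (lift fun a =>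
    (Coalgebra.counit (R := ℚ) (A := C)).smulRight (Finsupp.lsingle a : N →ₗ[ℚ] ℤ →₀ N)))

theorem wtComp_apply {N : Type} [AddCommGroup N] [Module ℚ N] (t : N ⊗[ℚ] OG C) (i : ℤ) :
    wtComp N t i = Words.contract (wtFun i) t := by
  refine LinearMap.congr_fun (f := Finsupp.lapply i ∘ₗ wtComp N) (g := Words.contract (wtFun i))
    (TensorProduct.ext' fun m x => ?_) t
  refine LinearMap.congr_fun (f := (Finsupp.lapply i ∘ₗ wtComp N) ∘ₗ TensorProduct.mk ℚ _ _ m)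
    (g := Words.contract (wtFun i) ∘ₗ TensorProduct.mk ℚ _ _ m) (lin_ext fun a c => ?_) x
  simp only [LinearMap.comp_apply, TensorProduct.mk_apply, Words.contract_tmul, wtFun_mon, wtComp,
    TensorProduct.lift.tmul, LinearMap.flip_apply, lift_mon, LinearMap.smulRight_apply,
    LinearMap.smul_apply, Finsupp.lsingle_apply, Finsupp.lapply_apply, Finsupp.smul_apply]
  classical
  rw [Finsupp.single_apply]
  split_ifs <;> simp

theorem wtComp_sum {N : Type} [AddCommGroup N] [Module ℚ N] (t : N ⊗[ℚ] OG C) :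
    ((wtComp N t).sum fun _ x => x) = Words.contract counitLin t := by
  refine LinearMap.congr_fun (f := Finsupp.lsum ℚ (fun _ : ℤ => (LinearMap.id : N →ₗ[ℚ] N)) ∘ₗ
    wtComp N) (g := Words.contract counitLin) (TensorProduct.ext' fun m x => ?_) t
  refine LinearMap.congr_fun (f := (Finsupp.lsum ℚ (fun _ : ℤ => (LinearMap.id : N →ₗ[ℚ] N)) ∘ₗ
    wtComp N) ∘ₗ TensorProduct.mk ℚ _ _ m)
    (g := Words.contract counitLin ∘ₗ TensorProduct.mk ℚ _ _ m) (lin_ext fun a c => ?_) x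
  simp only [LinearMap.comp_apply, TensorProduct.mk_apply, Words.contract_tmul, counitLin_mon,
    wtComp, TensorProduct.lift.tmul, LinearMap.flip_apply, lift_mon, LinearMap.smulRight_apply,
    LinearMap.smul_apply, Finsupp.lsingle_apply, map_smul]
  simp

theorem wtFun_comul (i a : ℤ) (c : C) :
    Words.contract (wtFun i) (TensorProduct.comm ℚ _ _ (comulLin (mon a c))) =
      mon i (coeffAt i (mon a c)) := by
  have h1 := ext_comul (a := a)
    (f := Words.contract (wtFun i) ∘ₗ (TensorProduct.comm ℚ (OG C) (OG C)).toLinearMap)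
    (g := if a = i then mon i ∘ₗ Words.contract (Coalgebra.counit (R := ℚ) (A := C)) ∘ₗ
      (TensorProduct.comm ℚ C C).toLinearMap else 0)
    (fun k l x y hx hy => by
      rw [LinearMap.comp_apply, LinearEquiv.coe_coe, TensorProduct.comm_tmul, Words.contract_tmul,
        wtFun_mon]
      rcases eq_zero_of_counit hx with h0 | rfl
      · by_cases h1 : a = i
        · rw [if_pos h1, if_pos h1, h0, zero_smul, LinearMap.comp_apply, LinearMap.comp_apply,
            LinearEquiv.coe_coe, TensorProduct.comm_tmul, Words.contract_tmul, h0, zero_smul,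
            map_zero]
        · rw [if_neg h1, if_neg h1, zero_smul, LinearMap.zero_apply]
      · by_cases h1 : a = i
        · rw [if_pos h1, if_pos h1, h1, add_zero, LinearMap.comp_apply, LinearMap.comp_apply,
            LinearEquiv.coe_coe, TensorProduct.comm_tmul, Words.contract_tmul, map_smul]
        · rw [if_neg h1, if_neg h1, zero_smul, LinearMap.zero_apply]) c
  refine h1.trans ?_
  rw [coeffAt_mon]
  by_cases h : a = i
  · rw [if_pos h, if_pos h]
    exact congrArg (mon i) (contract_counit_comm_comul c)
  · rw [if_neg h, if_neg h]
    exact (map_zero (mon i)).symm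

section reconstruct
variable (V : DGComod PUnit (OG C))

theorem op_wtFun (i j : ℤ) (n : V.X) :
    V.op (wtFun i) (V.op (wtFun j) n) = if i = j then V.op (wtFun i) n else 0 := by
  rw [DGComod.op_op, conv_wtFun]
  split_ifs
  · rfl
  · simp [DGComod.op, Words.contract]

/-- The weight grading of a representation. -/
def weightGr : Grading ℤ V.X where
  comp := wtComp V.X ∘ₗ V.coact
  comp_comp m i := by
    classical
    ext j
    rw [LinearMap.comp_apply, LinearMap.comp_apply, wtComp_apply, wtComp_apply]
    have := op_wtFun V j i m
    refine this.trans ?_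
    rw [Finsupp.single_apply]
    split_ifs with h h' h'
    · rw [h]; rfl
    · exact absurd h.symm h'
    · exact absurd h'.symm h
    · rfl
  sum_comp m := by
    rw [LinearMap.comp_apply, wtComp_sum]
    have h := V.coact_counit m
    change TensorProduct.rid ℚ V.X (TensorProduct.map LinearMap.id
      (Coalgebra.counit (R := ℚ) (A := OG C)) (V.coact m)) = m
    rw [h]
    simp

theorem weightGr_comp (i : ℤ) (n : V.X) : (weightGr V).comp n i = V.op (wtFun i) n :=
  wtComp_apply _ _

theorem op_isHom (φ : OG C →ₗ[ℚ] ℚ) (i : ℤ × PUnit) (n : V.X) (hn : V.gr.IsHom i n) :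
    V.gr.IsHom i (V.op φ n) := by
  refine Grading.tensor_map (s := fun i => i) (G := V.gr) (H := cgr PUnit (OG C))
    (f := Words.contract φ) (fun a b m x hm hx => ?_) i _ (V.coact_hom i n hn)
  rcases Grading.inc_isHom hx with rfl | ⟨h1, -⟩
  · rw [TensorProduct.tmul_zero, map_zero]; exact Grading.IsHom.zero _ _
  · rw [Words.contract_tmul]
    have : a + b = a := Prod.ext (by rw [Prod.fst_add, h1, add_zero]) rfl
    rw [this]
    exact hm.smul _

/-- The grading of a representation by complex degree and weight. -/
def biGr : Grading (ℤ × ℤ) V.X :=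
  V.gr.combine (weightGr V) (fun i j => (i.1, j)) fun i m j hm => by
    rw [weightGr_comp]
    exact op_isHom V _ i m hm

theorem biGr_coarsen_fst : (biGr V).coarsen (fun i => (i.1, PUnit.unit)) = V.gr :=
  Grading.combine_coarsen_fst _ _ fun _ _ => rfl

theorem biGr_coarsen_snd : (biGr V).coarsen Prod.snd = weightGr V :=
  Grading.combine_coarsen_snd _ _ fun _ _ => rfl

/-- The coaction of `C` on a representation. -/
def coactOne : V.X →ₗ[ℚ] V.X ⊗[ℚ] C := TensorProduct.map LinearMap.id evalOne ∘ₗ V.coact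

theorem op_coact (i : ℤ) (n : V.X) :
    TensorProduct.map (V.op (wtFun i)) LinearMap.id (V.coact n) =
      TensorProduct.map LinearMap.id (mon i ∘ₗ coeffAt i) (V.coact n) := by
  have h1 : ∀ t : V.X ⊗[ℚ] OG C, TensorProduct.map (V.op (wtFun i)) LinearMap.id t =
      TensorProduct.map LinearMap.id (Words.contract (wtFun i) ∘ₗ
        (TensorProduct.comm ℚ (OG C) (OG C)).toLinearMap) (TensorProduct.assoc ℚ _ _ _
          (TensorProduct.map V.coact LinearMap.id t)) := by
    intro t
    induction t with
    | zero => simp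
    | add s t hs ht => simp only [map_add, hs, ht]
    | tmul m x =>
      rw [TensorProduct.map_tmul, TensorProduct.map_tmul, DGComod.op, LinearMap.comp_apply]
      induction V.coact m with
      | zero => simp
      | add s t hs ht => simp only [map_add, TensorProduct.add_tmul, hs, ht]
      | tmul a b =>
        rw [TensorProduct.assoc_tmul, Words.contract_tmul, TensorProduct.map_tmul,
          TensorProduct.smul_tmul]
        rfl
  rw [h1, V.coassoc]
  have h2 : ∀ x : OG C, Words.contract (wtFun i)
      (TensorProduct.comm ℚ _ _ (Coalgebra.comul (R := ℚ) x)) = mon i (coeffAt i x) :=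
    LinearMap.congr_fun (f := Words.contract (wtFun i) ∘ₗ
        (TensorProduct.comm ℚ (OG C) (OG C)).toLinearMap ∘ₗ comulLin) (g := mon i ∘ₗ coeffAt i)
      (lin_ext (wtFun_comul i))
  induction V.coact n with
  | zero => simp
  | add s t hs ht => simp only [map_add, hs, ht]
  | tmul m x =>
    rw [TensorProduct.map_tmul, TensorProduct.map_tmul, TensorProduct.map_tmul,
      LinearMap.comp_apply, LinearMap.comp_apply, LinearEquiv.coe_coe, h2]
    rfl

theorem shift_coactOne (n : V.X) : shift (weightGr V) (coactOne V n) = V.coact n := by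
  refine eq_of_coeffAt fun i => ?_
  rw [coeffAt_shift]
  have h1 : Finsupp.lapply i ∘ₗ (weightGr V).comp = V.op (wtFun i) :=
    LinearMap.ext fun n => weightGr_comp V i n
  have h2 : ∀ t : V.X ⊗[ℚ] OG C, TensorProduct.map (V.op (wtFun i)) LinearMap.id
      (TensorProduct.map LinearMap.id (evalOne (C := C)) t) =
      TensorProduct.map LinearMap.id evalOne (TensorProduct.map (V.op (wtFun i)) LinearMap.id t) :=
    LinearMap.congr_fun (f := TensorProduct.map (V.op (wtFun i)) LinearMap.id ∘ₗ
      TensorProduct.map LinearMap.id (evalOne (C := C)))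
      (g := TensorProduct.map LinearMap.id evalOne ∘ₗ
        TensorProduct.map (V.op (wtFun i)) LinearMap.id) (TensorProduct.ext' fun _ _ => rfl)
  have h3 : (evalOne : OG C →ₗ[ℚ] C) ∘ₗ (mon i ∘ₗ coeffAt i) = coeffAt i :=
    LinearMap.ext fun x => evalOne_mon i _
  rw [h1, coactOne, LinearMap.comp_apply, h2, op_coact]
  exact (LinearMap.congr_fun (TensorProduct.map_comp (LinearMap.id : V.X →ₗ[ℚ] V.X)
    evalOne LinearMap.id (mon i ∘ₗ coeffAt i)) (V.coact n)).symm.trans (by rw [h3]; rfl)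

end reconstruct
end OG

theorem DGComod.coact_op {J C : Type} [AddCommGroup J] [CommRing C] [Bialgebra ℚ C]
    [GradedBialgebra J C] (N : DGComod J C) (φ : C →ₗ[ℚ] ℚ) (n : N.X) :
    N.coact (N.op φ n) = TensorProduct.map LinearMap.id
      (Words.contract φ ∘ₗ Coalgebra.comul (R := ℚ)) (N.coact n) := by
  have h1 : ∀ t : N.X ⊗[ℚ] C, N.coact (Words.contract φ t) = TensorProduct.map LinearMap.id
      (Words.contract φ) (TensorProduct.assoc ℚ N.X C C
        (TensorProduct.map N.coact LinearMap.id t)) := by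
    intro t
    induction t with
    | zero => simp
    | add s t hs ht => simp only [map_add, hs, ht]
    | tmul m x =>
      rw [Words.contract_tmul, map_smul, TensorProduct.map_tmul, LinearMap.id_apply]
      induction N.coact m with
      | zero => simp
      | add s t hs ht => simp only [map_add, smul_add, TensorProduct.add_tmul, hs, ht]
      | tmul a b =>
        rw [TensorProduct.assoc_tmul, TensorProduct.map_tmul, Words.contract_tmul,
          TensorProduct.tmul_smul]
        rfl
  rw [DGComod.op, LinearMap.comp_apply, h1, N.coassoc]
  induction N.coact n with
  | zero => simp
  | add s t hs ht => simp only [map_add, hs, ht]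
  | tmul m x => rfl

namespace OG
variable {C : Type} [CommRing C] [Bialgebra ℚ C] [GradedBialgebra ℤ C]

theorem comul_evalOne (x : OG C) : Coalgebra.comul (R := ℚ) (evalOne x) =
    TensorProduct.map evalOne evalOne (Coalgebra.comul (R := ℚ) x) := by
  refine LinearMap.congr_fun (f := Coalgebra.comul (R := ℚ) (A := C) ∘ₗ evalOne)
    (g := TensorProduct.map evalOne evalOne ∘ₗ comulLin) (lin_ext fun a c => ?_) x
  rw [LinearMap.comp_apply, LinearMap.comp_apply, evalOne_mon]
  refine ((ext_comul (a := a) (f := TensorProduct.map evalOne evalOne) (g := LinearMap.id)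
    (fun k l x y hx hy => ?_) c).trans rfl).symm
  rw [TensorProduct.map_tmul, evalOne_mon, evalOne_mon]
  rfl

theorem counit_evalOne (x : OG C) :
    Coalgebra.counit (R := ℚ) (evalOne x) = Coalgebra.counit (R := ℚ) x := by
  refine LinearMap.congr_fun (f := Coalgebra.counit (R := ℚ) (A := C) ∘ₗ evalOne)
    (g := counitLin) (lin_ext fun a c => ?_) x
  rw [LinearMap.comp_apply, evalOne_mon, counitLin_mon]

theorem contract_wtFun_comul (i : ℤ) (x : OG C) :
    Words.contract (wtFun i) (comulLin x) = (gr : Grading ℤ (OG C)).comp x i := by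
  rw [comulLin, LinearMap.comp_apply, contract_wtFun_shift]
  congr 2
  have h : TensorProduct.map LinearMap.id (Coalgebra.counit (R := ℚ)) (coactC x) =
    x ⊗ₜ[ℚ] (1 : ℚ) := coactC_counit x
  rw [Words.contract, LinearMap.comp_apply, h]
  simp

theorem shift_comp {N : Type} [AddCommGroup N] [Module ℚ N] (K : Grading ℤ N) (i : ℤ)
    (t : N ⊗[ℚ] C) : TensorProduct.map LinearMap.id (Finsupp.lapply i ∘ₗ
      (gr : Grading ℤ (OG C)).comp) (shift K t) =
      shift K ((K.tensor (GradedBialgebra.gr : Grading ℤ C)).comp t i) := by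
  classical
  refine LinearMap.congr_fun (f := TensorProduct.map LinearMap.id (Finsupp.lapply i ∘ₗ
      (gr : Grading ℤ (OG C)).comp) ∘ₗ shift K)
    (g := shift K ∘ₗ Finsupp.lapply i ∘ₗ (K.tensor (GradedBialgebra.gr : Grading ℤ C)).comp)
    (LinearMap.ext_on (Grading.span_tmul_of_span K.span_isHom
      (GradedBialgebra.gr : Grading ℤ C).span_isHom) ?_) t
  rintro _ ⟨m, ⟨j, hm⟩, c, ⟨k, hc⟩, rfl⟩
  have h1 : (gr : Grading ℤ (OG C)).comp (mon j c) = Finsupp.single (j + k) (mon j c) :=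
    mon_isHom j hc
  have h2 : (K.tensor (GradedBialgebra.gr : Grading ℤ C)).comp (m ⊗ₜ c) =
    Finsupp.single (j + k) (m ⊗ₜ c) := hm.tmul hc
  rw [LinearMap.comp_apply, shift_tmul hm, TensorProduct.map_tmul, LinearMap.comp_apply, h1,
    LinearMap.comp_apply, LinearMap.comp_apply, h2, Finsupp.lapply_apply, Finsupp.lapply_apply,
    Finsupp.single_apply, Finsupp.single_apply]
  split_ifs
  · rw [shift_tmul hm]; rfl
  · simp

section reconstruct
variable (V : DGComod PUnit (OG C))

theorem coactOne_wt {j : ℤ} {n : V.X} (hn : (weightGr V).IsHom j n) :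
    ((weightGr V).tensor (GradedBialgebra.gr : Grading ℤ C)).IsHom j (coactOne V n) := by
  classical
  have hinj : Function.Injective (shift (C := C) (weightGr V)) :=
    Function.LeftInverse.injective (evalOne_shift (weightGr V))
  have hc : ∀ i, (Words.contract (wtFun i) ∘ₗ Coalgebra.comul (R := ℚ) : OG C →ₗ[ℚ] OG C) =
      Finsupp.lapply i ∘ₗ (gr : Grading ℤ (OG C)).comp := fun i =>
    LinearMap.ext (contract_wtFun_comul i)
  refine Finsupp.ext fun i => hinj ?_
  rw [← shift_comp, shift_coactOne, ← hc, ← DGComod.coact_op, ← weightGr_comp,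
    show (weightGr V).comp n = _ from hn, Finsupp.single_apply, Finsupp.single_apply]
  split_ifs
  · rw [shift_coactOne]
  · rw [map_zero, map_zero]

theorem tmul_coarsen_fst {c : ℤ × PUnit} {m : V.X} (hm : V.gr.IsHom c m) (y : C) :
    (((biGr V).tensor (cgr ℤ C)).coarsen (fun i => (i.1, PUnit.unit))).IsHom c (m ⊗ₜ y) := by
  rw [← biGr_coarsen_fst] at hm
  refine Grading.coarsen_map (s := fun i => i) (f := (TensorProduct.mk ℚ V.X C).flip y)
    (fun i m hm => ?_) c m hm
  rw [← (GradedBialgebra.gr : Grading ℤ C).sum_comp y, Finsupp.sum, map_sum,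
    LinearMap.sum_apply]
  refine Grading.IsHom.sum fun b _ => ?_
  have h1 := (hm.tmul ((GradedBialgebra.gr : Grading ℤ C).isHom_comp b y).inc).coarsen
    (fun i => (i.1, PUnit.unit))
  rw [Prod.fst_add, add_zero] at h1
  exact h1

theorem coactOne_hom (i : ℤ × ℤ) (n : V.X) (hn : (biGr V).IsHom i n) :
    ((biGr V).tensor (cgr ℤ C)).IsHom i (coactOne V n) := by
  refine Grading.isHom_of_coarsen (p := fun i => (i.1, PUnit.unit)) (q := Prod.snd)
    (fun l h1 h2 => Prod.ext (Prod.mk.inj h1).1 h2) ?_ ?_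
  · have h1 := hn.coarsen (fun i => (i.1, PUnit.unit))
    rw [biGr_coarsen_fst] at h1
    refine Grading.tensor_map (s := fun i => i) (G := V.gr) (H := cgr PUnit (OG C))
      (f := TensorProduct.map LinearMap.id evalOne) (fun a b m x hm hx => ?_) _ _
      (V.coact_hom _ n h1)
    rcases Grading.inc_isHom hx with rfl | ⟨h1, -⟩
    · rw [TensorProduct.tmul_zero, map_zero]; exact Grading.IsHom.zero _ _
    · have : a + b = a := Prod.ext (by rw [Prod.fst_add, h1, add_zero]) rfl
      rw [this]
      exact tmul_coarsen_fst V hm _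
  · have h1 := hn.coarsen Prod.snd
    rw [biGr_coarsen_snd] at h1
    refine Grading.tensor_map (s := fun i => i) (f := LinearMap.id) (G := weightGr V)
      (H := GradedBialgebra.gr) (fun a b m x hm hx => ?_) _ _ (coactOne_wt V h1)
    rw [← biGr_coarsen_snd] at hm
    refine Grading.coarsen_map (s := fun a => a + b) (f := (TensorProduct.mk ℚ V.X C).flip x)
      (fun i m hm => ?_) a m hm
    exact (hm.tmul hx.inc).coarsen Prod.snd

/-- The graded comodule of a representation. -/
def unpbw : DGComod ℤ C where
  X := V.X
  gr := biGr V
  d := V.d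
  d_hom i n hn := by
    refine Grading.isHom_of_coarsen (p := fun i => (i.1, PUnit.unit)) (q := Prod.snd)
      (fun l h1 h2 => Prod.ext (Prod.mk.inj h1).1 h2) ?_ ?_
    · have h1 := hn.coarsen (fun i => (i.1, PUnit.unit))
      rw [biGr_coarsen_fst] at h1 ⊢
      exact V.d_hom _ n h1
    · have h1 := hn.coarsen Prod.snd
      rw [biGr_coarsen_snd] at h1 ⊢
      have h2 : (weightGr V).comp n = Finsupp.single i.2 n := h1
      change (weightGr V).comp (V.d n) = Finsupp.single (i.2 + 0) (V.d n)
      classical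
      ext k
      have h3 : V.op (wtFun k) (V.d n) = V.d (V.op (wtFun k) n) := by
        rw [DGComod.op, LinearMap.comp_apply, V.coact_d, ← Words.map_contract]
        rfl
      rw [weightGr_comp, h3, ← weightGr_comp, h2, add_zero, Finsupp.single_apply,
        Finsupp.single_apply]
      split_ifs
      · rfl
      · rw [map_zero]
  d_d := V.d_d
  coact := coactOne V
  coact_hom := coactOne_hom V
  coact_d n := by
    rw [coactOne, LinearMap.comp_apply, LinearMap.comp_apply, V.coact_d]
    exact Push.natural _ _
  coassoc := Push.coassoc comul_evalOne V.coassoc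
  coact_counit := Push.counit counit_evalOne V.coact_counit

/-- A representation is determined by its graded comodule. -/
def pbwUnpbw : (pbw C).obj (unpbw V) ≅ V :=
  DGComod.mkIso (M := (pbw C).obj (unpbw V)) (N := V)
    (Cx.mkIso (M := ((pbw C).obj (unpbw V)).toCx) (N := V.toCx) (LinearEquiv.refl ℚ V.X)
      (fun i m hm => by
        have h : ((biGr V).coarsen (fun i => (i.1, PUnit.unit))).IsHom i m := hm
        rw [biGr_coarsen_fst] at h
        exact h)
      (fun i m hm => by
        have h : V.gr.IsHom i m := hm
        rw [← biGr_coarsen_fst] at h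
        exact h)
      (fun _ => rfl))
    (fun m => by
      have h : ∀ m : V.X, V.coact m = shift ((biGr V).coarsen Prod.snd) (coactOne V m) :=
        fun m => by rw [biGr_coarsen_snd, shift_coactOne]
      exact (h m).trans (LinearMap.congr_fun (TensorProduct.map_id) _).symm)

end reconstruct

theorem pbw_op_wtFun (N : DGComod ℤ C) (i : ℤ) (n : N.X) :
    ((pbw C).obj N).op (wtFun i) n = (wt N.toCx).comp n i := by
  have h := contract_wtFun_shift (wt N.toCx) i (N.coact n)
  have h1 : Words.contract (Coalgebra.counit (R := ℚ)) (N.coact n) = n := by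
    rw [Words.contract, LinearMap.comp_apply, N.coact_counit]
    simp
  rw [h1] at h
  exact h

instance : (pbw C).Faithful where
  map_injective h := DGComod.hom_ext (congrArg (fun f => f.toLin) h)

instance : (pbw C).Full where
  map_surjective {M N} f := by
    let g : M.X →ₗ[ℚ] N.X := f.toLin
    have hg : ∀ m, shift (wt N.toCx) (N.coact (g m)) =
      TensorProduct.map g LinearMap.id (shift (wt M.toCx) (M.coact m)) := f.map_coact
    have h1 : ∀ i (m : M.X), g ((wt M.toCx).comp m i) = (wt N.toCx).comp (g m) i := by
      intro i m
      have h2 := pbw_op_wtFun M i m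
      have h3 := pbw_op_wtFun N i (g m)
      rw [← h2, ← h3]
      refine (Words.map_contract g (wtFun i) (shift (wt M.toCx) (M.coact m))).trans ?_
      rw [← hg]
      rfl
    refine ⟨{ toLin := f.toLin, map_hom := fun i m hm => ?_, map_d := f.map_d,
              map_coact := fun m => ?_ }, rfl⟩
    · refine Grading.isHom_of_coarsen (p := fun i => (i.1, PUnit.unit)) (q := Prod.snd)
        (fun l h1 h2 => Prod.ext (Prod.mk.inj h1).1 h2) ?_ ?_
      · exact f.map_hom _ m (hm.coarsen _)
      · have h2 : (wt M.toCx).comp m = Finsupp.single i.2 m := hm.coarsen Prod.snd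
        classical
        refine Finsupp.ext fun k => ?_
        refine (h1 k m).symm.trans ?_
        rw [h2, Finsupp.single_apply, Finsupp.single_apply]
        split_ifs
        · rfl
        · exact map_zero g
    · have h3 := congrArg (TensorProduct.map LinearMap.id (evalOne (C := C))) (hg m)
      rw [evalOne_shift] at h3
      have h4 := Push.natural (φ := evalOne (C := C)) g (shift (wt M.toCx) (M.coact m))
      rw [evalOne_shift] at h4
      exact h3.trans h4

instance : (pbw C).EssSurj where
  mem_essImage V := ⟨unpbw V, ⟨pbwUnpbw V⟩⟩

instance : (pbw C).IsEquivalence where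

end OG

namespace Grading
variable {Γ Γ' M N : Type} [AddCommGroup Γ] [AddCommGroup Γ'] [AddCommGroup M] [Module ℚ M]
  [AddCommGroup N] [Module ℚ N]

theorem tensor_coarsen (G : Grading Γ M) (H : Grading Γ N) {p : Γ → Γ'}
    (hp : ∀ i j, p (i + j) = p i + p j) :
    (G.tensor H).coarsen p = (G.coarsen p).tensor (H.coarsen p) :=
  eq_of_isHom <| coarsen_map (s := fun i => i) (f := LinearMap.id) <|
    tensor_map (s := p) (f := LinearMap.id) fun i j m n hm hn => by
      rw [hp]
      exact (hm.coarsen p).tmul (hn.coarsen p)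

theorem unit_coarsen {p : Γ → Γ'} (hp : p 0 = 0) : (unit Γ).coarsen p = unit Γ' :=
  eq_of_isHom <| coarsen_map (s := fun i => i) (f := LinearMap.id) fun i m hm => by
    rcases Cx.unit_isHom' hm with rfl | rfl
    · rw [map_zero]; exact IsHom.zero _ _
    · rw [hp]; rfl

theorem sign_coarsen {J J' : Type} [AddCommGroup J] [AddCommGroup J'] (G : Grading (ℤ × J) M)
    (q : J → J') : (G.coarsen fun i => (i.1, q i.2)).sign = G.sign :=
  G.ext_hom fun i m hm => by
    rw [sign_apply hm, sign_apply (hm.coarsen fun i => (i.1, q i.2))]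

theorem swap_coarsen {J J' : Type} [AddCommGroup J] [AddCommGroup J'] (G : Grading (ℤ × J) M)
    (H : Grading (ℤ × J) N) (q : J → J') :
    (G.coarsen fun i => (i.1, q i.2)).swap (H.coarsen fun i => (i.1, q i.2)) = G.swap H := by
  rw [swap, swap, sign_coarsen, sign_coarsen]

theorem dT_coarsen {J J' : Type} [AddCommGroup J] [AddCommGroup J'] (G : Grading (ℤ × J) M)
    (q : J → J') (dM : M →ₗ[ℚ] M) (dN : N →ₗ[ℚ] N) :
    (G.coarsen fun i => (i.1, q i.2)).dT dM dN = G.dT dM dN := by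
  rw [dT, dT, sign_coarsen]

end Grading

namespace OG
open Functor
variable {C : Type} [CommRing C] [Bialgebra ℚ C] [GradedBialgebra ℤ C]

theorem shift_cmb {M N : Type} [AddCommGroup M] [Module ℚ M] [AddCommGroup N] [Module ℚ N]
    (K : Grading ℤ M) (L : Grading ℤ N) (t : (M ⊗[ℚ] C) ⊗[ℚ] (N ⊗[ℚ] C)) :
    shift (K.tensor L) (cmb M N C t) =
      cmb M N (OG C) (TensorProduct.map (shift K) (shift L) t) := by
  refine LinearMap.congr_fun (f := shift (K.tensor L) ∘ₗ cmb M N C)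
    (g := cmb M N (OG C) ∘ₗ TensorProduct.map (shift K) (shift L))
    (LinearMap.ext_on (Grading.span_tmul_of_span
      (Grading.span_tmul_of_span K.span_isHom Submodule.span_univ)
      (Grading.span_tmul_of_span L.span_isHom Submodule.span_univ)) ?_) t
  rintro _ ⟨_, ⟨m, ⟨i, hm⟩, x, -, rfl⟩, _, ⟨n, ⟨j, hn⟩, y, -, rfl⟩, rfl⟩
  rw [LinearMap.comp_apply, LinearMap.comp_apply, cmb_tmul, shift_tmul (hm.tmul hn),
    TensorProduct.map_tmul, shift_tmul hm, shift_tmul hn, cmb_tmul, mon_mul]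

theorem tensor_coarsen_iff (M N : DGComod ℤ C) (i : ℤ × PUnit) (t : M.X ⊗[ℚ] N.X) :
    ((M.gr.tensor N.gr).coarsen fun i => (i.1, PUnit.unit)).IsHom i t ↔
      ((M.gr.coarsen fun i => (i.1, PUnit.unit)).tensor
        (N.gr.coarsen fun i => (i.1, PUnit.unit))).IsHom i t := by
  rw [M.gr.tensor_coarsen N.gr fun _ _ => rfl]

/-- The representation of a tensor product of graded comodules. -/
def pbwMu (M N : DGComod ℤ C) : (pbw C).obj M ⊗ (pbw C).obj N ≅ (pbw C).obj (M ⊗ N) :=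
  DGComod.mkIso (M := ((pbw C).obj M).tens ((pbw C).obj N)) (N := (pbw C).obj (M.tens N))
    (Cx.mkIso (M := (((pbw C).obj M).tens ((pbw C).obj N)).toCx)
      (N := ((pbw C).obj (M.tens N)).toCx) (LinearEquiv.refl ℚ (M.X ⊗[ℚ] N.X))
      (fun i t => (tensor_coarsen_iff M N i t).mpr) (fun i t => (tensor_coarsen_iff M N i t).mp)
      (fun t => LinearMap.congr_fun (Grading.dT_coarsen M.gr (fun _ => PUnit.unit) M.d N.d) t))
    (fun t => by
      have h : shift ((M.gr.tensor N.gr).coarsen Prod.snd) ∘ₗ coactT M.coact N.coact =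
          coactT (pcoact (wt M.toCx) M.coact) (pcoact (wt N.toCx) N.coact) := by
        rw [M.gr.tensor_coarsen N.gr fun _ _ => rfl]
        exact TensorProduct.ext' fun m n => shift_cmb _ _ (M.coact m ⊗ₜ N.coact n)
      exact (LinearMap.congr_fun h t).trans (LinearMap.congr_fun TensorProduct.map_id _).symm)

/-- The representation of the unit. -/
def pbwEps : 𝟙_ (DGComod PUnit (OG C)) ≅ (pbw C).obj (𝟙_ (DGComod ℤ C)) :=
  DGComod.mkIso (M := DGComod.unit PUnit (OG C)) (N := (pbw C).obj (DGComod.unit ℤ C))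
    (Cx.mkIso (M := Cx.one PUnit) (N := ((pbw C).obj (DGComod.unit ℤ C)).toCx)
      (LinearEquiv.refl ℚ ℚ)
      (fun i t ht => by
        have h := Grading.unit_coarsen (Γ := ℤ × ℤ) (p := fun i => (i.1, PUnit.unit)) rfl
        exact (congrArg (fun G => Grading.IsHom G i t) h).mpr ht)
      (fun i t ht => by
        have h := Grading.unit_coarsen (Γ := ℤ × ℤ) (p := fun i => (i.1, PUnit.unit)) rfl
        exact (congrArg (fun G => Grading.IsHom G i t) h).mp ht)
      (fun t => rfl))
    (fun t => by
      have h : shift ((Grading.unit (ℤ × ℤ)).coarsen Prod.snd) (t ⊗ₜ (1 : C)) =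
          t ⊗ₜ[ℚ] (1 : OG C) := by
        rw [Grading.unit_coarsen rfl, shift_tmul (show (Grading.unit ℤ).IsHom 0 t from rfl), one_eq]
        rfl
      exact h.trans (LinearMap.congr_fun TensorProduct.map_id _).symm)

instance : (pbw C).Monoidal := CoreMonoidal.toMonoidal
  { εIso := pbwEps
    μIso := pbwMu
    μIso_hom_natural_left := fun _ _ => DGComod.hom_ext (TensorProduct.ext' fun _ _ => rfl)
    μIso_hom_natural_right := fun _ _ => DGComod.hom_ext (TensorProduct.ext' fun _ _ => rfl)
    associativity := fun _ _ _ => DGComod.hom_ext (TensorProduct.ext_threefold fun _ _ _ => rfl)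
    left_unitality := fun _ => DGComod.hom_ext (TensorProduct.ext' fun _ _ => rfl)
    right_unitality := fun _ => DGComod.hom_ext (TensorProduct.ext' fun _ _ => rfl) }

instance : (pbw C).Braided where
  braided M N := by
    refine DGComod.hom_ext ?_
    have h1 := Grading.swap_coarsen M.gr N.gr fun _ => PUnit.unit
    have h2 : (LaxMonoidal.μ (pbw C) M N ≫ (pbw C).map (β_ M N).hom).toLin = M.gr.swap N.gr := rfl
    have h3 : ((β_ ((pbw C).obj M) ((pbw C).obj N)).hom ≫ LaxMonoidal.μ (pbw C) N M).toLin =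
       (M.gr.coarsen fun i => (i.1, PUnit.unit)).swap (N.gr.coarsen fun i => (i.1, PUnit.unit)) := rfl
    exact h2.trans (h1.symm.trans h3.symm)

end OG

section push
open Functor
variable {J C C' : Type} [AddCommGroup J] [CommRing C] [Bialgebra ℚ C] [GradedBialgebra J C]
  [CommRing C'] [Bialgebra ℚ C'] [GradedBialgebra J C'] (E : C ≃ₐc[ℚ] C')
  (hE : ∀ j x, (GradedBialgebra.gr : Grading J C).IsHom j x →
    (GradedBialgebra.gr : Grading J C').IsHom j (E x))

/-- The push forward of a tensor product. -/
def pushMu (M N : DGComod J C) :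
    (pushEquiv E hE).obj M ⊗ (pushEquiv E hE).obj N ≅ (pushEquiv E hE).obj (M ⊗ N) :=
  DGComod.mkIso (M := ((pushEquiv E hE).obj M).tens ((pushEquiv E hE).obj N))
    (N := (pushEquiv E hE).obj (M.tens N)) (Iso.refl (Cx.tens M.toCx N.toCx))
    (fun t => by
      have h : TensorProduct.map LinearMap.id (E : C →ₗ[ℚ] C') ∘ₗ coactT M.coact N.coact =
          coactT (TensorProduct.map LinearMap.id (E : C →ₗ[ℚ] C') ∘ₗ M.coact)
            (TensorProduct.map LinearMap.id (E : C →ₗ[ℚ] C') ∘ₗ N.coact) :=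
        TensorProduct.ext' fun m n => by
          have k := cmb_map (LinearMap.id : M.X →ₗ[ℚ] M.X) (LinearMap.id : N.X →ₗ[ℚ] N.X)
            (E : C →ₐ[ℚ] C') (M.coact m ⊗ₜ N.coact n)
          rw [TensorProduct.map_id] at k
          exact k
      exact (LinearMap.congr_fun h t).trans (LinearMap.congr_fun TensorProduct.map_id _).symm)

/-- The push forward of the unit. -/
def pushEps : 𝟙_ (DGComod J C') ≅ (pushEquiv E hE).obj (𝟙_ (DGComod J C)) :=
  DGComod.mkIso (M := DGComod.unit J C') (N := (pushEquiv E hE).obj (DGComod.unit J C))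
    (Iso.refl (Cx.one J))
    (fun t => by
      have h : TensorProduct.map LinearMap.id (E : C →ₗ[ℚ] C') (t ⊗ₜ (1 : C)) =
          t ⊗ₜ[ℚ] (1 : C') := by
        rw [TensorProduct.map_tmul]
        exact congrArg (TensorProduct.tmul ℚ t) (map_one E)
      exact h.trans (LinearMap.congr_fun TensorProduct.map_id _).symm)

instance : (pushEquiv E hE).Monoidal := CoreMonoidal.toMonoidal
  { εIso := pushEps E hE
    μIso := pushMu E hE
    μIso_hom_natural_left := fun _ _ => DGComod.hom_ext (TensorProduct.ext' fun _ _ => rfl)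
    μIso_hom_natural_right := fun _ _ => DGComod.hom_ext (TensorProduct.ext' fun _ _ => rfl)
    associativity := fun _ _ _ => DGComod.hom_ext (TensorProduct.ext_threefold fun _ _ _ => rfl)
    left_unitality := fun _ => DGComod.hom_ext (TensorProduct.ext' fun _ _ => rfl)
    right_unitality := fun _ => DGComod.hom_ext (TensorProduct.ext' fun _ _ => rfl) }

instance : (pushEquiv E hE).Braided where
  braided _ _ := DGComod.hom_ext (TensorProduct.ext' fun _ _ => rfl)

instance : (pushEquiv E hE).Faithful where
  map_injective h := DGComod.hom_ext (congrArg (fun f => f.toLin) h)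

theorem map_symm_map {X : Type} [AddCommGroup X] [Module ℚ X] (t : X ⊗[ℚ] C) :
    TensorProduct.map LinearMap.id (E.symm : C' →ₗ[ℚ] C)
      (TensorProduct.map LinearMap.id (E : C →ₗ[ℚ] C') t) = t := by
  induction t with
  | zero => simp
  | add s t hs ht => simp only [_root_.map_add, hs, ht]
  | tmul x c => exact congrArg (TensorProduct.tmul ℚ x) (E.symm_apply_apply c)

theorem map_map_symm {X : Type} [AddCommGroup X] [Module ℚ X] (t : X ⊗[ℚ] C') :
    TensorProduct.map LinearMap.id (E : C →ₗ[ℚ] C')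
      (TensorProduct.map LinearMap.id (E.symm : C' →ₗ[ℚ] C) t) = t := by
  induction t with
  | zero => simp
  | add s t hs ht => simp only [_root_.map_add, hs, ht]
  | tmul x c => exact congrArg (TensorProduct.tmul ℚ x) (E.apply_symm_apply c)

instance : (pushEquiv E hE).Full where
  map_surjective {M N} f := by
    let g : M.X →ₗ[ℚ] N.X := f.toLin
    have hg : ∀ m, TensorProduct.map LinearMap.id (E : C →ₗ[ℚ] C') (N.coact (g m)) =
      TensorProduct.map g LinearMap.id
        (TensorProduct.map LinearMap.id (E : C →ₗ[ℚ] C') (M.coact m)) := f.map_coact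
    refine ⟨{ toLin := f.toLin, map_hom := f.map_hom, map_d := f.map_d,
              map_coact := fun m => ?_ }, rfl⟩
    have h := congrArg (TensorProduct.map LinearMap.id (E.symm : C' →ₗ[ℚ] C)) (hg m)
    rw [map_symm_map, Push.natural, map_symm_map] at h
    exact h

theorem symm_isHom (E : C ≃ₐc[ℚ] C')
    (hE : ∀ j x, (GradedBialgebra.gr : Grading J C).IsHom j x →
      (GradedBialgebra.gr : Grading J C').IsHom j (E x)) (j : J) (x : C') (hx : (GradedBialgebra.gr : Grading J C').IsHom j x) :
    (GradedBialgebra.gr : Grading J C).IsHom j (E.symm x) := by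
  classical
  have h : ∀ i, E ((GradedBialgebra.gr : Grading J C).comp (E.symm x) i) =
      (GradedBialgebra.gr : Grading J C').comp x i := fun i => by
    have h1 := Grading.comp_map (s := fun i => i) (f := (E : C →ₗ[ℚ] C')) Function.injective_id hE i
      (E.symm x)
    refine h1.symm.trans ?_
    exact congrArg (fun y => (GradedBialgebra.gr : Grading J C').comp y i) (E.apply_symm_apply x)
  refine Finsupp.ext fun i => (EquivLike.injective E) ((h i).trans ?_)
  rw [show (GradedBialgebra.gr : Grading J C').comp x = _ from hx, Finsupp.single_apply,
    Finsupp.single_apply]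
  split_ifs
  · exact (E.apply_symm_apply x).symm
  · exact (map_zero E).symm

instance : (pushEquiv E hE).EssSurj where
  mem_essImage N := ⟨(pushEquiv E.symm (symm_isHom E hE)).obj N,
    ⟨DGComod.mkIso (M := (pushEquiv E hE).obj ((pushEquiv E.symm (symm_isHom E hE)).obj N)) (N := N)
      (Iso.refl N.toCx) fun n => ((LinearMap.congr_fun TensorProduct.map_id _).trans
        (map_map_symm E (N.coact n))).symm⟩⟩

instance : (pushEquiv E hE).IsEquivalence where

end push

section
open Functor

theorem Grading.apply_eq_zero_of_coarsen {Γ Γ' M V : Type} [AddCommGroup M] [Module ℚ M]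
    [AddCommGroup V] [Module ℚ V] {G : Grading Γ M} {p : Γ → Γ'} {k : Γ'} {f : M →ₗ[ℚ] V}
    (h : ∀ i m, p i = k → G.IsHom i m → f m = 0) {m : M} (hm : (G.coarsen p).IsHom k m) :
    f m = 0 := by
  classical
  have key : f ∘ₗ Finsupp.lapply k ∘ₗ (G.coarsen p).comp = 0 := G.ext_hom fun i m hm => by
    have h1 : (G.coarsen p).comp m = Finsupp.single (p i) m := hm.coarsen p
    rw [LinearMap.comp_apply, LinearMap.comp_apply, h1, Finsupp.lapply_apply, Finsupp.single_apply]
    split_ifs with hi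
    · exact h i m hi hm
    · exact map_zero f
  have h1 := LinearMap.congr_fun key m
  rwa [LinearMap.comp_apply, LinearMap.comp_apply, Finsupp.lapply_apply,
    IsHom.comp_eq hm] at h1

theorem OG.pbw_bounded_iff {C : Type} [CommRing C] [Bialgebra ℚ C] [GradedBialgebra ℤ C]
    (N : DGComod ℤ C) : Cx.bounded PUnit ((pbw C).obj N).toCx ↔ Cx.bounded ℤ N.toCx := by
  constructor
  · rintro ⟨a, b, h⟩
    exact ⟨a, b, fun i m hm h0 hi => h (i.1, PUnit.unit) m (hm.coarsen _) h0 hi⟩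
  · rintro ⟨a, b, hb⟩
    obtain ⟨h, -, h2⟩ := N.toCx.exists_homotopy hb
    refine ⟨a, b, fun k m hm h0 hk => ?_⟩
    have h1 : ∀ m : N.X, (N.gr.coarsen fun i => (i.1, PUnit.unit)).IsHom k m → N.d m = 0 →
        N.d (h m) = m := fun m hm h0 => by
      have h3 := Grading.apply_eq_zero_of_coarsen (f := LinearMap.id - N.d ∘ₗ h - h ∘ₗ N.d)
        (fun i m hi hm => h2 i m hm (by rw [← hi] at hk; exact hk)) hm
      change m - N.d (h m) - h (N.d m) = 0 at h3
      rw [h0, map_zero, sub_zero] at h3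
      exact (sub_eq_zero.mp h3).symm
    exact ⟨h m, h1 m hm h0⟩

section
variable {J C J' C' : Type} [AddCommGroup J] [CommRing C] [Bialgebra ℚ C] [GradedBialgebra J C]
  [AddCommGroup J'] [CommRing C'] [Bialgebra ℚ C'] [GradedBialgebra J' C']

/-- An equivalence of categories of comodules which preserves and reflects quasi-isomorphisms. -/
def comodLocalizer (F : DGComod J C ⥤ DGComod J' C')
    (hF : (DGComod.qis J' C').inverseImage F = DGComod.qis J C) :
    LocalizerMorphism (DGComod.qis J C) (DGComod.qis J' C') where
  functor := F
  map := hF.ge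

theorem comod_inverts (F : DGComod J C ⥤ DGComod J' C')
    (hF : (DGComod.qis J' C').inverseImage F = DGComod.qis J C) :
    (DGComod.qis J C).IsInvertedBy (F ⋙ DGComod.toDer J' C') :=
  fun _ _ f hf => isIso_toDer_map (F.map f) (hF.ge f hf)

/-- The functor on the derived categories induced by an exact functor. -/
def comodDer (F : DGComod J C ⥤ DGComod J' C')
    (hF : (DGComod.qis J' C').inverseImage F = DGComod.qis J C) :
    DGComod.Der J C ⥤ DGComod.Der J' C' :=
  Localization.lift (F ⋙ DGComod.toDer J' C') (comod_inverts F hF) (DGComod.toDer J C)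

variable (F : DGComod J C ⥤ DGComod J' C')
  (hF : (DGComod.qis J' C').inverseImage F = DGComod.qis J C)

instance : Localization.Lifting (DGComod.toDer J C) (DGComod.qis J C) (F ⋙ DGComod.toDer J' C')
    (comodDer F hF) :=
  Localization.liftingLift (F ⋙ DGComod.toDer J' C') (comod_inverts F hF) (DGComod.toDer J C)

/-- The functor on the derived categories is induced by the given functor. -/
def comodDerIso : DGComod.toDer J C ⋙ comodDer F hF ≅ F ⋙ DGComod.toDer J' C' :=
  Localization.Lifting.iso (DGComod.toDer J C) (DGComod.qis J C) (F ⋙ DGComod.toDer J' C')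
    (comodDer F hF)

instance [F.Braided] : (comodDer F hF).Braided :=
  braidedOfComp (DGComod.toDer J C) (DGComod.qis J C) (comodDer F hF) (F ⋙ DGComod.toDer J' C')

instance [F.IsEquivalence] : (comodDer F hF).IsEquivalence := by
  have : (comodLocalizer F hF).IsInduced := ⟨hF⟩
  have : (comodLocalizer F hF).functor.IsEquivalence := ‹F.IsEquivalence›
  have : (DGComod.qis J' C').RespectsIso :=
    inferInstanceAs ((Cx.qis J').inverseImage DGComod.forget).RespectsIso
  have := (comodLocalizer F hF).isLocalizedEquivalence_of_isInduced
  have : CatCommSq (comodLocalizer F hF).functor (DGComod.toDer J C) (DGComod.toDer J' C')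
    (comodDer F hF) := ⟨(comodDerIso F hF).symm⟩
  exact (comodLocalizer F hF).isEquivalence (DGComod.toDer J C) (DGComod.toDer J' C')
    (comodDer F hF)

theorem comodDer_bounded (hb : ∀ N, Cx.bounded J' (F.obj N).toCx ↔ Cx.bounded J N.toCx)
    {M : DGComod.Der J C} (h : DGComod.derBounded J C M) :
    DGComod.derBounded J' C' ((comodDer F hF).obj M) := by
  obtain ⟨X, hX, ⟨e⟩⟩ := h
  exact ⟨F.obj X, (hb X).mpr hX, ⟨((comodDerIso F hF).app X).symm ≪≫ (comodDer F hF).mapIso e⟩⟩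

theorem exists_comodDer_iso [F.IsEquivalence]
    (hb : ∀ N, Cx.bounded J' (F.obj N).toCx ↔ Cx.bounded J N.toCx)
    {N : DGComod.Der J' C'} (h : DGComod.derBounded J' C' N) :
    ∃ M, DGComod.derBounded J C M ∧ Nonempty ((comodDer F hF).obj M ≅ N) := by
  obtain ⟨X, hX, ⟨e⟩⟩ := h
  have h1 : DGComod.qis J' C' (F.objObjPreimageIso X).inv :=
    MorphismProperty.of_isIso (Cx.qis J') (DGComod.forget.map (F.objObjPreimageIso X).inv)
  refine ⟨(DGComod.toDer J C).obj (F.objPreimage X), ⟨F.objPreimage X, (hb _).mp ?_, ⟨Iso.refl _⟩⟩,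
    ⟨(comodDerIso F hF).app _ ≪≫ (DGComod.toDer J' C').mapIso (F.objObjPreimageIso X) ≪≫ e⟩⟩
  exact Cx.bounded_of_qis (DGComod.forget.map (F.objObjPreimageIso X).inv) h1 hX

end

theorem pushEquiv_qis {J C C' : Type} [AddCommGroup J] [CommRing C] [Bialgebra ℚ C]
    [GradedBialgebra J C] [CommRing C'] [Bialgebra ℚ C'] [GradedBialgebra J C'] (E : C ≃ₐc[ℚ] C')
    (hE : ∀ j x, (GradedBialgebra.gr : Grading J C).IsHom j x →
      (GradedBialgebra.gr : Grading J C').IsHom j (E x)) :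
    (DGComod.qis J C').inverseImage (pushEquiv E hE) = DGComod.qis J C := by
  ext M N f
  exact Iff.rfl

theorem pushEquiv_bounded_iff {J C C' : Type} [AddCommGroup J] [CommRing C] [Bialgebra ℚ C]
    [GradedBialgebra J C] [CommRing C'] [Bialgebra ℚ C'] [GradedBialgebra J C'] (E : C ≃ₐc[ℚ] C')
    (hE : ∀ j x, (GradedBialgebra.gr : Grading J C).IsHom j x →
      (GradedBialgebra.gr : Grading J C').IsHom j (E x)) (N : DGComod J C) :
    Cx.bounded J ((pushEquiv E hE).obj N).toCx ↔ Cx.bounded J N.toCx := Iff.rfl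

theorem OG.pbw_qis (C : Type) [CommRing C] [Bialgebra ℚ C] [GradedBialgebra ℤ C] :
    (DGComod.qis PUnit (OG C)).inverseImage (pbw C) = DGComod.qis ℤ C := by
  ext M N f
  exact Iff.rfl

section
variable (E : Hkm.W ≃ₐc[ℚ] QS)
  (hE : ∀ j x, (GradedBialgebra.gr : Grading ℤ Hkm.W).IsHom j x →
    (GradedBialgebra.gr : Grading ℤ QS).IsHom j (E x))

/-- Pushing coactions forward along the isomorphism, on the derived categories. -/
abbrev pushDer : DGComod.Der ℤ Hkm.W ⥤ DGComod.Der ℤ QS :=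
  comodDer (pushEquiv E hE) (pushEquiv_qis E hE)

/-- From graded comodules to representations, on the derived categories. -/
abbrev pbwDer : DGComod.Der ℤ QS ⥤ DGComod.Der PUnit (OG QS) := comodDer (pbw QS) (OG.pbw_qis QS)

/-- From modules to representations, on the bounded derived categories. -/
abbrev repDer : DbMod ⥤ DGComod.Der PUnit (OG QS) :=
  barBounded ⋙ (DGComod.derBounded ℤ Hkm.W).ι ⋙ pushDer E hE ⋙ pbwDer

theorem repDer_bounded (M : DbMod) :
    DGComod.derBounded PUnit (OG QS) ((repDer E hE).obj M) :=
  comodDer_bounded (pbw QS) (OG.pbw_qis QS) OG.pbw_bounded_iff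
    (comodDer_bounded (pushEquiv E hE) (pushEquiv_qis E hE) (pushEquiv_bounded_iff E hE) (barBounded.obj M).property)

/-- From modules to representations, with bounded values. -/
def repBounded : DbMod ⥤ DbComod PUnit (OG QS) :=
  (DGComod.derBounded PUnit (OG QS)).lift (repDer E hE) (repDer_bounded E hE)

instance : (repBounded E hE).Braided := liftBraided _ _ _

/-- The values in the bounded derived category are the given ones. -/
def repBoundedIso : repBounded E hE ⋙ (DGComod.derBounded PUnit (OG QS)).ι ≅ repDer E hE :=
  ObjectProperty.liftCompιIso _ _ _

instance : (repBounded E hE).IsEquivalence where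
  faithful := inferInstanceAs ((DGComod.derBounded PUnit (OG QS)).lift _ _).Faithful
  full := inferInstanceAs ((DGComod.derBounded PUnit (OG QS)).lift _ _).Full
  essSurj := ⟨fun N => by
    obtain ⟨M, hM, ⟨e⟩⟩ := exists_comodDer_iso (pbw QS) (OG.pbw_qis QS) OG.pbw_bounded_iff N.property
    obtain ⟨L, hL, ⟨e'⟩⟩ := exists_comodDer_iso (pushEquiv E hE) (pushEquiv_qis E hE) (pushEquiv_bounded_iff E hE) hM
    refine ⟨barBounded.objPreimage ⟨L, hL⟩, ⟨ObjectProperty.isoMk _ ?_⟩⟩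
    exact (pushDer E hE ⋙ pbwDer).mapIso ((DGComod.derBounded ℤ Hkm.W).ι.mapIso
      (barBounded.objObjPreimageIso ⟨L, hL⟩)) ≪≫ pbwDer.mapIso e' ≪≫ e⟩

end

end

namespace NSymm
open Words

theorem mono_nil : mono [] = 1 := rfl
theorem mono_cons (a : ℕ) (u : List ℕ) : mono (a :: u) = FreeAlgebra.ι ℚ a * mono u := by
  simp [mono]
theorem mono_append (u v : List ℕ) : mono (u ++ v) = mono u * mono v := by simp [mono]

/-- The monomials form a basis. -/
def monoBasis : Module.Basis (List ℕ) ℚ NSymm := FreeAlgebra.basisFreeMonoid ℚ ℕ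

theorem monoBasis_apply (u : List ℕ) : monoBasis u = mono u := by
  have h : monoBasis u = FreeAlgebra.equivMonoidAlgebraFreeMonoid.symm
      (MonoidAlgebra.single (FreeMonoid.ofList u) (1 : ℚ)) := rfl
  rw [h]
  change MonoidAlgebra.lift ℚ (FreeAlgebra ℚ ℕ) (FreeMonoid ℕ) (FreeMonoid.lift (FreeAlgebra.ι ℚ))
    (MonoidAlgebra.single (FreeMonoid.ofList u) (1 : ℚ)) = _
  rw [MonoidAlgebra.lift_single, one_smul, FreeMonoid.lift_apply]
  rfl

theorem lin_ext {V : Type*} [AddCommGroup V] [Module ℚ V] {f g : NSymm →ₗ[ℚ] V}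
    (h : ∀ u, f (mono u) = g (mono u)) : f = g :=
  monoBasis.ext fun u => by rw [monoBasis_apply]; exact h u

/-- The pairing for which the words are dual to the monomials. -/
def pairing : NSymm →ₗ[ℚ] Module.Dual ℚ QS := monoBasis.constr ℚ fun u => co u

theorem pairing_mono (u : List ℕ) : pairing (mono u) = co u := by
  rw [← monoBasis_apply]
  exact monoBasis.constr_basis ℚ _ u

theorem pairing_wd (u v : List ℕ) : pairing (mono u) (wd v) = if u = v then 1 else 0 := by
  rw [pairing_mono, co_wd]
  simp only [eq_comm]

theorem pairing_one (s : QS) : pairing 1 s = Coalgebra.counit (R := ℚ) s := by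
  rw [← mono_nil, pairing_mono, co_nil]
  rfl

theorem pair₂_tmul (p : NSymm →ₗ[ℚ] Module.Dual ℚ QS) (x y : NSymm) (s t : QS) :
    pair₂ p (x ⊗ₜ y) (s ⊗ₜ t) = p x s * p y t := by
  rw [pair₂, LinearMap.comp_apply, TensorProduct.map_tmul, TensorProduct.dualDistrib_apply]

theorem pairing_mul (x y : NSymm) (s : QS) :
    pairing (x * y) s = pair₂ pairing (x ⊗ₜ y) (Coalgebra.comul (R := ℚ) s) := by
  have key : (LinearMap.mul ℚ NSymm).compr₂ pairing = (TensorProduct.mk ℚ NSymm NSymm).compr₂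
      ((LinearMap.lcomp ℚ ℚ (Coalgebra.comul (R := ℚ) (A := QS))) ∘ₗ pair₂ pairing) := by
    refine lin_ext fun u => lin_ext fun v => ?_
    change pairing (mono u * mono v) = pair₂ pairing (mono u ⊗ₜ mono v) ∘ₗ Coalgebra.comul (R := ℚ)
    rw [← mono_append, pairing_mono, ← conv_co, conv, ← LinearMap.comp_assoc]
    congr 1
    refine TensorProduct.ext' fun s t => ?_
    rw [pair₂_tmul, pairing_mono, pairing_mono]
    rfl
  exact LinearMap.congr_fun (LinearMap.congr_fun (LinearMap.congr_fun key x) y) s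

theorem pairing_apply_one (x : NSymm) : pairing x 1 = counit x := by
  refine LinearMap.congr_fun (f := LinearMap.applyₗ (1 : QS) ∘ₗ pairing)
    (g := counit.toLinearMap) (lin_ext fun u => ?_) x
  rw [LinearMap.comp_apply, pairing_mono]
  change co u (wd []) = counit (mono u)
  rw [co_wd]
  cases u with
  | nil => rw [mono_nil, map_one, if_pos rfl]
  | cons a u => rw [mono_cons, map_mul, counit, FreeAlgebra.lift_ι_apply, zero_mul, if_neg (by simp)]

/-- Removing the first letter of a word if it is `c`. -/
def lead (c : ℕ) : QS →ₗ[ℚ] QS := Words.lift fun u => match u with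
  | [] => 0
  | a :: u => if a = c then wd u else 0

theorem lead_one (c : ℕ) : lead c 1 = 0 := lift_wd _ _

theorem lead_cons (c a : ℕ) (x : QS) : lead c (cons a x) = if a = c then x else 0 := by
  have h : lead c ∘ₗ cons a = if a = c then LinearMap.id else 0 := Words.lin_ext fun u => by
    rw [LinearMap.comp_apply, cons_wd]
    refine (lift_wd _ _).trans ?_
    dsimp only
    split_ifs <;> rfl
  refine (LinearMap.congr_fun h x).trans ?_
  split_ifs <;> rfl

/-- The transpose of the multiplication by `Z_{2k}` from the left. -/
def leadZ : ℕ → QS →ₗ[ℚ] QS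
  | 0 => LinearMap.id
  | c + 1 => lead c

theorem pairing_ι_mul (c : ℕ) (y : NSymm) (s : QS) :
    pairing (FreeAlgebra.ι ℚ c * y) s = pairing y (lead c s) := by
  refine LinearMap.congr_fun (LinearMap.congr_fun (f := pairing ∘ₗ LinearMap.mulLeft ℚ
      (FreeAlgebra.ι ℚ c)) (g := LinearMap.lcomp ℚ ℚ (lead c) ∘ₗ pairing) (lin_ext fun u =>
      Words.lin_ext fun v => ?_) y) s
  change pairing (FreeAlgebra.ι ℚ c * mono u) (wd v) = pairing (mono u) (lead c (wd v))
  rw [← mono_cons, pairing_mono, pairing_mono]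
  cases v with
  | nil => rw [← one_def, lead_one, map_zero, one_def, co_wd, if_neg (by simp)]
  | cons a v =>
    rw [← cons_wd, co_cons_cons, lead_cons]
    split_ifs <;> simp

theorem pairing_Z_mul (i : ℕ) (y : NSymm) (s : QS) :
    pairing (Z i * y) s = pairing y (leadZ i s) := by
  cases i with
  | zero => rw [Z, one_mul]; rfl
  | succ c => exact pairing_ι_mul c y s

theorem pair₂_Z_mul (i j : ℕ) (y : NSymm ⊗[ℚ] NSymm) (s t : QS) :
    pair₂ pairing ((Z i ⊗ₜ Z j) * y) (s ⊗ₜ t) =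
      pair₂ pairing y (leadZ i s ⊗ₜ leadZ j t) := by
  induction y with
  | zero => simp
  | add a b ha hb => simp only [mul_add, map_add, LinearMap.add_apply, ha, hb]
  | tmul a b =>
    rw [Algebra.TensorProduct.tmul_mul_tmul, pair₂_tmul, pair₂_tmul, pairing_Z_mul, pairing_Z_mul]

theorem leadZ_one (i : ℕ) : leadZ i 1 = if i = 0 then 1 else 0 := by
  cases i with
  | zero => rfl
  | succ c => rw [if_neg (by simp)]; exact lead_one c

theorem sum_antidiagonal_of_letters {R : Type} [Ring R] {f g : ℕ → R} {a b : ℕ} {x y : R}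
    (hf : ∀ i, f (i + 1) = if a = i then x else 0) (hg : ∀ i, g (i + 1) = if b = i then y else 0)
    (c : ℕ) : ∑ p ∈ Finset.HasAntidiagonal.antidiagonal (c + 1), f p.1 * g p.2 =
      (if a = c then x * g 0 else 0) + (if b = c then f 0 * y else 0) +
        (if a + b + 1 = c then x * y else 0) := by
  rw [Finset.Nat.sum_antidiagonal_succ, hg c, mul_ite, mul_zero]
  have h1 : ∑ p ∈ Finset.HasAntidiagonal.antidiagonal c, f (p.1 + 1) * g p.2 =
      if a ≤ c then x * g (c - a) else 0 := by
    split_ifs with h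
    · rw [Finset.sum_eq_single_of_mem (a, c - a) (by simpa using by omega), hf, if_pos rfl]
      rintro ⟨i, j⟩ hp hne
      rw [hf, if_neg, zero_mul]
      rintro rfl
      rw [Finset.HasAntidiagonal.mem_antidiagonal] at hp
      exact hne (Prod.ext rfl (by simp only at hp ⊢; omega))
    · refine Finset.sum_eq_zero ?_
      rintro ⟨i, j⟩ hp
      rw [Finset.HasAntidiagonal.mem_antidiagonal] at hp
      rw [hf, if_neg (by simp only at hp ⊢; omega), zero_mul]
  rw [h1]
  rcases lt_trichotomy a c with h | rfl | h
  · obtain ⟨d, rfl⟩ := Nat.exists_eq_add_of_lt h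
    rw [if_pos h.le, if_neg h.ne, show a + d + 1 - a = d + 1 by omega, hg, mul_ite, mul_zero,
      zero_add]
    congr 1
    exact if_congr (by omega) rfl rfl
  · rw [if_pos le_rfl, if_pos rfl, Nat.sub_self, if_neg (by omega : ¬ a + b + 1 = a), add_zero,
      add_comm]
  · rw [if_neg h.not_ge, if_neg h.ne', if_neg (by omega : ¬ a + b + 1 = c), zero_add]

theorem lead_wd_mul_wd (c : ℕ) (u v : List ℕ) : lead c (wd u * wd v) =
    ∑ p ∈ Finset.HasAntidiagonal.antidiagonal (c + 1), leadZ p.1 (wd u) * leadZ p.2 (wd v) := by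
  cases u with
  | nil =>
    rw [← one_def, one_mul, Finset.sum_eq_single_of_mem (0, c + 1) (by simp)]
    · rw [leadZ_one, if_pos rfl, one_mul, leadZ]
    · rintro ⟨i, j⟩ hp h
      rw [leadZ_one, if_neg, zero_mul]
      rintro rfl
      rw [Finset.HasAntidiagonal.mem_antidiagonal, zero_add] at hp
      exact h (by rw [show j = c + 1 from hp])
  | cons a u =>
    cases v with
    | nil =>
      rw [← one_def, mul_one, Finset.sum_eq_single_of_mem (c + 1, 0) (by simp)]
      · rw [leadZ_one, if_pos rfl, mul_one, leadZ]
      · rintro ⟨i, j⟩ hp h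
        rw [leadZ_one, if_neg, mul_zero]
        rintro rfl
        rw [Finset.HasAntidiagonal.mem_antidiagonal, add_zero] at hp
        exact h (by rw [show i = c + 1 from hp])
    | cons b v =>
      rw [sum_antidiagonal_of_letters (f := fun i => leadZ i (wd (a :: u)))
        (g := fun i => leadZ i (wd (b :: v))) (a := a) (b := b) (x := wd u) (y := wd v)
        (fun i => by rw [← cons_wd]; exact lead_cons i a _)
        (fun i => by rw [← cons_wd]; exact lead_cons i b _),
        ← cons_wd, ← cons_wd, mul_def, mulLin_cons, map_add, map_add, one_smul, lead_cons,
        lead_cons, lead_cons]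
      rfl

theorem lead_mul (c : ℕ) (s t : QS) : lead c (s * t) =
    ∑ p ∈ Finset.HasAntidiagonal.antidiagonal (c + 1), leadZ p.1 s * leadZ p.2 t := by
  have h1 : ∀ u t, lead c (wd u * t) =
      ∑ p ∈ Finset.HasAntidiagonal.antidiagonal (c + 1), leadZ p.1 (wd u) * leadZ p.2 t :=
    fun u t => by
      have h := LinearMap.congr_fun (f := lead c ∘ₗ LinearMap.mulLeft ℚ (wd u))
        (g := ∑ p ∈ Finset.HasAntidiagonal.antidiagonal (c + 1),
          LinearMap.mulLeft ℚ (leadZ p.1 (wd u)) ∘ₗ leadZ p.2)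
        (Words.lin_ext fun v => by
          rw [LinearMap.sum_apply]
          exact lead_wd_mul_wd c u v) t
      rw [LinearMap.sum_apply] at h
      exact h
  have h := LinearMap.congr_fun (f := lead c ∘ₗ LinearMap.mulRight ℚ t)
    (g := ∑ p ∈ Finset.HasAntidiagonal.antidiagonal (c + 1),
      LinearMap.mulRight ℚ (leadZ p.2 t) ∘ₗ leadZ p.1)
    (Words.lin_ext fun u => by
      rw [LinearMap.sum_apply]
      exact h1 u t) s
  rw [LinearMap.sum_apply] at h
  exact h

theorem pairing_apply_mul (x : NSymm) (s t : QS) :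
    pairing x (s * t) = pair₂ pairing (comul x) (s ⊗ₜ t) := by
  have key : ∀ u : List ℕ, ∀ s t : QS,
      pairing (mono u) (s * t) = pair₂ pairing (comul (mono u)) (s ⊗ₜ t) := by
    intro u
    induction u with
    | nil =>
      intro s t
      rw [mono_nil, map_one comul, Algebra.TensorProduct.one_def, pair₂_tmul, pairing_one,
        pairing_one, pairing_one, Bialgebra.counit_mul]
    | cons c u ih =>
      intro s t
      have hc : comul (FreeAlgebra.ι ℚ c) = ∑ p ∈ Finset.HasAntidiagonal.antidiagonal (c + 1),
        Z p.1 ⊗ₜ[ℚ] Z p.2 := FreeAlgebra.lift_ι_apply _ _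
      rw [mono_cons, pairing_ι_mul, lead_mul, map_mul comul, hc, Finset.sum_mul, map_sum, map_sum,
        LinearMap.sum_apply]
      refine Finset.sum_congr rfl fun p _ => ?_
      rw [pair₂_Z_mul]
      exact ih _ _
  refine LinearMap.congr_fun (f := LinearMap.applyₗ (s * t) ∘ₗ pairing)
    (g := LinearMap.applyₗ (s ⊗ₜ[ℚ] t) ∘ₗ pair₂ pairing ∘ₗ comul.toLinearMap)
    (lin_ext fun u => key u s t) x

end NSymm

section euler
variable {R S : Type} [Ring R] [Ring S]

/-- The Euler operator `t d/dt`. -/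
def euler (f : PowerSeries R) : PowerSeries R := PowerSeries.mk fun n => n • PowerSeries.coeff n f

theorem coeff_euler (n : ℕ) (f : PowerSeries R) :
    PowerSeries.coeff n (euler f) = n • PowerSeries.coeff n f := PowerSeries.coeff_mk _ _

theorem euler_mul (f g : PowerSeries R) : euler (f * g) = euler f * g + f * euler g := by
  ext n
  rw [map_add, coeff_euler, PowerSeries.coeff_mul, PowerSeries.coeff_mul, PowerSeries.coeff_mul,
    Finset.smul_sum, ← Finset.sum_add_distrib]
  refine Finset.sum_congr rfl fun p hp => ?_
  rw [coeff_euler, coeff_euler, smul_mul_assoc, mul_smul_comm, ← add_smul,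
    Finset.HasAntidiagonal.mem_antidiagonal.mp hp]

theorem euler_map (φ : R →+* S) (f : PowerSeries R) :
    euler (PowerSeries.map φ f) = PowerSeries.map φ (euler f) := by
  ext n
  rw [coeff_euler, PowerSeries.coeff_map, PowerSeries.coeff_map, coeff_euler, map_nsmul]

theorem commute_of_coeff {f g : PowerSeries R}
    (h : ∀ i j, Commute (PowerSeries.coeff i f) (PowerSeries.coeff j g)) : Commute f g := by
  ext n
  rw [PowerSeries.coeff_mul, PowerSeries.coeff_mul, ← Finset.Nat.sum_antidiagonal_swap]
  exact Finset.sum_congr rfl fun p _ => h _ _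

theorem mul_left_cancel_of_coeff_zero {f g h : PowerSeries R} (hf : PowerSeries.coeff 0 f = 1)
    (e : f * g = f * h) : g = h := by
  have h1 : PowerSeries.invOfUnit f 1 * f = 1 :=
    PowerSeries.invOfUnit_mul f 1 (by rw [← PowerSeries.coeff_zero_eq_constantCoeff_apply, hf]; rfl)
  rw [← one_mul g, ← one_mul h, ← h1, mul_assoc, mul_assoc, e]

/-- The solution of `t f' = f g` is determined by its constant term. -/
theorem eq_of_euler [Algebra ℚ R] {f f' g : PowerSeries R} (h : euler f = f * g)
    (h' : euler f' = f' * g) (hg : PowerSeries.coeff 0 g = 0)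
    (h0 : PowerSeries.coeff 0 f = PowerSeries.coeff 0 f') : f = f' := by
  ext n
  induction n using Nat.strong_induction_on with
  | _ n ih =>
    rcases Nat.eq_zero_or_pos n with rfl | hn
    · exact h0
    · have h1 := congrArg (PowerSeries.coeff n) h
      have h2 := congrArg (PowerSeries.coeff n) h'
      rw [coeff_euler, PowerSeries.coeff_mul] at h1 h2
      have h3 : n • PowerSeries.coeff n f = n • PowerSeries.coeff n f' := by
        rw [h1, h2]
        refine Finset.sum_congr rfl fun p hp => ?_
        have hp' := Finset.HasAntidiagonal.mem_antidiagonal.mp hp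
        rcases Nat.eq_zero_or_pos p.2 with h4 | h4
        · rw [h4, hg, mul_zero, mul_zero]
        · rw [ih p.1 (by omega)]
      have hn' : (n : ℚ) ≠ 0 := Nat.cast_ne_zero.mpr hn.ne'
      rw [← Nat.cast_smul_eq_nsmul ℚ, ← Nat.cast_smul_eq_nsmul ℚ] at h3
      exact (smul_right_injective R hn') h3

end euler

namespace NSymm

/-- The generating series of the generators. -/
def zSeries : PowerSeries NSymm := PowerSeries.mk Z

theorem coeff_zSeries (n : ℕ) : PowerSeries.coeff n zSeries = Z n := PowerSeries.coeff_mk _ _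

/-- The generating series of the Newton primitives. -/
def newton : PowerSeries NSymm := PowerSeries.invOfUnit zSeries 1 * euler zSeries

theorem zSeries_mul_newton : zSeries * newton = euler zSeries := by
  have h : zSeries * PowerSeries.invOfUnit zSeries 1 = 1 :=
    PowerSeries.mul_invOfUnit zSeries 1
      (by rw [← PowerSeries.coeff_zero_eq_constantCoeff_apply, coeff_zSeries]; rfl)
  rw [newton, ← mul_assoc, h, one_mul]

theorem coeff_zero_newton : PowerSeries.coeff 0 newton = 0 := by
  have h := congrArg (PowerSeries.coeff 0) zSeries_mul_newton
  rw [PowerSeries.coeff_mul, Finset.Nat.antidiagonal_zero, Finset.sum_singleton, coeff_euler,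
    zero_smul, coeff_zSeries, Z, one_mul] at h
  exact h

theorem comul_Z (n : ℕ) :
    comul (Z n) = ∑ p ∈ Finset.HasAntidiagonal.antidiagonal n, Z p.1 ⊗ₜ[ℚ] Z p.2 := by
  cases n with
  | zero => simp [Z, Algebra.TensorProduct.one_def]
  | succ k => rw [Z, comul, FreeAlgebra.lift_ι_apply]

theorem prim_newton (n : ℕ) : Prim (PowerSeries.coeff n newton) := by
  let L : NSymm →+* NSymm ⊗[ℚ] NSymm :=
    (Algebra.TensorProduct.includeLeft : NSymm →ₐ[ℚ] NSymm ⊗[ℚ] NSymm).toRingHom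
  let R : NSymm →+* NSymm ⊗[ℚ] NSymm :=
    (Algebra.TensorProduct.includeRight : NSymm →ₐ[ℚ] NSymm ⊗[ℚ] NSymm).toRingHom
  have hL : ∀ x, L x = x ⊗ₜ 1 := fun _ => rfl
  have hR : ∀ x, R x = 1 ⊗ₜ x := fun _ => rfl
  let Δ : NSymm →+* NSymm ⊗[ℚ] NSymm := comul.toRingHom
  have hc : ∀ f g : PowerSeries NSymm, Commute (PowerSeries.map L f) (PowerSeries.map R g) :=
    fun f g => commute_of_coeff fun i j => by
      rw [PowerSeries.coeff_map, PowerSeries.coeff_map, hL, hR, Commute, SemiconjBy,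
        Algebra.TensorProduct.tmul_mul_tmul, Algebra.TensorProduct.tmul_mul_tmul, one_mul, mul_one,
        one_mul, mul_one]
  have h1 : PowerSeries.map Δ zSeries = PowerSeries.map L zSeries * PowerSeries.map R zSeries := by
    ext n
    rw [PowerSeries.coeff_map, PowerSeries.coeff_mul, coeff_zSeries]
    refine (comul_Z n).trans (Finset.sum_congr rfl fun p _ => ?_)
    rw [PowerSeries.coeff_map, PowerSeries.coeff_map, hL, hR, Algebra.TensorProduct.tmul_mul_tmul,
      one_mul, mul_one, coeff_zSeries, coeff_zSeries]
  have h2 : PowerSeries.map Δ newton = PowerSeries.map L newton + PowerSeries.map R newton := by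
    refine mul_left_cancel_of_coeff_zero (f := PowerSeries.map Δ zSeries) ?_ ?_
    · rw [PowerSeries.coeff_map, coeff_zSeries]
      exact map_one Δ
    · rw [← map_mul, zSeries_mul_newton, ← euler_map, h1, euler_mul, euler_map, euler_map,
        ← zSeries_mul_newton, map_mul, map_mul, mul_add, mul_assoc, (hc newton zSeries).eq,
        ← mul_assoc, ← mul_assoc]
  have h3 := congrArg (PowerSeries.coeff n) h2
  rw [map_add, PowerSeries.coeff_map, PowerSeries.coeff_map, PowerSeries.coeff_map] at h3
  exact h3

theorem one_mem_deg : (1 : NSymm) ∈ deg 0 := Submodule.subset_span ⟨[], rfl, rfl⟩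

theorem Z_mem_deg (n : ℕ) : Z n ∈ deg n := by
  cases n with
  | zero => exact one_mem_deg
  | succ k => exact Submodule.subset_span ⟨[k], by simp [Words.weight], by simp [mono, Z]⟩

theorem mul_mem_deg {i j : ℤ} {x y : NSymm} (hx : x ∈ deg i) (hy : y ∈ deg j) :
    x * y ∈ deg (i + j) := by
  refine Submodule.mul_le.mp ?_ x hx y hy
  rw [deg, deg, Submodule.span_mul_span, Submodule.span_le]
  rintro _ ⟨_, ⟨u, rfl, rfl⟩, _, ⟨v, rfl, rfl⟩, rfl⟩
  exact Submodule.subset_span ⟨u ++ v, Words.weight_append u v, (mono_append u v).symm⟩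

theorem newton_mem_deg (n : ℕ) : PowerSeries.coeff n newton ∈ deg n := by
  induction n using Nat.strong_induction_on with
  | _ n ih =>
    have h := congrArg (PowerSeries.coeff n) zSeries_mul_newton
    rw [PowerSeries.coeff_mul, coeff_euler, coeff_zSeries, ← Finset.add_sum_erase _ _
      (show (0, n) ∈ Finset.HasAntidiagonal.antidiagonal n by simp), coeff_zSeries, Z,
      one_mul] at h
    rw [eq_sub_of_add_eq h]
    refine Submodule.sub_mem _ (Submodule.smul_of_tower_mem _ n (Z_mem_deg n))
      (Submodule.sum_mem _ fun p hp => ?_)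
    obtain ⟨hp1, hp2⟩ := Finset.mem_erase.mp hp
    rw [Finset.HasAntidiagonal.mem_antidiagonal] at hp2
    have hp3 : p.2 < n := by
      rcases Nat.eq_zero_or_pos p.1 with h0 | h0
      · exact absurd (Prod.ext h0 (by simpa [h0] using hp2)) hp1
      · omega
    have h4 := mul_mem_deg (Z_mem_deg p.1) (ih p.2 hp3)
    rw [coeff_zSeries]
    rwa [← Nat.cast_add, hp2] at h4

/-- The series of the generators, without constant term. -/
def genSeries : PowerSeries NSymm := PowerSeries.mk fun n => match n with
  | 0 => 0
  | k + 1 => FreeAlgebra.ι ℚ k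

/-- The solution of the equation of the generating series. -/
def solCoeff : ℕ → NSymm
  | 0 => 1
  | n + 1 => ((n + 1 : ℕ) : ℚ)⁻¹ • ∑ i : Fin (n + 1), solCoeff i * FreeAlgebra.ι ℚ (n - i)

/-- The series whose Newton series is the series of the generators. -/
def sol : PowerSeries NSymm := PowerSeries.mk solCoeff

theorem coeff_zero_sol : PowerSeries.coeff 0 sol = 1 := by
  rw [sol, PowerSeries.coeff_mk, solCoeff]

theorem euler_sol : euler sol = sol * genSeries := by
  ext n
  rw [coeff_euler, PowerSeries.coeff_mul]
  cases n with
  | zero => simp [genSeries]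
  | succ n =>
    rw [Finset.Nat.sum_antidiagonal_succ', Finset.Nat.sum_antidiagonal_eq_sum_range_succ_mk,
      Finset.sum_range]
    have hn : ((n + 1 : ℕ) : ℚ) ≠ 0 := Nat.cast_ne_zero.mpr n.succ_ne_zero
    rw [sol, PowerSeries.coeff_mk, solCoeff, ← Nat.cast_smul_eq_nsmul ℚ, smul_inv_smul₀ hn]
    simp [genSeries]

/-- The homomorphism which maps the generators to the Newton primitives. -/
def toNewton : FreeAlgebra ℚ ℕ →ₐ[ℚ] NSymm :=
  FreeAlgebra.lift ℚ fun k => PowerSeries.coeff (k + 1) newton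

/-- The inverse of `toNewton`. -/
def ofNewton : NSymm →ₐ[ℚ] FreeAlgebra ℚ ℕ :=
  FreeAlgebra.lift ℚ fun k => solCoeff (k + 1)

theorem map_ofNewton : PowerSeries.map ofNewton.toRingHom zSeries = sol := by
  ext n
  rw [PowerSeries.coeff_map, coeff_zSeries, sol, PowerSeries.coeff_mk]
  cases n with
  | zero => rw [Z, solCoeff]; exact map_one ofNewton
  | succ k => exact FreeAlgebra.lift_ι_apply _ _

theorem map_toNewton : PowerSeries.map toNewton.toRingHom genSeries = newton := by
  ext n
  rw [PowerSeries.coeff_map, genSeries, PowerSeries.coeff_mk]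
  cases n with
  | zero => rw [coeff_zero_newton]; exact map_zero toNewton
  | succ k => exact FreeAlgebra.lift_ι_apply _ _

theorem ofNewton_newton : PowerSeries.map ofNewton.toRingHom newton = genSeries :=
  mul_left_cancel_of_coeff_zero coeff_zero_sol (by
    rw [← euler_sol, ← map_ofNewton, ← map_mul, zSeries_mul_newton, euler_map])

theorem toNewton_sol : PowerSeries.map toNewton.toRingHom sol = zSeries := by
  refine eq_of_euler (g := newton) ?_ zSeries_mul_newton.symm coeff_zero_newton ?_
  · rw [euler_map, euler_sol, map_mul, map_toNewton]
  · rw [PowerSeries.coeff_map, coeff_zero_sol, coeff_zSeries]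
    exact map_one toNewton

/-- The automorphism of the free algebra which maps the generators to the Newton primitives. -/
def newtonEquiv : FreeAlgebra ℚ ℕ ≃ₐ[ℚ] NSymm :=
  AlgEquiv.ofAlgHom toNewton ofNewton
    (FreeAlgebra.hom_ext (funext fun k => by
      have h := congrArg (PowerSeries.coeff (k + 1)) toNewton_sol
      rw [PowerSeries.coeff_map, coeff_zSeries, sol, PowerSeries.coeff_mk] at h
      exact (congrArg toNewton (FreeAlgebra.lift_ι_apply _ _)).trans h))
    (FreeAlgebra.hom_ext (funext fun k => by
      have h := congrArg (PowerSeries.coeff (k + 1)) ofNewton_newton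
      rw [PowerSeries.coeff_map, genSeries, PowerSeries.coeff_mk] at h
      exact (congrArg ofNewton (FreeAlgebra.lift_ι_apply _ _)).trans h))

/-- The free Lie algebra generates the noncommutative symmetric functions. -/
def envEquiv : UniversalEnvelopingAlgebra ℚ FLie ≃ₐ[ℚ] NSymm :=
  (FreeLieAlgebra.universalEnvelopingEquivFreeAlgebra ℚ ℕ).trans newtonEquiv

theorem envEquiv_of (k : ℕ) : envEquiv (UniversalEnvelopingAlgebra.ι ℚ (FreeLieAlgebra.of ℚ k)) =
    PowerSeries.coeff (k + 1) newton := by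
  have h : FreeLieAlgebra.universalEnvelopingEquivFreeAlgebra ℚ ℕ
      (UniversalEnvelopingAlgebra.ι ℚ (FreeLieAlgebra.of ℚ k)) = FreeAlgebra.ι ℚ k := by
    simp
  exact (congrArg newtonEquiv h).trans (FreeAlgebra.lift_ι_apply _ _)

attribute [local instance] LieRing.ofAssociativeRing

/-- The Lie algebra of primitive elements. -/
def primitives : LieSubalgebra ℚ NSymm where
  carrier := {x | Prim x}
  add_mem' {x y} hx hy := by
    change comul (x + y) = _
    rw [map_add, show comul x = _ from hx, show comul y = _ from hy, TensorProduct.add_tmul,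
      TensorProduct.tmul_add]
    abel
  zero_mem' := by
    change comul 0 = _
    rw [map_zero, TensorProduct.zero_tmul, TensorProduct.tmul_zero, add_zero]
  smul_mem' a x hx := by
    change comul (a • x) = _
    rw [map_smul, show comul x = _ from hx, smul_add, TensorProduct.smul_tmul',
      TensorProduct.tmul_smul]
  lie_mem' {x y} hx hy := by
    change comul ⁅x, y⁆ = _
    rw [LieRing.of_associative_ring_bracket, map_sub, map_mul, map_mul,
      show comul x = _ from hx, show comul y = _ from hy]
    simp only [add_mul, mul_add, Algebra.TensorProduct.tmul_mul_tmul, one_mul, mul_one,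
      TensorProduct.sub_tmul, TensorProduct.tmul_sub]
    abel

theorem prim_envEquiv (x : FLie) : Prim (envEquiv (UniversalEnvelopingAlgebra.ι ℚ x)) := by
  let f : FLie →ₗ⁅ℚ⁆ primitives :=
    FreeLieAlgebra.lift ℚ fun k => ⟨PowerSeries.coeff (k + 1) newton, prim_newton (k + 1)⟩
  have h : primitives.incl.comp f =
      (AlgHom.toLieHom (envEquiv : UniversalEnvelopingAlgebra ℚ FLie →ₐ[ℚ] NSymm)).comp
        (UniversalEnvelopingAlgebra.ι ℚ) := by
    refine FreeLieAlgebra.hom_ext fun k => ?_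
    refine Eq.trans ?_ (envEquiv_of k).symm
    exact congrArg Subtype.val (FreeLieAlgebra.lift_of_apply _ k)
  have h1 := LieHom.congr_fun h x
  exact h1 ▸ (f x).property

end NSymm

end HKM
end

open HKM CategoryTheory in
theorem mainTheorem2 :
    -- the localization `DGMod.Der` of the `K`-flat modules is the derived category of all modules
    DGMod.flatLocalizer.IsLocalizedEquivalence ∧
    -- the bar construction computes the derived tensor product with `ℚ`
    (∀ M : DGMod, DGMod.kflat M → Cx.qis ℤ (Hkm.aug M)) ∧
    -- the bialgebras below are Hopf algebras
    HasAntipode Hkm.W ∧ HasAntipode QS ∧ HasAntipode (OG QS) ∧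
    -- the noncommutative symmetric functions are the universal enveloping algebra of the free Lie
    -- algebra, which is generated by primitive elements
    (∃ θ : UniversalEnvelopingAlgebra ℚ FLie ≃ₐ[ℚ] NSymm,
      (∀ x, NSymm.Prim (θ (UniversalEnvelopingAlgebra.ι ℚ x))) ∧
      ∀ k : ℕ, θ (UniversalEnvelopingAlgebra.ι ℚ (FreeLieAlgebra.of ℚ k)) ∈
        NSymm.deg ((k : ℤ) + 1)) ∧
    -- the quasi-symmetric functions are the graded dual of the noncommutative symmetric functions
    (∃ p : NSymm →ₗ[ℚ] Module.Dual ℚ QS,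
      (∀ u v, p (NSymm.mono u) (Words.wd v) = if u = v then 1 else 0) ∧
      (∀ s, p 1 s = Coalgebra.counit (R := ℚ) s) ∧
      (∀ x y s, p (x * y) s = NSymm.pair₂ p (x ⊗ₜ y) (Coalgebra.comul (R := ℚ) s)) ∧
      (∀ x, p x 1 = NSymm.counit x) ∧
      ∀ x s t, p x (s * t) = NSymm.pair₂ p (NSymm.comul x) (s ⊗ₜ t)) ∧
    ∃ (_ : DGMod.derBounded.IsMonoidal) (_ : (DGComod.derBounded ℤ Hkm.W).IsMonoidal)
      (_ : (DGComod.derBounded PUnit (OG QS)).IsMonoidal)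
      -- the derived functor, as a symmetric monoidal functor
      (L : DGMod.Der ⥤ DGComod.Der ℤ Hkm.W) (_ : L.Braided)
      (α : DGMod.toDer ⋙ L ≅ DGMod.kflat.ι ⋙ hkm ⋙ DGComod.toDer ℤ Hkm.W)
      (_ : NatTrans.IsMonoidal α.hom)
      -- its restriction to the bounded derived categories
      (Lb : DbMod ⥤ DbComod ℤ Hkm.W) (_ : Lb.Braided)
      (β : Lb ⋙ (DGComod.derBounded ℤ Hkm.W).ι ≅ DGMod.derBounded.ι ⋙ L)
      (_ : NatTrans.IsMonoidal β.hom)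
      -- the exponential isomorphism of graded Hopf algebras
      (E : Hkm.W ≃ₐc[ℚ] QS)
      (hE : ∀ j x, (GradedBialgebra.gr : Grading ℤ Hkm.W).IsHom j x →
        (GradedBialgebra.gr : Grading ℤ QS).IsHom j (E x))
      -- the functors on the derived categories that are induced by it, and by the passage from
      -- graded comodules to representations of the semidirect product
      (T₁ : DGComod.Der ℤ Hkm.W ⥤ DGComod.Der ℤ QS)
      (_ : DGComod.toDer ℤ Hkm.W ⋙ T₁ ≅ pushEquiv E hE ⋙ DGComod.toDer ℤ QS)
      (T₂ : DGComod.Der ℤ QS ⥤ DGComod.Der PUnit (OG QS))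
      (_ : DGComod.toDer ℤ QS ⋙ T₂ ≅ pbw QS ⋙ DGComod.toDer PUnit (OG QS))
      -- the composite, with values in the bounded derived category of representations
      (R : DbMod ⥤ DbComod PUnit (OG QS)) (_ : R.Braided)
      (_ : R ⋙ (DGComod.derBounded PUnit (OG QS)).ι ≅
        Lb ⋙ (DGComod.derBounded ℤ Hkm.W).ι ⋙ T₁ ⋙ T₂),
      Lb.IsEquivalence ∧ (∀ u, E (Words.wd u) = expWord u) ∧ (pbw QS).IsEquivalence ∧
        R.IsEquivalence := by
  refine ⟨flatLocalizer_isLocalizedEquivalence, Hkm.aug_qis, Words.hasAntipode 0,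
    Words.hasAntipode 1, OG.hasAntipode (Words.hasAntipode 1),
    ⟨NSymm.envEquiv, NSymm.prim_envEquiv, fun k => ?_⟩,
    ⟨NSymm.pairing, NSymm.pairing_wd, NSymm.pairing_one, NSymm.pairing_mul,
      NSymm.pairing_apply_one, NSymm.pairing_apply_mul⟩,
    inferInstance, inferInstance, inferInstance, barFunctor, inferInstance, barFunctorIso,
    inferInstance, barBounded, inferInstance, barBoundedIso, inferInstance, Words.expEquiv,
    Words.expEquiv_isHom, pushDer Words.expEquiv Words.expEquiv_isHom, comodDerIso _ _, pbwDer,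
    comodDerIso _ _, repBounded Words.expEquiv Words.expEquiv_isHom, inferInstance,
    repBoundedIso Words.expEquiv Words.expEquiv_isHom, inferInstance, Words.expEquiv_wd,
    inferInstance, inferInstance⟩
  rw [NSymm.envEquiv_of]
  exact_mod_cast NSymm.newton_mem_deg (k + 1)
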